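/- Let $\lambda<0$, let $K\ge 2$ be an even integer, let $s>2K+5$, and let $\phi,\psi\in H^s(\mathbb R^2)$ be real-valued. For $\varepsilon>0$ consider the cubic Klein–Gordon equation $\varepsilon^2\partial_{tt}u-\Delta u+\varepsilon^{-2}u+\lambda u^3=0$ with $u(0)=\phi$, $\partial_tu(0)=\varepsilon^{-2}\psi$, written as a hyperbolic system for $U=(w,v,u)=(\varepsilon\nabla u,\varepsilon^2\partial_tu,u)$: $$\partial_tU-\tfrac1\varepsilon A(\partial_x)U+\tfrac1{\varepsilon^2}A_0U=F(U),\qquad U(0)=(\varepsilon\nabla\phi,\psi,\phi),\tag{1}$$ where $A(\partial_x)U=(\nabla v,\operatorname{div}w,0)$, $A_0U=(0,u,-v)$ and $F(U)=(0,-\lambda u^3,0)$. Let $T^*\in(0,\infty]$ be the (maximal) existence time in $H^s$ of the cubic Schrödinger equation $$2i\partial_tg_0-\Delta g_0+3\lambda|g_0|^2g_0=0,\qquad g_0(0)=\tfrac{\phi-i\psi}2 .$$ A *WKB solution of order $K$* is $$U_a(t)=\sum_{n=0}^{K+2}\varepsilon^n\sum_{p\in H_n}e^{ipt/\varepsilon^2}U_{n,p}(t),\qquad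 H_n=\{p\ \text{odd}:|p|\le n+1\}\ (n\text{ even}),\quad H_n=\{p\ \text{odd}:|p|\le n\}\ (n\text{ odd}),$$ with $\varepsilon$-independent amplitudes $U_{n,p}\in C([0,T^*);H^{s-2n}(\mathbb R^2))$, $U_{n,-p}=\overline{U_{n,p}}$, $U_{0,1}=g_0\,(0,i,1)$ with $g_0$ the Schrödinger solution, such that: * with $U_{n,p}:=0$ for all other indices and $u_{n,p}$ the last component of $U_{n,p}$, for all $-2\le n\le K$ and $p\in\mathbb Z$, on $(0,T^*)$, $$\partial_tU_{n,p}-A(\partial_x)U_{n+1,p}+(ip+A_0)U_{n+2,p}=\Bigl(0,-\lambda\!\!\sum_{n_1+n_2+n_3=n}\ \sum_{p_1+p_2+p_3=p}u_{n_1,p_1}u_{n_2,p_2}u_{n_3,p_3},0\Bigr);$$ * for all $\varepsilon\in(0,1]$ and $t\in(0,T^*)$, $$\partial_tU_a-\tfrac1\varepsilon A(\partial_x)U_a+\tfrac1{\varepsilon^2}A_0U_a=F(U_a)-\varepsilon^{K+1}R_\varepsilon,\qquad U_a(0)=(\varepsilon\nabla\phi,\psi,\phi)-\varepsilon^{K+2}r_\varepsilon,$$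 with $\|R_\varepsilon(t)\|_{H^{s-2K-4}}\le C(t)$ and $\|r_\varepsilon\|_{H^{s-2K-2}}\le C_0$, where $C_0$ and the positive, continuous, increasing function $C$ on $[0,T^*)$ do not depend on $\varepsilon$. Then: 1. $T^*>0$, and for every $\varepsilon>0$ problem (1) has a unique maximal solution $U\in C([0,T^*_\varepsilon);H^{s-2K-4}(\mathbb R^2))$; its existence time $T^*_\varepsilon\in(0,\infty]$ is maximal, $U$ is real-valued, and every solution of (1) in $C([0,T');H^{s-2K-4})$ has $T'\le T^*_\varepsilon$ and equals $U$ on $[0,T')$. Moreover $\liminf_{\varepsilon\to0}T^*_\varepsilon\ge T^*$. 2. WKB solutions of order $K$ exist, and every WKB solution $U_a$ of order $K$ is stable: there is a positive, continuous, increasing function $C$ on $[0,T^*)$, independent of $\varepsilon$, such that for every $T<T^*$ there is $\varepsilon_0=\varepsilon_0(T)>0$ with $$\|(U-U_a)(t)\|_{H^{s-2K-4}(\mathbb R^2)}\le C(t)\,\varepsilon^{K+1}\qquad\text{for all }0<\varepsilon<\varepsilon_0,\ 0\le t\le T,\ t<T^*_\varepsilon .$$ -/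

import Mathlib

open MeasureTheory Filter Topology FourierTransform
open scoped ENNReal SchwartzMap LineDeriv Laplacian

noncomputable section

namespace NonRelLimit

/-- The plane `ℝ²` with its Euclidean norm. -/
abbrev Plane : Type := EuclideanSpace ℝ (Fin 2)

/-- `L²(ℝ²; ℂ)`. -/
abbrev L2 : Type := Lp ℂ 2 (volume : Measure Plane)

/-- Tempered distributions on `ℝ²`. -/
abbrev Dist : Type := 𝓢'(Plane, ℂ)

/-- A state `U = (w₁, w₂, v, u)` of the hyperbolic system, with components in `L²`
(the components `w₁, w₂, v, u` have the indices `0, 1, 2, 3`). -/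
abbrev State : Type := Fin 4 → L2

/-- An `L²` function, seen as a tempered distribution. -/
def toDist (f : L2) : Dist := (f : 𝓢'(Plane, ℂ))

/-- The partial derivative `∂_{x_j}` of an `L²` function, in the sense of distributions. -/
def partialD (j : Fin 2) (f : L2) : Dist :=
  ∂_{(EuclideanSpace.single j (1 : ℝ) : Plane)} (toDist f)

/-! ### Sobolev norms and continuity in time -/

/-- The `H^σ(ℝ²)` norm (`σ ≥ 0`) of an `L²` function: the `L²` norm of `(1 + |ξ|²)^{σ/2} f̂(ξ)`.
It is `∞` exactly when `f` is not in `H^σ`. -/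
def hsNorm (σ : ℝ) (f : L2) : ℝ≥0∞ :=
  eLpNorm (fun ξ : Plane => (((1 + ‖ξ‖ ^ 2) ^ (σ / 2) : ℝ) : ℂ) * (𝓕 f : L2) ξ) 2 volume

/-- The space `H^σ(ℝ²; ℂ)`. -/
def MemHs (σ : ℝ) (f : L2) : Prop := hsNorm σ f < ∞

/-- The `H^σ(ℝ²; ℂ⁴)` norm of a state. -/
def stateNorm (σ : ℝ) (U : State) : ℝ≥0∞ :=
  (∑ k, hsNorm σ (U k) ^ 2) ^ (1 / 2 : ℝ)

/-- The time interval `[0, T)`, for `T ∈ [0, ∞]`. -/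
def timeSet (T : ℝ≥0∞) : Set ℝ := {t | 0 ≤ t ∧ ENNReal.ofReal t < T}

/-- `f ∈ C([0, T); H^σ(ℝ²))`. -/
def ContHs (σ : ℝ) (T : ℝ≥0∞) (f : ℝ → L2) : Prop :=
  ∀ t ∈ timeSet T, MemHs σ (f t) ∧
    Tendsto (fun τ => hsNorm σ (f τ - f t)) (𝓝[timeSet T] t) (𝓝 0)

/-- `f` is real-valued. -/
def IsReal (f : L2) : Prop := star f = f

/-! ### The cubic Schrödinger equation -/

/-- `g ∈ C([0, T); H^s)` solves `2i ∂ₜg - Δg + 3λ|g|²g = 0`, `g(0) = (φ - iψ)/2`.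
The time derivative is taken in `L²`, the equation holds in the sense of distributions. -/
structure IsNLSSolution (lam : ℝ) (φ ψ : L2) (s : ℝ) (T : ℝ≥0∞) (g : ℝ → L2) : Prop where
  cont : ContHs s T g
  init : g 0 = (1 / 2 : ℂ) • (φ - Complex.I • ψ)
  eqn : ∀ t ∈ timeSet T, 0 < t → ∃ dg N : L2, HasDerivAt g dg t ∧
    (∀ᵐ x : Plane, N x = 3 * (lam : ℂ) * ((‖g t x‖ ^ 2 : ℝ) : ℂ) * g t x) ∧
    (2 * Complex.I) • toDist dg - Δ (toDist (g t)) + toDist N = 0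

/-- The existence time `T* ∈ [0, ∞]` of the Schrödinger equation in `H^s`. -/
def nlsLifespan (lam : ℝ) (φ ψ : L2) (s : ℝ) : ℝ≥0∞ :=
  sSup {T : ℝ≥0∞ | ∃ g, IsNLSSolution lam φ ψ s T g}

/-! ### The hyperbolic system -/

/-- `A(∂ₓ) U = (∇v, div w, 0)`. -/
def opA (U : State) : Fin 4 → Dist :=
  ![partialD 0 (U 2), partialD 1 (U 2), partialD 0 (U 0) + partialD 1 (U 1), 0]

/-- `A₀ U = (0, 0, u, -v)`. -/
def opA0 (U : State) : State := ![0, 0, U 3, -U 2]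

/-- The vector `(0, 0, -N, 0)`; this is `F(U)` when `N = f(u)`. -/
def sourceF (N : L2) : State := ![0, 0, -N, 0]

/-- `∂ₜU - ε⁻¹ A(∂ₓ)U + ε⁻² A₀U = F(U) - R` for one time, where `dU` stands for `∂ₜU`
and `f(u) = λu³`. -/
def SystemEq (lam ε : ℝ) (dU U R : State) : Prop :=
  ∃ N : L2, (∀ᵐ x : Plane, N x = (lam : ℂ) * (U 3 x) ^ 3) ∧
    ∀ k, toDist (dU k) - ((ε⁻¹ : ℝ) : ℂ) • opA U k + (((ε ^ 2)⁻¹ : ℝ) : ℂ) • toDist (opA0 U k)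
      = toDist (sourceF N k) - toDist (R k)

/-- The initial datum `(ε ∇φ, ψ, φ)`. -/
def initialDatum (φ ψ : L2) (ε : ℝ) : Fin 4 → Dist :=
  ![(ε : ℂ) • partialD 0 φ, (ε : ℂ) • partialD 1 φ, toDist ψ, toDist φ]

/-- `U ∈ C([0, T); H^σ)` solves the hyperbolic form of the cubic Klein-Gordon equation with
initial datum `(ε ∇φ, ψ, φ)`. -/
structure IsKGSolution (lam : ℝ) (φ ψ : L2) (ε σ : ℝ) (T : ℝ≥0∞) (U : ℝ → State) : Prop where
  cont : ∀ k, ContHs σ T (fun t => U t k)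
  init : ∀ k, toDist (U 0 k) = initialDatum φ ψ ε k
  eqn : ∀ t ∈ timeSet T, 0 < t → ∃ dU : State, HasDerivAt U dU t ∧ SystemEq lam ε dU (U t) 0

/-! ### WKB solutions -/

/-- The harmonics set `H_n`: the odd `p` with `|p| ≤ n + 1` (`n` even) or `|p| ≤ n` (`n` odd). -/
def harmonics (n : ℤ) : Finset ℤ :=
  (Finset.Icc (-(n + 1)) (n + 1)).filter
    (fun p => Odd p ∧ |p| ≤ if Even n then n + 1 else n)

/-- A family of amplitudes `U_{n,p}(t)`. -/
abbrev Amplitudes : Type := ℤ → ℤ → ℝ → State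

/-- `U_a(t) = ∑_{n=0}^{K+2} εⁿ ∑_{p ∈ H_n} e^{ipt/ε²} U_{n,p}(t)`. -/
def wkbSum (K : ℕ) (A : Amplitudes) (ε t : ℝ) : State :=
  ∑ n ∈ Finset.range (K + 3), ∑ p ∈ harmonics n,
    ((ε : ℂ) ^ n * Complex.exp (Complex.I * p * t / (ε : ℂ) ^ 2)) • A n p t

/-- `f(u_a)_{n,p} = λ ∑_{n₁+n₂+n₃=n} ∑_{p₁+p₂+p₃=p} u_{n₁,p₁} u_{n₂,p₂} u_{n₃,p₃}`, at the time `t`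
and the point `x`. -/
def cubicCoeff (lam : ℝ) (K : ℕ) (A : Amplitudes) (n p : ℤ) (t : ℝ) (x : Plane) : ℂ :=
  (lam : ℂ) *
    ∑ n₁ ∈ Finset.Icc (0 : ℤ) (K + 2), ∑ n₂ ∈ Finset.Icc (0 : ℤ) (K + 2),
    ∑ n₃ ∈ Finset.Icc (0 : ℤ) (K + 2),
    ∑ p₁ ∈ harmonics n₁, ∑ p₂ ∈ harmonics n₂, ∑ p₃ ∈ harmonics n₃,
      if n₁ + n₂ + n₃ = n ∧ p₁ + p₂ + p₃ = p then
        A n₁ p₁ t 3 x * A n₂ p₂ t 3 x * A n₃ p₃ t 3 x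
      else 0

/-- The profile equation
`∂ₜU_{n,p} - A(∂ₓ)U_{n+1,p} + (ip + A₀)U_{n+2,p} = F(U_a)_{n,p}` at the time `t`. -/
def ProfileEq (lam : ℝ) (K : ℕ) (A : Amplitudes) (n p : ℤ) (t : ℝ) : Prop :=
  ∃ (dU : State) (N : L2), HasDerivAt (A n p) dU t ∧
    (∀ᵐ x : Plane, N x = cubicCoeff lam K A n p t x) ∧
    ∀ k, toDist (dU k) - opA (A (n + 1) p t) k +
        toDist ((Complex.I * p) • A (n + 2) p t k + opA0 (A (n + 2) p t) k)
      = toDist (sourceF N k)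

/-- `C` is a positive, continuous, increasing function on `[0, T)`. -/
structure IsRate (T : ℝ≥0∞) (C : ℝ → ℝ) : Prop where
  pos : ∀ t ∈ timeSet T, 0 < C t
  cont : ContinuousOn C (timeSet T)
  mono : MonotoneOn C (timeSet T)

/-- The amplitudes `A` define a WKB solution of order `K` on `[0, T)`: they do not depend on `ε`,
they have the stated harmonics and regularity, the real symmetry and the leading term
`e^{iθ} g₀ (0,0,i,1) + c.c.` with `g₀` the Schrödinger solution, they solve the
profile equations up to order `K`, and `U_a` solves the system up to `ε^{K+1} R_ε`, with
initial error `ε^{K+2} r_ε`. -/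
structure IsWKBSolution (lam : ℝ) (φ ψ : L2) (s : ℝ) (K : ℕ) (T : ℝ≥0∞) (A : Amplitudes) :
    Prop where
  support : ∀ n p : ℤ, ¬ (0 ≤ n ∧ n ≤ K + 2 ∧ p ∈ harmonics n) → ∀ t, A n p t = 0
  regular : ∀ n : ℕ, n ≤ K + 2 → ∀ p ∈ harmonics n, ∀ k,
    ContHs (s - 2 * n) T (fun t => A n p t k)
  conj_symm : ∀ n p : ℤ, ∀ t ∈ timeSet T, ∀ k, A n (-p) t k = star (A n p t k)
  leading : ∃ g₀, IsNLSSolution lam φ ψ s T g₀ ∧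
    ∀ t ∈ timeSet T, A 0 1 t = ![0, 0, Complex.I • g₀ t, g₀ t]
  profile : ∀ n : ℤ, -2 ≤ n → n ≤ K → ∀ p : ℤ, ∀ t ∈ timeSet T, 0 < t → ProfileEq lam K A n p t
  approx : ∃ (R : ℝ → ℝ → State) (r : ℝ → State) (C : ℝ → ℝ) (C₀ : ℝ), IsRate T C ∧
    ∀ ε : ℝ, 0 < ε → ε ≤ 1 →
      (∀ t ∈ timeSet T, 0 < t →
        (∃ dU : State, HasDerivAt (wkbSum K A ε) dU t ∧
          SystemEq lam ε dU (wkbSum K A ε t) (((ε : ℂ) ^ (K + 1)) • R ε t)) ∧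
        stateNorm (s - 2 * K - 4) (R ε t) ≤ ENNReal.ofReal (C t)) ∧
      (∀ k, toDist (wkbSum K A ε 0 k)
        = initialDatum φ ψ ε k - ((ε : ℂ) ^ (K + 2)) • toDist (r ε k)) ∧
      stateNorm (s - 2 * K - 2) (r ε) ≤ ENNReal.ofReal C₀

end NonRelLimit

end

open MeasureTheory Filter Topology FourierTransform
open scoped ENNReal SchwartzMap LineDeriv Laplacian

noncomputable section

namespace NonRelLimit

open Set Metric
open scoped NNReal

/-! ### Ordinary differential equations on `[0, T)` in Banach spaces -/

section ODE

variable {X : Type*} [NormedAddCommGroup X] [NormedSpace ℝ X]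

/-! Functional setting. `ofFreq σ` is an isometry from `L²` onto `H^σ`, so every Sobolev statement
becomes a statement about `L²` on the frequency side. There derivatives are bounded multipliers
(`dFreq`, `lapFreq`), the free groups are multipliers of modulus one or with unitary matrix symbols
(`schrFlow`, `kgFlow`), and for `σ > 1`, which is half the dimension, the product is a bounded
bilinear map (`exists_ofFreq_pmul`).

Well-posedness. An equation `u' = Λu + N(u)` becomes `y' = S(-t) N(S(t) y)` for `y = S(-t) u`. This
is an ordinary differential equation in a Banach space with a locally Lipschitz vector field.
`Admissible.exists_maximal` gives its maximal solution, uniqueness and the blow-up alternative;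
`nls_iff` and `kg_iff` translate them back. Conjugation preserves the Klein-Gordon system, so
uniqueness makes its solutions real.

Construction of the WKB solution. Two components of the profile equations give `w_{n,p} =
∇u_{n-1,p}` and `v_{n,p} = ip u_{n,p} + ∂ₜu_{n-2,p}`. What remains is the scalar recurrence
`∂ₜ²u_{n-2,p} + 2ip ∂ₜu_{n,p} - Δu_{n,p} + f_{n,p} + (1 - p²) u_{n+2,p} = 0`, where `f_{n,p}`
involves orders up to `n` only. For `p ≠ ±1` it defines `u_{n+2,p}` algebraically
(`WkbFamily.extend`). For `p = ±1` the last term drops out and a Schrödinger equation for `u_{n,±1}`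
is left: the cubic one for `n = 0`, and for `n > 0` an affine one, which is solvable on all of `[0,
T*)` (`WkbFamily.solve`). The free initial value of `u_{n,1}` is used to cancel the initial data of
order `n`. All `u_{n,p}` with `n` odd vanish. One time derivative costs two space derivatives, so
that `u_{n,p}` lies in `H^{s-2n}`, and `s > 2K + 5` leaves the last remainder in an algebra `H^σ`
with `σ > 1`. When the sum is inserted into the system all orders up to `K` cancel, which leaves
`ε^{K+1} R_ε` (`WkbFamily.sum_profile_eq`).

Stability. The symbol of `ε⁻¹A(∂ₓ) - ε⁻²A₀` is skew-adjoint, so its group is bounded in `H^σ`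
independently of `ε`, although its generator is singular in `ε`. As long as the error is at most `1`
the cubic term is Lipschitz with a constant that depends on the WKB solution only, and Grönwall
bounds the error by `C(t) ε^{K+1}`. For small `ε` this is below `1`, which closes a continuity
argument (`kg_stability`). The resulting bound on `U` up to any `T < T*` and the blow-up alternative
give the lower bound for the existence times (`le_liminf_lifespan`). -/

lemma timeSet_mem_nhdsWithin {T : ℝ≥0∞} {t : ℝ} (ht : t ∈ timeSet T) :
    timeSet T ∈ 𝓝[Ici 0] t := by
  have h : {τ : ℝ | ENNReal.ofReal τ < T} ∈ 𝓝 t :=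
    (ENNReal.continuous_ofReal.isOpen_preimage _ isOpen_Iio).mem_nhds ht.2
  filter_upwards [self_mem_nhdsWithin, mem_nhdsWithin_of_mem_nhds h] with τ h1 h2 using ⟨h1, h2⟩

lemma timeSet_mem_nhds {T : ℝ≥0∞} {t : ℝ} (ht : t ∈ timeSet T) (h0 : 0 < t) :
    timeSet T ∈ 𝓝 t := by
  have := timeSet_mem_nhdsWithin ht
  rwa [nhdsWithin_eq_nhds.2 (Ici_mem_nhds h0)] at this

lemma Icc_subset_timeSet {T : ℝ≥0∞} {t : ℝ} (ht : t ∈ timeSet T) : Icc 0 t ⊆ timeSet T :=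
  fun _ hτ => ⟨hτ.1, (ENNReal.ofReal_le_ofReal hτ.2).trans_lt ht.2⟩

lemma timeSet_mono {T T' : ℝ≥0∞} (h : T ≤ T') : timeSet T ⊆ timeSet T' :=
  fun _ ht => ⟨ht.1, ht.2.trans_le h⟩

/-- Vector fields that are continuous in time, and Lipschitz in space on bounded sets, uniformly
on compact time intervals. -/
structure Admissible (f : ℝ → X → X) (T : ℝ≥0∞) : Prop where
  cont : ∀ x, ContinuousOn (fun t => f t x) (timeSet T)
  lip : ∀ T' ∈ timeSet T, ∀ R : ℝ, ∃ K : ℝ≥0, ∀ t ∈ Icc 0 T',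
    LipschitzOnWith K (f t) (closedBall 0 R)

/-- `y' = f(t, y)` on `[0, T)` with `y(0) = x₀`. -/
structure IsSol (f : ℝ → X → X) (x₀ : X) (T : ℝ≥0∞) (y : ℝ → X) : Prop where
  init : y 0 = x₀
  deriv : ∀ t ∈ timeSet T, HasDerivWithinAt y (f t (y t)) (Ici 0) t

lemma IsSol.continuousOn {f : ℝ → X → X} {x₀ : X} {T : ℝ≥0∞} {y : ℝ → X} (h : IsSol f x₀ T y) :
    ContinuousOn y (timeSet T) :=
  fun t ht => (h.deriv t ht).continuousWithinAt.mono fun _ h => h.1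

lemma exists_norm_le_on_Icc {Z : Type*} [NormedAddCommGroup Z] {T : ℝ≥0∞} {u : ℝ → Z}
    (hu : ContinuousOn u (timeSet T))
    {T' : ℝ} (hT' : T' ∈ timeSet T) : ∃ C : ℝ, 0 ≤ C ∧ ∀ t ∈ Icc 0 T', ‖u t‖ ≤ C := by
  obtain ⟨C, hC⟩ := isCompact_Icc.exists_bound_of_continuousOn
    (hu.mono (Icc_subset_timeSet hT'))
  exact ⟨max C 0, le_max_right _ _, fun t ht => (hC t ht).trans (le_max_left _ _)⟩

/-- Near `t` the curve stays in a fixed ball, where a Lipschitz constant uniform in time controls `f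
τ (u τ) - f τ (u t)`; the rest is continuity in time at the fixed point `u t`. -/
lemma Admissible.comp_continuousOn {f : ℝ → X → X} {T : ℝ≥0∞} (hf : Admissible f T) {u : ℝ → X}
    (hu : ContinuousOn u (timeSet T)) : ContinuousOn (fun t => f t (u t)) (timeSet T) := by
  intro t ht
  obtain ⟨T', hT', htT'⟩ : ∃ T' ∈ timeSet T, t < T' := by
    obtain ⟨r, hr1, hr2⟩ := ENNReal.lt_iff_exists_nnreal_btwn.1 ht.2
    refine ⟨r, ⟨r.2, by simpa using hr2⟩, ?_⟩
    have := (ENNReal.ofReal_lt_iff_lt_toReal ht.1 ENNReal.coe_ne_top).1 hr1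
    simpa using this
  obtain ⟨C, hC0, hC⟩ := exists_norm_le_on_Icc hu hT'
  obtain ⟨K, hK⟩ := hf.lip T' hT' C
  have h1 : Tendsto (fun τ => f τ (u t)) (𝓝[timeSet T] t) (𝓝 (f t (u t))) := hf.cont _ t ht
  have h2 : Tendsto (fun τ => f τ (u τ) - f τ (u t)) (𝓝[timeSet T] t) (𝓝 0) := by
    have h3 : Tendsto (fun τ => (K : ℝ) * ‖u τ - u t‖) (𝓝[timeSet T] t) (𝓝 0) := by
      have : Tendsto (fun τ => (K : ℝ) * ‖u τ - u t‖) (𝓝[timeSet T] t) (𝓝 (K * ‖u t - u t‖)) :=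
        ((hu t ht).sub (continuousWithinAt_const (b := u t))).norm.const_mul (K : ℝ)
      simpa using this
    refine squeeze_zero_norm' ?_ h3
    filter_upwards [self_mem_nhdsWithin, mem_nhdsWithin_of_mem_nhds (Iio_mem_nhds htT')]
      with τ hτ hτ'
    have h4 : τ ∈ Icc 0 T' := ⟨hτ.1, hτ'.le⟩
    have := (hK τ h4).dist_le_mul (u τ) (by simpa using hC τ h4) (u t)
      (by simpa using hC t ⟨ht.1, htT'.le⟩)
    simpa [dist_eq_norm] using this
  have := h2.add h1
  simpa [ContinuousWithinAt] using this

lemma IsSol.eqOn {f : ℝ → X → X} {T T₁ T₂ : ℝ≥0∞} (hf : Admissible f T) {x₀ : X} {y z : ℝ → X}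
    (hy : IsSol f x₀ T₁ y) (hz : IsSol f x₀ T₂ z) {t : ℝ} (h : t ∈ timeSet T) (h1 : t ∈ timeSet T₁)
    (h2 : t ∈ timeSet T₂) : y t = z t := by
  obtain ⟨C, -, hC⟩ := exists_norm_le_on_Icc hy.continuousOn h1
  obtain ⟨D, -, hD⟩ := exists_norm_le_on_Icc hz.continuousOn h2
  obtain ⟨K, hK⟩ := hf.lip t h (max C D)
  refine ODE_solution_unique_of_mem_Icc_right (v := f) (s := fun _ => closedBall 0 (max C D))
    (K := K) (fun τ hτ => hK τ (Ico_subset_Icc_self hτ))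
    (hy.continuousOn.mono (Icc_subset_timeSet h1))
    (fun τ hτ => (hy.deriv τ (Icc_subset_timeSet h1 (Ico_subset_Icc_self hτ))).mono
      (Ici_subset_Ici.2 hτ.1))
    (fun τ hτ => by simpa using Or.inl (hC τ (Ico_subset_Icc_self hτ)))
    (hz.continuousOn.mono (Icc_subset_timeSet h2))
    (fun τ hτ => (hz.deriv τ (Icc_subset_timeSet h2 (Ico_subset_Icc_self hτ))).mono
      (Ici_subset_Ici.2 hτ.1))
    (fun τ hτ => by simpa using Or.inr (hD τ (Ico_subset_Icc_self hτ)))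
    (hy.init.trans hz.init.symm) ⟨h.1, le_rfl⟩

/-- Picard–Lindelöf. On the ball of radius `max R 0 + 1` the field is bounded by `L`, so a solution
starting within radius `R` needs at least time `1/(L+1)` to move by `1`. The point is that `δ`
depends on neither `t₀` nor `x₀`; this yields the blow-up alternative. -/
lemma Admissible.exists_local [CompleteSpace X] {f : ℝ → X → X} {T : ℝ≥0∞} (hf : Admissible f T)
    {T' : ℝ} (hT' : T' ∈ timeSet T) (R : ℝ) :
    ∃ δ > 0, ∀ t₀ ∈ Icc 0 T', ∀ x₀ : X, ‖x₀‖ ≤ R → ∃ α : ℝ → X, α t₀ = x₀ ∧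
      ∀ t ∈ Icc t₀ (min (t₀ + δ) T'),
        HasDerivWithinAt α (f t (α t)) (Icc t₀ (min (t₀ + δ) T')) t := by
  obtain ⟨K, hK⟩ := hf.lip T' hT' (max R 0 + 1)
  obtain ⟨C, hC0, hC⟩ := exists_norm_le_on_Icc (hf.cont 0) hT'
  set R' : ℝ := max R 0 + 1 with hR'
  have hR'0 : 0 < R' := by positivity
  let L : ℝ≥0 := ⟨K * R' + C, by positivity⟩
  have hL : ∀ t ∈ Icc 0 T', ∀ x ∈ closedBall (0 : X) R', ‖f t x‖ ≤ L := by
    intro t ht x hx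
    have := (hK t ht).norm_sub_le hx (mem_closedBall_self hR'0.le)
    calc ‖f t x‖ = ‖(f t x - f t 0) + f t 0‖ := by simp
      _ ≤ ‖f t x - f t 0‖ + ‖f t 0‖ := norm_add_le _ _
      _ ≤ K * R' + C := by
        refine add_le_add (this.trans ?_) (hC t ht)
        have h : ‖x‖ ≤ R' := by simpa using hx
        simpa using mul_le_mul_of_nonneg_left h K.2
  refine ⟨1 / (L + 1), by positivity, fun t₀ ht₀ x₀ hx₀ => ?_⟩
  set δ : ℝ := 1 / (L + 1) with hδ
  have hδ0 : 0 < δ := by positivity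
  have hle : t₀ ≤ min (t₀ + δ) T' := le_min (by linarith) ht₀.2
  have hball : closedBall x₀ 1 ⊆ closedBall (0 : X) R' := by
    intro x hx
    rw [mem_closedBall, dist_eq_norm] at hx
    rw [mem_closedBall, dist_zero_right]
    calc ‖x‖ = ‖(x - x₀) + x₀‖ := by simp
      _ ≤ ‖x - x₀‖ + ‖x₀‖ := norm_add_le _ _
      _ ≤ 1 + max R 0 := add_le_add hx (hx₀.trans (le_max_left _ _))
      _ = R' := by rw [hR']; ring
  have hsub : Icc t₀ (min (t₀ + δ) T') ⊆ Icc 0 T' :=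
    Icc_subset_Icc ht₀.1 (min_le_right _ _)
  have hPL : IsPicardLindelof f (tmin := t₀) (tmax := min (t₀ + δ) T')
      ⟨t₀, left_mem_Icc.2 hle⟩ x₀ 1 0 L K :=
    { lipschitzOnWith := fun t ht => (hK t (hsub ht)).mono (by simpa using hball)
      continuousOn := fun x _ => (hf.cont x).mono (hsub.trans (Icc_subset_timeSet hT'))
      norm_le := fun t ht x hx => hL t (hsub ht) x (hball (by simpa using hx))
      mul_max_le := by
        have h1 : min (t₀ + δ) T' - t₀ ≤ δ := by linarith [min_le_left (t₀ + δ) T']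
        have h2 : max (min (t₀ + δ) T' - t₀) (t₀ - t₀) ≤ δ := max_le h1 (by simpa using hδ0.le)
        have h3 : (L : ℝ) * δ ≤ 1 := by
          rw [hδ, mul_one_div, div_le_one (by positivity)]; linarith
        simpa using (mul_le_mul_of_nonneg_left h2 L.2).trans h3 }
  exact hPL.exists_eq_forall_mem_Icc_hasDerivWithinAt₀

/-- The maximal solution of an ordinary differential equation. -/
theorem Admissible.exists_maximal [CompleteSpace X] {f : ℝ → X → X} {T : ℝ≥0∞}
    (hf : Admissible f T) (hT : 0 < T) (x₀ : X) :
    ∃ Tm ≤ T, 0 < Tm ∧ ∃ y, IsSol f x₀ Tm y ∧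
      (∀ T' ≤ T, ∀ z, IsSol f x₀ T' z → T' ≤ Tm ∧ ∀ t ∈ timeSet T', z t = y t) ∧
      (Tm < T → ∀ R : ℝ, ∃ t ∈ timeSet Tm, R < ‖y t‖) := by
  classical
  -- The maximal time is the supremum of all existence times; by uniqueness the solutions on the
  -- shorter intervals glue to one curve.
  set 𝒯 : Set ℝ≥0∞ := {T' | T' ≤ T ∧ ∃ y, IsSol f x₀ T' y} with h𝒯
  set Tm := sSup 𝒯 with hTm
  have hTmT : Tm ≤ T := sSup_le fun _ h => h.1
  have hex : ∀ t : ℝ, t ∈ timeSet Tm → ∃ T' ∈ 𝒯, t ∈ timeSet T' := by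
    intro t ht
    obtain ⟨T', hT', htT'⟩ := lt_sSup_iff.1 ht.2
    exact ⟨T', hT', ht.1, htT'⟩
  choose! τ hτ hτt using hex
  have hsol : ∀ T' ∈ 𝒯, ∃ y, IsSol f x₀ T' y := fun _ h => h.2
  choose! Y hY using hsol
  set y : ℝ → X := fun t => if t ∈ timeSet Tm then Y (τ t) t else x₀ with hy
  have huniq : ∀ T' ≤ T, ∀ z, IsSol f x₀ T' z → T' ≤ Tm ∧ ∀ t ∈ timeSet T', z t = y t := by
    intro T' hT'T z hz
    have hle : T' ≤ Tm := le_sSup ⟨hT'T, z, hz⟩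
    refine ⟨hle, fun t ht => ?_⟩
    have ht' := timeSet_mono hle ht
    rw [hy]
    simp only [if_pos ht']
    exact hz.eqOn hf (hY _ (hτ t ht')) (timeSet_mono hT'T ht) ht (hτt t ht')
  have hy0 : y 0 = x₀ := by
    by_cases h : (0 : ℝ) ∈ timeSet Tm
    · simp only [hy, if_pos h]; exact (hY _ (hτ 0 h)).init
    · simp only [hy, if_neg h]
  have hysol : IsSol f x₀ Tm y := by
    refine ⟨hy0, fun t ht => ?_⟩
    have hz := hY _ (hτ t ht)
    have heq := (huniq _ (hτ t ht).1 _ hz).2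
    rw [← heq t (hτt t ht)]
    refine (hz.deriv t (hτt t ht)).congr_of_eventuallyEq ?_ (heq t (hτt t ht)).symm
    filter_upwards [timeSet_mem_nhdsWithin (hτt t ht)] with r hr using (heq r hr).symm
  -- If the norm stayed below `R`, the equation could be restarted slightly before `Tm` with a step
  -- `δ` that reaches beyond `Tm`, against maximality.
  have hblow : Tm < T → ∀ R : ℝ, ∃ t ∈ timeSet Tm, R < ‖y t‖ := by
    intro hlt R
    by_contra! hcon
    obtain ⟨T', hT'1, hT'2⟩ := ENNReal.lt_iff_exists_nnreal_btwn.1 hlt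
    have hT'mem : (T' : ℝ) ∈ timeSet T := ⟨T'.2, by simpa using hT'2⟩
    obtain ⟨δ, hδ, hloc⟩ := hf.exists_local hT'mem (max R ‖x₀‖)
    have hTmtop : Tm ≠ ⊤ := ne_top_of_lt hlt
    set s := Tm.toReal with hs
    have hs0 : 0 ≤ s := ENNReal.toReal_nonneg
    have hsT : ENNReal.ofReal s = Tm := ENNReal.ofReal_toReal hTmtop
    have hsT' : s < T' := by
      have := ENNReal.toReal_strict_mono ENNReal.coe_ne_top hT'1
      simpa using this
    -- The maximum with `0` covers `Tm < δ / 2`, and even `Tm = 0`, where the restart is the initial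
    -- value itself; hence the bound `max R ‖x₀‖` above.
    set t₀ := max 0 (s - δ / 2) with ht₀
    have ht₀0 : 0 ≤ t₀ := le_max_left _ _
    have ht₀s : t₀ ≤ s := max_le hs0 (by linarith)
    have ht₀mem : 0 < t₀ → t₀ ∈ timeSet Tm := by
      intro h
      refine ⟨ht₀0, ?_⟩
      rw [← hsT]
      have h1 : t₀ = s - δ / 2 := by
        rcases max_choice 0 (s - δ / 2) with h' | h'
        · rw [ht₀, h'] at h; exact absurd h (lt_irrefl _)
        · exact h'
      exact (ENNReal.ofReal_lt_ofReal_iff (by linarith)).2 (by linarith)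
    have hyR : ‖y t₀‖ ≤ max R ‖x₀‖ := by
      rcases ht₀0.eq_or_lt with h | h
      · rw [← h, hy0]; exact le_max_right _ _
      · exact (hcon t₀ (ht₀mem h)).trans (le_max_left _ _)
    obtain ⟨α, hα0, hα⟩ := hloc t₀ ⟨ht₀0, ht₀s.trans hsT'.le⟩ (y t₀) hyR
    set t₁ := min (t₀ + δ) T' with ht₁
    have hst₁ : s < t₁ := lt_min (by linarith [le_max_right 0 (s - δ / 2)]) hsT'
    set z : ℝ → X := fun t => if t ≤ t₀ then y t else α t with hz
    have hzα : ∀ t, t₀ ≤ t → z t = α t := by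
      intro t ht
      rcases ht.eq_or_lt with h | h
      · simp only [hz, ← h, le_refl, if_true]; exact hα0.symm
      · simp only [hz, if_neg (not_le.2 h)]
    have hzy : ∀ t, t ≤ t₀ → z t = y t := fun t ht => by simp only [hz, if_pos ht]
    have hzsol : IsSol f x₀ (ENNReal.ofReal t₁) z := by
      refine ⟨by rw [hzy 0 ht₀0, hy0], fun t ht => ?_⟩
      have htt₁ : t < t₁ := (ENNReal.ofReal_lt_ofReal_iff (by linarith)).1 ht.2
      rcases lt_trichotomy t t₀ with h | h | h
      · have htm : t ∈ timeSet Tm :=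
          ⟨ht.1, (ENNReal.ofReal_lt_ofReal_iff'.2 ⟨h, ht.1.trans_lt h⟩).trans
            (ht₀mem (ht.1.trans_lt h)).2⟩
        rw [hzy t h.le]
        refine (hysol.deriv t htm).congr_of_eventuallyEq ?_ (hzy t h.le)
        filter_upwards [mem_nhdsWithin_of_mem_nhds (Iio_mem_nhds h)] with r hr
          using hzy r (le_of_lt hr)
      · have hr : HasDerivWithinAt z (f t (z t)) (Icc t₀ t₁) t := by
          rw [hzα t h.ge]
          refine (hα t ⟨h.ge, htt₁.le⟩).congr (fun r hr => hzα r hr.1) (hzα t h.ge)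
        -- At the junction the derivatives from the two sides agree and are united. For `t₀ = 0` the
        -- left piece is a single point and carries no condition.
        have hl : HasDerivWithinAt z (f t (z t)) (Icc 0 t₀) t := by
          rcases ht₀0.eq_or_lt with h0 | h0
          · rw [h, ← h0, Icc_self]; exact HasFDerivWithinAt.of_subsingleton Set.subsingleton_singleton
          · rw [hzy t h.le]
            have htm : t ∈ timeSet Tm := h ▸ ht₀mem h0
            exact ((hysol.deriv t htm).mono fun r hr => hr.1).congr
              (fun r hr => hzy r hr.2) (hzy t h.le)
        have hu := hl.union hr
        rw [Icc_union_Icc_eq_Icc ht₀0 (h ▸ htt₁.le)] at hu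
        refine hu.mono_of_mem_nhdsWithin ?_
        filter_upwards [self_mem_nhdsWithin, mem_nhdsWithin_of_mem_nhds (Iio_mem_nhds htt₁)]
          with r h1 h2 using ⟨h1, le_of_lt h2⟩
      · rw [hzα t h.le]
        have h1 := (hα t ⟨h.le, htt₁.le⟩).hasDerivAt (Icc_mem_nhds h htt₁)
        refine (h1.congr_of_eventuallyEq ?_).hasDerivWithinAt
        filter_upwards [Ioi_mem_nhds h] with r hr using hzα r (le_of_lt hr)
    have h1 : ENNReal.ofReal t₁ ≤ T := by
      refine le_trans ?_ hT'2.le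
      rw [← ENNReal.ofReal_coe_nnreal]
      exact ENNReal.ofReal_le_ofReal (min_le_right _ _)
    have h2 : ENNReal.ofReal t₁ ≤ Tm := (huniq _ h1 z hzsol).1
    rw [← hsT] at h2
    exact absurd hst₁ (not_lt.2 ((ENNReal.ofReal_le_ofReal_iff hs0).1 h2))
  refine ⟨Tm, hTmT, ?_, y, hysol, huniq, hblow⟩
  -- If `Tm` were `0`, the blow-up alternative would produce a point of the empty set `timeSet 0`.
  by_contra h0
  have h0' : Tm = 0 := nonpos_iff_eq_zero.1 (not_lt.1 h0)
  obtain ⟨t, ht, -⟩ := hblow (h0' ▸ hT) 0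
  rw [h0'] at ht
  exact absurd ht.2 (not_lt.2 zero_le)

/-- Linear growth and Grönwall bound the maximal solution on `[0, Tm)`, which excludes blow-up
before `T`. -/
theorem Admissible.exists_global [CompleteSpace X] {f : ℝ → X → X} {T : ℝ≥0∞}
    (hf : Admissible f T) (hT : 0 < T)
    (hgrow : ∀ T' ∈ timeSet T, ∃ K c : ℝ, ∀ t ∈ Icc 0 T', ∀ x, ‖f t x‖ ≤ K * ‖x‖ + c) (x₀ : X) :
    ∃ y, IsSol f x₀ T y := by
  obtain ⟨Tm, hTm, -, y, hy, -, hblow⟩ := hf.exists_maximal hT x₀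
  rcases hTm.eq_or_lt with h | h
  · exact ⟨y, h ▸ hy⟩
  exfalso
  have hTmtop : Tm ≠ ⊤ := ne_top_of_lt h
  have hmem : Tm.toReal ∈ timeSet T :=
    ⟨ENNReal.toReal_nonneg, by rwa [ENNReal.ofReal_toReal hTmtop]⟩
  obtain ⟨K, c, hKc⟩ := hgrow _ hmem
  set K' := max K 0
  set c' := max c 0
  obtain ⟨t, ht, hlt⟩ := hblow h (gronwallBound ‖x₀‖ K' c' Tm.toReal)
  have htT : t ≤ Tm.toReal := (ENNReal.ofReal_le_iff_le_toReal hTmtop).1 ht.2.le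
  have := norm_le_gronwallBound_of_norm_deriv_right_le (f := y) (f' := fun t => f t (y t))
    (δ := ‖x₀‖) (K := K') (ε := c') (a := 0) (b := t)
    (hy.continuousOn.mono (Icc_subset_timeSet ht))
    (fun τ hτ => (hy.deriv τ (Icc_subset_timeSet ht (Ico_subset_Icc_self hτ))).mono
      (Ici_subset_Ici.2 hτ.1))
    (by rw [hy.init])
    (fun τ hτ => (hKc τ ⟨hτ.1, hτ.2.le.trans htT⟩ _).trans
      (add_le_add (mul_le_mul_of_nonneg_right (le_max_left _ _) (norm_nonneg _))
        (le_max_left _ _)))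
    t ⟨ht.1, le_rfl⟩
  rw [sub_zero] at this
  exact absurd (this.trans (gronwallBound_mono (norm_nonneg _) (le_max_right _ _)
    (le_max_right _ _) htT)) (not_le.2 hlt)

end ODE

/-! ### Bounded groups of operators and the interaction representation -/

section Flow

variable {X : Type*} [NormedAddCommGroup X] [NormedSpace ℝ X]

/-- A uniformly bounded, strongly continuous one-parameter group. -/
structure Flow (X : Type*) [NormedAddCommGroup X] [NormedSpace ℝ X] where
  toFun : ℝ → X →L[ℝ] X
  bd : ℝ
  bd_nonneg : 0 ≤ bd
  zero : toFun 0 = ContinuousLinearMap.id ℝ X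
  add : ∀ s t x, toFun (s + t) x = toFun s (toFun t x)
  bound : ∀ t x, ‖toFun t x‖ ≤ bd * ‖x‖
  cont : ∀ x, Continuous (fun t => toFun t x)

instance : CoeFun (Flow X) (fun _ => ℝ → X →L[ℝ] X) := ⟨Flow.toFun⟩

/-- The unbounded generator of the flow, composed with the smoothing operator `J`, is `Λ`. -/
structure Flow.Generates (S : Flow X) (J Λ : X →L[ℝ] X) : Prop where
  comm : ∀ t x, S t (J x) = J (S t x)
  deriv : ∀ x, HasDerivAt (fun t => S t (J x)) (Λ x) 0

/-- `J` has approximate left inverses. -/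
def ApproxInv (J : X →L[ℝ] X) : Prop :=
  ∃ Q : ℕ → X →L[ℝ] X, (∀ n x, ‖Q n (J x)‖ ≤ ‖x‖) ∧
    ∀ x, Tendsto (fun n => Q n (J x)) atTop (𝓝 x)

lemma ApproxInv.injective {J : X →L[ℝ] X} (h : ApproxInv J) : Function.Injective J := by
  obtain ⟨Q, -, hQ⟩ := h
  intro x y hxy
  exact tendsto_nhds_unique (hQ x) (by rw [hxy]; exact hQ y)

variable (S : Flow X)

lemma Flow.neg_apply (t : ℝ) (x : X) : S (-t) (S t x) = x := by
  rw [← S.add, neg_add_cancel, S.zero]; rfl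

lemma Flow.apply_neg (t : ℝ) (x : X) : S t (S (-t) x) = x := by
  rw [← S.add, add_neg_cancel, S.zero]; rfl

/-- Strong continuity and the uniform bound give joint continuity in time and vector. -/
lemma Flow.tendsto {α : Type*} {l : Filter α} {t : α → ℝ} {u : α → X} {t₀ : ℝ} {x : X}
    (ht : Tendsto t l (𝓝 t₀)) (hu : Tendsto u l (𝓝 x)) :
    Tendsto (fun a => S (t a) (u a)) l (𝓝 (S t₀ x)) := by
  have h1 : Tendsto (fun a => S (t a) x) l (𝓝 (S t₀ x)) := ((S.cont x).tendsto t₀).comp ht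
  have h2 : Tendsto (fun a => S (t a) (u a - x)) l (𝓝 0) := by
    have h3 : Tendsto (fun a => S.bd * ‖u a - x‖) l (𝓝 (S.bd * ‖x - x‖)) :=
      (hu.sub_const x).norm.const_mul _
    rw [sub_self, norm_zero, mul_zero] at h3
    exact squeeze_zero_norm (fun a => S.bound _ _) h3
  have := h2.add h1
  simpa using this

lemma Flow.norm_le (t : ℝ) (x : X) : ‖x‖ ≤ S.bd * ‖S t x‖ := by
  have := S.bound (-t) (S t x)
  rwa [S.neg_apply] at this

/-- The reversed flow. -/
def Flow.reverse : Flow X where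
  toFun t := S (-t)
  bd := S.bd
  bd_nonneg := S.bd_nonneg
  zero := by rw [neg_zero, S.zero]
  add s t x := by rw [neg_add, S.add]
  bound t x := S.bound _ _
  cont x := (S.cont x).comp continuous_neg

variable {S}

lemma Flow.Generates.deriv_at {J Λ : X →L[ℝ] X} (h : S.Generates J Λ) (t : ℝ) (x : X) :
    HasDerivAt (fun τ => S τ (J x)) (S t (Λ x)) t := by
  have h1 : HasDerivAt (fun τ => S (τ - t) (J x)) (Λ x) t := by
    have h0 := h.deriv x
    rw [← sub_self t] at h0
    exact h0.comp_sub_const t t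
  have h2 := (S t).hasFDerivAt.comp_hasDerivAt t h1
  refine h2.congr_of_eventuallyEq (Eventually.of_forall fun τ => ?_)
  simp only [Function.comp_apply]
  rw [← S.add]
  congr 2
  ring

/-- Both sides are the derivative at `t` of `τ ↦ S τ (J x)`: once by factoring out `S t` on the
left, once by moving `S t` onto `x`. -/
lemma Flow.Generates.comm_gen {J Λ : X →L[ℝ] X} (h : S.Generates J Λ) (t : ℝ) (x : X) :
    S t (Λ x) = Λ (S t x) := by
  have h1 := h.deriv_at t x
  have h2 : HasDerivAt (fun τ => S τ (J x)) (Λ (S t x)) t := by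
    have h0 := h.deriv (S t x)
    rw [← sub_self t] at h0
    refine (h0.comp_sub_const t t).congr_of_eventuallyEq (Eventually.of_forall fun τ => ?_)
    beta_reduce
    rw [← h.comm, ← S.add, sub_add_cancel]
  exact h1.unique h2

lemma Flow.Generates.reverse {J Λ : X →L[ℝ] X} (h : S.Generates J Λ) :
    S.reverse.Generates J (-Λ) where
  comm t x := h.comm _ _
  deriv x := by
    have h0 := h.deriv x
    rw [← neg_zero] at h0
    have := HasDerivAt.scomp (0 : ℝ) h0 (hasDerivAt_neg 0)
    simpa [Function.comp_def, Flow.reverse] using this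

/-- Product rule for a flow applied to a curve. -/
lemma Flow.Generates.hasDerivAt_apply {J Λ : X →L[ℝ] X} (h : S.Generates J Λ) {a : ℝ → X}
    {a' x : X} {t : ℝ} (ha : HasDerivAt a a' t) (hx : a t = J x) :
    HasDerivAt (fun τ => S τ (a τ)) (S t (Λ x) + S t a') t := by
  rw [hasDerivAt_iff_tendsto_slope] at ha ⊢
  have h1 := hasDerivAt_iff_tendsto_slope.1 (h.deriv_at t x)
  have h2 : Tendsto (fun τ => S τ (slope a t τ)) (𝓝[≠] t) (𝓝 (S t a')) :=
    S.tendsto (tendsto_id.mono_left nhdsWithin_le_nhds) ha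
  -- The slope of `S τ (a τ)` splits exactly into the slope of `S τ (J x)` and `S τ` applied to the
  -- slope of `a`.
  refine (h1.add h2).congr fun τ => ?_
  simp only [slope_def_module, hx, map_smul, map_sub, ← smul_add]
  congr 1
  abel

/-- A curve solving the equation in the interaction representation is a strong solution. -/
lemma Flow.Generates.strong_of_mild {J Λ : X →L[ℝ] X} (h : S.Generates J Λ) {y : ℝ → X} {g : X}
    {t : ℝ} (hy : HasDerivAt y (S (-t) g) t) :
    HasDerivAt (fun τ => J (S τ (y τ))) (Λ (S t (y t)) + J g) t := by
  have h1 : HasDerivAt (fun τ => J (y τ)) (J (S (-t) g)) t := J.hasFDerivAt.comp_hasDerivAt t hy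
  have h2 := h.hasDerivAt_apply h1 rfl
  rw [h.comm_gen, h.comm, S.apply_neg] at h2
  simpa only [h.comm] using h2

/-- The product rule for the reversed flow, whose generator is `-Λ`: the two generator terms cancel.
-/
lemma Flow.Generates.hasDerivAt_interaction {J Λ : X →L[ℝ] X} (h : S.Generates J Λ) {v : ℝ → X}
    {g x : X} {t : ℝ} (hx : v t = J x) (hv : HasDerivAt v (Λ x + g) t) :
    HasDerivAt (fun τ => S (-τ) (v τ)) (S (-t) g) t := by
  have := h.reverse.hasDerivAt_apply hv hx
  simpa [Flow.reverse] using this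

lemma hasDerivWithinAt_of_integral [CompleteSpace X] {T : ℝ≥0∞} {g : ℝ → X}
    (hg : ContinuousOn g (timeSet T)) {t : ℝ} (ht : t ∈ timeSet T) :
    HasDerivWithinAt (fun u => ∫ τ in (0 : ℝ)..u, g τ) (g t) (Ici 0) t := by
  obtain ⟨r, hr1, hr2⟩ := ENNReal.lt_iff_exists_nnreal_btwn.1 ht.2
  have htr : t < r := by
    have := (ENNReal.ofReal_lt_iff_lt_toReal ht.1 ENNReal.coe_ne_top).1 hr1
    simpa using this
  have hr : (r : ℝ) ∈ timeSet T := ⟨r.2, by simpa using hr2⟩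
  have hc : ContinuousOn g (Icc 0 (r : ℝ)) := hg.mono (Icc_subset_timeSet hr)
  have hr0 : (0 : ℝ) ≤ r := r.2
  have : Fact (t ∈ Icc 0 (r : ℝ)) := ⟨ht.1, htr.le⟩
  have h1 : HasDerivWithinAt (fun u => ∫ τ in (0 : ℝ)..u, g τ) (g t) (Icc 0 (r : ℝ)) t := by
    refine intervalIntegral.integral_hasDerivWithinAt_right ?_
      ((hc.stronglyMeasurableAtFilter_nhdsWithin measurableSet_Icc t)) (hc t ⟨ht.1, htr.le⟩)
    refine (hc.mono ?_).intervalIntegrable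
    rw [uIcc_of_le ht.1]
    exact Icc_subset_Icc_right htr.le
  refine h1.mono_of_mem_nhdsWithin ?_
  filter_upwards [self_mem_nhdsWithin, mem_nhdsWithin_of_mem_nhds (Iio_mem_nhds htr)]
    with u h1 h2 using ⟨h1, le_of_lt h2⟩

/-- A strong solution solves the equation in the interaction representation. -/
lemma Flow.Generates.mild_of_strong [CompleteSpace X] {J Λ : X →L[ℝ] X} (h : S.Generates J Λ)
    (hJ : Function.Injective J) {T : ℝ≥0∞} {u g : ℝ → X} (hu : ContinuousOn u (timeSet T))
    (hg : ContinuousOn g (timeSet T))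
    (hd : ∀ t ∈ timeSet T, 0 < t → HasDerivAt (fun τ => J (u τ)) (Λ (u t) + J (g t)) t) :
    ∀ t ∈ timeSet T, HasDerivWithinAt (fun τ => S (-τ) (u τ)) (S (-t) (g t)) (Ici 0) t := by
  have hSc : ∀ {w : ℝ → X}, ContinuousOn w (timeSet T) →
      ContinuousOn (fun τ => S (-τ) (w τ)) (timeSet T) := fun hw t ht =>
    S.tendsto ((continuous_neg.tendsto t).mono_left nhdsWithin_le_nhds) (hw t ht)
  -- The equation is only known after `J` has been applied. Integrating in time and then using that
  -- `J` is injective recovers an identity in `X`, which can be differentiated without loss.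
  have key : ∀ t ∈ timeSet T, S (-t) (u t) = u 0 + ∫ τ in (0 : ℝ)..t, S (-τ) (g τ) := by
    intro t ht
    apply hJ
    have hsub := Icc_subset_timeSet ht
    have hint : IntervalIntegrable (fun τ => S (-τ) (g τ)) volume 0 t := by
      refine ((hSc hg).mono ?_).intervalIntegrable
      rw [uIcc_of_le ht.1]; exact hsub
    have h1 := intervalIntegral.integral_eq_sub_of_hasDerivAt_of_le ht.1
      (f := fun τ => J (S (-τ) (u τ))) (f' := fun τ => J (S (-τ) (g τ)))
      (J.continuous.comp_continuousOn ((hSc hu).mono hsub))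
      (fun τ hτ => by
        have := h.hasDerivAt_interaction rfl (hd τ (hsub (Ioo_subset_Icc_self hτ)) hτ.1)
        simpa only [h.comm] using this)
      (by
        refine (J.continuous.comp_continuousOn ((hSc hg).mono ?_)).intervalIntegrable
        rw [uIcc_of_le ht.1]; exact hsub)
    rw [ContinuousLinearMap.intervalIntegral_comp_comm J hint] at h1
    rw [map_add, h1, neg_zero, S.zero]
    simp
  intro t ht
  have h1 := (hasDerivWithinAt_of_integral (hSc hg) ht).const_add (u 0)
  refine h1.congr_of_eventuallyEq ?_ (key t ht)
  filter_upwards [timeSet_mem_nhdsWithin ht] with τ hτ using key τ hτ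

/-- A bound on the increments in the interaction representation. -/
lemma Flow.Generates.norm_increment_le {J Λ : X →L[ℝ] X} (h : S.Generates J Λ)
    (hJ : ApproxInv J) {a b M : ℝ} (hab : a ≤ b) {u g : ℝ → X} (hu : ContinuousOn u (Icc a b))
    (hd : ∀ t ∈ Ioo a b, HasDerivAt (fun τ => J (u τ)) (Λ (u t) + J (g t)) t)
    (hg : ∀ t ∈ Ioo a b, ‖g t‖ ≤ M) :
    ‖S (-b) (u b) - S (-a) (u a)‖ ≤ S.bd * M * (b - a) := by
  obtain ⟨Q, hQ1, hQ2⟩ := hJ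
  set w : ℝ → X := fun τ => S (-τ) (u τ) with hw
  have hwc : ContinuousOn w (Icc a b) := fun t ht =>
    S.tendsto ((continuous_neg.tendsto t).mono_left nhdsWithin_le_nhds) (hu t ht)
  rcases hab.eq_or_lt with rfl | hab
  · simp
  have hderiv : ∀ t ∈ Ioo a b, HasDerivAt (fun τ => J (w τ)) (J (S (-t) (g t))) t := by
    intro t ht
    have := h.hasDerivAt_interaction rfl (hd t ht)
    simpa only [h.comm] using this
  -- Only `J w` is differentiable. The maps `Q n ∘ J` do not increase norms, so the mean value
  -- inequality holds for `Q n (J w)` uniformly in `n` and passes to the limit. The endpoint `a` is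
  -- reached by continuity, since the equation is assumed on the open interval.
  have hstep : ∀ a' ∈ Ioo a b, ‖w b - w a'‖ ≤ S.bd * M * (b - a') := by
    intro a' ha'
    have h1 : ∀ n, ‖Q n (J (w b)) - Q n (J (w a'))‖ ≤ S.bd * M * (b - a') := fun n =>
      norm_image_sub_le_of_norm_deriv_right_le_segment (f := fun τ => Q n (J (w τ)))
        (f' := fun τ => Q n (J (S (-τ) (g τ)))) (a := a') (b := b)
        ((Q n).continuous.comp_continuousOn
          (J.continuous.comp_continuousOn (hwc.mono (Icc_subset_Icc_left ha'.1.le))))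
        (fun t ht => ((Q n).hasFDerivAt.comp_hasDerivAt t
          (hderiv t ⟨ha'.1.trans_le ht.1, ht.2⟩)).hasDerivWithinAt)
        (fun t ht => (hQ1 n _).trans ((S.bound _ _).trans
          (mul_le_mul_of_nonneg_left (hg t ⟨ha'.1.trans_le ht.1, ht.2⟩) S.bd_nonneg)))
        b ⟨ha'.2.le, le_rfl⟩
    exact le_of_tendsto ((hQ2 (w b)).sub (hQ2 (w a'))).norm (Eventually.of_forall h1)
  have h1 : Tendsto (fun a' => ‖w b - w a'‖) (𝓝[>] a) (𝓝 ‖w b - w a‖) := by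
    have h2 : Tendsto w (𝓝[>] a) (𝓝 (w a)) := by
      have := hwc a ⟨le_rfl, hab.le⟩
      exact this.mono_left (nhdsWithin_le_of_mem (mem_of_superset (Ioc_mem_nhdsGT hab)
        Ioc_subset_Icc_self))
    exact (tendsto_const_nhds.sub h2).norm
  have h2 : Tendsto (fun a' => S.bd * M * (b - a')) (𝓝[>] a) (𝓝 (S.bd * M * (b - a))) :=
    ((tendsto_const_nhds.sub tendsto_id).const_mul _).mono_left nhdsWithin_le_nhds
  refine le_of_tendsto_of_tendsto h1 h2 ?_
  filter_upwards [Ioo_mem_nhdsGT hab] with a' ha' using hstep a' ha'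

/-- Gronwall's inequality for strong solutions. -/
lemma Flow.Generates.gronwall {J Λ : X →L[ℝ] X} (h : S.Generates J Λ)
    (hJ : ApproxInv J) {b K c δ : ℝ} (hb : 0 ≤ b) (hK : 0 ≤ K) {u g : ℝ → X}
    (hu : ContinuousOn u (Icc 0 b))
    (hd : ∀ t ∈ Ioo 0 b, HasDerivAt (fun τ => J (u τ)) (Λ (u t) + J (g t)) t)
    (hg : ∀ t ∈ Ioo 0 b, ‖g t‖ ≤ K * ‖u t‖ + c) (h0 : ‖u 0‖ ≤ δ) :
    ‖u b‖ ≤ S.bd * gronwallBound δ (S.bd * K * S.bd) (S.bd * c) b := by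
  set w : ℝ → X := fun τ => S (-τ) (u τ) with hw
  have hwc : ContinuousOn w (Icc 0 b) := fun t ht =>
    S.tendsto ((continuous_neg.tendsto t).mono_left nhdsWithin_le_nhds) (hu t ht)
  have huw : ∀ t, ‖u t‖ ≤ S.bd * ‖w t‖ := fun t => S.norm_le (-t) (u t)
  -- `w` need not be differentiable in `X`, so Grönwall is used in the form that asks for bounds on
  -- right difference quotients only. They come from `norm_increment_le` on `[t, z]`, with the
  -- maximum of `‖u‖` there.
  have key : ‖w b‖ ≤ gronwallBound δ (S.bd * K * S.bd) (S.bd * c) (b - 0) := by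
    refine le_gronwallBound_of_liminf_deriv_right_le (f := fun t => ‖w t‖)
      (f' := fun t => S.bd * (K * ‖u t‖ + c)) (a := 0) (b := b) hwc.norm ?_ ?_ ?_ b ⟨hb, le_rfl⟩
    · intro t ht r hr
      have hlt : ∀ᶠ τ in 𝓝[Icc 0 b] t, S.bd * (K * ‖u τ‖ + c) < r :=
        ((((hu t ⟨ht.1, ht.2.le⟩).norm.const_mul K).add_const c).const_mul S.bd).eventually
          (gt_mem_nhds hr)
      obtain ⟨ε, hε, hball⟩ := Metric.mem_nhdsWithin_iff.1 hlt
      refine Eventually.frequently ?_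
      filter_upwards [Ioo_mem_nhdsGT (lt_min (lt_add_of_pos_right t hε) ht.2)] with z hz
      have hzb : z ≤ b := hz.2.le.trans (min_le_right _ _)
      have hsubs : ∀ τ ∈ Icc t z, S.bd * (K * ‖u τ‖ + c) < r := fun τ hτ => hball
        ⟨by
          rw [Metric.mem_ball, Real.dist_eq, abs_of_nonneg (by linarith [hτ.1])]
          linarith [hτ.2, hz.2, min_le_left (t + ε) b], ht.1.trans hτ.1, hτ.2.trans hzb⟩
      obtain ⟨m, hm, hmax⟩ := isCompact_Icc.exists_isMaxOn (nonempty_Icc.2 hz.1.le)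
        ((hu.mono (Icc_subset_Icc ht.1 hzb)).norm)
      have h1 := h.norm_increment_le hJ hz.1.le (M := K * ‖u m‖ + c)
        (hu.mono (Icc_subset_Icc ht.1 hzb))
        (fun τ hτ => hd τ ⟨ht.1.trans_lt hτ.1, hτ.2.trans_le hzb⟩)
        (fun τ hτ => (hg τ ⟨ht.1.trans_lt hτ.1, hτ.2.trans_le hzb⟩).trans
          (add_le_add_left (mul_le_mul_of_nonneg_left (hmax (Ioo_subset_Icc_self hτ)) hK) c))
      have hzt : 0 < z - t := sub_pos.2 hz.1
      rw [inv_mul_lt_iff₀ hzt]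
      calc ‖w z‖ - ‖w t‖ ≤ ‖w z - w t‖ := norm_sub_norm_le _ _
        _ ≤ S.bd * (K * ‖u m‖ + c) * (z - t) := h1
        _ < (z - t) * r := by
          rw [mul_comm (z - t)]
          exact mul_lt_mul_of_pos_right (hsubs m hm) hzt
    · simpa [hw, S.zero] using h0
    · intro t ht
      have : S.bd * (K * ‖u t‖) ≤ S.bd * (K * (S.bd * ‖w t‖)) :=
        mul_le_mul_of_nonneg_left (mul_le_mul_of_nonneg_left (huw t) hK) S.bd_nonneg
      nlinarith
  rw [sub_zero] at key
  exact (huw b).trans (mul_le_mul_of_nonneg_left key S.bd_nonneg)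

/-- The vector field in the interaction representation. -/
def Flow.interaction (S : Flow X) (N : ℝ → X → X) (t : ℝ) (x : X) : X := S (-t) (N t (S t x))

/-- The uniform bound of the group maps the ball of radius `R` into that of radius `S.bd * R` and
costs the factor `S.bd` twice in the Lipschitz constant. -/
lemma Flow.interaction_admissible {N : ℝ → X → X} {T : ℝ≥0∞} (hN : Admissible N T) :
    Admissible (S.interaction N) T where
  cont x t ht := S.tendsto ((continuous_neg.tendsto t).mono_left nhdsWithin_le_nhds)
    (hN.comp_continuousOn (S.cont x).continuousOn t ht)
  lip T' hT' R := by
    obtain ⟨K, hK⟩ := hN.lip T' hT' (S.bd * R)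
    refine ⟨S.bd.toNNReal * K * S.bd.toNNReal, fun t ht => ?_⟩
    refine LipschitzOnWith.of_dist_le_mul fun x hx y hy => ?_
    rw [mem_closedBall_zero_iff] at hx hy
    have h1 := (hK t ht).dist_le_mul (S t x)
      (by simpa using (S.bound t x).trans (mul_le_mul_of_nonneg_left hx S.bd_nonneg)) (S t y)
      (by simpa using (S.bound t y).trans (mul_le_mul_of_nonneg_left hy S.bd_nonneg))
    rw [dist_eq_norm, dist_eq_norm, ← map_sub] at h1
    rw [dist_eq_norm, dist_eq_norm, Flow.interaction, Flow.interaction, ← map_sub]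
    calc _ ≤ S.bd * ‖N t (S t x) - N t (S t y)‖ := S.bound _ _
      _ ≤ S.bd * (K * (S.bd * ‖x - y‖)) := by
        gcongr
        · exact S.bd_nonneg
        · exact h1.trans (mul_le_mul_of_nonneg_left (S.bound _ _) K.2)
      _ = _ := by push_cast; rw [Real.coe_toNNReal _ S.bd_nonneg]; ring

end Flow

/-! ### Bounded Fourier multipliers on the frequency side -/

section Mult

/-- `m` is a measurable function bounded by `C`. -/
structure BddMult (m : Plane → ℂ) (C : ℝ) : Prop where
  meas : Measurable m
  le : ∀ ξ, ‖m ξ‖ ≤ C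

lemma BddMult.memLp {m : Plane → ℂ} {C : ℝ} (h : BddMult m C) : MemLp m ∞ (volume : Measure Plane) :=
  memLp_top_of_bound h.meas.aestronglyMeasurable C (Eventually.of_forall h.le)

lemma BddMult.nonneg {m : Plane → ℂ} {C : ℝ} (h : BddMult m C) : 0 ≤ C :=
  (norm_nonneg _).trans (h.le 0)

lemma BddMult.mul {m n : Plane → ℂ} {C D : ℝ} (h : BddMult m C) (k : BddMult n D) :
    BddMult (fun ξ => m ξ * n ξ) (C * D) :=
  ⟨h.meas.mul k.meas, fun ξ => by
    rw [norm_mul]; exact mul_le_mul (h.le ξ) (k.le ξ) (norm_nonneg _) h.nonneg⟩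

open Classical in
/-- Multiplication by a bounded measurable function (`0` if `m` is not essentially bounded). -/
def mulOp (m : Plane → ℂ) : L2 →L[ℂ] L2 :=
  if h : MemLp m ∞ (volume : Measure Plane) then
    (ContinuousLinearMap.mul ℂ ℂ).holderL (volume : Measure Plane) ∞ 2 2 (h.toLp m) else 0

lemma mulOp_coe {m : Plane → ℂ} {C : ℝ} (h : BddMult m C) (f : L2) :
    mulOp m f =ᵐ[volume] fun ξ => m ξ * f ξ := by
  rw [mulOp, dif_pos h.memLp]
  refine ((ContinuousLinearMap.mul ℂ ℂ).coeFn_holder (r := 2) (h.memLp.toLp m) f).trans ?_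
  filter_upwards [h.memLp.coeFn_toLp] with ξ hξ
  simp [hξ]

lemma enorm_L2_sq (f : L2) : ‖f‖ₑ ^ 2 = ∫⁻ ξ, ‖f ξ‖ₑ ^ 2 := by
  rw [Lp.enorm_def, eLpNorm_eq_lintegral_rpow_enorm_toReal (by norm_num) (by norm_num)]
  rw [← ENNReal.rpow_natCast, ← ENNReal.rpow_mul]
  simp

lemma eq_of_ae {f g : L2} (h : ∀ᵐ ξ, f ξ = g ξ) : f = g := Lp.ext h

lemma norm_mulOp_le {m : Plane → ℂ} {C : ℝ} (h : BddMult m C) (f : L2) :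
    ‖mulOp m f‖ ≤ C * ‖f‖ := by
  refine Lp.norm_le_mul_norm_of_ae_le_mul ?_
  filter_upwards [mulOp_coe h f] with ξ hξ
  rw [hξ, norm_mul]
  exact mul_le_mul_of_nonneg_right (h.le ξ) (norm_nonneg _)

lemma mulOp_mulOp {m n : Plane → ℂ} {C D : ℝ} (h : BddMult m C) (k : BddMult n D) (f : L2) :
    mulOp m (mulOp n f) = mulOp (fun ξ => m ξ * n ξ) f := by
  refine eq_of_ae ?_
  filter_upwards [mulOp_coe h (mulOp n f), mulOp_coe k f, mulOp_coe (h.mul k) f] with ξ h1 h2 h3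
  rw [h1, h2, h3, mul_assoc]

lemma mulOp_comm {m n : Plane → ℂ} {C D : ℝ} (h : BddMult m C) (k : BddMult n D) (f : L2) :
    mulOp m (mulOp n f) = mulOp n (mulOp m f) := by
  rw [mulOp_mulOp h k, mulOp_mulOp k h]
  simp_rw [mul_comm]

lemma bddMult_const (c : ℂ) : BddMult (fun _ => c) ‖c‖ := ⟨measurable_const, fun _ => le_rfl⟩

lemma mulOp_const (c : ℂ) (f : L2) : mulOp (fun _ => c) f = c • f := by
  refine eq_of_ae ?_
  filter_upwards [mulOp_coe (bddMult_const c) f, Lp.coeFn_smul c f] with ξ h1 h2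
  rw [h1, h2]; rfl

lemma mulOp_one (f : L2) : mulOp (fun _ => 1) f = f := by rw [mulOp_const, one_smul]

lemma BddMult.sum {ι : Type*} {s : Finset ι} {m : ι → Plane → ℂ} {C : ι → ℝ}
    (h : ∀ i ∈ s, BddMult (m i) (C i)) : BddMult (fun ξ => ∑ i ∈ s, m i ξ) (∑ i ∈ s, C i) :=
  ⟨Finset.measurable_fun_sum _ fun i hi => (h i hi).meas, fun ξ =>
    (norm_sum_le _ _).trans (Finset.sum_le_sum fun i hi => (h i hi).le ξ)⟩

lemma mulOp_sum {ι : Type*} {s : Finset ι} {m : ι → Plane → ℂ} {C : ι → ℝ}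
    (h : ∀ i ∈ s, BddMult (m i) (C i)) (f : L2) :
    mulOp (fun ξ => ∑ i ∈ s, m i ξ) f = ∑ i ∈ s, mulOp (m i) f := by
  refine eq_of_ae ?_
  have h2 : ∀ᵐ ξ, ∀ i ∈ s, mulOp (m i) f ξ = m i ξ * f ξ :=
    (ae_ball_iff s.countable_toSet).2 fun i hi => mulOp_coe (h i hi) f
  filter_upwards [mulOp_coe (BddMult.sum h) f, Lp.coeFn_fun_finsetSum s (fun i => mulOp (m i) f), h2]
    with ξ h1 h3 h4
  rw [h1, h3, Finset.sum_mul]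
  exact Finset.sum_congr rfl fun i hi => (h4 i hi).symm

lemma BddMult.sub {m n : Plane → ℂ} {C D : ℝ} (h : BddMult m C) (k : BddMult n D) :
    BddMult (fun ξ => m ξ - n ξ) (C + D) :=
  ⟨h.meas.sub k.meas, fun ξ => (norm_sub_le _ _).trans (add_le_add (h.le ξ) (k.le ξ))⟩

lemma mulOp_sub {m n : Plane → ℂ} {C D : ℝ} (h : BddMult m C) (k : BddMult n D) (f : L2) :
    mulOp (fun ξ => m ξ - n ξ) f = mulOp m f - mulOp n f := by
  refine eq_of_ae ?_
  filter_upwards [mulOp_coe (h.sub k) f, mulOp_coe h f, mulOp_coe k f,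
    Lp.coeFn_sub (mulOp m f) (mulOp n f)] with ξ h1 h2 h3 h4
  rw [h1, h4, Pi.sub_apply, h2, h3, sub_mul]

lemma mulOp_const_mul {m : Plane → ℂ} {C : ℝ} (c : ℂ) (h : BddMult m C) (f : L2) :
    mulOp (fun ξ => c * m ξ) f = c • mulOp m f := by
  rw [← mulOp_mulOp (bddMult_const c) h, mulOp_const]

/-- Dominated convergence for multiplication operators. -/
lemma tendsto_mulOp {α : Type*} {l : Filter α} [l.IsCountablyGenerated] {m : α → Plane → ℂ}
    {m₀ : Plane → ℂ} {C : ℝ} (hm : ∀ᶠ a in l, BddMult (m a) C) (hm₀ : BddMult m₀ C)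
    (hlim : ∀ ξ, Tendsto (fun a => m a ξ) l (𝓝 (m₀ ξ))) (f : L2) :
    Tendsto (fun a => mulOp (m a) f) l (𝓝 (mulOp m₀ f)) := by
  have hf : ∫⁻ ξ, ‖f ξ‖ₑ ^ 2 ≠ ∞ := by
    rw [← enorm_L2_sq]; exact ENNReal.pow_ne_top enorm_ne_top
  have hfm : Measurable (fun ξ => f ξ) := (Lp.stronglyMeasurable f).measurable
  have h1 : Tendsto (fun a => ∫⁻ ξ, ‖(m a ξ - m₀ ξ) * f ξ‖ₑ ^ 2) l (𝓝 (∫⁻ _ : Plane, 0)) := by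
    refine tendsto_lintegral_filter_of_dominated_convergence
      (fun ξ => (ENNReal.ofReal (C + C)) ^ 2 * ‖f ξ‖ₑ ^ 2) ?_ ?_ ?_ ?_
    · filter_upwards [hm] with a ha
      exact (((ha.meas.sub hm₀.meas).mul hfm).enorm.pow_const 2)
    · filter_upwards [hm] with a ha
      refine Eventually.of_forall fun ξ => ?_
      rw [enorm_mul, mul_pow]
      gcongr
      rw [← ofReal_norm]
      exact ENNReal.ofReal_le_ofReal ((ha.sub hm₀).le ξ)
    · rw [lintegral_const_mul' _ _ (by finiteness)]
      exact ENNReal.mul_ne_top (by finiteness) hf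
    · refine Eventually.of_forall fun ξ => ?_
      have h2 : Tendsto (fun a => (m a ξ - m₀ ξ) * f ξ) l (𝓝 0) := by
        have := ((hlim ξ).sub_const (m₀ ξ)).mul_const (f ξ)
        simpa using this
      have h3 := (ENNReal.continuous_pow 2).tendsto _ |>.comp h2.enorm
      simpa [Function.comp_def] using h3
  rw [lintegral_zero] at h1
  have h2 : Tendsto (fun a => ‖mulOp (m a) f - mulOp m₀ f‖ₑ ^ 2) l (𝓝 0) := by
    refine h1.congr' ?_
    filter_upwards [hm] with a ha
    rw [← mulOp_sub ha hm₀, enorm_L2_sq]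
    refine lintegral_congr_ae ?_
    filter_upwards [mulOp_coe (ha.sub hm₀) f] with ξ hξ
    rw [hξ]
  have h3 : Tendsto (fun a => ‖mulOp (m a) f - mulOp m₀ f‖ₑ) l (𝓝 0) := by
    have := (ENNReal.continuous_rpow_const (y := 1 / 2)).tendsto 0 |>.comp h2
    refine (this.congr fun a => ?_).trans (by simp)
    simp only [Function.comp]
    rw [← ENNReal.rpow_natCast, ← ENNReal.rpow_mul]
    simp
  rw [tendsto_iff_edist_tendsto_0]
  simpa only [edist_eq_enorm_sub] using h3

end Mult

/-! ### The space `H^σ` as an isometric copy of `L²` -/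

section Sobolev

/-- The weight `(1 + |ξ|²)^{σ/2}`. -/
def jap (σ : ℝ) (ξ : Plane) : ℂ := (((1 + ‖ξ‖ ^ 2) ^ (σ / 2) : ℝ) : ℂ)

lemma norm_jap (σ : ℝ) (ξ : Plane) : ‖jap σ ξ‖ = (1 + ‖ξ‖ ^ 2) ^ (σ / 2) := by
  rw [jap, Complex.norm_real, Real.norm_of_nonneg (by positivity)]

lemma continuous_jap (σ : ℝ) : Continuous (jap σ) := by
  unfold jap
  refine Complex.continuous_ofReal.comp (Continuous.rpow_const (by fun_prop) fun ξ => Or.inl ?_)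
  positivity

lemma jap_add (σ τ : ℝ) (ξ : Plane) : jap (σ + τ) ξ = jap σ ξ * jap τ ξ := by
  rw [jap, jap, jap, ← Complex.ofReal_mul, ← Real.rpow_add (by positivity), add_div]

lemma jap_zero (ξ : Plane) : jap 0 ξ = 1 := by simp [jap]

lemma jap_neg_mul (σ : ℝ) (ξ : Plane) : jap σ ξ * jap (-σ) ξ = 1 := by
  rw [← jap_add, add_neg_cancel, jap_zero]

lemma norm_jap_neg_le {σ : ℝ} (hσ : 0 ≤ σ) (ξ : Plane) : ‖jap (-σ) ξ‖ ≤ 1 := by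
  rw [norm_jap]
  exact Real.rpow_le_one_of_one_le_of_nonpos (by nlinarith [sq_nonneg ‖ξ‖]) (by linarith)

lemma bddMult_jap {σ : ℝ} (hσ : 0 ≤ σ) : BddMult (jap (-σ)) 1 :=
  ⟨(continuous_jap _).measurable, norm_jap_neg_le hσ⟩

lemma norm_le_jap_one (ξ : Plane) : ‖ξ‖ ≤ ‖jap 1 ξ‖ := by
  rw [norm_jap, ← Real.sqrt_eq_rpow]
  exact Real.le_sqrt_of_sq_le (by linarith)

/-- Multiplication by `(1 + |ξ|²)^{-σ/2}`. -/
def smoothing (σ : ℝ) : L2 →L[ℂ] L2 := mulOp (jap (-σ))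

/-- The `H^σ` function with Fourier transform `(1 + |ξ|²)^{-σ/2} h(ξ)`. -/
def ofFreq (σ : ℝ) (h : L2) : L2 := 𝓕⁻ (smoothing σ h)

lemma fourier_ofFreq (σ : ℝ) (h : L2) : 𝓕 (ofFreq σ h) = smoothing σ h := fourier_fourierInv_eq _

lemma ofFreq_add (σ : ℝ) (h k : L2) : ofFreq σ (h + k) = ofFreq σ h + ofFreq σ k := by
  simp [ofFreq, FourierTransform.fourierInv_add]

lemma ofFreq_smul (σ : ℝ) (c : ℂ) (h : L2) : ofFreq σ (c • h) = c • ofFreq σ h := by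
  simp [ofFreq, FourierTransform.fourierInv_smul]

lemma norm_fourierInv (f : L2) : ‖(𝓕⁻ f : L2)‖ = ‖f‖ := by
  rw [← Lp.norm_fourier_eq, fourier_fourierInv_eq]

/-- `ofFreq` as a continuous linear map. -/
def ofFreqL (σ : ℝ) : L2 →L[ℂ] L2 :=
  (LinearMap.mkContinuous
    { toFun := ofFreq σ, map_add' := ofFreq_add σ, map_smul' := ofFreq_smul σ } ‖smoothing σ‖
    fun h => by
      change ‖ofFreq σ h‖ ≤ _
      rw [ofFreq, norm_fourierInv]; exact (smoothing σ).le_opNorm h)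

lemma ofFreq_sub (σ : ℝ) (h k : L2) : ofFreq σ (h - k) = ofFreq σ h - ofFreq σ k :=
  map_sub (ofFreqL σ) h k

variable {σ : ℝ}

lemma smoothing_coe (hσ : 0 ≤ σ) (h : L2) :
    smoothing σ h =ᵐ[volume] fun ξ => jap (-σ) ξ * h ξ := mulOp_coe (bddMult_jap hσ) h

lemma norm_smoothing_le (hσ : 0 ≤ σ) (h : L2) : ‖smoothing σ h‖ ≤ ‖h‖ := by
  simpa [smoothing] using norm_mulOp_le (bddMult_jap hσ) h

lemma hsNorm_ofFreq (hσ : 0 ≤ σ) (h : L2) : hsNorm σ (ofFreq σ h) = ‖h‖ₑ := by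
  rw [hsNorm, fourier_ofFreq, Lp.enorm_def]
  refine eLpNorm_congr_ae ?_
  filter_upwards [smoothing_coe hσ h] with ξ hξ
  change jap σ ξ * _ = _
  rw [hξ, ← mul_assoc, jap_neg_mul, one_mul]

lemma exists_ofFreq (hσ : 0 ≤ σ) {f : L2} (hf : MemHs σ f) : ∃ h : L2, f = ofFreq σ h := by
  have hm : MemLp (fun ξ => jap σ ξ * (𝓕 f : L2) ξ) 2 volume :=
    ⟨(continuous_jap σ).aestronglyMeasurable.mul (Lp.aestronglyMeasurable _), hf⟩
  refine ⟨hm.toLp _, ?_⟩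
  suffices h : smoothing σ (hm.toLp _) = 𝓕 f by rw [ofFreq, h, fourierInv_fourier_eq]
  refine eq_of_ae ?_
  filter_upwards [smoothing_coe hσ (hm.toLp _), hm.coeFn_toLp] with ξ h1 h2
  rw [h1, h2, ← mul_assoc, mul_comm (jap (-σ) ξ), jap_neg_mul, one_mul]

lemma memHs_ofFreq (hσ : 0 ≤ σ) (h : L2) : MemHs σ (ofFreq σ h) := by
  rw [MemHs, hsNorm_ofFreq hσ]; exact enorm_lt_top

lemma ofFreq_injective (hσ : 0 ≤ σ) : Function.Injective (ofFreq σ) := by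
  intro h k hk
  have := hsNorm_ofFreq hσ (h - k)
  rw [ofFreq_sub, hk, ← ofFreq_sub, sub_self, hsNorm_ofFreq hσ, enorm_zero, eq_comm,
    enorm_eq_zero] at this
  exact sub_eq_zero.1 this

/-- The dictionary used throughout: since `ofFreq σ` is an isometry onto `H^σ`, continuity in `H^σ`
is ordinary continuity of an `L²`-valued curve. -/
lemma contHs_iff (hσ : 0 ≤ σ) {T : ℝ≥0∞} {f : ℝ → L2} :
    ContHs σ T f ↔ ∃ h : ℝ → L2, ContinuousOn h (timeSet T) ∧ ∀ t ∈ timeSet T, f t = ofFreq σ (h t) := by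
  constructor
  · intro hf
    have : ∀ t, ∃ h : L2, t ∈ timeSet T → f t = ofFreq σ h := fun t => by
      by_cases ht : t ∈ timeSet T
      · obtain ⟨h, hh⟩ := exists_ofFreq hσ (hf t ht).1
        exact ⟨h, fun _ => hh⟩
      · exact ⟨0, fun h => absurd h ht⟩
    choose h hh using this
    refine ⟨h, fun t ht => ?_, hh⟩
    rw [ContinuousWithinAt, tendsto_iff_edist_tendsto_0]
    refine (hf t ht).2.congr' ?_
    filter_upwards [self_mem_nhdsWithin] with τ hτ
    rw [hh t ht, hh τ hτ, ← ofFreq_sub, hsNorm_ofFreq hσ, edist_eq_enorm_sub]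
  · rintro ⟨h, hc, hh⟩ t ht
    refine ⟨hh t ht ▸ memHs_ofFreq hσ _, ?_⟩
    have := hc t ht
    rw [ContinuousWithinAt, tendsto_iff_edist_tendsto_0] at this
    refine this.congr' ?_
    filter_upwards [self_mem_nhdsWithin] with τ hτ
    rw [hh t ht, hh τ hτ, ← ofFreq_sub, hsNorm_ofFreq hσ, edist_eq_enorm_sub]

lemma ofFreq_of_le {σ' : ℝ} (hσ' : 0 ≤ σ') (h : σ' ≤ σ) (f : L2) :
    ofFreq σ f = ofFreq σ' (smoothing (σ - σ') f) := by
  rw [ofFreq, ofFreq, smoothing, smoothing, smoothing,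
    mulOp_mulOp (bddMult_jap hσ') (bddMult_jap (sub_nonneg.2 h))]
  congr 3
  ext ξ
  rw [← jap_add]
  congr 1
  ring

lemma ContHs.of_le {σ' : ℝ} (hσ' : 0 ≤ σ') (h : σ' ≤ σ) {T : ℝ≥0∞} {f : ℝ → L2}
    (hf : ContHs σ T f) : ContHs σ' T f := by
  obtain ⟨k, hk, hfk⟩ := (contHs_iff (hσ'.trans h)).1 hf
  exact (contHs_iff hσ').2 ⟨fun t => smoothing (σ - σ') (k t),
    (smoothing _).continuous.comp_continuousOn hk, fun t ht => by
      rw [hfk t ht, ofFreq_of_le hσ' h]⟩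

lemma MemHs.of_le {σ' : ℝ} (hσ' : 0 ≤ σ') (h : σ' ≤ σ) {f : L2} (hf : MemHs σ f) :
    MemHs σ' f := by
  obtain ⟨k, rfl⟩ := exists_ofFreq (hσ'.trans h) hf
  rw [ofFreq_of_le hσ' h]
  exact memHs_ofFreq hσ' _

/-- `Q n` multiplies by the inverse weight `(1 + |ξ|²)^{σ/2}` truncated at height `n`. Composed with
the smoothing it has a symbol bounded by `1` that tends to `1` pointwise. -/
lemma approxInv_smoothing (hσ : 0 ≤ σ) :
    ApproxInv ((smoothing σ).restrictScalars ℝ) := by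
  have hq : ∀ n : ℕ, BddMult (fun ξ => ((min (‖jap σ ξ‖) n : ℝ) : ℂ)) n := fun n =>
    ⟨(Complex.continuous_ofReal.comp
      ((continuous_jap σ).norm.min continuous_const)).measurable, fun ξ => by
      rw [Complex.norm_real, Real.norm_of_nonneg (by positivity)]; exact min_le_right _ _⟩
  have hn : ∀ ξ, ‖jap σ ξ‖ * ‖jap (-σ) ξ‖ = 1 := fun ξ => by
    rw [← norm_mul, jap_neg_mul, norm_one]
  have hqs : ∀ n : ℕ, BddMult (fun ξ => ((min (‖jap σ ξ‖) n : ℝ) : ℂ) * jap (-σ) ξ) 1 := fun n =>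
    ⟨(hq n).meas.mul (bddMult_jap hσ).meas, fun ξ => by
      rw [norm_mul, Complex.norm_real, Real.norm_of_nonneg (by positivity), ← hn ξ]
      exact mul_le_mul_of_nonneg_right (min_le_left _ _) (norm_nonneg _)⟩
  refine ⟨fun n => (mulOp (fun ξ => ((min (‖jap σ ξ‖) n : ℝ) : ℂ))).restrictScalars ℝ,
    fun n x => ?_, fun x => ?_⟩
  · change ‖mulOp _ (mulOp _ x)‖ ≤ _
    rw [mulOp_mulOp (hq n) (bddMult_jap hσ)]
    simpa using norm_mulOp_le (hqs n) x
  · change Tendsto (fun n : ℕ => mulOp _ (mulOp _ x)) _ _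
    simp_rw [fun n => mulOp_mulOp (hq n) (bddMult_jap hσ)]
    conv => enter [3]; rw [← mulOp_one x]
    refine tendsto_mulOp (Eventually.of_forall hqs) ⟨measurable_const, fun _ => by simp⟩
      (fun ξ => ?_) x
    refine tendsto_const_nhds.congr' ?_
    obtain ⟨N, hN⟩ := exists_nat_ge ‖jap σ ξ‖
    filter_upwards [eventually_ge_atTop N] with n hnN
    have : ‖jap σ ξ‖ ≤ n := hN.trans (by exact_mod_cast hnN)
    rw [min_eq_left this, norm_jap]
    exact (jap_neg_mul σ ξ).symm

lemma ApproxInv.pi {X : Type*} [NormedAddCommGroup X] [NormedSpace ℝ X] {ι : Type*} [Fintype ι]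
    {J : X →L[ℝ] X} (h : ApproxInv J) {J' : (ι → X) →L[ℝ] (ι → X)} (hJ' : ∀ x i, J' x i = J (x i)) :
    ApproxInv J' := by
  obtain ⟨Q, hQ1, hQ2⟩ := h
  refine ⟨fun n => ContinuousLinearMap.pi fun i => (Q n).comp (ContinuousLinearMap.proj i),
    fun n x => ?_, fun x => ?_⟩
  · refine (pi_norm_le_iff_of_nonneg (norm_nonneg _)).2 fun i => ?_
    simp only [ContinuousLinearMap.coe_pi', ContinuousLinearMap.comp_apply,
      ContinuousLinearMap.proj_apply, hJ']
    exact (hQ1 n _).trans (norm_le_pi_norm x i)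
  · rw [tendsto_pi_nhds]
    intro i
    simpa [hJ'] using hQ2 (x i)

/-! ### Derivatives as multipliers -/

lemma toDist_injective : Function.Injective toDist := by
  have := Lp.ker_toTemperedDistributionCLM_eq_bot (F := ℂ) (μ := (volume : Measure Plane)) (p := 2)
  exact LinearMap.ker_eq_bot.1 this

lemma toDist_add (f g : L2) : toDist (f + g) = toDist f + toDist g :=
  map_add (Lp.toTemperedDistributionCLM ℂ (volume : Measure Plane) 2) f g

lemma toDist_sub (f g : L2) : toDist (f - g) = toDist f - toDist g :=
  map_sub (Lp.toTemperedDistributionCLM ℂ (volume : Measure Plane) 2) f g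

lemma toDist_neg (f : L2) : toDist (-f) = -toDist f :=
  map_neg (Lp.toTemperedDistributionCLM ℂ (volume : Measure Plane) 2) f

lemma toDist_smul (c : ℂ) (f : L2) : toDist (c • f) = c • toDist f :=
  map_smul (Lp.toTemperedDistributionCLM ℂ (volume : Measure Plane) 2) c f

lemma toDist_zero : toDist 0 = 0 :=
  map_zero (Lp.toTemperedDistributionCLM ℂ (volume : Measure Plane) 2)

lemma fourierMultiplier_toDist {m : Plane → ℂ} (hm : m.HasTemperateGrowth) {f g : L2}
    (h : ∀ᵐ ξ, (𝓕 g : L2) ξ = m ξ * (𝓕 f : L2) ξ) :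
    TemperedDistribution.fourierMultiplierCLM ℂ m (toDist f) = toDist g := by
  rw [TemperedDistribution.fourierMultiplierCLM_apply, toDist, toDist,
    Lp.fourier_toTemperedDistribution_eq, ← fourierInv_fourier_eq (F := L2) g,
    ← Lp.fourierInv_toTemperedDistribution_eq]
  congr 1
  ext u
  rw [TemperedDistribution.smulLeftCLM_apply_apply, Lp.toTemperedDistribution_apply,
    Lp.toTemperedDistribution_apply]
  refine integral_congr_ae ?_
  filter_upwards [h] with ξ hξ
  rw [hξ, SchwartzMap.smulLeftCLM_apply_apply hm]
  simp only [smul_eq_mul]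
  ring

/-- The symbol of `∂_{x_j}`. -/
def symD (j : Fin 2) (ξ : Plane) : ℂ := 2 * Real.pi * Complex.I * ((ξ j : ℝ) : ℂ)

/-- The symbol of `Δ`. -/
def symLap (ξ : Plane) : ℂ := -(((2 * Real.pi) ^ 2 * ‖ξ‖ ^ 2 : ℝ) : ℂ)

lemma partialD_eq {j : Fin 2} {f g : L2} (h : ∀ᵐ ξ, (𝓕 g : L2) ξ = symD j ξ * (𝓕 f : L2) ξ) :
    partialD j f = toDist g := by
  rw [partialD, TemperedDistribution.lineDeriv_eq_fourierMultiplierCLM]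
  have h1 := fourierMultiplier_toDist (m := fun ξ => ((inner ℝ ξ
      (EuclideanSpace.single j (1 : ℝ) : Plane) : ℝ) : ℂ)) (by fun_prop) (f := f)
    (g := (2 * Real.pi * Complex.I)⁻¹ • g) (by
      have h2 : (𝓕 ((2 * Real.pi * Complex.I)⁻¹ • g) : L2)
          = (2 * Real.pi * Complex.I)⁻¹ • (𝓕 g : L2) := FourierTransform.fourier_smul _ _
      rw [h2]
      filter_upwards [h, Lp.coeFn_smul ((2 * Real.pi * Complex.I)⁻¹) (𝓕 g : L2)] with ξ h3 h4
      rw [h4, Pi.smul_apply, h3, symD, smul_eq_mul, EuclideanSpace.inner_single_right]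
      have : (2 * Real.pi * Complex.I : ℂ) ≠ 0 := by simp [Real.pi_ne_zero]
      field_simp
      simp [mul_comm])
  rw [h1, toDist_smul, smul_smul, mul_inv_cancel₀ (by simp [Real.pi_ne_zero]), one_smul]

lemma laplacian_eq {f g : L2} (h : ∀ᵐ ξ, (𝓕 g : L2) ξ = symLap ξ * (𝓕 f : L2) ξ) :
    Δ (toDist f) = toDist g := by
  rw [TemperedDistribution.laplacian_eq_fourierMultiplierCLM]
  set c : ℂ := -((2 * Real.pi : ℝ) : ℂ) ^ 2 with hc
  have hc0 : c ≠ 0 := by simp [hc, Real.pi_ne_zero]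
  have h1 := fourierMultiplier_toDist (m := fun ξ => Complex.ofReal (‖ξ‖ ^ 2)) (by fun_prop) (f := f)
    (g := c⁻¹ • g) (by
      have h2 : (𝓕 (c⁻¹ • g) : L2) = c⁻¹ • (𝓕 g : L2) := FourierTransform.fourier_smul _ _
      rw [h2]
      filter_upwards [h, Lp.coeFn_smul (c⁻¹) (𝓕 g : L2)] with ξ h3 h4
      rw [h4, Pi.smul_apply, h3, symLap, smul_eq_mul, inv_mul_eq_iff_eq_mul₀ hc0, hc]
      push_cast
      ring)
  rw [h1, toDist_smul]
  have h3 : (-(2 * Real.pi) ^ 2 : ℝ) • (c⁻¹ • toDist g) = c • (c⁻¹ • toDist g) := by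
    have h4 : c = ((-(2 * Real.pi) ^ 2 : ℝ) : ℂ) := by rw [hc]; push_cast; ring
    rw [h4]
    ext u
    exact (Complex.coe_smul _ ((((-(2 * Real.pi) ^ 2 : ℝ) : ℂ)⁻¹ • toDist g) u)).symm
  rw [h3, smul_smul, mul_inv_cancel₀ hc0, one_smul]

end Sobolev

/-! ### Products in `H^σ`, `σ > 1` -/

section Product

lemma continuous_neg_inner : Continuous fun p : Plane × Plane => (-innerₗ Plane) p.1 p.2 := by
  have : Continuous fun p : Plane × Plane => inner ℝ p.1 p.2 := continuous_inner
  exact this.neg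

/-- The `L²` extension of the inverse transform agrees with the integral: both have the same pairing
with test functions, because the transform can be moved onto the test function by Fubini. -/
lemma fourierInv_L2_ae_eq (a : L2) (ha : Integrable (fun ξ => a ξ)) :
    ∀ᵐ x, (𝓕⁻ a : L2) x = 𝓕⁻ (fun ξ => a ξ) x := by
  have hcont : Continuous (𝓕⁻ (fun ξ => a ξ)) :=
    VectorFourier.fourierIntegral_continuous Real.continuous_fourierChar
      continuous_neg_inner ha
  refine ae_eq_of_integral_contDiff_smul_eq
    ((Lp.memLp (𝓕⁻ a : L2)).locallyIntegrable (by norm_num)) hcont.locallyIntegrable ?_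
  intro g hg hgc
  have hg₁ : HasCompactSupport (Complex.ofRealCLM ∘ g) := hgc.comp_left rfl
  have hg₂ : ContDiff ℝ ((⊤ : ℕ∞) : WithTop ℕ∞) (Complex.ofRealCLM ∘ g) := by fun_prop
  set u : 𝓢(Plane, ℂ) := hg₁.toSchwartzMap hg₂ with hu
  have hug : ∀ x, u x = (g x : ℂ) := fun x => by simp [hu]
  have h1 : ∫ x, g x • (𝓕⁻ a : L2) x = toDist (𝓕⁻ a : L2) u := by
    rw [toDist, Lp.toTemperedDistribution_apply]
    simp [hug]
  have h2 : toDist (𝓕⁻ a : L2) u = ∫ ξ, (𝓕⁻ u) ξ • a ξ := by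
    rw [toDist, ← Lp.fourierInv_toTemperedDistribution_eq, TemperedDistribution.fourierInv_apply,
      Lp.toTemperedDistribution_apply]
  have h3 : ∫ ξ, (𝓕⁻ u) ξ • a ξ = ∫ x, u x • 𝓕⁻ (fun ξ => a ξ) x := by
    have hsw : ∀ ξ, (𝓕⁻ u) ξ = 𝓕⁻ (fun x => u x) ξ := fun ξ => by
      rw [SchwartzMap.fourierInv_coe]
    simp_rw [hsw]
    have := VectorFourier.integral_fourierIntegral_smul_eq_flip (L := -innerₗ Plane)
      (μ := volume) (ν := volume) (f := fun x => u x) (g := fun ξ => a ξ)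
      Real.continuous_fourierChar continuous_neg_inner u.integrable ha
    refine this.trans ?_
    congr 1
    ext x
    congr 2
    have : (-innerₗ Plane).flip = -innerₗ Plane := by
      ext v w
      simp [real_inner_comm]
    rw [this]
  rw [h1, h2, h3]
  simp [hug]

lemma lintegral_mul_sq_le {α : Type*} [MeasurableSpace α] {μ : Measure α} {f g : α → ℝ≥0∞}
    (hf : AEMeasurable f μ) (hg : AEMeasurable g μ) :
    (∫⁻ a, f a * g a ∂μ) ^ 2 ≤ (∫⁻ a, f a ^ 2 ∂μ) * ∫⁻ a, g a ^ 2 ∂μ := by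
  have h := ENNReal.lintegral_mul_le_Lp_mul_Lq μ Real.HolderConjugate.two_two hf hg
  calc (∫⁻ a, f a * g a ∂μ) ^ 2
      ≤ ((∫⁻ a, f a ^ (2 : ℝ) ∂μ) ^ (1 / 2 : ℝ) * (∫⁻ a, g a ^ (2 : ℝ) ∂μ) ^ (1 / 2 : ℝ)) ^ 2 := by
        gcongr; exact h
    _ = _ := by
        rw [mul_pow, ← ENNReal.rpow_natCast, ← ENNReal.rpow_mul, ← ENNReal.rpow_natCast,
          ← ENNReal.rpow_mul]
        simp

/-- `∫ (1 + |ξ|²)^{-σ} dξ`. -/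
def japMass (σ : ℝ) : ℝ≥0∞ := ∫⁻ ξ : Plane, ‖jap (-σ) ξ‖ₑ ^ 2

variable {σ : ℝ}

/-- In the plane `(1 + |ξ|²)^{-σ}` is integrable when `2σ > 2`; this is the origin of every
condition `1 < σ` below. -/
lemma japMass_lt_top (hσ : 1 < σ) : japMass σ < ∞ := by
  have h := integrable_rpow_neg_one_add_norm_sq (E := Plane) (μ := volume) (r := 2 * σ) (by
    simp only [finrank_euclideanSpace, Fintype.card_fin]; push_cast; linarith)
  have h2 := h.2
  rw [HasFiniteIntegral] at h2
  refine (lintegral_mono fun ξ => ?_).trans_lt h2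
  rw [← ofReal_norm, norm_jap, ← ENNReal.ofReal_pow (by positivity), ← Real.rpow_natCast,
    ← Real.rpow_mul (by positivity), ← ofReal_norm]
  refine ENNReal.ofReal_le_ofReal ?_
  rw [Real.norm_of_nonneg (by positivity)]
  apply le_of_eq
  congr 1
  push_cast
  ring

/-- Cauchy–Schwarz: the Fourier transform of an `H^σ` function is integrable, whence the embedding
into bounded functions in `ofFreq_bound`. -/
lemma lintegral_smoothing_sq (hσ : 1 < σ) (h : L2) :
    (∫⁻ ξ, ‖smoothing σ h ξ‖ₑ) ^ 2 ≤ japMass σ * ‖h‖ₑ ^ 2 := by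
  have h1 : ∫⁻ ξ, ‖smoothing σ h ξ‖ₑ = ∫⁻ ξ, ‖jap (-σ) ξ‖ₑ * ‖h ξ‖ₑ := by
    refine lintegral_congr_ae ?_
    filter_upwards [smoothing_coe (by linarith : 0 ≤ σ) h] with ξ hξ
    rw [hξ, enorm_mul]
  rw [h1, enorm_L2_sq]
  exact lintegral_mul_sq_le (continuous_jap _).measurable.enorm.aemeasurable
    (Lp.stronglyMeasurable h).measurable.enorm.aemeasurable

lemma integrable_smoothing (hσ : 1 < σ) (h : L2) : Integrable (fun ξ => smoothing σ h ξ) := by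
  refine ⟨Lp.aestronglyMeasurable _, ?_⟩
  rw [HasFiniteIntegral]
  have h1 := (lintegral_smoothing_sq hσ h).trans_lt
    (ENNReal.mul_lt_top (japMass_lt_top hσ) (ENNReal.pow_lt_top enorm_lt_top))
  by_contra hc
  rw [not_lt, top_le_iff] at hc
  rw [hc] at h1
  simp at h1

lemma ofFreq_ae_eq (hσ : 1 < σ) (h : L2) :
    ∀ᵐ x, ofFreq σ h x = 𝓕⁻ (fun ξ => smoothing σ h ξ) x :=
  fourierInv_L2_ae_eq _ (integrable_smoothing hσ h)

/-- The constant in the embedding of `H^σ` into the bounded functions. -/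
def embConst (σ : ℝ) : ℝ := √(japMass σ).toReal

lemma integral_norm_smoothing_le (hσ : 1 < σ) (h : L2) :
    ∫ ξ, ‖smoothing σ h ξ‖ ≤ embConst σ * ‖h‖ := by
  rw [integral_norm_eq_lintegral_enorm (Lp.aestronglyMeasurable _)]
  have h1 := lintegral_smoothing_sq hσ h
  have h2 := ENNReal.toReal_mono
    (ENNReal.mul_ne_top (japMass_lt_top hσ).ne (ENNReal.pow_ne_top enorm_ne_top)) h1
  rw [ENNReal.toReal_pow, ENNReal.toReal_mul, ENNReal.toReal_pow, toReal_enorm] at h2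
  rw [embConst]
  refine Real.le_sqrt_of_sq_le h2 |>.trans ?_
  rw [Real.sqrt_mul ENNReal.toReal_nonneg, Real.sqrt_sq (norm_nonneg _)]

lemma ofFreq_bound (hσ : 1 < σ) (h : L2) : ∀ᵐ x, ‖ofFreq σ h x‖ ≤ embConst σ * ‖h‖ := by
  filter_upwards [ofFreq_ae_eq hσ h] with x hx
  rw [hx]
  refine le_trans ?_ (integral_norm_smoothing_le hσ h)
  exact VectorFourier.norm_fourierIntegral_le_integral_norm _ _ _ _ _

open Classical in
/-- The pointwise product of two `L²` functions (`0` if it is not in `L²`). -/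
def pmul (f g : L2) : L2 :=
  if h : MemLp (fun x => f x * g x) 2 (volume : Measure Plane) then h.toLp _ else 0

lemma memLp_ofFreq_mul (hσ : 1 < σ) (h f : L2) :
    MemLp (fun x => ofFreq σ h x * f x) 2 (volume : Measure Plane) := by
  refine MemLp.of_le_mul (c := embConst σ * ‖h‖) (Lp.memLp f)
    ((Lp.aestronglyMeasurable _).mul (Lp.aestronglyMeasurable _)) ?_
  filter_upwards [ofFreq_bound hσ h] with x hx
  rw [norm_mul]
  exact mul_le_mul_of_nonneg_right hx (norm_nonneg _)

lemma pmul_coe (hσ : 1 < σ) (h f : L2) :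
    ∀ᵐ x, pmul (ofFreq σ h) f x = ofFreq σ h x * f x := by
  rw [pmul, dif_pos (memLp_ofFreq_mul hσ h f)]
  exact MemLp.coeFn_toLp _

lemma norm_pmul_le (hσ : 1 < σ) (h f : L2) :
    ‖pmul (ofFreq σ h) f‖ ≤ embConst σ * ‖h‖ * ‖f‖ := by
  refine Lp.norm_le_mul_norm_of_ae_le_mul ?_
  filter_upwards [ofFreq_bound hσ h, pmul_coe hσ h f] with x hx hx'
  rw [hx', norm_mul]
  exact mul_le_mul_of_nonneg_right hx (norm_nonneg _)

lemma pmul_comm (f g : L2) : pmul f g = pmul g f := by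
  have h : (fun x => f x * g x) = fun x => g x * f x := funext fun x => mul_comm _ _
  rw [pmul, pmul]
  by_cases hm : MemLp (fun x => f x * g x) 2 (volume : Measure Plane)
  · rw [dif_pos hm, dif_pos (h ▸ hm)]
    exact MemLp.toLp_congr _ _ (Eventually.of_forall fun x => mul_comm _ _)
  · rw [dif_neg hm, dif_neg (fun hn => hm (h ▸ hn))]

/-- Multiplication of `H^σ` and `L²` functions. -/
def pmulL (hσ : 1 < σ) : L2 →L[ℂ] L2 →L[ℂ] L2 :=
  LinearMap.mkContinuous₂
    (LinearMap.mk₂ ℂ (fun h f => pmul (ofFreq σ h) f)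
      (fun h k f => by
        refine eq_of_ae ?_
        filter_upwards [pmul_coe hσ (h + k) f, pmul_coe hσ h f, pmul_coe hσ k f,
          Lp.coeFn_add (pmul (ofFreq σ h) f) (pmul (ofFreq σ k) f),
          Lp.coeFn_add (ofFreq σ h) (ofFreq σ k)] with x h1 h2 h3 h4 h5
        rw [h1, h4, Pi.add_apply, h2, h3, ofFreq_add, h5, Pi.add_apply, add_mul])
      (fun c h f => by
        refine eq_of_ae ?_
        filter_upwards [pmul_coe hσ (c • h) f, pmul_coe hσ h f,
          Lp.coeFn_smul c (pmul (ofFreq σ h) f), Lp.coeFn_smul c (ofFreq σ h)] with x h1 h2 h3 h4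
        rw [h1, h3, Pi.smul_apply, h2, ofFreq_smul, h4, Pi.smul_apply, smul_mul_assoc])
      (fun h f g => by
        refine eq_of_ae ?_
        filter_upwards [pmul_coe hσ h (f + g), pmul_coe hσ h f, pmul_coe hσ h g,
          Lp.coeFn_add (pmul (ofFreq σ h) f) (pmul (ofFreq σ h) g),
          Lp.coeFn_add f g] with x h1 h2 h3 h4 h5
        rw [h1, h4, Pi.add_apply, h2, h3, h5, Pi.add_apply, mul_add])
      (fun c h f => by
        refine eq_of_ae ?_
        filter_upwards [pmul_coe hσ h (c • f), pmul_coe hσ h f,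
          Lp.coeFn_smul c (pmul (ofFreq σ h) f), Lp.coeFn_smul c f] with x h1 h2 h3 h4
        rw [h1, h3, Pi.smul_apply, h2, h4, Pi.smul_apply, mul_smul_comm]))
    (embConst σ) (fun h f => norm_pmul_le hσ h f)

@[simp] lemma pmulL_apply (hσ : 1 < σ) (h f : L2) : pmulL hσ h f = pmul (ofFreq σ h) f := rfl

/-! ### The algebra property -/

/-- One of `|η|`, `|ξ - η|` is at least `|ξ|/2`, so `1 + |ξ|²` is at most four times the larger of
the two weights. -/
lemma enorm_jap_sq_le (hσ : 0 ≤ σ) (ξ η : Plane) :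
    ‖jap σ ξ‖ₑ ^ 2 ≤ ENNReal.ofReal (4 ^ σ) * (‖jap σ η‖ₑ ^ 2 + ‖jap σ (ξ - η)‖ₑ ^ 2) := by
  have key : ∀ ζ, ‖jap σ ζ‖ₑ ^ 2 = ENNReal.ofReal ((1 + ‖ζ‖ ^ 2) ^ σ) := fun ζ => by
    rw [← ofReal_norm, norm_jap, ← ENNReal.ofReal_pow (by positivity), ← Real.rpow_natCast,
      ← Real.rpow_mul (by positivity)]
    congr 2; push_cast; ring
  rw [key, key, key, ← ENNReal.ofReal_add (by positivity) (by positivity),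
    ← ENNReal.ofReal_mul (by positivity)]
  refine ENNReal.ofReal_le_ofReal ?_
  have htri : ‖ξ‖ ≤ ‖η‖ + ‖ξ - η‖ := by
    simpa using norm_add_le η (ξ - η)
  set a := ‖η‖
  set b := ‖ξ - η‖
  have ha : 0 ≤ a := norm_nonneg _
  have hb : 0 ≤ b := norm_nonneg _
  have h1 : 1 + ‖ξ‖ ^ 2 ≤ 4 * max (1 + a ^ 2) (1 + b ^ 2) := by
    have h2 : ‖ξ‖ ^ 2 ≤ (a + b) ^ 2 := by gcongr
    have h3 := le_max_left (1 + a ^ 2) (1 + b ^ 2)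
    have h4 := le_max_right (1 + a ^ 2) (1 + b ^ 2)
    nlinarith [sq_nonneg (a - b)]
  calc (1 + ‖ξ‖ ^ 2) ^ σ ≤ (4 * max (1 + a ^ 2) (1 + b ^ 2)) ^ σ :=
        Real.rpow_le_rpow (by positivity) h1 hσ
    _ = 4 ^ σ * (max (1 + a ^ 2) (1 + b ^ 2)) ^ σ := by
        rw [Real.mul_rpow (by positivity) (by positivity)]
    _ ≤ 4 ^ σ * ((1 + a ^ 2) ^ σ + (1 + b ^ 2) ^ σ) := by
        gcongr
        rcases max_choice (1 + a ^ 2) (1 + b ^ 2) with h | h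
        · rw [h]; exact le_add_of_nonneg_right (by positivity)
        · rw [h]; exact le_add_of_nonneg_left (by positivity)

/-- The constant in the algebra property of `H^σ`. -/
def algConst (σ : ℝ) : ℝ≥0∞ := ENNReal.ofReal (4 ^ σ) * (japMass σ + japMass σ)

lemma algConst_lt_top (hσ : 1 < σ) : algConst σ < ∞ :=
  ENNReal.mul_lt_top ENNReal.ofReal_lt_top
    (ENNReal.add_lt_top.2 ⟨japMass_lt_top hσ, japMass_lt_top hσ⟩)

/-- After the splitting of `⟨ξ⟩^σ` one of the two decaying weights is cancelled and the other one is
left, whose integral is `japMass σ` whatever `ξ` is. -/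
lemma lintegral_weight_le (hσ : 0 ≤ σ) (ξ : Plane) :
    ∫⁻ η, (‖jap σ ξ‖ₑ * (‖jap (-σ) η‖ₑ * ‖jap (-σ) (ξ - η)‖ₑ)) ^ 2 ≤ algConst σ := by
  have hone : ∀ ζ : Plane, ‖jap σ ζ‖ₑ ^ 2 * ‖jap (-σ) ζ‖ₑ ^ 2 = 1 := fun ζ => by
    rw [← mul_pow, ← enorm_mul, jap_neg_mul]; simp
  have hpt : ∀ η, (‖jap σ ξ‖ₑ * (‖jap (-σ) η‖ₑ * ‖jap (-σ) (ξ - η)‖ₑ)) ^ 2 ≤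
      ENNReal.ofReal (4 ^ σ) * (‖jap (-σ) (ξ - η)‖ₑ ^ 2 + ‖jap (-σ) η‖ₑ ^ 2) := by
    intro η
    calc _ = ‖jap σ ξ‖ₑ ^ 2 * (‖jap (-σ) η‖ₑ ^ 2 * ‖jap (-σ) (ξ - η)‖ₑ ^ 2) := by
            rw [mul_pow, mul_pow]
      _ ≤ (ENNReal.ofReal (4 ^ σ) * (‖jap σ η‖ₑ ^ 2 + ‖jap σ (ξ - η)‖ₑ ^ 2)) *
          (‖jap (-σ) η‖ₑ ^ 2 * ‖jap (-σ) (ξ - η)‖ₑ ^ 2) := by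
            gcongr; exact enorm_jap_sq_le hσ ξ η
      _ = ENNReal.ofReal (4 ^ σ) * ((‖jap σ η‖ₑ ^ 2 * ‖jap (-σ) η‖ₑ ^ 2) * ‖jap (-σ) (ξ - η)‖ₑ ^ 2
          + (‖jap σ (ξ - η)‖ₑ ^ 2 * ‖jap (-σ) (ξ - η)‖ₑ ^ 2) * ‖jap (-σ) η‖ₑ ^ 2) := by ring
      _ = _ := by rw [hone, hone, one_mul, one_mul]
  have hm : Measurable (fun η : Plane => ‖jap (-σ) η‖ₑ ^ 2) :=
    (continuous_jap _).measurable.enorm.pow_const 2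
  refine (lintegral_mono hpt).trans ?_
  rw [lintegral_const_mul' _ _ ENNReal.ofReal_ne_top,
    lintegral_add_right _ hm, algConst]
  gcongr
  · exact (lintegral_sub_left_eq_self (fun η => ‖jap (-σ) η‖ₑ ^ 2) ξ).le
  · exact le_rfl

/-- Cauchy–Schwarz in `η`, with all weights in one factor and `h η`, `k (ξ - η)` in the other;
Tonelli and translation invariance then integrate the second factor in `ξ`. -/
lemma lintegral_conv_sq_le (hσ : 0 ≤ σ) (h k : L2) :
    ∫⁻ ξ, (‖jap σ ξ‖ₑ * ∫⁻ η, ‖jap (-σ) η * h η‖ₑ * ‖jap (-σ) (ξ - η) * k (ξ - η)‖ₑ) ^ 2 ≤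
      algConst σ * (‖h‖ₑ ^ 2 * ‖k‖ₑ ^ 2) := by
  have hh : Measurable (fun η => h η) := (Lp.stronglyMeasurable h).measurable
  have hk : Measurable (fun η => k η) := (Lp.stronglyMeasurable k).measurable
  have hj : Measurable (jap (-σ)) := (continuous_jap _).measurable
  have hpt : ∀ ξ, (‖jap σ ξ‖ₑ * ∫⁻ η, ‖jap (-σ) η * h η‖ₑ * ‖jap (-σ) (ξ - η) * k (ξ - η)‖ₑ) ^ 2 ≤
      algConst σ * ∫⁻ η, (‖h η‖ₑ * ‖k (ξ - η)‖ₑ) ^ 2 := by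
    intro ξ
    have h1 : ‖jap σ ξ‖ₑ * ∫⁻ η, ‖jap (-σ) η * h η‖ₑ * ‖jap (-σ) (ξ - η) * k (ξ - η)‖ₑ =
        ∫⁻ η, (‖jap σ ξ‖ₑ * (‖jap (-σ) η‖ₑ * ‖jap (-σ) (ξ - η)‖ₑ)) * (‖h η‖ₑ * ‖k (ξ - η)‖ₑ) := by
      rw [← lintegral_const_mul' _ _ enorm_ne_top]
      refine lintegral_congr fun η => ?_
      rw [enorm_mul, enorm_mul]
      ring
    rw [h1]
    refine (lintegral_mul_sq_le (by fun_prop) (by fun_prop)).trans ?_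
    gcongr
    exact lintegral_weight_le hσ ξ
  refine (lintegral_mono hpt).trans ?_
  have hmm : Measurable (fun p : Plane × Plane => (‖h p.2‖ₑ * ‖k (p.1 - p.2)‖ₑ) ^ 2) := by
    fun_prop
  rw [lintegral_const_mul _ (by exact hmm.lintegral_prod_right')]
  gcongr
  rw [lintegral_lintegral_swap hmm.aemeasurable, enorm_L2_sq h, enorm_L2_sq k,
    ← lintegral_mul_const _ (by fun_prop)]
  refine lintegral_mono fun η => ?_
  simp_rw [mul_pow]
  rw [lintegral_const_mul _ (by fun_prop)]
  refine mul_le_mul_right ?_ _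
  exact (lintegral_sub_right_eq_self (μ := volume) (fun ξ => ‖k ξ‖ₑ ^ 2) η).le

-- The algebra property of `H^σ`: the transform of a product is the convolution `c` of the
-- transforms, and `⟨ξ⟩^σ c` is square integrable by `lintegral_conv_sq_le`. It is the frequency
-- representative of the product.
open scoped Convolution in
lemma exists_ofFreq_pmul (hσ : 1 < σ) (h k : L2) :
    ∃ l : L2, pmul (ofFreq σ h) (ofFreq σ k) = ofFreq σ l ∧
      ‖l‖ ≤ √(algConst σ).toReal * ‖h‖ * ‖k‖ := by
  have hσ0 : 0 ≤ σ := by linarith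
  set a : Plane → ℂ := fun ξ => jap (-σ) ξ * h ξ with ha
  set b : Plane → ℂ := fun ξ => jap (-σ) ξ * k ξ with hb
  have hae : (fun ξ => smoothing σ h ξ) =ᵐ[volume] a := smoothing_coe hσ0 h
  have hbe : (fun ξ => smoothing σ k ξ) =ᵐ[volume] b := smoothing_coe hσ0 k
  have hai : Integrable a := (integrable_smoothing hσ h).congr hae
  have hbi : Integrable b := (integrable_smoothing hσ k).congr hbe
  set c : Plane → ℂ := a ⋆[ContinuousLinearMap.mul ℂ ℂ] b with hc
  have hci : Integrable c := hai.integrable_convolution _ hbi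
  have hbound : ∫⁻ ξ, ‖jap σ ξ * c ξ‖ₑ ^ 2 ≤ algConst σ * (‖h‖ₑ ^ 2 * ‖k‖ₑ ^ 2) := by
    refine (lintegral_mono fun ξ => ?_).trans (lintegral_conv_sq_le hσ0 h k)
    rw [enorm_mul]
    gcongr
    rw [hc, convolution]
    refine (enorm_integral_le_lintegral_enorm _).trans (lintegral_mono fun η => ?_)
    rw [ContinuousLinearMap.mul_apply', enorm_mul]
  have hfin : algConst σ * (‖h‖ₑ ^ 2 * ‖k‖ₑ ^ 2) < ∞ :=
    ENNReal.mul_lt_top (algConst_lt_top hσ)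
      (ENNReal.mul_lt_top (ENNReal.pow_lt_top enorm_lt_top) (ENNReal.pow_lt_top enorm_lt_top))
  have hm : MemLp (fun ξ => jap σ ξ * c ξ) 2 (volume : Measure Plane) := by
    refine ⟨(continuous_jap σ).aestronglyMeasurable.mul hci.aestronglyMeasurable, ?_⟩
    rw [eLpNorm_lt_top_iff_lintegral_rpow_enorm_lt_top (by norm_num) (by norm_num)]
    simpa using hbound.trans_lt hfin
  set l : L2 := hm.toLp _ with hl
  have hsl : (fun ξ => smoothing σ l ξ) =ᵐ[volume] c := by
    filter_upwards [smoothing_coe hσ0 l, hm.coeFn_toLp] with ξ h1 h2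
    rw [h1, h2, ← mul_assoc, mul_comm (jap (-σ) ξ), jap_neg_mul, one_mul]
  refine ⟨l, ?_, ?_⟩
  · refine eq_of_ae ?_
    filter_upwards [pmul_coe hσ h (ofFreq σ k), ofFreq_ae_eq hσ h, ofFreq_ae_eq hσ k,
      ofFreq_ae_eq hσ l] with x h1 h2 h3 h4
    rw [h1, h2, h3, h4, Real.fourierInv_congr_ae hae, Real.fourierInv_congr_ae hbe,
      -- The convolution theorem is available for the direct transform, hence the passage to the
      -- point `-x`.
      Real.fourierInv_congr_ae hsl, Real.fourierInv_eq_fourier_neg, Real.fourierInv_eq_fourier_neg,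
      Real.fourierInv_eq_fourier_neg, hc, Real.fourier_mul_convolution_eq hai hbi]
  · have h1 : ‖l‖ₑ ^ 2 ≤ algConst σ * (‖h‖ₑ ^ 2 * ‖k‖ₑ ^ 2) := by
      rw [enorm_L2_sq]
      refine le_trans (le_of_eq (lintegral_congr_ae ?_)) hbound
      filter_upwards [hm.coeFn_toLp] with ξ h1
      rw [h1]
    have h2 := ENNReal.toReal_mono hfin.ne h1
    rw [ENNReal.toReal_mul, ENNReal.toReal_mul, ENNReal.toReal_pow, ENNReal.toReal_pow,
      ENNReal.toReal_pow, toReal_enorm, toReal_enorm, toReal_enorm] at h2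
    refine (Real.le_sqrt_of_sq_le h2).trans ?_
    rw [Real.sqrt_mul ENNReal.toReal_nonneg, ← mul_pow, Real.sqrt_sq (by positivity), mul_assoc]

/-- The product of `H^σ` functions, on the frequency side. -/
def freqMul (hσ : 1 < σ) (h k : L2) : L2 := (exists_ofFreq_pmul hσ h k).choose

lemma ofFreq_freqMul (hσ : 1 < σ) (h k : L2) :
    ofFreq σ (freqMul hσ h k) = pmul (ofFreq σ h) (ofFreq σ k) :=
  (exists_ofFreq_pmul hσ h k).choose_spec.1.symm

/-- The product of `H^σ` functions, as a bounded bilinear map on the frequency side. -/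
def freqMulL (hσ : 1 < σ) : L2 →L[ℂ] L2 →L[ℂ] L2 :=
  have hinj := ofFreq_injective (by linarith : 0 ≤ σ)
  LinearMap.mkContinuous₂
    (LinearMap.mk₂ ℂ (freqMul hσ)
      (fun h k f => hinj (by
        rw [ofFreq_add, ofFreq_freqMul, ofFreq_freqMul, ofFreq_freqMul, ← pmulL_apply hσ (h + k),
          map_add]
        rfl))
      (fun c h f => hinj (by
        simp only [ofFreq_smul, ofFreq_freqMul]
        rw [← ofFreq_smul, ← pmulL_apply hσ, map_smul]; rfl))
      (fun h f g => hinj (by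
        simp only [ofFreq_add, ofFreq_freqMul]
        rw [← pmulL_apply hσ, map_add]; rfl))
      (fun c h f => hinj (by
        simp only [ofFreq_smul, ofFreq_freqMul]
        rw [← pmulL_apply hσ, map_smul]; rfl)))
    √(algConst σ).toReal (fun h k => (exists_ofFreq_pmul hσ h k).choose_spec.2)

lemma ofFreq_freqMulL (hσ : 1 < σ) (h k : L2) :
    ofFreq σ (freqMulL hσ h k) = pmul (ofFreq σ h) (ofFreq σ k) := ofFreq_freqMul hσ h k

end Product

/-! ### Complex conjugation -/

section Conj

lemma star_coe (f : L2) : ∀ᵐ x, (star f : L2) x = star (f x) := Lp.coeFn_star f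

/-- Complex conjugation on `L²`. -/
def starL : L2 →L[ℝ] L2 :=
  LinearMap.mkContinuous
    { toFun := star
      map_add' := fun f g => by
        refine eq_of_ae ?_
        filter_upwards [star_coe (f + g), star_coe f, star_coe g, Lp.coeFn_add f g,
          Lp.coeFn_add (star f) (star g)] with x h1 h2 h3 h4 h5
        rw [h1, h4, h5, Pi.add_apply, Pi.add_apply, h2, h3, star_add]
      map_smul' := fun c f => by
        refine eq_of_ae ?_
        filter_upwards [star_coe (c • f), star_coe f, Lp.coeFn_smul c f,
          Lp.coeFn_smul c (star f)] with x h1 h2 h3 h4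
        rw [h1, h3, RingHom.id_apply, h4, Pi.smul_apply, Pi.smul_apply, h2]
        simp }
    1 fun f => by
      refine Lp.norm_le_mul_norm_of_ae_le_mul ?_
      filter_upwards [star_coe f] with x hx
      change ‖(star f : L2) x‖ ≤ _
      rw [hx, norm_star, one_mul]

lemma star_smul' (c : ℂ) (f : L2) : star (c • f) = star c • star f := by
  refine eq_of_ae ?_
  filter_upwards [star_coe (c • f), star_coe f, Lp.coeFn_smul c f,
    Lp.coeFn_smul (star c) (star f)] with x h1 h2 h3 h4
  rw [h1, h3, h4, Pi.smul_apply, Pi.smul_apply, h2, smul_eq_mul, smul_eq_mul, star_mul, mul_comm]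

lemma star_add' (f g : L2) : star (f + g) = star f + star g := map_add starL f g

lemma star_sub' (f g : L2) : star (f - g) = star f - star g := map_sub starL f g

lemma star_zero' : star (0 : L2) = 0 := map_zero starL

lemma star_sum' {ι : Type*} (s : Finset ι) (f : ι → L2) :
    star (∑ i ∈ s, f i) = ∑ i ∈ s, star (f i) := map_sum starL f s

lemma norm_star' (f : L2) : ‖(star f : L2)‖ = ‖f‖ := by
  have h : ∀ g : L2, ‖(star g : L2)‖ ≤ ‖g‖ := fun g => by
    have : ‖(star g : L2)‖ ≤ 1 * ‖g‖ := by
      refine Lp.norm_le_mul_norm_of_ae_le_mul ?_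
      filter_upwards [star_coe g] with x hx
      rw [hx, norm_star, one_mul]
    simpa using this
  exact le_antisymm (h f) (by simpa using h (star f))

/-- The reflection `f ↦ f(-·)`. -/
def reflL : L2 →L[ℂ] L2 :=
  (Lp.compMeasurePreservingₗᵢ ℂ (fun x : Plane => -x)
    (Measure.measurePreserving_neg volume)).toContinuousLinearMap

lemma reflL_coe (f : L2) : ∀ᵐ x, reflL f x = f (-x) :=
  Lp.coeFn_compMeasurePreserving f (Measure.measurePreserving_neg volume)

/-- The conjugation on the frequency side: `h ↦ conj h(-·)`. -/
def conjFreq (h : L2) : L2 := star (reflL h)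

/-- `conjFreq` as a real-linear map. -/
def conjFreqL : L2 →L[ℝ] L2 := starL.comp (reflL.restrictScalars ℝ)

@[simp] lemma conjFreqL_apply (h : L2) : conjFreqL h = conjFreq h := rfl

lemma ae_neg {p : Plane → Prop} (h : ∀ᵐ x, p x) : ∀ᵐ x : Plane, p (-x) :=
  (Measure.measurePreserving_neg (volume : Measure Plane)).quasiMeasurePreserving.ae h

lemma conjFreq_coe (h : L2) : ∀ᵐ ξ, conjFreq h ξ = star (h (-ξ)) := by
  filter_upwards [star_coe (reflL h), reflL_coe h] with ξ h1 h2
  rw [conjFreq, h1, h2]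

lemma norm_conjFreq (h : L2) : ‖conjFreq h‖ = ‖h‖ := by
  rw [conjFreq, norm_star']
  exact LinearIsometry.norm_map _ h

/-- Both sides are continuous in `b`, so Schwartz functions suffice; for them the inverse transform
is an integral, which is conjugated after the substitution `ξ ↦ -ξ`. -/
lemma star_fourierInv (b : L2) : star (𝓕⁻ b : L2) = 𝓕⁻ (conjFreq b) := by
  refine DenseRange.induction_on (p := fun b : L2 => star (𝓕⁻ b : L2) = 𝓕⁻ (conjFreq b))
    (SchwartzMap.denseRange_toLpCLM (F := ℂ) (E := Plane) (p := 2) (μ := volume)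
      ENNReal.ofNat_ne_top) b ?_ ?_
  · exact isClosed_eq (starL.continuous.comp (fourierInvCLM ℂ L2).continuous)
      ((fourierInvCLM ℂ L2).continuous.comp conjFreqL.continuous)
  · intro u
    set f : L2 := SchwartzMap.toLpCLM ℝ ℂ 2 volume u with hf
    have hfi : Integrable (fun ξ => f ξ) :=
      u.integrable.congr (SchwartzMap.coeFn_toLp u 2 volume).symm
    have hci : Integrable (fun ξ => conjFreq f ξ) := by
      have h1 : Integrable (fun ξ => star (f (-ξ))) := by
        have h2 : Integrable (fun ξ => f (-ξ)) := hfi.comp_neg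
        exact (Complex.conjCLE.integrable_comp_iff (φ := fun ξ => f (-ξ))).2 h2
      refine h1.congr ?_
      filter_upwards [conjFreq_coe f] with ξ hξ using hξ.symm
    refine eq_of_ae ?_
    filter_upwards [star_coe (𝓕⁻ f : L2), fourierInv_L2_ae_eq f hfi,
      fourierInv_L2_ae_eq _ hci] with x h1 h2 h3
    rw [h1, h2, h3, Real.fourierInv_congr_ae (conjFreq_coe f), Real.fourierInv_eq',
      Real.fourierInv_eq', ← integral_neg_eq_self]
    rw [show star (∫ v, Complex.exp (↑(2 * Real.pi * inner ℝ (-v) x) * Complex.I) • f (-v))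
      = ∫ v, star (Complex.exp (↑(2 * Real.pi * inner ℝ (-v) x) * Complex.I) • f (-v))
      from integral_conj.symm]
    refine integral_congr_ae (Eventually.of_forall fun v => ?_)
    simp only [smul_eq_mul, star_mul]
    rw [mul_comm]
    congr 1
    rw [Complex.star_def, ← Complex.exp_conj]
    congr 1
    simp only [inner_neg_left, map_mul, Complex.conj_ofReal, Complex.conj_I]
    push_cast
    ring

lemma conjFreq_mulOp {m : Plane → ℂ} {C : ℝ} (hm : BddMult m C) (h : L2) :
    conjFreq (mulOp m h) = mulOp (fun ξ => star (m (-ξ))) (conjFreq h) := by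
  have hm' : BddMult (fun ξ => star (m (-ξ))) C :=
    ⟨(continuous_star.measurable.comp (hm.meas.comp measurable_neg)), fun ξ => by
      rw [norm_star]; exact hm.le _⟩
  refine eq_of_ae ?_
  filter_upwards [conjFreq_coe (mulOp m h), conjFreq_coe h, mulOp_coe hm' (conjFreq h),
    ae_neg (mulOp_coe hm h)] with ξ h1 h2 h3 h4
  rw [h1, h3, h4, h2, star_mul, mul_comm]

lemma star_ofFreq {σ : ℝ} (hσ : 0 ≤ σ) (h : L2) : star (ofFreq σ h) = ofFreq σ (conjFreq h) := by
  rw [ofFreq, star_fourierInv, ofFreq, smoothing, conjFreq_mulOp (bddMult_jap hσ)]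
  congr 3
  ext ξ
  rw [jap, jap, norm_neg]
  simp

lemma star_pmul {σ : ℝ} (hσ : 1 < σ) (h k : L2) :
    star (pmul (ofFreq σ h) k) = pmul (star (ofFreq σ h)) (star k) := by
  have hσ0 : 0 ≤ σ := by linarith
  rw [star_ofFreq hσ0]
  refine eq_of_ae ?_
  filter_upwards [star_coe (pmul (ofFreq σ h) k), pmul_coe hσ h k,
    pmul_coe hσ (conjFreq h) (star k), star_coe k, star_coe (ofFreq σ h)] with x h1 h2 h3 h4 h5
  rw [h1, h2, h3, h4, ← star_ofFreq hσ0, h5, star_mul, mul_comm]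

end Conj

/-! ### Multiplier flows -/

section Flows

lemma mulOp_zero (f : L2) : mulOp (fun _ => 0) f = 0 := by rw [mulOp_const, zero_smul]

lemma smoothing_mulOp {m : Plane → ℂ} {C σ : ℝ} (hσ : 0 ≤ σ) (hm : BddMult m C) (f : L2) :
    smoothing σ (mulOp m f) = mulOp m (smoothing σ f) := mulOp_comm (bddMult_jap hσ) hm f

/-- Differentiation of a family of multipliers applied to smooth functions. -/
lemma hasDerivAt_mulOp_smoothing {E : ℝ → Plane → ℂ} {D : Plane → ℂ} {C B σ : ℝ} (hσ : 0 ≤ σ)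
    (hE : ∀ t, BddMult (E t) C) (hDm : Measurable D)
    (hd : ∀ ξ, HasDerivAt (fun t => E t ξ) (D ξ) 0)
    (hB : ∀ t ξ, ‖E t ξ - E 0 ξ‖ ≤ |t| * (B * ‖jap σ ξ‖)) (x : L2) :
    HasDerivAt (fun t => mulOp (E t) (smoothing σ x)) (mulOp (fun ξ => D ξ * jap (-σ) ξ) x) 0 := by
  have hone : ∀ ξ, ‖jap σ ξ‖ * ‖jap (-σ) ξ‖ = 1 := fun ξ => by
    rw [← norm_mul, jap_neg_mul, norm_one]
  -- The difference quotients grow at most like `⟨ξ⟩^σ`, which the smoothing absorbs; with this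
  -- uniform bound dominated convergence applies.
  have hB' : ∀ (t : ℝ) ξ, ‖((t : ℂ)⁻¹ * (E t ξ - E 0 ξ)) * jap (-σ) ξ‖ ≤ max B 0 := by
    intro t ξ
    rw [norm_mul, norm_mul, norm_inv, Complex.norm_real, Real.norm_eq_abs]
    rcases eq_or_ne t 0 with rfl | ht
    · simp
    have ht' : 0 < |t| := abs_pos.2 ht
    calc |t|⁻¹ * ‖E t ξ - E 0 ξ‖ * ‖jap (-σ) ξ‖
        ≤ |t|⁻¹ * (|t| * (B * ‖jap σ ξ‖)) * ‖jap (-σ) ξ‖ := by gcongr; exact hB t ξ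
      _ = B * (‖jap σ ξ‖ * ‖jap (-σ) ξ‖) := by field_simp
      _ ≤ max B 0 := by rw [hone, mul_one]; exact le_max_left _ _
  have hslope : ∀ ξ, Tendsto (fun t : ℝ => (t : ℂ)⁻¹ * (E t ξ - E 0 ξ)) (𝓝[≠] 0) (𝓝 (D ξ)) := by
    intro ξ
    refine (hasDerivAt_iff_tendsto_slope.1 (hd ξ)).congr fun t => ?_
    rw [slope_def_module, sub_zero, Complex.real_smul, Complex.ofReal_inv]
  have hbd : ∀ t : ℝ, BddMult (fun ξ => ((t : ℂ)⁻¹ * (E t ξ - E 0 ξ)) * jap (-σ) ξ) (max B 0) :=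
    fun t => ⟨(((hE t).meas.sub (hE 0).meas).const_mul _).mul (continuous_jap _).measurable,
      hB' t⟩
  have hlim : ∀ ξ, Tendsto (fun t : ℝ => ((t : ℂ)⁻¹ * (E t ξ - E 0 ξ)) * jap (-σ) ξ) (𝓝[≠] 0)
      (𝓝 (D ξ * jap (-σ) ξ)) := fun ξ => (hslope ξ).mul_const _
  have hD : BddMult (fun ξ => D ξ * jap (-σ) ξ) (max B 0) :=
    ⟨hDm.mul (continuous_jap _).measurable, fun ξ =>
      le_of_tendsto (hlim ξ).norm (Eventually.of_forall fun t => hB' t ξ)⟩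
  rw [hasDerivAt_iff_tendsto_slope]
  refine (tendsto_mulOp (Eventually.of_forall hbd) hD hlim x).congr fun t => ?_
  rw [slope_def_module, sub_zero, smoothing, mulOp_mulOp (hE t) (bddMult_jap hσ),
    mulOp_mulOp (hE 0) (bddMult_jap hσ),
    ← mulOp_sub ((hE t).mul (bddMult_jap hσ)) ((hE 0).mul (bddMult_jap hσ)),
    show ∀ v : L2, t⁻¹ • v = ((t : ℂ)⁻¹) • v from fun v => by
      rw [← Complex.ofReal_inv]; exact (Complex.coe_smul t⁻¹ v).symm,
    ← mulOp_const_mul _ (((hE t).mul (bddMult_jap hσ)).sub ((hE 0).mul (bddMult_jap hσ)))]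
  congr 2
  ext ξ
  ring

/-- The symbol of the free Schrödinger flow at time `t`. -/
def schrSym (t : ℝ) (ξ : Plane) : ℂ := Complex.exp ((t * (2 * Real.pi ^ 2 * ‖ξ‖ ^ 2) : ℝ) * Complex.I)

lemma norm_schrSym (t : ℝ) (ξ : Plane) : ‖schrSym t ξ‖ = 1 := Complex.norm_exp_ofReal_mul_I _

lemma bddMult_schrSym (t : ℝ) : BddMult (schrSym t) 1 :=
  ⟨by unfold schrSym; fun_prop, fun ξ => (norm_schrSym t ξ).le⟩

/-- The free Schrödinger group on the frequency side. -/
def schrFlow : Flow L2 where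
  toFun t := (mulOp (schrSym t)).restrictScalars ℝ
  bd := 1
  bd_nonneg := zero_le_one
  zero := by
    ext1 f
    change mulOp (schrSym 0) f = f
    rw [show schrSym 0 = fun _ => 1 from funext fun ξ => by simp [schrSym], mulOp_one]
  add s t x := by
    change mulOp (schrSym (s + t)) x = mulOp (schrSym s) (mulOp (schrSym t) x)
    rw [mulOp_mulOp (bddMult_schrSym s) (bddMult_schrSym t)]
    congr 2
    ext ξ
    rw [schrSym, schrSym, schrSym, ← Complex.exp_add]
    push_cast
    ring_nf
  bound t x := norm_mulOp_le (bddMult_schrSym t) x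
  cont x := by
    refine continuous_iff_continuousAt.2 fun t => ?_
    refine tendsto_mulOp (Eventually.of_forall bddMult_schrSym) (bddMult_schrSym t)
      (fun ξ => Continuous.tendsto ?_ t) x
    unfold schrSym
    fun_prop

/-- `-(i/2) Δ`, composed with `smoothing σ`, on the frequency side. -/
def schrGen (σ : ℝ) : L2 →L[ℂ] L2 := mulOp (fun ξ => (2 * Complex.I)⁻¹ * symLap ξ * jap (-σ) ξ)

lemma sq_le_jap {σ : ℝ} (hσ : 2 ≤ σ) (ξ : Plane) : ‖ξ‖ ^ 2 ≤ ‖jap σ ξ‖ := by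
  rw [norm_jap]
  calc ‖ξ‖ ^ 2 ≤ 1 + ‖ξ‖ ^ 2 := by linarith
    _ = (1 + ‖ξ‖ ^ 2) ^ (1 : ℝ) := by simp
    _ ≤ _ := Real.rpow_le_rpow_of_exponent_le (by nlinarith [sq_nonneg ‖ξ‖]) (by linarith)

/-- The phase of `schrSym` is `t (2i)⁻¹` times the symbol `-4π²|ξ|²` of the Laplacian. Its growth
`|ξ|²` is what requires `σ ≥ 2`. -/
lemma schrFlow_generates {σ : ℝ} (hσ : 2 ≤ σ) :
    schrFlow.Generates ((smoothing σ).restrictScalars ℝ) ((schrGen σ).restrictScalars ℝ) where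
  comm t x := (smoothing_mulOp (by linarith) (bddMult_schrSym t) x).symm
  deriv x := by
    refine hasDerivAt_mulOp_smoothing (E := schrSym) (C := 1) (B := 2 * Real.pi ^ 2)
      (D := fun ξ => (2 * Complex.I)⁻¹ * symLap ξ) (by linarith)
      bddMult_schrSym (by unfold symLap; fun_prop) (fun ξ => ?_) (fun t ξ => ?_) x
    · have h1 : HasDerivAt (fun t : ℝ => ((t * (2 * Real.pi ^ 2 * ‖ξ‖ ^ 2) : ℝ) : ℂ) * Complex.I)
          (((2 * Real.pi ^ 2 * ‖ξ‖ ^ 2 : ℝ) : ℂ) * Complex.I) 0 := by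
        have := ((hasDerivAt_id (0 : ℝ)).mul_const (2 * Real.pi ^ 2 * ‖ξ‖ ^ 2)).ofReal_comp
        simpa using this.mul_const Complex.I
      have h2 := h1.cexp
      refine h2.congr_deriv ?_
      rw [zero_mul, Complex.ofReal_zero, zero_mul, Complex.exp_zero, one_mul, symLap, mul_inv,
        Complex.inv_I]
      push_cast
      ring
    · have h1 := Real.norm_exp_I_mul_ofReal_sub_one_le (x := t * (2 * Real.pi ^ 2 * ‖ξ‖ ^ 2))
      rw [mul_comm Complex.I] at h1
      rw [show schrSym 0 ξ = 1 by simp [schrSym]]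
      refine h1.trans ?_
      rw [Real.norm_eq_abs, abs_mul, abs_of_nonneg (by positivity : 0 ≤ 2 * Real.pi ^ 2 * ‖ξ‖ ^ 2)]
      gcongr
      exact sq_le_jap hσ ξ

/-! #### Systems -/

variable {ι : Type*} [Fintype ι] [DecidableEq ι]

/-- The entries of `exp(t M(ξ))`. -/
def expSym (M : Plane → Matrix ι ι ℂ) (t : ℝ) (i j : ι) (ξ : Plane) : ℂ :=
  NormedSpace.exp ((t : ℂ) • M ξ) i j

section
open scoped Matrix.Norms.Operator

lemma continuous_matrix_exp : Continuous (fun A : Matrix ι ι ℂ => NormedSpace.exp A) :=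
  NormedSpace.exp_continuous

lemma hasDerivAt_expSym (M : Plane → Matrix ι ι ℂ) (t : ℝ) (i j : ι) (ξ : Plane) :
    HasDerivAt (fun t => expSym M t i j ξ) (∑ k, M ξ i k * expSym M t k j ξ) t := by
  have h1 : HasDerivAt (fun z : ℂ => NormedSpace.exp (z • M ξ))
      (M ξ * NormedSpace.exp ((t : ℂ) • M ξ)) (t : ℂ) := hasDerivAt_exp_smul_const' (M ξ) (t : ℂ)
  have h2 : HasDerivAt (fun t : ℝ => NormedSpace.exp ((t : ℂ) • M ξ))
      (M ξ * NormedSpace.exp ((t : ℂ) • M ξ)) t := by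
    refine (h1.scomp t Complex.ofRealCLM.hasDerivAt).congr_deriv ?_
    rw [Complex.ofRealCLM_apply, Complex.ofReal_one, one_smul]
  have h3 := hasDerivAt_pi.1 (hasDerivAt_pi.1 h2 i) j
  simpa [expSym, Matrix.mul_apply] using h3

end

variable {M : Plane → Matrix ι ι ℂ}

lemma expSym_add (s t : ℝ) (i j : ι) (ξ : Plane) :
    expSym M (s + t) i j ξ = ∑ k, expSym M s i k ξ * expSym M t k j ξ := by
  rw [expSym, Complex.ofReal_add, add_smul, Matrix.exp_add_of_commute, Matrix.mul_apply]
  · rfl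
  · exact (Commute.refl (M ξ)).smul_left _ |>.smul_right _

lemma expSym_zero (i j : ι) (ξ : Plane) : expSym M 0 i j ξ = if i = j then 1 else 0 := by
  rw [expSym, Complex.ofReal_zero, zero_smul, NormedSpace.exp_zero, Matrix.one_apply]

/-- The exponential of a skew-adjoint matrix is unitary and so has entries of modulus at most `1`,
however large the matrix is. The uniformity in `ε` of all later estimates rests on this. -/
lemma norm_expSym_le (hs : ∀ ξ, (M ξ).conjTranspose = -M ξ) (t : ℝ) (i j : ι) (ξ : Plane) :
    ‖expSym M t i j ξ‖ ≤ 1 := by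
  refine entry_norm_bound_of_unitary ?_ i j
  have h1 : (NormedSpace.exp ((t : ℂ) • M ξ)).conjTranspose
      = NormedSpace.exp (-((t : ℂ) • M ξ)) := by
    rw [← Matrix.exp_conjTranspose, Matrix.conjTranspose_smul, hs]
    simp
  rw [Matrix.mem_unitaryGroup_iff, Matrix.star_eq_conjTranspose, h1,
    ← Matrix.exp_add_of_commute _ _ ((Commute.refl ((t : ℂ) • M ξ)).neg_right), add_neg_cancel,
    NormedSpace.exp_zero]

lemma bddMult_expSym (hM : Continuous M) (hs : ∀ ξ, (M ξ).conjTranspose = -M ξ) (t : ℝ)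
    (i j : ι) : BddMult (expSym M t i j) 1 := by
  refine ⟨Continuous.measurable ?_, norm_expSym_le hs t i j⟩
  have : Continuous fun ξ => NormedSpace.exp ((t : ℂ) • M ξ) :=
    continuous_matrix_exp.comp (by fun_prop)
  exact this.matrix_elem i j

/-- The multiplier with a matrix-valued symbol, on the frequency side. -/
def matOp (m : ι → ι → Plane → ℂ) : (ι → L2) →L[ℝ] (ι → L2) :=
  ContinuousLinearMap.pi fun i => ∑ j,
    ((mulOp (m i j)).restrictScalars ℝ).comp (ContinuousLinearMap.proj j)

omit [DecidableEq ι] in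
lemma matOp_apply (m : ι → ι → Plane → ℂ) (h : ι → L2) (i : ι) :
    matOp m h i = ∑ j, mulOp (m i j) (h j) := by
  simp [matOp]

/-- The group generated by a skew-adjoint multiplier. -/
def matFlow (hM : Continuous M) (hs : ∀ ξ, (M ξ).conjTranspose = -M ξ) : Flow (ι → L2) where
  toFun t := matOp (expSym M t)
  -- A row of the matrix has `card ι` entries of modulus at most one, and the product carries the
  -- sup norm; the bound does not involve `M`.
  bd := Fintype.card ι
  bd_nonneg := Nat.cast_nonneg _
  zero := by
    ext1 h
    funext i
    rw [matOp_apply, ContinuousLinearMap.id_apply, Finset.sum_eq_single i]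
    · rw [show expSym M 0 i i = fun _ => 1 from funext fun ξ => by rw [expSym_zero, if_pos rfl],
        mulOp_one]
    · intro j _ hj
      rw [show expSym M 0 i j = fun _ => 0 from funext fun ξ => by
        rw [expSym_zero, if_neg hj.symm], mulOp_zero]
    · simp
  add s t h := by
    funext i
    have hb := bddMult_expSym hM hs
    simp_rw [matOp_apply, map_sum, fun k j => mulOp_mulOp (hb s i k) (hb t k j)]
    rw [Finset.sum_comm]
    refine Finset.sum_congr rfl fun j _ => ?_
    rw [← mulOp_sum (C := fun _ => 1 * 1) (fun k _ => (hb s i k).mul (hb t k j))]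
    congr 2
    ext ξ
    rw [expSym_add]
  bound t h := by
    refine (pi_norm_le_iff_of_nonneg (by positivity)).2 fun i => ?_
    rw [matOp_apply]
    calc ‖∑ j, mulOp (expSym M t i j) (h j)‖ ≤ ∑ j, ‖mulOp (expSym M t i j) (h j)‖ :=
          norm_sum_le _ _
      _ ≤ ∑ _j : ι, ‖h‖ := Finset.sum_le_sum fun j _ => by
          have := norm_mulOp_le (bddMult_expSym hM hs t i j) (h j)
          rw [one_mul] at this
          exact this.trans (norm_le_pi_norm h j)
      _ = Fintype.card ι * ‖h‖ := by simp
  cont h := by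
    refine continuous_pi fun i => ?_
    simp_rw [matOp_apply]
    refine continuous_finsetSum _ fun j _ => ?_
    refine continuous_iff_continuousAt.2 fun t => ?_
    exact tendsto_mulOp (Eventually.of_forall fun t => bddMult_expSym hM hs t i j)
      (bddMult_expSym hM hs t i j)
      (fun ξ => (hasDerivAt_expSym M t i j ξ).continuousAt) (h j)

/-- `smoothing σ` on each component. -/
def smoothings (σ : ℝ) : (ι → L2) →L[ℝ] (ι → L2) :=
  ContinuousLinearMap.pi fun i =>
    ((smoothing σ).restrictScalars ℝ).comp (ContinuousLinearMap.proj i)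

omit [Fintype ι] [DecidableEq ι] in
@[simp] lemma smoothings_apply (σ : ℝ) (h : ι → L2) (i : ι) :
    smoothings σ h i = smoothing σ (h i) := rfl

omit [DecidableEq ι] in
lemma approxInv_smoothings {σ : ℝ} (hσ : 0 ≤ σ) : ApproxInv (smoothings (ι := ι) σ) :=
  (approxInv_smoothing hσ).pi fun _ _ => rfl

lemma matFlow_generates (hM : Continuous M) (hs : ∀ ξ, (M ξ).conjTranspose = -M ξ) {σ B : ℝ}
    (hσ : 0 ≤ σ) (hB : ∀ ξ i j, ‖M ξ i j‖ ≤ B * ‖jap σ ξ‖) :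
    (matFlow hM hs).Generates (smoothings σ) (matOp fun i j ξ => M ξ i j * jap (-σ) ξ) where
  comm t h := by
    funext i
    change matOp (expSym M t) (smoothings σ h) i = smoothing σ (matOp (expSym M t) h i)
    rw [matOp_apply, matOp_apply, map_sum]
    exact Finset.sum_congr rfl fun j _ => (smoothing_mulOp hσ (bddMult_expSym hM hs t i j) _).symm
  deriv h := by
    refine hasDerivAt_pi.2 fun i => ?_
    change HasDerivAt (fun t => matOp (expSym M t) (smoothings σ h) i) _ 0
    simp_rw [matOp_apply]
    refine HasDerivAt.fun_sum fun j _ => ?_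
    refine hasDerivAt_mulOp_smoothing (E := fun t => expSym M t i j) (C := 1)
      (B := Fintype.card ι * B)
      (D := fun ξ => M ξ i j) hσ (fun t => bddMult_expSym hM hs t i j)
      (hM.matrix_elem i j).measurable (fun ξ => ?_) (fun t ξ => ?_) (h j)
    · refine (hasDerivAt_expSym M 0 i j ξ).congr_deriv ?_
      simp [expSym_zero]
    -- Mean value inequality: the derivative is a sum of `card ι` terms, each an entry of `M ξ`
    -- times an entry of the unitary matrix.
    · have := Convex.norm_image_sub_le_of_norm_hasDerivWithin_le (s := univ)
        (f := fun t => expSym M t i j ξ) (x := 0) (y := t) (C := Fintype.card ι * B * ‖jap σ ξ‖)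
        (fun τ _ => (hasDerivAt_expSym M τ i j ξ).hasDerivWithinAt) (fun τ _ => ?_)
        convex_univ (mem_univ _) (mem_univ _)
      · rw [sub_zero, Real.norm_eq_abs] at this
        linarith
      · refine (norm_sum_le _ _).trans ?_
        calc ∑ k, ‖M ξ i k * expSym M τ k j ξ‖ ≤ ∑ _k : ι, B * ‖jap σ ξ‖ := by
              refine Finset.sum_le_sum fun k _ => ?_
              rw [norm_mul]
              calc ‖M ξ i k‖ * ‖expSym M τ k j ξ‖ ≤ ‖M ξ i k‖ * 1 := by
                    gcongr; exact norm_expSym_le hs τ k j ξ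
                _ ≤ _ := by rw [mul_one]; exact hB ξ i k
          _ = _ := by simp [mul_assoc]

/-! #### The Klein-Gordon system -/

/-- The symbol of `ε⁻¹ A(∂ₓ) - ε⁻² A₀`. -/
def kgSym (ε : ℝ) (ξ : Plane) : Matrix (Fin 4) (Fin 4) ℂ :=
  !![0, 0, (ε⁻¹ : ℝ) * symD 0 ξ, 0;
     0, 0, (ε⁻¹ : ℝ) * symD 1 ξ, 0;
     (ε⁻¹ : ℝ) * symD 0 ξ, (ε⁻¹ : ℝ) * symD 1 ξ, 0, -((ε ^ 2)⁻¹ : ℝ);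
     0, 0, ((ε ^ 2)⁻¹ : ℝ), 0]

lemma continuous_symD (j : Fin 2) : Continuous (symD j) := by
  unfold symD
  have : Continuous fun ξ : Plane => ξ j := by fun_prop
  fun_prop

lemma continuous_kgSym (ε : ℝ) : Continuous (kgSym ε) := by
  have h0 := continuous_symD 0
  have h1 := continuous_symD 1
  refine continuous_matrix fun i j => ?_
  fin_cases i <;> fin_cases j <;> simp [kgSym] <;> fun_prop

lemma star_symD (j : Fin 2) (ξ : Plane) : (starRingEnd ℂ) (symD j ξ) = -symD j ξ := by
  simp [symD, Complex.conj_ofReal, map_ofNat]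

lemma kgSym_skew (ε : ℝ) (ξ : Plane) : (kgSym ε ξ).conjTranspose = -kgSym ε ξ := by
  ext i j
  fin_cases i <;> fin_cases j <;>
    simp [kgSym, Matrix.conjTranspose_apply, star_symD, -Complex.ofReal_inv, -Complex.ofReal_pow]

lemma norm_symD_le (j : Fin 2) (ξ : Plane) : ‖symD j ξ‖ ≤ 2 * Real.pi * ‖jap 1 ξ‖ := by
  have h1 : ‖symD j ξ‖ = 2 * Real.pi * ‖ξ j‖ := by
    simp [symD, abs_of_pos Real.pi_pos]
  rw [h1]
  gcongr
  exact (PiLp.norm_apply_le ξ j).trans (norm_le_jap_one ξ)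

lemma norm_jap_mono {σ τ : ℝ} (h : σ ≤ τ) (ξ : Plane) : ‖jap σ ξ‖ ≤ ‖jap τ ξ‖ := by
  rw [norm_jap, norm_jap]
  exact Real.rpow_le_rpow_of_exponent_le (by nlinarith [sq_nonneg ‖ξ‖]) (by linarith)

/-- `B` blows up as `ε → 0`. This is harmless: it serves for differentiability of the group and
boundedness of its symbols, never for a bound in the stability estimate. -/
lemma kgSym_bound (ε : ℝ) {σ : ℝ} (hσ : 1 ≤ σ) : ∃ B : ℝ, ∀ ξ i j,
    ‖kgSym ε ξ i j‖ ≤ B * ‖jap σ ξ‖ := by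
  set B : ℝ := |ε⁻¹| * (2 * Real.pi) + |(ε ^ 2)⁻¹| with hB
  have hB0 : 0 ≤ B := by positivity
  refine ⟨B, fun ξ i j => ?_⟩
  have hj : 1 ≤ ‖jap σ ξ‖ := by
    have := norm_jap_mono (show (0 : ℝ) ≤ σ by linarith) ξ
    rwa [jap_zero, norm_one] at this
  have h1 : ∀ k, ‖((ε⁻¹ : ℝ) : ℂ) * symD k ξ‖ ≤ B * ‖jap σ ξ‖ := fun k => by
    rw [norm_mul, Complex.norm_real, Real.norm_eq_abs]
    calc |ε⁻¹| * ‖symD k ξ‖ ≤ |ε⁻¹| * (2 * Real.pi * ‖jap 1 ξ‖) := by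
          gcongr; exact norm_symD_le k ξ
      _ ≤ |ε⁻¹| * (2 * Real.pi * ‖jap σ ξ‖) := by gcongr; exact norm_jap_mono hσ ξ
      _ = (|ε⁻¹| * (2 * Real.pi)) * ‖jap σ ξ‖ := by ring
      _ ≤ _ := by gcongr; rw [hB]; exact le_add_of_nonneg_right (by positivity)
  have h2 : ‖(((ε ^ 2)⁻¹ : ℝ) : ℂ)‖ ≤ B * ‖jap σ ξ‖ := by
    rw [Complex.norm_real, Real.norm_eq_abs]
    calc |(ε ^ 2)⁻¹| ≤ B := by rw [hB]; exact le_add_of_nonneg_left (by positivity)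
      _ ≤ _ := le_mul_of_one_le_right hB0 hj
  have h0 : ‖(0 : ℂ)‖ ≤ B * ‖jap σ ξ‖ := by rw [norm_zero]; positivity
  have h3 : ‖-(((ε ^ 2)⁻¹ : ℝ) : ℂ)‖ ≤ B * ‖jap σ ξ‖ := by rwa [norm_neg]
  fin_cases i <;> fin_cases j <;>
    first | exact h0 | exact h1 _ | exact h2 | exact h3

/-- The linear Klein-Gordon group. -/
def kgFlow (ε : ℝ) : Flow State := matFlow (continuous_kgSym ε) (kgSym_skew ε)

/-- The generator of the Klein-Gordon group composed with `smoothings σ`. -/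
def kgGen (ε σ : ℝ) : State →L[ℝ] State := matOp fun i j ξ => kgSym ε ξ i j * jap (-σ) ξ

lemma kgFlow_generates (ε : ℝ) {σ : ℝ} (hσ : 1 ≤ σ) :
    (kgFlow ε).Generates (smoothings σ) (kgGen ε σ) := by
  obtain ⟨B, hB⟩ := kgSym_bound ε hσ
  exact matFlow_generates _ _ (by linarith) hB

lemma kgFlow_bd (ε : ℝ) : (kgFlow ε).bd = 4 := by
  change ((Fintype.card (Fin 4) : ℕ) : ℝ) = 4
  simp

end Flows

/-! ### Derivatives of Sobolev functions -/

section Derivatives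

lemma bddMult_symD (j : Fin 2) : BddMult (fun ξ => symD j ξ * jap (-1) ξ) (2 * Real.pi) :=
  ⟨(continuous_symD j).measurable.mul (continuous_jap _).measurable, fun ξ => by
    rw [norm_mul]
    calc ‖symD j ξ‖ * ‖jap (-1) ξ‖ ≤ 2 * Real.pi * ‖jap 1 ξ‖ * ‖jap (-1) ξ‖ := by
          gcongr; exact norm_symD_le j ξ
      _ = 2 * Real.pi * ‖jap 1 ξ * jap (-1) ξ‖ := by rw [norm_mul]; ring
      _ = 2 * Real.pi := by rw [jap_neg_mul, norm_one, mul_one]⟩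

lemma bddMult_symLap : BddMult (fun ξ => symLap ξ * jap (-2) ξ) ((2 * Real.pi) ^ 2) :=
  ⟨(by unfold symLap; fun_prop : Measurable symLap).mul (continuous_jap _).measurable, fun ξ => by
    rw [norm_mul]
    have h1 : ‖symLap ξ‖ = (2 * Real.pi) ^ 2 * ‖ξ‖ ^ 2 := by
      rw [symLap, norm_neg, Complex.norm_real, Real.norm_of_nonneg (by positivity)]
    calc ‖symLap ξ‖ * ‖jap (-2) ξ‖ ≤ (2 * Real.pi) ^ 2 * ‖jap 2 ξ‖ * ‖jap (-2) ξ‖ := by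
          rw [h1]; gcongr; exact sq_le_jap le_rfl ξ
      _ = (2 * Real.pi) ^ 2 * ‖jap 2 ξ * jap (-2) ξ‖ := by rw [norm_mul]; ring
      _ = (2 * Real.pi) ^ 2 := by rw [jap_neg_mul, norm_one, mul_one]⟩

/-- `∂_{x_j} : H^{σ+1} → H^σ` on the frequency side. -/
def dFreq (j : Fin 2) : L2 →L[ℂ] L2 := mulOp fun ξ => symD j ξ * jap (-1) ξ

/-- `Δ : H^{σ+2} → H^σ` on the frequency side. -/
def lapFreq : L2 →L[ℂ] L2 := mulOp fun ξ => symLap ξ * jap (-2) ξ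

variable {σ : ℝ}

lemma partialD_ofFreq (hσ : 0 ≤ σ) (j : Fin 2) (h : L2) :
    partialD j (ofFreq (σ + 1) h) = toDist (ofFreq σ (dFreq j h)) := by
  refine partialD_eq ?_
  rw [fourier_ofFreq, fourier_ofFreq]
  filter_upwards [smoothing_coe hσ (dFreq j h), smoothing_coe (by linarith : 0 ≤ σ + 1) h,
    mulOp_coe (bddMult_symD j) h] with ξ h1 h2 h3
  rw [h1, h2, dFreq, h3, neg_add, jap_add]
  ring

lemma laplacian_ofFreq (hσ : 0 ≤ σ) (h : L2) :
    Δ (toDist (ofFreq (σ + 2) h)) = toDist (ofFreq σ (lapFreq h)) := by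
  refine laplacian_eq ?_
  rw [fourier_ofFreq, fourier_ofFreq]
  filter_upwards [smoothing_coe hσ (lapFreq h), smoothing_coe (by linarith : 0 ≤ σ + 2) h,
    mulOp_coe bddMult_symLap h] with ξ h1 h2 h3
  rw [h1, h2, lapFreq, h3, neg_add, jap_add]
  ring

lemma fourierInv_mulOp_symD (hσ : 0 ≤ σ) (j : Fin 2) (h : L2) :
    (𝓕⁻ (mulOp (fun ξ => symD j ξ * jap (-(σ + 1)) ξ) h) : L2) = ofFreq σ (dFreq j h) := by
  rw [ofFreq, dFreq, smoothing, mulOp_mulOp (bddMult_jap hσ) (bddMult_symD j)]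
  congr 3
  ext ξ
  rw [neg_add, jap_add]
  ring

lemma fourierInv_schrGen (hσ : 0 ≤ σ) (h : L2) :
    (𝓕⁻ (schrGen (σ + 2) h) : L2) = (2 * Complex.I)⁻¹ • ofFreq σ (lapFreq h) := by
  rw [schrGen, ofFreq, lapFreq, smoothing, mulOp_mulOp (bddMult_jap hσ) bddMult_symLap,
    ← FourierTransform.fourierInv_smul,
    ← mulOp_const_mul _ ((bddMult_jap hσ).mul bddMult_symLap)]
  congr 3
  ext ξ
  rw [neg_add, jap_add]
  ring

/-- The inverse Fourier transform as a real-linear map. -/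
def invL : L2 →L[ℝ] L2 := (fourierInvCLM ℂ L2).restrictScalars ℝ

/-- The Fourier transform as a real-linear map. -/
def fouL : L2 →L[ℝ] L2 := (fourierCLM ℂ L2).restrictScalars ℝ

/-- By Plancherel, a derivative in `L²` of an `H^σ`-valued curve is a derivative of the smoothed
frequency curve. This is why `Generates` speaks of the flow composed with `J`. -/
lemma hasDerivAt_ofFreq_iff {h : ℝ → L2} {d : L2} {t : ℝ} :
    HasDerivAt (fun τ => ofFreq σ (h τ)) (𝓕⁻ d : L2) t ↔
      HasDerivAt (fun τ => smoothing σ (h τ)) d t := by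
  constructor
  · intro H
    have := fouL.hasFDerivAt.comp_hasDerivAt t H
    have h2 : fouL (𝓕⁻ d : L2) = d := by
      change (𝓕 (𝓕⁻ d : L2) : L2) = d
      exact fourier_fourierInv_eq d
    rw [h2] at this
    refine this.congr_of_eventuallyEq (Eventually.of_forall fun τ => ?_)
    exact (fourier_ofFreq σ (h τ)).symm
  · intro H
    exact invL.hasFDerivAt.comp_hasDerivAt t H

/-- Trilinear products in `H^σ`, on the frequency side. -/
def tri (hσ : 1 < σ) (a b c : L2) : L2 := freqMulL hσ a (freqMulL hσ b c)

lemma ofFreq_tri (hσ : 1 < σ) (a b c : L2) :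
    ofFreq σ (tri hσ a b c) = pmul (ofFreq σ a) (pmul (ofFreq σ b) (ofFreq σ c)) := by
  rw [tri, ofFreq_freqMulL, ofFreq_freqMulL]

lemma ofFreq_tri_coe (hσ : 1 < σ) (a b c : L2) :
    ∀ᵐ x, ofFreq σ (tri hσ a b c) x = ofFreq σ a x * (ofFreq σ b x * ofFreq σ c x) := by
  rw [ofFreq_tri]
  filter_upwards [pmul_coe hσ a (pmul (ofFreq σ b) (ofFreq σ c)), pmul_coe hσ b (ofFreq σ c)]
    with x h1 h2
  rw [h1, h2]

/-- A bound for the trilinear product. -/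
def triConst (hσ : 1 < σ) : ℝ := ‖freqMulL hσ‖ * ‖freqMulL hσ‖

lemma triConst_nonneg (hσ : 1 < σ) : 0 ≤ triConst hσ := by unfold triConst; positivity

lemma norm_tri_le (hσ : 1 < σ) (a b c : L2) :
    ‖tri hσ a b c‖ ≤ triConst hσ * (‖a‖ * ‖b‖ * ‖c‖) := by
  calc ‖tri hσ a b c‖ ≤ ‖freqMulL hσ‖ * ‖a‖ * ‖freqMulL hσ b c‖ :=
        (freqMulL hσ).le_opNorm₂ _ _
    _ ≤ ‖freqMulL hσ‖ * ‖a‖ * (‖freqMulL hσ‖ * ‖b‖ * ‖c‖) := by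
        gcongr; exact (freqMulL hσ).le_opNorm₂ _ _
    _ = _ := by rw [triConst]; ring

lemma tri_sub_tri (hσ : 1 < σ) (a b c a' b' c' : L2) :
    tri hσ a b c - tri hσ a' b' c' =
      tri hσ (a - a') b c + tri hσ a' (b - b') c + tri hσ a' b' (c - c') := by
  simp only [tri, map_sub, sub_apply]
  abel

lemma norm_tri_sub_le (hσ : 1 < σ) {a b c a' b' c' : L2} {R : ℝ} (hb : ‖b‖ ≤ R) (hc : ‖c‖ ≤ R)
    (ha' : ‖a'‖ ≤ R) (hb' : ‖b'‖ ≤ R) :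
    ‖tri hσ a b c - tri hσ a' b' c'‖ ≤
      triConst hσ * R ^ 2 * (‖a - a'‖ + ‖b - b'‖ + ‖c - c'‖) := by
  have hR : 0 ≤ R := (norm_nonneg _).trans hb
  have hκ := triConst_nonneg hσ
  rw [tri_sub_tri]
  have h1 : ‖tri hσ (a - a') b c‖ ≤ triConst hσ * (‖a - a'‖ * R * R) :=
    (norm_tri_le hσ _ _ _).trans (by gcongr)
  have h2 : ‖tri hσ a' (b - b') c‖ ≤ triConst hσ * (R * ‖b - b'‖ * R) :=
    (norm_tri_le hσ _ _ _).trans (by gcongr)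
  have h3 : ‖tri hσ a' b' (c - c')‖ ≤ triConst hσ * (R * R * ‖c - c'‖) :=
    (norm_tri_le hσ _ _ _).trans (by gcongr)
  calc _ ≤ ‖tri hσ (a - a') b c‖ + ‖tri hσ a' (b - b') c‖ + ‖tri hσ a' b' (c - c')‖ :=
        norm_add₃_le
    _ ≤ _ := by linarith

lemma continuousOn_tri (hσ : 1 < σ) {s : Set ℝ} {a b c : ℝ → L2} (ha : ContinuousOn a s)
    (hb : ContinuousOn b s) (hc : ContinuousOn c s) :
    ContinuousOn (fun t => tri hσ (a t) (b t) (c t)) s := by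
  have h1 : ContinuousOn (fun t => freqMulL hσ (b t) (c t)) s :=
    ((freqMulL hσ).continuous.comp_continuousOn hb).clm_apply hc
  exact ((freqMulL hσ).continuous.comp_continuousOn ha).clm_apply h1

end Derivatives

/-! ### The cubic Schrödinger equation -/

section NLS

variable {σ : ℝ}

/-- From the interaction representation to the Schrödinger equation. -/
lemma schr_strong (hσ : 0 ≤ σ) {y : ℝ → L2} {G : L2} {t : ℝ}
    (hy : HasDerivAt y (schrFlow (-t) G) t) :
    HasDerivAt (fun τ => ofFreq (σ + 2) (schrFlow τ (y τ)))
      ((2 * Complex.I)⁻¹ • ofFreq σ (lapFreq (schrFlow t (y t))) + ofFreq (σ + 2) G) t := by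
  have h1 := (schrFlow_generates (by linarith : 2 ≤ σ + 2)).strong_of_mild hy
  have h2 := hasDerivAt_ofFreq_iff.2 h1
  refine h2.congr_deriv ?_
  rw [FourierTransform.fourierInv_add]
  congr 1
  exact fourierInv_schrGen hσ _

/-- From the Schrödinger equation to the interaction representation. -/
lemma schr_mild (hσ : 0 ≤ σ) {T : ℝ≥0∞} {h G : ℝ → L2} (hh : ContinuousOn h (timeSet T))
    (hG : ContinuousOn G (timeSet T))
    (hd : ∀ t ∈ timeSet T, 0 < t → HasDerivAt (fun τ => ofFreq (σ + 2) (h τ))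
      ((2 * Complex.I)⁻¹ • ofFreq σ (lapFreq (h t)) + ofFreq (σ + 2) (G t)) t) :
    ∀ t ∈ timeSet T, HasDerivWithinAt (fun τ => schrFlow (-τ) (h τ)) (schrFlow (-t) (G t))
      (Ici 0) t := by
  refine (schrFlow_generates (by linarith : 2 ≤ σ + 2)).mild_of_strong
    (approxInv_smoothing (by linarith)).injective hh hG fun t ht ht0 => ?_
  refine hasDerivAt_ofFreq_iff.1 ?_
  refine (hd t ht ht0).congr_deriv ?_
  have h1 : (𝓕⁻ (((schrGen (σ + 2)).restrictScalars ℝ) (h t) +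
      ((smoothing (σ + 2)).restrictScalars ℝ) (G t)) : L2) =
      (𝓕⁻ (schrGen (σ + 2) (h t)) : L2) + (𝓕⁻ (smoothing (σ + 2) (G t)) : L2) :=
    FourierTransform.fourierInv_add _ _
  rw [h1, fourierInv_schrGen hσ]
  rfl

/-- The cubic nonlinearity of the Schrödinger equation on the frequency side. -/
def nlsN (lam : ℝ) (hσ : 1 < σ) (h : L2) : L2 :=
  (-(2 * Complex.I)⁻¹ * (3 * lam)) • tri hσ h (conjFreq h) h

lemma nlsN_admissible (lam : ℝ) (hσ : 1 < σ) (T : ℝ≥0∞) :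
    Admissible (fun _ => nlsN lam hσ) T where
  cont _ := continuousOn_const
  lip T' _ R := by
    set c : ℂ := -(2 * Complex.I)⁻¹ * (3 * lam)
    refine ⟨(‖c‖ * (triConst hσ * (max R 0) ^ 2 * 3)).toNNReal, fun _ _ => ?_⟩
    refine LipschitzOnWith.of_dist_le_mul fun x hx y hy => ?_
    rw [mem_closedBall_zero_iff] at hx hy
    have hx' := hx.trans (le_max_left R 0)
    have hy' := hy.trans (le_max_left R 0)
    have hκ := triConst_nonneg hσ
    rw [dist_eq_norm, dist_eq_norm, nlsN, nlsN, ← smul_sub, norm_smul,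
      Real.coe_toNNReal _ (by positivity)]
    have h1 := norm_tri_sub_le hσ (a := x) (a' := y) (R := max R 0)
      (b := conjFreq x) (b' := conjFreq y) (c := x) (c' := y)
      (by rwa [norm_conjFreq]) hx' hy' (by rwa [norm_conjFreq])
    have h2 : ‖conjFreq x - conjFreq y‖ = ‖x - y‖ := by
      rw [← conjFreqL_apply, ← conjFreqL_apply, ← map_sub, conjFreqL_apply, norm_conjFreq]
    rw [h2] at h1
    calc _ ≤ ‖c‖ * (triConst hσ * max R 0 ^ 2 * (‖x - y‖ + ‖x - y‖ + ‖x - y‖)) := by gcongr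
      _ = _ := by ring

lemma ofFreq_nlsN (lam : ℝ) (hσ : 1 < σ) (h : L2) :
    ∀ᵐ x, ((-(2 * Complex.I)) • ofFreq σ (nlsN lam hσ h) : L2) x =
      3 * (lam : ℂ) * ((‖ofFreq σ h x‖ ^ 2 : ℝ) : ℂ) * ofFreq σ h x := by
  have h2 : (-(2 * Complex.I)) • ofFreq σ (nlsN lam hσ h)
      = (3 * lam : ℂ) • ofFreq σ (tri hσ h (conjFreq h) h) := by
    rw [nlsN, ofFreq_smul, smul_smul]
    congr 1
    field_simp
  rw [h2]
  filter_upwards [Lp.coeFn_smul (3 * lam : ℂ) (ofFreq σ (tri hσ h (conjFreq h) h)),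
    ofFreq_tri_coe hσ h (conjFreq h) h, star_coe (ofFreq σ h)] with x h3 h4 h5
  rw [h3, Pi.smul_apply, h4, ← star_ofFreq (by linarith : 0 ≤ σ), h5, smul_eq_mul,
    Complex.star_def, ← mul_assoc (ofFreq σ h x), Complex.mul_conj, Complex.normSq_eq_norm_sq]
  ring

/-- The equation for `g = ofFreq h` is equivalent to the ordinary differential equation for `y =
S(-t) h`. The space `H^{σ+2}` with `σ ≥ 0` makes the Laplacian an `L²` function. -/
lemma nls_iff (lam : ℝ) (hσ : 0 ≤ σ) {φ ψ h₀ : L2}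
    (h0 : ofFreq (σ + 2) h₀ = (1 / 2 : ℂ) • (φ - Complex.I • ψ)) {T : ℝ≥0∞} {g : ℝ → L2} :
    IsNLSSolution lam φ ψ (σ + 2) T g ↔ g 0 = ofFreq (σ + 2) h₀ ∧ ∃ y,
      IsSol (schrFlow.interaction fun _ => nlsN lam (by linarith : 1 < σ + 2)) h₀ T y ∧
      ∀ t ∈ timeSet T, g t = ofFreq (σ + 2) (schrFlow t (y t)) := by
  have hσ2 : 0 ≤ σ + 2 := by linarith
  have hσ1 : 1 < σ + 2 := by linarith
  have h2I : (2 * Complex.I : ℂ) ≠ 0 := by simp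
  have heq : ∀ (h N dg : L2), (∀ᵐ x : Plane, N x =
        3 * (lam : ℂ) * ((‖ofFreq (σ + 2) h x‖ ^ 2 : ℝ) : ℂ) * ofFreq (σ + 2) h x) →
      ((2 * Complex.I) • toDist dg - Δ (toDist (ofFreq (σ + 2) h)) + toDist N = 0 ↔
        dg = (2 * Complex.I)⁻¹ • ofFreq σ (lapFreq h) + ofFreq (σ + 2) (nlsN lam hσ1 h)) := by
    intro h N dg hN
    have hN' : N = (-(2 * Complex.I)) • ofFreq (σ + 2) (nlsN lam hσ1 h) := by
      refine eq_of_ae ?_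
      filter_upwards [hN, ofFreq_nlsN lam hσ1 h] with x h1 h2
      rw [h1, h2]
    rw [laplacian_ofFreq hσ, ← toDist_smul, ← toDist_sub, ← toDist_add, ← toDist_zero,
      toDist_injective.eq_iff, hN']
    constructor
    · intro hE
      have h3 : (2 * Complex.I) • dg = ofFreq σ (lapFreq h) +
          (2 * Complex.I) • ofFreq (σ + 2) (nlsN lam hσ1 h) := by
        rw [neg_smul] at hE
        rw [← sub_eq_zero, ← hE]
        abel
      rw [← smul_right_injective L2 h2I |>.eq_iff]
      simp only [smul_add, smul_smul, mul_inv_cancel₀ h2I, one_smul]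
      exact h3
    · rintro rfl
      simp only [smul_add, smul_smul, mul_inv_cancel₀ h2I, one_smul, neg_smul]
      abel
  constructor
  · rintro ⟨hc, hi, he⟩
    refine ⟨hi.trans h0.symm, ?_⟩
    obtain ⟨h, hh, hg⟩ := (contHs_iff hσ2).1 hc
    have hG : ContinuousOn (fun t => nlsN lam hσ1 (h t)) (timeSet T) :=
      (nlsN_admissible lam hσ1 T).comp_continuousOn hh
    have hm := schr_mild hσ hh hG fun t ht ht0 => by
      obtain ⟨dg, N, hdg, hN, hNLS⟩ := he t ht ht0
      rw [hg t ht] at hNLS hN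
      rw [← (heq _ _ _ hN).1 hNLS]
      refine hdg.congr_of_eventuallyEq ?_
      filter_upwards [timeSet_mem_nhds ht ht0] with τ hτ using (hg τ hτ).symm
    -- For `T = 0` nothing relates `h 0` to the datum, yet `IsSol` still prescribes `y 0`; a
    -- constant curve does.
    rcases eq_or_ne T 0 with rfl | hT
    · have hempty : ∀ t, t ∉ timeSet 0 := fun t ht => absurd ht.2 (not_lt.2 zero_le)
      exact ⟨fun _ => h₀, ⟨rfl, fun t ht => absurd ht (hempty t)⟩, fun t ht =>
        absurd ht (hempty t)⟩
    have h0T : (0 : ℝ) ∈ timeSet T := ⟨le_rfl, by simpa using pos_iff_ne_zero.2 hT⟩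
    refine ⟨fun τ => schrFlow (-τ) (h τ), ⟨?_, fun t ht => ?_⟩, fun t ht => ?_⟩
    · rw [neg_zero, schrFlow.zero]
      exact ofFreq_injective hσ2 (by rw [ContinuousLinearMap.id_apply, ← hg 0 h0T, hi, h0])
    · rw [Flow.interaction, schrFlow.apply_neg]
      exact hm t ht
    · rw [schrFlow.apply_neg, hg t ht]
  · rintro ⟨hi, y, hy, hg⟩
    refine ⟨(contHs_iff hσ2).2 ⟨fun t => schrFlow t (y t), fun t ht =>
      schrFlow.tendsto (tendsto_id.mono_left nhdsWithin_le_nhds) (hy.continuousOn t ht), hg⟩,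
      hi.trans h0, fun t ht ht0 => ?_⟩
    have h1 := (hy.deriv t ht).hasDerivAt (Ici_mem_nhds ht0)
    have h2 := schr_strong hσ h1
    refine ⟨_, (-(2 * Complex.I)) • ofFreq (σ + 2) (nlsN lam hσ1 (schrFlow t (y t))),
      h2.congr_of_eventuallyEq ?_, ?_, ?_⟩
    · filter_upwards [timeSet_mem_nhds ht ht0] with τ hτ using hg τ hτ
    · rw [hg t ht]
      exact ofFreq_nlsN lam hσ1 _
    · rw [hg t ht]
      exact (heq _ _ _ (ofFreq_nlsN lam hσ1 _)).2 rfl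

/-- The Schrödinger equation is well posed in `H^σ`, `σ ≥ 2`, up to its lifespan. -/
theorem nls_lifespan (lam : ℝ) {φ ψ : L2} (hσ : 2 ≤ σ) (hφ : MemHs σ φ) (hψ : MemHs σ ψ) :
    0 < nlsLifespan lam φ ψ σ ∧
      ∃ g, IsNLSSolution lam φ ψ σ (nlsLifespan lam φ ψ σ) g := by
  obtain ⟨τ, hτ, rfl⟩ : ∃ τ, 0 ≤ τ ∧ σ = τ + 2 := ⟨σ - 2, by linarith, by ring⟩
  obtain ⟨a, rfl⟩ := exists_ofFreq (by linarith) hφ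
  obtain ⟨b, rfl⟩ := exists_ofFreq (by linarith) hψ
  have h0 : ofFreq (τ + 2) ((1 / 2 : ℂ) • (a - Complex.I • b)) =
      (1 / 2 : ℂ) • (ofFreq (τ + 2) a - Complex.I • ofFreq (τ + 2) b) := by
    rw [ofFreq_smul, ofFreq_sub, ofFreq_smul]
  have hiff := fun T g => nls_iff lam hτ h0 (T := T) (g := g)
  obtain ⟨Tm, -, hpos, y, hy, huniq, -⟩ := (schrFlow.interaction_admissible
    (nlsN_admissible lam (by linarith : 1 < τ + 2) ⊤)).exists_maximal ENNReal.zero_lt_top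
    ((1 / 2 : ℂ) • (a - Complex.I • b))
  have hsol : ∃ g, IsNLSSolution lam (ofFreq (τ + 2) a) (ofFreq (τ + 2) b) (τ + 2) Tm g := by
    refine ⟨fun t => ofFreq (τ + 2) (schrFlow t (y t)), (hiff _ _).2 ⟨?_, y, hy, fun t _ => rfl⟩⟩
    rw [schrFlow.zero, hy.init]; rfl
  have hTm : nlsLifespan lam (ofFreq (τ + 2) a) (ofFreq (τ + 2) b) (τ + 2) = Tm := by
    refine le_antisymm (sSup_le ?_) (le_sSup hsol)
    rintro T ⟨g, hg⟩
    obtain ⟨-, z, hz, -⟩ := (hiff _ _).1 hg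
    exact (huniq T le_top z hz).1
  rw [hTm]
  exact ⟨hpos, hsol⟩

end NLS

/-! ### The Klein-Gordon system -/

section KleinGordon

variable {σ : ℝ}

/-- The state with components of given frequency representation. -/
def ofFreqS (σ : ℝ) (h : State) : State := fun k => ofFreq σ (h k)

lemma ofFreqS_injective (hσ : 0 ≤ σ) : Function.Injective (ofFreqS σ) := fun _ _ h =>
  funext fun k => ofFreq_injective hσ (congrFun h k)

lemma ofFreqS_sub (h k : State) : ofFreqS σ (h - k) = ofFreqS σ h - ofFreqS σ k :=
  funext fun _ => ofFreq_sub _ _ _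

lemma ofFreqS_smul (c : ℂ) (h : State) : ofFreqS σ (c • h) = c • ofFreqS σ h :=
  funext fun _ => ofFreq_smul _ _ _

/-- The factor `2 = √4` compares the Euclidean norm of four components with the sup norm. -/
lemma stateNorm_ofFreqS_le (hσ : 0 ≤ σ) (h : State) :
    stateNorm σ (ofFreqS σ h) ≤ 2 * ‖h‖ₑ := by
  have h1 : ∑ k, hsNorm σ (ofFreqS σ h k) ^ 2 ≤ (2 * ‖h‖ₑ) ^ 2 := by
    calc ∑ k, hsNorm σ (ofFreqS σ h k) ^ 2 ≤ ∑ _k : Fin 4, ‖h‖ₑ ^ 2 := by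
          refine Finset.sum_le_sum fun k _ => ?_
          rw [ofFreqS, hsNorm_ofFreq hσ]
          gcongr
          simp only [enorm_eq_nnnorm, ENNReal.coe_le_coe]
          exact nnnorm_le_pi_nnnorm h k
      _ = (2 * ‖h‖ₑ) ^ 2 := by
          rw [Finset.sum_const, Finset.card_univ, Fintype.card_fin, mul_pow]
          norm_num
  calc stateNorm σ (ofFreqS σ h) ≤ ((2 * ‖h‖ₑ) ^ 2) ^ (1 / 2 : ℝ) := by
        rw [stateNorm]; gcongr
    _ = 2 * ‖h‖ₑ := by
        rw [← ENNReal.rpow_natCast, ← ENNReal.rpow_mul]; simp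

lemma enorm_le_stateNorm (hσ : 0 ≤ σ) (h : State) : ‖h‖ₑ ≤ stateNorm σ (ofFreqS σ h) := by
  have h1 : ∀ k, ‖h k‖ₑ ≤ stateNorm σ (ofFreqS σ h) := fun k => by
    calc ‖h k‖ₑ = (‖h k‖ₑ ^ 2) ^ (1 / 2 : ℝ) := by
          rw [← ENNReal.rpow_natCast, ← ENNReal.rpow_mul]; simp
      _ ≤ _ := by
          rw [stateNorm]
          refine ENNReal.rpow_le_rpow ?_ (by norm_num)
          rw [← hsNorm_ofFreq hσ (h k)]
          exact Finset.single_le_sum (f := fun k => hsNorm σ (ofFreqS σ h k) ^ 2)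
            (fun _ _ => zero_le) (Finset.mem_univ k)
  rcases eq_or_ne (stateNorm σ (ofFreqS σ h)) ∞ with h2 | h2
  · rw [h2]; exact le_top
  · rw [← ENNReal.ofReal_toReal h2, ← ofReal_norm]
    refine ENNReal.ofReal_le_ofReal ((pi_norm_le_iff_of_nonneg ENNReal.toReal_nonneg).2 fun k => ?_)
    have := ENNReal.toReal_mono h2 (h1 k)
    simpa using this

lemma hasDerivAt_ofFreqS_iff {h : ℝ → State} {d : State} {t : ℝ} :
    HasDerivAt (fun τ => ofFreqS σ (h τ)) (fun k => (𝓕⁻ (d k) : L2)) t ↔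
      HasDerivAt (fun τ => smoothings σ (h τ)) d t := by
  rw [hasDerivAt_pi, hasDerivAt_pi]
  exact forall_congr' fun k => hasDerivAt_ofFreq_iff

lemma fourierInv_kgGen (ε : ℝ) (hσ : 0 ≤ σ) (h : State) (k : Fin 4) :
    toDist (𝓕⁻ (kgGen ε (σ + 1) h k) : L2) =
      ((ε⁻¹ : ℝ) : ℂ) • opA (ofFreqS (σ + 1) h) k
        - (((ε ^ 2)⁻¹ : ℝ) : ℂ) • toDist (opA0 (ofFreqS (σ + 1) h) k) := by
  have hD : ∀ (j : Fin 2) (f : L2),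
      toDist (𝓕⁻ (mulOp (fun ξ => ((ε⁻¹ : ℝ) : ℂ) * symD j ξ * jap (-(σ + 1)) ξ) f) : L2) =
        ((ε⁻¹ : ℝ) : ℂ) • partialD j (ofFreq (σ + 1) f) := by
    intro j f
    have hb : BddMult (fun ξ => symD j ξ * jap (-(σ + 1)) ξ) (1 * (2 * Real.pi)) := by
      have := (bddMult_jap hσ).mul (bddMult_symD j)
      convert this using 2 with ξ
      rw [neg_add, jap_add]; ring
    simp only [mul_assoc]
    rw [mulOp_const_mul _ hb, FourierTransform.fourierInv_smul, fourierInv_mulOp_symD hσ,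
      partialD_ofFreq hσ, toDist_smul]
  have hJ : ∀ (c : ℂ) (f : L2), (𝓕⁻ (mulOp (fun ξ => c * jap (-(σ + 1)) ξ) f) : L2) =
      c • ofFreq (σ + 1) f := by
    intro c f
    rw [mulOp_const_mul _ (bddMult_jap (by linarith : 0 ≤ σ + 1)),
      FourierTransform.fourierInv_smul]
    rfl
  have h0 : ∀ f : L2, mulOp (fun ξ => 0 * jap (-(σ + 1)) ξ) f = 0 := fun f => by
    simp only [zero_mul]; exact mulOp_zero f
  rw [kgGen, matOp_apply, Fin.sum_univ_four]
  simp only [FourierTransform.fourierInv_add, toDist_add]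
  have hz : ∀ c : ℂ, c • (0 : Dist) = 0 := fun c => by
    rw [← toDist_zero, ← toDist_smul, smul_zero]
  fin_cases k <;>
    simp [kgSym, opA, opA0, ofFreqS, hz, -Complex.coe_smul, -Complex.ofReal_inv, -Complex.ofReal_pow, -neg_add_rev, -neg_mul,
      mulOp_zero, FourierTransform.fourierInv_zero, toDist_zero, toDist_neg, toDist_smul, hD, hJ,
      sub_eq_add_neg]

/-- The nonlinearity of the Klein-Gordon system on the frequency side. -/
def kgN (lam : ℝ) (hσ : 1 < σ) (h : State) : State :=
  ![0, 0, -((lam : ℂ) • tri hσ (h 3) (h 3) (h 3)), 0]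

lemma ofFreq_zero : ofFreq σ 0 = 0 := (ofFreqL σ).map_zero

lemma ofFreq_neg (h : L2) : ofFreq σ (-h) = -ofFreq σ h := (ofFreqL σ).map_neg h

lemma ofFreqS_kgN (lam : ℝ) (hσ : 1 < σ) (h : State) {N : L2}
    (hN : ∀ᵐ x : Plane, N x = (lam : ℂ) * (ofFreqS σ h 3 x) ^ 3) :
    ofFreqS σ (kgN lam hσ h) = sourceF N := by
  have h1 : N = (lam : ℂ) • ofFreq σ (tri hσ (h 3) (h 3) (h 3)) := by
    refine eq_of_ae ?_
    filter_upwards [hN, Lp.coeFn_smul (lam : ℂ) (ofFreq σ (tri hσ (h 3) (h 3) (h 3))),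
      ofFreq_tri_coe hσ (h 3) (h 3) (h 3)] with x h2 h3 h4
    rw [h2, h3, Pi.smul_apply, h4, smul_eq_mul, ofFreqS]
    ring
  ext1 k
  fin_cases k
  · exact ofFreq_zero
  · exact ofFreq_zero
  · change ofFreq σ (-((lam : ℂ) • tri hσ (h 3) (h 3) (h 3))) = -N
    rw [ofFreq_neg, ofFreq_smul, h1]
  · exact ofFreq_zero

lemma exists_cube (lam : ℝ) (hσ : 1 < σ) (h : State) :
    ∃ N : L2, ∀ᵐ x : Plane, N x = (lam : ℂ) * (ofFreqS σ h 3 x) ^ 3 := by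
  refine ⟨(lam : ℂ) • ofFreq σ (tri hσ (h 3) (h 3) (h 3)), ?_⟩
  filter_upwards [Lp.coeFn_smul (lam : ℂ) (ofFreq σ (tri hσ (h 3) (h 3) (h 3))),
    ofFreq_tri_coe hσ (h 3) (h 3) (h 3)] with x h3 h4
  rw [h3, Pi.smul_apply, h4, smul_eq_mul, ofFreqS]
  ring

/-- As `toDist` is injective, the system in the sense of distributions determines `dU` as an `L²`
function: the generator applied to `h` plus the smoothed nonlinearity minus the remainder. -/
lemma systemEq_iff (lam ε : ℝ) (hσ : 0 < σ) (dU h ρ : State) :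
    SystemEq lam ε dU (ofFreqS (σ + 1) h) (ofFreqS (σ + 1) ρ) ↔
      dU = fun k => (𝓕⁻ ((kgGen ε (σ + 1) h + smoothings (σ + 1)
        (kgN lam (by linarith : 1 < σ + 1) h - ρ)) k) : L2) := by
  have hσ1 : 1 < σ + 1 := by linarith
  have key : ∀ k, toDist (𝓕⁻ ((kgGen ε (σ + 1) h + smoothings (σ + 1)
        (kgN lam hσ1 h - ρ)) k) : L2) =
      ((ε⁻¹ : ℝ) : ℂ) • opA (ofFreqS (σ + 1) h) k
        - (((ε ^ 2)⁻¹ : ℝ) : ℂ) • toDist (opA0 (ofFreqS (σ + 1) h) k)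
        + (toDist (ofFreqS (σ + 1) (kgN lam hσ1 h) k) - toDist (ofFreqS (σ + 1) ρ k)) := by
    intro k
    rw [Pi.add_apply, FourierTransform.fourierInv_add, toDist_add, fourierInv_kgGen ε hσ.le,
      ← toDist_sub]
    congr 2
    exact ofFreq_sub _ _ _
  constructor
  · rintro ⟨N, hN, hE⟩
    funext k
    refine toDist_injective ?_
    rw [key, ofFreqS_kgN lam hσ1 h hN, ← hE k]
    abel
  · rintro rfl
    obtain ⟨N, hN⟩ := exists_cube lam hσ1 h
    refine ⟨N, hN, fun k => ?_⟩
    rw [key, ofFreqS_kgN lam hσ1 h hN]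
    abel

lemma norm_kgN_sub_le (lam : ℝ) (hσ : 1 < σ) {h k : State} {R : ℝ} (hh : ‖h‖ ≤ R)
    (hk : ‖k‖ ≤ R) :
    ‖kgN lam hσ h - kgN lam hσ k‖ ≤ |lam| * (triConst hσ * R ^ 2 * 3) * ‖h - k‖ := by
  have hκ := triConst_nonneg hσ
  have h1 := norm_tri_sub_le hσ (a := h 3) (b := h 3) (c := h 3) (a' := k 3) (b' := k 3)
    (c' := k 3) ((norm_le_pi_norm h 3).trans hh) ((norm_le_pi_norm h 3).trans hh)
    ((norm_le_pi_norm k 3).trans hk) ((norm_le_pi_norm k 3).trans hk)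
  have h2 : ‖h 3 - k 3‖ ≤ ‖h - k‖ := norm_le_pi_norm (h - k) 3
  have hnn : 0 ≤ |lam| * (triConst hσ * R ^ 2 * 3) * ‖h - k‖ := by positivity
  refine (pi_norm_le_iff_of_nonneg hnn).2 fun i => ?_
  have hz : ‖(0 : L2) - 0‖ ≤ |lam| * (triConst hσ * R ^ 2 * 3) * ‖h - k‖ := by
    rw [sub_zero, norm_zero]; exact hnn
  have h3 : ‖-((lam : ℂ) • tri hσ (h 3) (h 3) (h 3)) - -((lam : ℂ) • tri hσ (k 3) (k 3) (k 3))‖ ≤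
      |lam| * (triConst hσ * R ^ 2 * 3) * ‖h - k‖ := by
    rw [neg_sub_neg, ← smul_sub, norm_smul, Complex.norm_real, Real.norm_eq_abs, norm_sub_rev]
    calc _ ≤ |lam| * (triConst hσ * R ^ 2 * (‖h 3 - k 3‖ + ‖h 3 - k 3‖ + ‖h 3 - k 3‖)) := by gcongr
      _ ≤ |lam| * (triConst hσ * R ^ 2 * (‖h - k‖ + ‖h - k‖ + ‖h - k‖)) := by gcongr
      _ = _ := by ring
  fin_cases i
  · exact hz
  · exact hz
  · exact h3
  · exact hz

lemma kgN_admissible (lam : ℝ) (hσ : 1 < σ) (T : ℝ≥0∞) : Admissible (fun _ => kgN lam hσ) T where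
  cont _ := continuousOn_const
  lip T' _ R := by
    have hκ := triConst_nonneg hσ
    refine ⟨(|lam| * (triConst hσ * (max R 0) ^ 2 * 3)).toNNReal, fun _ _ => ?_⟩
    refine LipschitzOnWith.of_dist_le_mul fun x hx y hy => ?_
    rw [mem_closedBall_zero_iff] at hx hy
    rw [dist_eq_norm, dist_eq_norm, Real.coe_toNNReal _ (by positivity)]
    exact norm_kgN_sub_le lam hσ (hx.trans (le_max_left R 0)) (hy.trans (le_max_left R 0))

lemma contHs_state_iff (hσ : 0 ≤ σ) {T : ℝ≥0∞} {U : ℝ → State} :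
    (∀ k, ContHs σ T fun t => U t k) ↔
      ∃ h : ℝ → State, ContinuousOn h (timeSet T) ∧ ∀ t ∈ timeSet T, U t = ofFreqS σ (h t) := by
  simp only [contHs_iff hσ]
  constructor
  · intro H
    choose h hc hU using H
    exact ⟨fun t k => h k t, continuousOn_pi.2 hc, fun t ht => funext fun k => hU k t ht⟩
  · rintro ⟨h, hc, hU⟩ k
    exact ⟨fun t => h t k, continuousOn_pi.1 hc k, fun t ht => congrFun (hU t ht) k⟩

/-- The analogue of `nls_iff` for an operator of first order, so that one derivative above `L²`
suffices; `σ > 0` makes `H^{σ+1}` an algebra. -/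
lemma kg_iff (lam ε : ℝ) (hσ : 0 < σ) {φ ψ : L2} {h₀ : State}
    (h0 : ∀ k, toDist (ofFreqS (σ + 1) h₀ k) = initialDatum φ ψ ε k) {T : ℝ≥0∞} {U : ℝ → State} :
    IsKGSolution lam φ ψ ε (σ + 1) T U ↔ U 0 = ofFreqS (σ + 1) h₀ ∧ ∃ y,
      IsSol ((kgFlow ε).interaction fun _ => kgN lam (by linarith : 1 < σ + 1)) h₀ T y ∧
      ∀ t ∈ timeSet T, U t = ofFreqS (σ + 1) (kgFlow ε t (y t)) := by
  have hσ2 : 0 ≤ σ + 1 := by linarith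
  have hσ1 : 1 < σ + 1 := by linarith
  have hz : ofFreqS (σ + 1) 0 = 0 := funext fun _ => ofFreq_zero
  constructor
  · rintro ⟨hc, hi, he⟩
    refine ⟨funext fun k => toDist_injective ((hi k).trans (h0 k).symm), ?_⟩
    obtain ⟨h, hh, hU⟩ := (contHs_state_iff hσ2).1 hc
    have hG : ContinuousOn (fun t => kgN lam hσ1 (h t)) (timeSet T) :=
      (kgN_admissible lam hσ1 T).comp_continuousOn hh
    have hm := (kgFlow_generates ε hσ1.le).mild_of_strong
      (approxInv_smoothings hσ2).injective hh hG fun t ht ht0 => by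
      obtain ⟨dU, hdU, hS⟩ := he t ht ht0
      rw [hU t ht, ← hz, systemEq_iff lam ε hσ, sub_zero] at hS
      rw [hS] at hdU
      refine hasDerivAt_ofFreqS_iff.1 (hdU.congr_of_eventuallyEq ?_)
      filter_upwards [timeSet_mem_nhds ht ht0] with τ hτ using (hU τ hτ).symm
    rcases eq_or_ne T 0 with rfl | hT
    · have hempty : ∀ t, t ∉ timeSet 0 := fun t ht => absurd ht.2 (not_lt.2 zero_le)
      exact ⟨fun _ => h₀, ⟨rfl, fun t ht => absurd ht (hempty t)⟩, fun t ht =>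
        absurd ht (hempty t)⟩
    have h0T : (0 : ℝ) ∈ timeSet T := ⟨le_rfl, by simpa using pos_iff_ne_zero.2 hT⟩
    refine ⟨fun τ => kgFlow ε (-τ) (h τ), ⟨?_, fun t ht => ?_⟩, fun t ht => ?_⟩
    · rw [neg_zero, (kgFlow ε).zero]
      refine ofFreqS_injective hσ2 ?_
      rw [ContinuousLinearMap.id_apply, ← hU 0 h0T]
      exact funext fun k => toDist_injective ((hi k).trans (h0 k).symm)
    · rw [Flow.interaction, (kgFlow ε).apply_neg]
      exact hm t ht
    · rw [(kgFlow ε).apply_neg, hU t ht]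
  · rintro ⟨hi, y, hy, hU⟩
    refine ⟨(contHs_state_iff hσ2).2 ⟨fun t => kgFlow ε t (y t), fun t ht =>
      (kgFlow ε).tendsto (tendsto_id.mono_left nhdsWithin_le_nhds) (hy.continuousOn t ht), hU⟩,
      fun k => by rw [hi]; exact h0 k, fun t ht ht0 => ?_⟩
    have h1 := (hy.deriv t ht).hasDerivAt (Ici_mem_nhds ht0)
    have h2 := hasDerivAt_ofFreqS_iff.2 ((kgFlow_generates ε hσ1.le).strong_of_mild h1)
    refine ⟨_, h2.congr_of_eventuallyEq ?_, ?_⟩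
    · filter_upwards [timeSet_mem_nhds ht ht0] with τ hτ using hU τ hτ
    · rw [hU t ht, ← hz, systemEq_iff lam ε hσ, sub_zero]

/-! #### Real solutions -/

lemma star_jap (σ : ℝ) (ξ : Plane) : star (jap σ (-ξ)) = jap σ ξ := by
  rw [jap, norm_neg, jap, Complex.star_def, Complex.conj_ofReal]

lemma star_symD_neg (j : Fin 2) (ξ : Plane) : star (symD j (-ξ)) = symD j ξ := by
  rw [Complex.star_def, star_symD]
  simp [symD]

lemma conjFreq_dFreq (j : Fin 2) (h : L2) : conjFreq (dFreq j h) = dFreq j (conjFreq h) := by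
  rw [dFreq, conjFreq_mulOp (bddMult_symD j)]
  congr 2
  ext ξ
  rw [star_mul', star_jap, star_symD_neg]

lemma conjFreq_tri (hσ : 1 < σ) (a b c : L2) :
    conjFreq (tri hσ a b c) = tri hσ (conjFreq a) (conjFreq b) (conjFreq c) := by
  have h0 : 0 ≤ σ := by linarith
  refine ofFreq_injective h0 ?_
  rw [← star_ofFreq h0, ofFreq_tri, ofFreq_tri, ← ofFreq_freqMulL hσ b c, star_pmul hσ,
    ofFreq_freqMulL, star_pmul hσ, star_ofFreq h0, star_ofFreq h0, star_ofFreq h0]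

/-- Complex conjugation of states on the frequency side. -/
def conjS (h : State) : State := fun k => conjFreq (h k)

lemma conjS_smoothings (hσ : 0 ≤ σ) (h : State) :
    conjS (smoothings σ h) = smoothings σ (conjS h) := by
  funext k
  rw [conjS, smoothings_apply, smoothings_apply, smoothing, conjFreq_mulOp (bddMult_jap hσ), conjS]
  congr 2
  ext ξ
  exact star_jap _ _

/-- The symbol form of the fact that the operator has real coefficients. -/
lemma star_kgSym_neg (ε : ℝ) (ξ : Plane) (i j : Fin 4) :
    star (kgSym ε (-ξ) i j) = kgSym ε ξ i j := by
  have h := star_symD_neg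
  fin_cases i <;> fin_cases j <;>
    simp [kgSym, -Complex.ofReal_inv, -Complex.ofReal_pow] <;> simp [← Complex.star_def, h]

lemma conjS_kgGen (ε : ℝ) (hσ : 1 ≤ σ) (h : State) : conjS (kgGen ε σ h) = kgGen ε σ (conjS h) := by
  obtain ⟨B, hB⟩ := kgSym_bound ε hσ
  have hb : ∀ i j, BddMult (fun ξ => kgSym ε ξ i j * jap (-σ) ξ) B := fun i j =>
    ⟨(((continuous_kgSym ε).matrix_elem i j).mul (continuous_jap _)).measurable, fun ξ => by
      rw [norm_mul]
      calc _ ≤ B * ‖jap σ ξ‖ * ‖jap (-σ) ξ‖ := by gcongr; exact hB ξ i j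
        _ = B * ‖jap σ ξ * jap (-σ) ξ‖ := by rw [norm_mul]; ring
        _ = B := by rw [jap_neg_mul, norm_one, mul_one]⟩
  funext k
  rw [conjS, kgGen, matOp_apply, matOp_apply, ← conjFreqL_apply, map_sum]
  refine Finset.sum_congr rfl fun j _ => ?_
  rw [conjFreqL_apply, conjFreq_mulOp (hb k j), conjS]
  congr 2
  ext ξ
  rw [star_mul', star_jap, star_kgSym_neg]

lemma conjFreq_smul (c : ℂ) (h : L2) : conjFreq (c • h) = star c • conjFreq h := by
  rw [conjFreq, map_smul, star_smul', conjFreq]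

lemma conjS_kgN (lam : ℝ) (hσ : 1 < σ) (h : State) :
    conjS (kgN lam hσ h) = kgN lam hσ (conjS h) := by
  have h0 : conjFreq 0 = 0 := map_zero conjFreqL
  have h1 : conjFreq (-((lam : ℂ) • tri hσ (h 3) (h 3) (h 3))) =
      -((lam : ℂ) • tri hσ (conjFreq (h 3)) (conjFreq (h 3)) (conjFreq (h 3))) := by
    rw [← conjFreqL_apply, map_neg, conjFreqL_apply, conjFreq_smul, conjFreq_tri,
      Complex.star_def, Complex.conj_ofReal]
  funext k
  fin_cases k
  · exact h0
  · exact h0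
  · exact h1
  · exact h0

lemma star_ofFreqS (hσ : 0 ≤ σ) (h : State) (k : Fin 4) :
    star (ofFreqS σ h k) = ofFreqS σ (conjS h) k := star_ofFreq hσ (h k)

/-- Complex conjugation maps solutions with real data to solutions. -/
lemma IsKGSolution.conj {lam ε : ℝ} (hσ : 0 < σ) {φ ψ : L2} {T : ℝ≥0∞} {U : ℝ → State}
    (h : IsKGSolution lam φ ψ ε (σ + 1) T U) (hreal : ∀ k, IsReal (U 0 k)) :
    IsKGSolution lam φ ψ ε (σ + 1) T fun t k => star (U t k) := by
  have hσ2 : 0 ≤ σ + 1 := by linarith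
  have hσ1 : 1 < σ + 1 := by linarith
  have hz : ofFreqS (σ + 1) 0 = 0 := funext fun _ => ofFreq_zero
  obtain ⟨u, hu, hU⟩ := (contHs_state_iff hσ2).1 h.cont
  have hU' : ∀ t ∈ timeSet T, (fun k => star (U t k)) = ofFreqS (σ + 1) (conjS (u t)) :=
    fun t ht => funext fun k => by rw [hU t ht, star_ofFreqS hσ2]
  refine ⟨(contHs_state_iff hσ2).2 ⟨fun t => conjS (u t), continuousOn_pi.2 fun k =>
    conjFreqL.continuous.comp_continuousOn (continuousOn_pi.1 hu k), hU'⟩,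
    fun k => by rw [hreal k]; exact h.init k, fun t ht ht0 => ?_⟩
  obtain ⟨dU, hdU, hS⟩ := h.eqn t ht ht0
  refine ⟨fun k => star (dU k), hasDerivAt_pi.2 fun k =>
    starL.hasFDerivAt.comp_hasDerivAt t (hasDerivAt_pi.1 hdU k), ?_⟩
  rw [hU t ht, ← hz, systemEq_iff lam ε hσ, sub_zero] at hS
  rw [hU' t ht, ← hz, systemEq_iff lam ε hσ, sub_zero, hS]
  funext k
  rw [star_fourierInv]
  congr 1
  change conjS (kgGen ε (σ + 1) (u t) + smoothings (σ + 1) (kgN lam hσ1 (u t))) k = _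
  have hadd : ∀ a b : State, conjS (a + b) = conjS a + conjS b := fun a b =>
    funext fun k => map_add conjFreqL (a k) (b k)
  rw [hadd, conjS_kgGen ε hσ1.le, conjS_smoothings hσ2, conjS_kgN]

/-- The initial datum on the frequency side. -/
lemma exists_initial (hσ : 0 ≤ σ) {φ ψ : L2} (ε : ℝ) (hφ : MemHs (σ + 2) φ)
    (hψ : MemHs (σ + 1) ψ) (hφ_real : IsReal φ) (hψ_real : IsReal ψ) : ∃ h₀ : State,
      (∀ k, toDist (ofFreqS (σ + 1) h₀ k) = initialDatum φ ψ ε k) ∧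
      ∀ k, IsReal (ofFreqS (σ + 1) h₀ k) := by
  have hσ1 : 0 ≤ σ + 1 := by linarith
  have hσ2 : 0 ≤ σ + 1 + 1 := by linarith
  have h2 : σ + 2 = σ + 1 + 1 := by ring
  rw [h2] at hφ
  obtain ⟨a', ha'⟩ := exists_ofFreq hσ1 (hφ.of_le hσ1 (by linarith))
  obtain ⟨a, rfl⟩ := exists_ofFreq hσ2 hφ
  obtain ⟨b, rfl⟩ := exists_ofFreq hσ1 hψ
  have ha : conjFreq a = a := ofFreq_injective hσ2 (by rw [← star_ofFreq hσ2]; exact hφ_real)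
  have hd : ∀ j, IsReal (ofFreq (σ + 1) ((ε : ℂ) • dFreq j a)) := fun j => by
    rw [IsReal, star_ofFreq hσ1, conjFreq_smul, conjFreq_dFreq, ha, Complex.star_def,
      Complex.conj_ofReal]
  refine ⟨![(ε : ℂ) • dFreq 0 a, (ε : ℂ) • dFreq 1 a, b, a'], fun k => ?_, fun k => ?_⟩
  · fin_cases k
    · simp [ofFreqS, initialDatum, ofFreq_smul, toDist_smul, partialD_ofFreq hσ1, -Complex.coe_smul]
    · simp [ofFreqS, initialDatum, ofFreq_smul, toDist_smul, partialD_ofFreq hσ1, -Complex.coe_smul]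
    · rfl
    · exact congrArg toDist ha'.symm
  · fin_cases k
    · exact hd 0
    · exact hd 1
    · exact hψ_real
    · change IsReal (ofFreq (σ + 1) a')
      rwa [← ha']

/-- The Klein-Gordon system has a unique maximal solution in `H^{σ+1}`, `σ > 0`; it is real, and
its norm is unbounded if its existence time is finite. -/
theorem kg_maximal (lam ε : ℝ) (hσ : 0 < σ) {φ ψ : L2} (hφ : MemHs (σ + 2) φ)
    (hψ : MemHs (σ + 1) ψ) (hφ_real : IsReal φ) (hψ_real : IsReal ψ) :
    ∃ (Tm : ℝ≥0∞) (h : ℝ → State), 0 < Tm ∧ ContinuousOn h (timeSet Tm) ∧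
      IsKGSolution lam φ ψ ε (σ + 1) Tm (fun t => ofFreqS (σ + 1) (h t)) ∧
      (∀ t ∈ timeSet Tm, ∀ k, IsReal (ofFreqS (σ + 1) (h t) k)) ∧
      (∀ (T' : ℝ≥0∞) (V : ℝ → State), IsKGSolution lam φ ψ ε (σ + 1) T' V →
        T' ≤ Tm ∧ ∀ t ∈ timeSet T', V t = ofFreqS (σ + 1) (h t)) ∧
      (Tm < ⊤ → ∀ R : ℝ, ∃ t ∈ timeSet Tm, R < ‖h t‖) := by
  have hσ1 : 1 < σ + 1 := by linarith
  obtain ⟨h₀, hh₀, hreal⟩ := exists_initial hσ.le ε hφ hψ hφ_real hψ_real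
  have hiff := fun T V => kg_iff lam ε hσ hh₀ (T := T) (U := V)
  obtain ⟨Tm, -, hpos, y, hy, huniq, hblow⟩ := ((kgFlow ε).interaction_admissible
    (kgN_admissible lam hσ1 ⊤)).exists_maximal ENNReal.zero_lt_top h₀
  have h0 : ofFreqS (σ + 1) (kgFlow ε 0 (y 0)) = ofFreqS (σ + 1) h₀ := by
    rw [(kgFlow ε).zero, hy.init]; rfl
  have hsol : IsKGSolution lam φ ψ ε (σ + 1) Tm (fun t => ofFreqS (σ + 1) (kgFlow ε t (y t))) :=
    (hiff _ _).2 ⟨h0, y, hy, fun t _ => rfl⟩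
  have huniq' : ∀ (T' : ℝ≥0∞) (V : ℝ → State), IsKGSolution lam φ ψ ε (σ + 1) T' V →
      T' ≤ Tm ∧ ∀ t ∈ timeSet T', V t = ofFreqS (σ + 1) (kgFlow ε t (y t)) := by
    intro T' V hV
    obtain ⟨-, z, hz, hVz⟩ := (hiff _ _).1 hV
    refine ⟨(huniq T' le_top z hz).1, fun t ht => ?_⟩
    rw [hVz t ht, (huniq T' le_top z hz).2 t ht]
  refine ⟨Tm, fun t => kgFlow ε t (y t), hpos, fun t ht =>
      (kgFlow ε).tendsto (tendsto_id.mono_left nhdsWithin_le_nhds) (hy.continuousOn t ht), hsol,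
    fun t ht k => ?_, huniq', fun hTm R => ?_⟩
  -- The conjugate curve solves the same problem with the same real data, so uniqueness identifies
  -- it with the solution.
  · have hc := hsol.conj hσ fun k => by rw [h0]; exact hreal k
    exact congrFun ((huniq' Tm _ hc).2 t ht) k
  -- Unboundedness passes from the interaction representation to the solution because the group is
  -- bounded below by `1 / bd`.
  · obtain ⟨t, ht, hR⟩ := hblow hTm ((kgFlow ε).bd * R)
    refine ⟨t, ht, lt_of_mul_lt_mul_left (hR.trans_le ?_) (kgFlow ε).bd_nonneg⟩
    exact (kgFlow ε).norm_le t (y t)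

end KleinGordon

/-! ### Stability -/

section Stability

/-- A continuous function on `[0, T)` is bounded by a positive, continuous, increasing function. -/
lemma exists_isRate {T : ℝ≥0∞} {m : ℝ → ℝ} (hm : ContinuousOn m (timeSet T)) :
    ∃ C, IsRate T C ∧ ∀ t ∈ timeSet T, m t ≤ C t := by
  have hmem : ∀ t ∈ timeSet T, ∀ θ : Icc (0 : ℝ) 1, (θ : ℝ) * t ∈ timeSet T := fun t ht θ =>
    Icc_subset_timeSet ht ⟨mul_nonneg θ.2.1 ht.1, mul_le_of_le_one_left ht.1 θ.2.2⟩
  set f : timeSet T → Icc (0 : ℝ) 1 → ℝ := fun t θ => |m (θ * t)| with hf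
  have hcont : Continuous ↿f := by
    refine Continuous.abs ?_
    refine hm.comp_continuous (f := fun p : timeSet T × Icc (0 : ℝ) 1 => (p.2 : ℝ) * (p.1 : ℝ))
      (by fun_prop) fun p => hmem _ p.1.2 p.2
  -- A running maximum plus one, for positivity. Writing the points of `[0, t]` as `θ t` with `θ` in
  -- the fixed compact set `[0, 1]` makes the supremum continuous in `t`.
  set C : ℝ → ℝ := fun t => sSup ((fun θ : Icc (0 : ℝ) 1 => |m (θ * t)|) '' univ) + 1 with hC
  have hbdd : ∀ t ∈ timeSet T,
      BddAbove ((fun θ : Icc (0 : ℝ) 1 => |m (θ * t)|) '' univ) := fun t ht =>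
    (isCompact_univ.image (f := f ⟨t, ht⟩) (hcont.comp (by fun_prop : Continuous fun θ =>
      ((⟨t, ht⟩ : timeSet T), θ)))).bddAbove
  have hle : ∀ t ∈ timeSet T, ∀ θ : Icc (0 : ℝ) 1, |m (θ * t)| ≤ C t - 1 := fun t ht θ => by
    rw [hC, add_sub_cancel_right]
    exact le_csSup (hbdd t ht) (mem_image_of_mem _ (mem_univ θ))
  have hm1 : ∀ t ∈ timeSet T, |m t| ≤ C t - 1 := fun t ht => by
    simpa using hle t ht ⟨1, by simp⟩
  refine ⟨C, ⟨fun t ht => ?_, ?_, fun t ht t' ht' htt' => ?_⟩, fun t ht => ?_⟩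
  · linarith [hm1 t ht, abs_nonneg (m t)]
  · rw [continuousOn_iff_continuous_domRestrict]
    exact (isCompact_univ.continuous_sSup hcont).add continuous_const
  · have : sSup ((fun θ : Icc (0 : ℝ) 1 => |m (θ * t)|) '' univ) ≤ C t' - 1 := by
      refine csSup_le (univ_nonempty.image _) ?_
      rintro _ ⟨θ, -, rfl⟩
      rcases eq_or_lt_of_le ht'.1 with h0 | h0
      · have : t = t' := le_antisymm htt' (h0 ▸ ht.1)
        exact this ▸ hle t ht θ
      have h1 : (θ : ℝ) * t / t' * t' = θ * t := div_mul_cancel₀ _ h0.ne'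
      have := hle t' ht' ⟨θ * t / t', div_nonneg (mul_nonneg θ.2.1 ht.1) h0.le,
        (div_le_one h0).2 ((mul_le_of_le_one_left ht.1 θ.2.2).trans htt')⟩
      simpa only [h1] using this
    simp only [hC] at this ⊢
    linarith
  · linarith [hm1 t ht, le_abs_self (m t)]

/-- This form is linear in `δ` and `c`, so a common factor `ε^{K+1}` can be taken out, and it needs
no case distinction at `K = 0`. -/
lemma gronwallBound_le {δ K c x : ℝ} (hK : 0 ≤ K) (hc : 0 ≤ c) :
    gronwallBound δ K c x ≤ (δ + c * x) * Real.exp (K * x) := by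
  rcases hK.eq_or_lt with rfl | hK
  · simp [gronwallBound_K0]
  · rw [gronwallBound_of_K_ne_0 hK.ne']
    have h1 : Real.exp (K * x) - 1 ≤ K * x * Real.exp (K * x) := by
      have h2 := Real.add_one_le_exp (-(K * x))
      have h3 : Real.exp (-(K * x)) * Real.exp (K * x) = 1 := by rw [← Real.exp_add]; simp
      nlinarith [Real.exp_pos (K * x)]
    have h2 : c / K * (Real.exp (K * x) - 1) ≤ c / K * (K * x * Real.exp (K * x)) := by gcongr
    have h3 : c / K * (K * x * Real.exp (K * x)) = c * x * Real.exp (K * x) := by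
      field_simp
    linarith

/-- Otherwise there is a first time at which the norm is at least `1`. Before it the norm is below
`1`, so the conditional estimate gives a norm at most `q < 1` at that very time. -/
lemma norm_le_of_bootstrap {X : Type*} [NormedAddCommGroup X] {D : ℝ → X} {b : ℝ}
    (hc : ContinuousOn D (Icc 0 b)) {q : ℝ → ℝ} (hq : ∀ t ∈ Icc 0 b, q t < 1)
    (h : ∀ t ∈ Icc 0 b, (∀ τ ∈ Ioo 0 t, ‖D τ‖ ≤ 1) → ‖D t‖ ≤ q t) :
    ∀ t ∈ Icc 0 b, ‖D t‖ ≤ q t := by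
  suffices H : ∀ t ∈ Icc 0 b, ‖D t‖ < 1 from fun t ht =>
    h t ht fun τ hτ => (H τ ⟨hτ.1.le, hτ.2.le.trans ht.2⟩).le
  by_contra! hcon
  set B : Set ℝ := Icc 0 b ∩ (fun t => ‖D t‖) ⁻¹' Ici 1 with hB
  have hBc : IsCompact B := isCompact_Icc.of_isClosed_subset
    (hc.norm.preimage_isClosed_of_isClosed isClosed_Icc isClosed_Ici) inter_subset_left
  obtain ⟨t₁, ht₁, hmin⟩ := hBc.exists_isMinOn hcon continuousOn_id
  refine absurd ((h t₁ ht₁.1 fun τ hτ => ?_).trans_lt (hq t₁ ht₁.1)) (not_lt.2 ht₁.2)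
  by_contra! hτ1
  exact absurd (hmin ⟨⟨hτ.1.le, hτ.2.le.trans ht₁.1.2⟩, hτ1.le⟩) (not_le.2 hτ.2)

variable {σ : ℝ}

lemma exists_ofFreqS (hσ : 0 ≤ σ) {R : State} {C : ℝ} (h : stateNorm σ R ≤ ENNReal.ofReal C) :
    ∃ ρ : State, R = ofFreqS σ ρ ∧ ‖ρ‖ ≤ max C 0 := by
  have h1 : ∀ k, MemHs σ (R k) := fun k => by
    have h2 : stateNorm σ R < ∞ := h.trans_lt ENNReal.ofReal_lt_top
    rw [stateNorm, ENNReal.rpow_lt_top_iff_of_pos (by norm_num)] at h2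
    have h3 := (ENNReal.sum_lt_top.1 h2) k (Finset.mem_univ k)
    exact (ENNReal.pow_lt_top_iff.1 h3).resolve_right (by norm_num)
  choose ρ hρ using fun k => exists_ofFreq hσ (h1 k)
  refine ⟨ρ, funext hρ, ?_⟩
  have h2 := enorm_le_stateNorm hσ ρ
  have h3 : ofFreqS σ ρ = R := (funext hρ).symm
  rw [h3, ← ofReal_norm] at h2
  have h4 := h2.trans h
  rcases le_total 0 C with hC | hC
  · rw [max_eq_left hC]
    exact (ENNReal.ofReal_le_ofReal_iff hC).1 h4
  · rw [max_eq_right hC]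
    rw [ENNReal.ofReal_of_nonpos hC] at h4
    simpa using h4

/-- The error estimate on an interval on which the error is at most `1`. -/
lemma kg_error_le (lam : ℝ) {ε : ℝ} (hσ : 0 < σ) {h a : ℝ → State} {b M c δ : ℝ}
    (hb : 0 ≤ b) (hM : 0 ≤ M) (hc : 0 ≤ c)
    (hh : ContinuousOn h (Icc 0 b)) (ha : ContinuousOn a (Icc 0 b))
    (hhd : ∀ t ∈ Ioo 0 b, ∃ dU, HasDerivAt (fun τ => ofFreqS (σ + 1) (h τ)) dU t ∧
      SystemEq lam ε dU (ofFreqS (σ + 1) (h t)) 0)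
    (had : ∀ t ∈ Ioo 0 b, ∃ (dU : State) (ρ : State),
      HasDerivAt (fun τ => ofFreqS (σ + 1) (a τ)) dU t ∧
      SystemEq lam ε dU (ofFreqS (σ + 1) (a t)) (ofFreqS (σ + 1) ρ) ∧ ‖ρ‖ ≤ c)
    (haM : ∀ t ∈ Ioo 0 b, ‖a t‖ ≤ M) (h1 : ∀ t ∈ Ioo 0 b, ‖h t - a t‖ ≤ 1)
    (h0 : ‖h 0 - a 0‖ ≤ δ) :
    ‖h b - a b‖ ≤ 4 * ((δ + 4 * c * b) *
      Real.exp (16 * (|lam| * (triConst (by linarith : 1 < σ + 1) * (M + 1) ^ 2 * 3)) * b)) := by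
  have hσ1 : 1 < σ + 1 := by linarith
  have hσ2 : 0 ≤ σ + 1 := by linarith
  have hz : ofFreqS (σ + 1) 0 = 0 := funext fun _ => ofFreq_zero
  -- The Lipschitz constant of the cubic term on the ball of radius `M + 1`, which contains both
  -- curves since the error is at most `1`.
  set κ := |lam| * (triConst hσ1 * (M + 1) ^ 2 * 3) with hκ
  have hκ0 : 0 ≤ κ := by have := triConst_nonneg hσ1; positivity
  have key : ∀ t ∈ Ioo 0 b, ∃ g : State, ‖g‖ ≤ κ * ‖h t - a t‖ + c ∧
      HasDerivAt (fun τ => smoothings (σ + 1) (h τ - a τ))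
        (kgGen ε (σ + 1) (h t - a t) + smoothings (σ + 1) g) t := by
    intro t ht
    obtain ⟨dU, hdU, hS⟩ := hhd t ht
    obtain ⟨dV, ρ, hdV, hS', hρ⟩ := had t ht
    rw [← hz, systemEq_iff lam ε hσ, sub_zero] at hS
    rw [systemEq_iff lam ε hσ] at hS'
    rw [hS, hasDerivAt_ofFreqS_iff] at hdU
    rw [hS', hasDerivAt_ofFreqS_iff] at hdV
    refine ⟨kgN lam hσ1 (h t) - kgN lam hσ1 (a t) + ρ, ?_, ?_⟩
    · have haR : ‖a t‖ ≤ M + 1 := (haM t ht).trans (by linarith)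
      have hhR : ‖h t‖ ≤ M + 1 := by
        calc ‖h t‖ = ‖a t + (h t - a t)‖ := by rw [add_sub_cancel]
          _ ≤ ‖a t‖ + ‖h t - a t‖ := norm_add_le _ _
          _ ≤ M + 1 := add_le_add (haM t ht) (h1 t ht)
      exact (norm_add_le _ _).trans (add_le_add (norm_kgN_sub_le lam hσ1 hhR haR) hρ)
    · have := hdU.sub hdV
      refine (this.congr_of_eventuallyEq (Eventually.of_forall fun τ => ?_)).congr_deriv ?_
      · exact map_sub _ _ _
      · simp only [map_sub, map_add]
        abel
  choose! g hg1 hg2 using key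
  have := (kgFlow_generates ε hσ1.le).gronwall (approxInv_smoothings hσ2) hb hκ0 (hh.sub ha)
    hg2 hg1 h0
  -- The group bound is `4` for every `ε`; it enters once in front, once with the remainder, and
  -- squared, as `16`, in the exponent.
  rw [kgFlow_bd] at this
  refine this.trans (mul_le_mul_of_nonneg_left ((gronwallBound_le (by positivity)
    (by positivity)).trans (le_of_eq ?_)) (by norm_num))
  congr 2
  ring

/-- Stability of approximate solutions of the Klein-Gordon system. -/
theorem kg_stability (lam : ℝ) (K : ℕ) (hσ : 0 < σ) {T : ℝ≥0∞} {Tm : ℝ → ℝ≥0∞}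
    {h a : ℝ → ℝ → State} {m C : ℝ → ℝ} {C₀ : ℝ} (hC₀ : 0 ≤ C₀) (hCr : IsRate T C)
    (hm : ContinuousOn m (timeSet T))
    (hh : ∀ ε, 0 < ε → ContinuousOn (h ε) (timeSet (Tm ε)))
    (hhd : ∀ ε, 0 < ε → ∀ t ∈ timeSet (Tm ε), 0 < t →
      ∃ dU, HasDerivAt (fun τ => ofFreqS (σ + 1) (h ε τ)) dU t ∧
      SystemEq lam ε dU (ofFreqS (σ + 1) (h ε t)) 0)
    (ha : ∀ ε, 0 < ε → ContinuousOn (a ε) (timeSet T))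
    (had : ∀ ε, 0 < ε → ε ≤ 1 → ∀ t ∈ timeSet T, 0 < t → ∃ (dU : State) (ρ : State),
      HasDerivAt (fun τ => ofFreqS (σ + 1) (a ε τ)) dU t ∧
      SystemEq lam ε dU (ofFreqS (σ + 1) (a ε t)) (ofFreqS (σ + 1) ρ) ∧
      ‖ρ‖ ≤ C t * ε ^ (K + 1))
    (ham : ∀ ε, 0 < ε → ε ≤ 1 → ∀ t ∈ timeSet T, ‖a ε t‖ ≤ m t)
    (h0 : ∀ ε, 0 < ε → ε ≤ 1 → ‖h ε 0 - a ε 0‖ ≤ C₀ * ε ^ (K + 2)) :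
    ∃ Cr, IsRate T Cr ∧ ∀ T' ∈ timeSet T, ∃ ε₀ : ℝ, 0 < ε₀ ∧ ∀ ε, 0 < ε → ε < ε₀ →
      ∀ t ∈ timeSet (Tm ε), t ≤ T' → ‖h ε t - a ε t‖ ≤ Cr t * ε ^ (K + 1) ∧
        ‖h ε t - a ε t‖ ≤ 1 := by
  have hσ1 : 1 < σ + 1 := by linarith
  obtain ⟨M, hM, hmM⟩ := exists_isRate hm
  -- The bound of `kg_error_le` after division by `ε^{K+1}`; the initial error of size `ε^{K+2}` is
  -- estimated by `ε^{K+1}`.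
  set q : ℝ → ℝ := fun t => 4 * ((C₀ + 4 * C t * t) *
    Real.exp (16 * (|lam| * (triConst hσ1 * (M t + 1) ^ 2 * 3)) * t)) with hq
  have hqc : ContinuousOn q (timeSet T) := by
    have h1 := hCr.cont
    have h2 := hM.cont
    fun_prop
  obtain ⟨Cr, hCr', hqCr⟩ := exists_isRate hqc
  -- For `ε` below this threshold `Cr T' * ε < 1`, so that the error bound stays below `1` on `[0,
  -- T']` and the continuity argument closes.
  refine ⟨Cr, hCr', fun T' hT' => ⟨min 1 (1 / (Cr T' + 1)), ?_, fun ε hε hεlt t ht htT => ?_⟩⟩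
  · have := hCr'.pos T' hT'
    positivity
  have hε1 : ε ≤ 1 := (hεlt.trans_le (min_le_left _ _)).le
  have hCrT := hCr'.pos T' hT'
  have hεC : Cr T' * ε < 1 := by
    have h1 := hεlt.trans_le (min_le_right _ _)
    rw [lt_div_iff₀ (by linarith)] at h1
    nlinarith
  have htT' : t ∈ timeSet T := Icc_subset_timeSet hT' ⟨ht.1, htT⟩
  have hlt : ∀ τ ∈ Icc 0 t, Cr τ * ε ^ (K + 1) < 1 := fun τ hτ => by
    have h1 : Cr τ ≤ Cr T' := hCr'.mono (Icc_subset_timeSet htT' hτ) hT' (hτ.2.trans htT)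
    have h2 : ε ^ (K + 1) ≤ ε := pow_le_of_le_one hε.le hε1 (by omega)
    calc Cr τ * ε ^ (K + 1) ≤ Cr T' * ε := by gcongr
      _ < 1 := hεC
  have hle := norm_le_of_bootstrap (D := fun τ => h ε τ - a ε τ) (b := t)
    (q := fun τ => Cr τ * ε ^ (K + 1))
    (((hh ε hε).mono (Icc_subset_timeSet ht)).sub ((ha ε hε).mono (Icc_subset_timeSet htT')))
    hlt fun b hb hb1 => by
      have hbT : b ∈ timeSet T := Icc_subset_timeSet htT' hb
      have hbm : b ∈ timeSet (Tm ε) := Icc_subset_timeSet ht hb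
      have hsub := Icc_subset_timeSet hbT
      have hsub' := Icc_subset_timeSet hbm
      have hCb := (hCr.pos b hbT).le
      have h1 := kg_error_le lam (ε := ε) hσ (h := h ε) (a := a ε) (b := b) (M := M b)
        (c := C b * ε ^ (K + 1)) (δ := C₀ * ε ^ (K + 1)) hb.1 (hM.pos b hbT).le (by positivity)
        ((hh ε hε).mono hsub') ((ha ε hε).mono hsub)
        (fun τ hτ => hhd ε hε τ (hsub' ⟨hτ.1.le, hτ.2.le⟩) hτ.1)
        (fun τ hτ => by
          have hτ' := hsub ⟨hτ.1.le, hτ.2.le⟩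
          obtain ⟨dU, ρ, h1, h2, h3⟩ := had ε hε hε1 τ hτ' hτ.1
          exact ⟨dU, ρ, h1, h2, h3.trans
            (mul_le_mul_of_nonneg_right (hCr.mono hτ' hbT hτ.2.le) (by positivity))⟩)
        (fun τ hτ => by
          have hτ' := hsub ⟨hτ.1.le, hτ.2.le⟩
          exact (ham ε hε hε1 τ hτ').trans ((hmM τ hτ').trans (hM.mono hτ' hbT hτ.2.le)))
        hb1 ((h0 ε hε hε1).trans (mul_le_mul_of_nonneg_left
          (pow_le_pow_of_le_one hε.le hε1 (by omega)) hC₀))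
      calc ‖h ε b - a ε b‖ ≤ _ := h1
        _ = q b * ε ^ (K + 1) := by rw [hq]; ring
        _ ≤ Cr b * ε ^ (K + 1) :=
          mul_le_mul_of_nonneg_right (hqCr b hbT) (by positivity)
  have := hle t ⟨ht.1, le_rfl⟩
  exact ⟨this, this.trans (hlt t ⟨ht.1, le_rfl⟩).le⟩

lemma norm_wkb_phase {ε : ℝ} (p : ℤ) (t : ℝ) :
    ‖Complex.exp (Complex.I * p * t / (ε : ℂ) ^ 2)‖ = 1 := by
  have : Complex.I * p * t / (ε : ℂ) ^ 2 = ((p * t / ε ^ 2 : ℝ) : ℂ) * Complex.I := by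
    push_cast; ring
  rw [this, Complex.norm_exp_ofReal_mul_I]

/-- Every WKB solution is stable, and the solutions live at least as long as the WKB solution. -/
theorem wkb_stability (lam : ℝ) (K : ℕ) {s : ℝ} (hs : 2 * (K : ℝ) + 5 < s) {φ ψ : L2} {T : ℝ≥0∞}
    {Tm : ℝ → ℝ≥0∞} {h : ℝ → ℝ → State} (hh : ∀ ε, 0 < ε → ContinuousOn (h ε) (timeSet (Tm ε)))
    (hsol : ∀ ε, 0 < ε → IsKGSolution lam φ ψ ε (s - 2 * K - 4) (Tm ε)
      fun t => ofFreqS (s - 2 * K - 4) (h ε t)) {A : Amplitudes}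
    (hA : IsWKBSolution lam φ ψ s K T A) :
    ∃ Cr M : ℝ → ℝ, IsRate T Cr ∧ IsRate T M ∧ ∀ T' ∈ timeSet T, ∃ ε₀ : ℝ, 0 < ε₀ ∧
      ∀ ε, 0 < ε → ε < ε₀ →
      ∀ t ∈ timeSet (Tm ε), t ≤ T' →
        stateNorm (s - 2 * K - 4) (ofFreqS (s - 2 * K - 4) (h ε t) - wkbSum K A ε t) ≤
          ENNReal.ofReal (Cr t * ε ^ (K + 1)) ∧ ‖h ε t‖ ≤ M t := by
  obtain ⟨σ, hσ, hσs⟩ : ∃ σ, 0 < σ ∧ s - 2 * K - 4 = σ + 1 := ⟨s - 2 * K - 5, by linarith, by ring⟩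
  have hσ2 : 0 ≤ σ + 1 := by linarith
  obtain ⟨R, r, C, C₀, hC, happ⟩ := hA.approx
  simp only [hσs] at hsol happ ⊢
  have hreg : ∀ n : ℕ, ∀ p : ℤ, ∃ α : ℝ → State, ContinuousOn α (timeSet T) ∧
      (n ≤ K + 2 → p ∈ harmonics n → ∀ t ∈ timeSet T, A n p t = ofFreqS (σ + 1) (α t)) := by
    intro n p
    by_cases hn : n ≤ K + 2 ∧ p ∈ harmonics n
    · have hn' : (n : ℝ) ≤ K + 2 := by exact_mod_cast hn.1
      obtain ⟨α, h1, h2⟩ := (contHs_state_iff hσ2).1 fun k =>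
        (hA.regular n hn.1 p hn.2 k).of_le hσ2 (by linarith)
      exact ⟨α, h1, fun _ _ => h2⟩
    · exact ⟨0, continuousOn_const, fun h1 h2 => absurd ⟨h1, h2⟩ hn⟩
  choose α hαc hα using hreg
  -- The WKB sum on the frequency side. All phases have modulus one, so for `ε ≤ 1` it is bounded by
  -- `m`, independently of `ε`.
  set a : ℝ → ℝ → State := fun ε t => ∑ n ∈ Finset.range (K + 3), ∑ p ∈ harmonics n,
    ((ε : ℂ) ^ n * Complex.exp (Complex.I * p * t / (ε : ℂ) ^ 2)) • α n p t with ha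
  set m : ℝ → ℝ := fun t => ∑ n ∈ Finset.range (K + 3), ∑ p ∈ harmonics n, ‖α n p t‖ with hm
  have hsum : ∀ ε t, t ∈ timeSet T → wkbSum K A ε t = ofFreqS (σ + 1) (a ε t) := by
    intro ε t ht
    funext k
    simp only [wkbSum, ha, Finset.sum_apply, ofFreqS]
    change _ = ofFreqL (σ + 1) _
    simp only [map_sum]
    refine Finset.sum_congr rfl fun n hn => Finset.sum_congr rfl fun p hp => ?_
    rw [hα n p (by have := Finset.mem_range.1 hn; omega) hp t ht]
    exact (ofFreq_smul _ _ _).symm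
  have hac : ∀ ε, ContinuousOn (a ε) (timeSet T) := fun ε => by
    refine continuousOn_finsetSum _ fun n _ => continuousOn_finsetSum _ fun p _ => ?_
    have hphase : Continuous fun t : ℝ =>
      (ε : ℂ) ^ n * Complex.exp (Complex.I * p * t / (ε : ℂ) ^ 2) := by fun_prop
    exact hphase.continuousOn.smul (hαc n p)
  have ham : ∀ ε, 0 < ε → ε ≤ 1 → ∀ t ∈ timeSet T, ‖a ε t‖ ≤ m t := fun ε hε hε1 t _ => by
    refine norm_sum_le_of_le _ fun n _ => norm_sum_le_of_le _ fun p _ => ?_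
    rw [norm_smul, norm_mul, norm_wkb_phase, mul_one, norm_pow, Complex.norm_real,
      Real.norm_of_nonneg hε.le]
    exact mul_le_of_le_one_left (norm_nonneg _) (pow_le_one₀ hε.le hε1)
  have hmc : ContinuousOn m (timeSet T) :=
    continuousOn_finsetSum _ fun n _ => continuousOn_finsetSum _ fun p _ => (hαc n p).norm
  -- The initial error is controlled in a smaller space; its embedding into `H^{σ+1}` is a smoothing
  -- and does not increase the norm. `T ≠ 0` is needed since the amplitudes are represented on
  -- `timeSet T` only.
  have hinit : T ≠ 0 → ∀ ε, 0 < ε → ε ≤ 1 → ‖h ε 0 - a ε 0‖ ≤ max C₀ 0 * ε ^ (K + 2) := by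
    intro hT ε hε hε1
    have h0T : (0 : ℝ) ∈ timeSet T := ⟨le_rfl, by simpa using pos_iff_ne_zero.2 hT⟩
    obtain ⟨-, hi, hr⟩ := happ ε hε hε1
    obtain ⟨ρ, hρ, hρn⟩ := exists_ofFreqS (by linarith) hr
    have h1 : h ε 0 - a ε 0 = ((ε : ℂ) ^ (K + 2)) • (fun k =>
        smoothing (s - 2 * K - 2 - (σ + 1)) (ρ k)) := by
      refine ofFreqS_injective hσ2 (funext fun k => toDist_injective ?_)
      rw [ofFreqS_sub, ← hsum ε 0 h0T, Pi.sub_apply, toDist_sub, (hsol ε hε).init k, hi k,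
        sub_sub_cancel, ofFreqS_smul, Pi.smul_apply, toDist_smul, hρ]
      congr 2
      exact ofFreq_of_le hσ2 (by linarith) _
    rw [h1, norm_smul, norm_pow, Complex.norm_real, Real.norm_of_nonneg hε.le, mul_comm]
    refine mul_le_mul_of_nonneg_right ?_ (by positivity)
    refine (pi_norm_le_iff_of_nonneg (le_max_right _ _)).2 fun k => ?_
    exact (norm_smoothing_le (by linarith) _).trans ((norm_le_pi_norm ρ k).trans hρn)
  rcases eq_or_ne T 0 with rfl | hT
  · have hempty : ∀ t, t ∉ timeSet 0 := fun t ht => absurd ht.2 (not_lt.2 zero_le)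
    exact ⟨C, C, hC, hC, fun T' hT' => absurd hT' (hempty T')⟩
  obtain ⟨Cr, hCr, hmain⟩ := kg_stability lam K hσ (le_max_right C₀ 0) hC hmc hh
    (fun ε hε t ht ht0 => (hsol ε hε).eqn t ht ht0) (fun ε _ => hac ε)
    (fun ε hε hε1 t ht ht0 => by
      obtain ⟨h1, -⟩ := happ ε hε hε1
      obtain ⟨⟨dU, hdU, hS⟩, hR⟩ := h1 t ht ht0
      obtain ⟨ρ, hρ, hρn⟩ := exists_ofFreqS hσ2 hR
      refine ⟨dU, ((ε : ℂ) ^ (K + 1)) • ρ, hdU.congr_of_eventuallyEq ?_, ?_, ?_⟩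
      · filter_upwards [timeSet_mem_nhds ht ht0] with τ hτ using (hsum ε τ hτ).symm
      · rw [ofFreqS_smul, ← hρ, ← hsum ε t ht]
        exact hS
      · rw [max_eq_left (hC.pos t ht).le] at hρn
        rw [norm_smul, norm_pow, Complex.norm_real, Real.norm_of_nonneg hε.le, mul_comm]
        gcongr) ham (hinit hT)
  -- The solution is within distance `1` of the WKB sum, hence bounded by `m + 1`.
  obtain ⟨M, hM, hmM⟩ := exists_isRate (hmc.add (continuousOn_const (c := (1 : ℝ))))
  refine ⟨fun t => 2 * Cr t, M, ⟨fun t ht => by linarith [hCr.pos t ht], hCr.cont.const_mul 2,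
    fun t ht t' ht' htt' => by linarith [hCr.mono ht ht' htt']⟩, hM, fun T' hT' => ?_⟩
  obtain ⟨ε₀, hε₀, H⟩ := hmain T' hT'
  refine ⟨min ε₀ 1, by positivity, fun ε hε hεlt t ht htT => ?_⟩
  have htT' : t ∈ timeSet T := Icc_subset_timeSet hT' ⟨ht.1, htT⟩
  obtain ⟨H1, H2⟩ := H ε hε (hεlt.trans_le (min_le_left _ _)) t ht htT
  constructor
  · rw [hsum ε t htT', ← ofFreqS_sub]
    calc _ ≤ 2 * ‖h ε t - a ε t‖ₑ := stateNorm_ofFreqS_le hσ2 _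
      _ = ENNReal.ofReal (2 * ‖h ε t - a ε t‖) := by
        rw [← ofReal_norm, ENNReal.ofReal_mul (by norm_num)]; simp
      _ ≤ _ := ENNReal.ofReal_le_ofReal (by linarith)
  · have h1 := ham ε hε (hεlt.trans_le (min_le_right _ _)).le t htT'
    calc ‖h ε t‖ = ‖a ε t + (h ε t - a ε t)‖ := by rw [add_sub_cancel]
      _ ≤ ‖a ε t‖ + ‖h ε t - a ε t‖ := norm_add_le _ _
      _ ≤ m t + 1 := add_le_add h1 H2
      _ ≤ M t := hmM t htT'

/-- If `Tm ε < y < T` for a small `ε`, the solution would be bounded by `M y` on its whole existence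
interval, which the blow-up alternative forbids. -/
lemma le_liminf_lifespan {T : ℝ≥0∞} {Tm : ℝ → ℝ≥0∞} {h : ℝ → ℝ → State} {M : ℝ → ℝ}
    (hM : IsRate T M)
    (hblow : ∀ ε, 0 < ε → Tm ε < ⊤ → ∀ R : ℝ, ∃ t ∈ timeSet (Tm ε), R < ‖h ε t‖)
    (hbd : ∀ T' ∈ timeSet T, ∃ ε₀ : ℝ, 0 < ε₀ ∧ ∀ ε, 0 < ε → ε < ε₀ →
      ∀ t ∈ timeSet (Tm ε), t ≤ T' → ‖h ε t‖ ≤ M t) :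
    T ≤ liminf Tm (𝓝[>] (0 : ℝ)) := by
  refine le_of_forall_lt fun x hx => ?_
  obtain ⟨y, hxy, hyT⟩ := exists_between hx
  have hy : y ≠ ⊤ := ne_top_of_lt hyT
  have hyT' : y.toReal ∈ timeSet T :=
    ⟨ENNReal.toReal_nonneg, by rwa [ENNReal.ofReal_toReal hy]⟩
  refine hxy.trans_le (le_liminf_of_le (by isBoundedDefault) ?_)
  obtain ⟨ε₀, hε₀, H⟩ := hbd _ hyT'
  filter_upwards [Ioo_mem_nhdsGT hε₀] with ε hε
  by_contra! hlt
  obtain ⟨t, ht, hR⟩ := hblow ε hε.1 (hlt.trans_le le_top) (M y.toReal)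
  have htT : t ≤ y.toReal := (ENNReal.ofReal_le_iff_le_toReal hy).1 (ht.2.trans hlt).le
  exact absurd ((H ε hε.1 hε.2 t ht htT).trans (hM.mono (Icc_subset_timeSet hyT' ⟨ht.1, htT⟩) hyT' htT))
    (not_le.2 hR)

end Stability

/-! ### Time regularity of Sobolev-valued functions -/

section TimeRegularity

/-- The weak derivative `∂_{x_j} f`, if it is in `L²`. -/
def pd (j : Fin 2) (f : L2) : L2 :=
  open Classical in if h : ∃ g, toDist g = partialD j f then h.choose else 0

/-- The weak Laplacian, if it is in `L²`. -/
def lap (f : L2) : L2 :=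
  open Classical in if h : ∃ g, toDist g = Δ (toDist f) then h.choose else 0

variable {ρ σ : ℝ} {T : ℝ≥0∞} {u u' v v' : ℝ → L2} {j : ℕ}

lemma pd_ofFreq (hρ : 0 ≤ ρ) (k : Fin 2) (h : L2) :
    pd k (ofFreq (ρ + 1) h) = ofFreq ρ (dFreq k h) := by
  have H : ∃ g, toDist g = partialD k (ofFreq (ρ + 1) h) := ⟨_, (partialD_ofFreq hρ k h).symm⟩
  rw [pd, dif_pos H]
  exact toDist_injective (H.choose_spec.trans (partialD_ofFreq hρ k h))

lemma lap_ofFreq (hρ : 0 ≤ ρ) (h : L2) : lap (ofFreq (ρ + 2) h) = ofFreq ρ (lapFreq h) := by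
  have H : ∃ g, toDist g = Δ (toDist (ofFreq (ρ + 2) h)) := ⟨_, (laplacian_ofFreq hρ h).symm⟩
  rw [lap, dif_pos H]
  exact toDist_injective (H.choose_spec.trans (laplacian_ofFreq hρ h))

lemma toDist_pd (k : Fin 2) {f : L2} (hf : MemHs 1 f) : toDist (pd k f) = partialD k f := by
  obtain ⟨h, rfl⟩ := exists_ofFreq (by norm_num) hf
  have := partialD_ofFreq le_rfl k h
  rw [← pd_ofFreq le_rfl, zero_add] at this
  exact this.symm

lemma toDist_lap {f : L2} (hf : MemHs 2 f) : toDist (lap f) = Δ (toDist f) := by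
  obtain ⟨h, rfl⟩ := exists_ofFreq (by norm_num) hf
  have := laplacian_ofFreq le_rfl h
  rw [← lap_ofFreq le_rfl, zero_add] at this
  exact this.symm

lemma pd_zero (k : Fin 2) : pd k 0 = 0 := by
  have := pd_ofFreq le_rfl k 0
  rwa [map_zero, ofFreq_zero, ofFreq_zero] at this

lemma lap_zero : lap 0 = 0 := by
  have := lap_ofFreq le_rfl 0
  rwa [map_zero, ofFreq_zero, ofFreq_zero] at this

lemma star_lap {f : L2} (hf : MemHs 2 f) : star (lap f) = lap (star f) := by
  obtain ⟨h, rfl⟩ := exists_ofFreq (by norm_num) hf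
  have h1 : ∀ h, lap (ofFreq 2 h) = ofFreq 0 (lapFreq h) := fun h => by
    have := lap_ofFreq le_rfl h
    rwa [zero_add] at this
  rw [star_ofFreq (by norm_num), h1, h1, star_ofFreq le_rfl, lapFreq, conjFreq_mulOp bddMult_symLap]
  congr 3
  ext ξ
  rw [star_mul', star_jap, symLap, symLap, norm_neg, star_neg, Complex.star_def,
    Complex.conj_ofReal]

/-- `u'` is the time derivative of `u` in `H^ρ` on `[0, T)`. -/
def DtHs (ρ : ℝ) (T : ℝ≥0∞) (u u' : ℝ → L2) : Prop :=
  ∃ a a' : ℝ → L2, (∀ t ∈ timeSet T, u t = ofFreq ρ (a t)) ∧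
    (∀ t ∈ timeSet T, u' t = ofFreq ρ (a' t)) ∧
    ∀ t ∈ timeSet T, HasDerivWithinAt a (a' t) (Ici 0) t

/-- The one-sided time derivative in `L²`. -/
def Dt (u : ℝ → L2) (t : ℝ) : L2 := derivWithin u (Ici 0) t

/-- `u` has `j` time derivatives on `[0, T)`, each of which costs two space derivatives. -/
def Cl : ℕ → ℝ → ℝ≥0∞ → (ℝ → L2) → Prop
  | 0, ρ, T, u => ContHs ρ T u
  | j + 1, ρ, T, u => ContHs ρ T u ∧ ∃ u', DtHs (ρ - 2) T u u' ∧ Cl j (ρ - 2) T u'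

/-! #### Continuous functions -/

lemma ContHs.congr (h : ContHs ρ T u) (huv : ∀ t ∈ timeSet T, v t = u t) : ContHs ρ T v := by
  intro t ht
  rw [huv t ht]
  refine ⟨(h t ht).1, (h t ht).2.congr' ?_⟩
  filter_upwards [self_mem_nhdsWithin] with τ hτ using by rw [huv τ hτ]

lemma contHs_zero (ρ : ℝ) (T : ℝ≥0∞) : ContHs ρ T fun _ => 0 := by
  have h : hsNorm ρ 0 = 0 := by
    rw [hsNorm, eLpNorm_eq_zero_iff (by
      exact (continuous_jap ρ).aestronglyMeasurable.mul (Lp.aestronglyMeasurable _)) (by norm_num)]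
    have : (𝓕 (0 : L2) : L2) = 0 := FourierTransform.fourier_zero ..
    filter_upwards [Lp.coeFn_zero ℂ 2 (volume : Measure Plane)] with ξ hξ
    rw [this, hξ]
    simp
  intro t _
  refine ⟨by rw [MemHs, h]; exact ENNReal.zero_lt_top, ?_⟩
  simp only [sub_zero, h]
  exact tendsto_const_nhds

lemma ContHs.add (hρ : 0 ≤ ρ) (hu : ContHs ρ T u) (hv : ContHs ρ T v) :
    ContHs ρ T fun t => u t + v t := by
  obtain ⟨a, ha, hua⟩ := (contHs_iff hρ).1 hu
  obtain ⟨b, hb, hvb⟩ := (contHs_iff hρ).1 hv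
  exact (contHs_iff hρ).2 ⟨fun t => a t + b t, ha.add hb, fun t ht => by
    rw [hua t ht, hvb t ht, ofFreq_add]⟩

lemma ContHs.smul (hρ : 0 ≤ ρ) (c : ℂ) (hu : ContHs ρ T u) : ContHs ρ T fun t => c • u t := by
  obtain ⟨a, ha, hua⟩ := (contHs_iff hρ).1 hu
  exact (contHs_iff hρ).2 ⟨fun t => c • a t, ha.const_smul c, fun t ht => by
    rw [hua t ht, ofFreq_smul]⟩

lemma ContHs.conj (hρ : 0 ≤ ρ) (hu : ContHs ρ T u) : ContHs ρ T fun t => star (u t) := by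
  obtain ⟨a, ha, hua⟩ := (contHs_iff hρ).1 hu
  exact (contHs_iff hρ).2 ⟨fun t => conjFreq (a t), conjFreqL.continuous.comp_continuousOn ha,
    fun t ht => by rw [hua t ht, star_ofFreq hρ]⟩

lemma ContHs.pmul (hρ : 1 < ρ) (hu : ContHs ρ T u) (hv : ContHs ρ T v) :
    ContHs ρ T fun t => pmul (u t) (v t) := by
  have hρ0 : 0 ≤ ρ := by linarith
  obtain ⟨a, ha, hua⟩ := (contHs_iff hρ0).1 hu
  obtain ⟨b, hb, hvb⟩ := (contHs_iff hρ0).1 hv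
  exact (contHs_iff hρ0).2 ⟨fun t => freqMulL hρ (a t) (b t),
    ((freqMulL hρ).continuous.comp_continuousOn ha).clm_apply hb,
    fun t ht => by rw [hua t ht, hvb t ht, ofFreq_freqMulL]⟩

lemma ContHs.lap (hρ : 0 ≤ ρ) (hu : ContHs (ρ + 2) T u) : ContHs ρ T fun t => lap (u t) := by
  obtain ⟨a, ha, hua⟩ := (contHs_iff (by linarith)).1 hu
  exact (contHs_iff hρ).2 ⟨fun t => lapFreq (a t), lapFreq.continuous.comp_continuousOn ha,
    fun t ht => by rw [hua t ht, lap_ofFreq hρ]⟩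

lemma ContHs.pd (hρ : 0 ≤ ρ) (k : Fin 2) (hu : ContHs (ρ + 1) T u) :
    ContHs ρ T fun t => pd k (u t) := by
  obtain ⟨a, ha, hua⟩ := (contHs_iff (by linarith)).1 hu
  exact (contHs_iff hρ).2 ⟨fun t => dFreq k (a t), (dFreq k).continuous.comp_continuousOn ha,
    fun t ht => by rw [hua t ht, pd_ofFreq hρ]⟩

/-! #### Time derivatives -/

lemma DtHs.congr (h : DtHs ρ T u u') (huv : ∀ t ∈ timeSet T, v t = u t)
    (huv' : ∀ t ∈ timeSet T, v' t = u' t) : DtHs ρ T v v' := by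
  obtain ⟨a, a', h1, h2, h3⟩ := h
  exact ⟨a, a', fun t ht => (huv t ht).trans (h1 t ht), fun t ht => (huv' t ht).trans (h2 t ht), h3⟩

lemma DtHs.hasDerivWithinAt (h : DtHs ρ T u u') {t : ℝ} (ht : t ∈ timeSet T) :
    HasDerivWithinAt u (u' t) (Ici 0) t := by
  obtain ⟨a, a', h1, h2, h3⟩ := h
  have h4 := ((ofFreqL ρ).restrictScalars ℝ).hasFDerivAt.comp_hasDerivWithinAt t (h3 t ht)
  rw [h2 t ht]
  refine h4.congr_of_eventuallyEq ?_ (h1 t ht)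
  filter_upwards [timeSet_mem_nhdsWithin ht] with τ hτ using h1 τ hτ

lemma DtHs.hasDerivAt (h : DtHs ρ T u u') {t : ℝ} (ht : t ∈ timeSet T) (h0 : 0 < t) :
    HasDerivAt u (u' t) t := (h.hasDerivWithinAt ht).hasDerivAt (Ici_mem_nhds h0)

lemma DtHs.dt_eq (h : DtHs ρ T u u') {t : ℝ} (ht : t ∈ timeSet T) : Dt u t = u' t :=
  (h.hasDerivWithinAt ht).derivWithin (uniqueDiffOn_Ici 0 t ht.1)

lemma DtHs.dt (h : DtHs ρ T u u') : DtHs ρ T u (Dt u) :=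
  h.congr (fun _ _ => rfl) fun _ ht => h.dt_eq ht

lemma dt_zero : Dt (0 : ℝ → L2) = 0 := by
  funext t
  exact congrFun (derivWithin_const (Ici 0) (0 : L2)) t

lemma dtHs_zero (ρ : ℝ) (T : ℝ≥0∞) : DtHs ρ T (fun _ => 0) fun _ => 0 :=
  ⟨0, 0, fun _ _ => ofFreq_zero.symm, fun _ _ => ofFreq_zero.symm, fun _ _ =>
    hasDerivWithinAt_const ..⟩

lemma DtHs.of_le (hσ : 0 ≤ σ) (hσρ : σ ≤ ρ) (h : DtHs ρ T u u') : DtHs σ T u u' := by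
  obtain ⟨a, a', h1, h2, h3⟩ := h
  refine ⟨fun t => smoothing (ρ - σ) (a t), fun t => smoothing (ρ - σ) (a' t), fun t ht => ?_,
    fun t ht => ?_, fun t ht =>
      ((smoothing (ρ - σ)).restrictScalars ℝ).hasFDerivAt.comp_hasDerivWithinAt t (h3 t ht)⟩
  · rw [h1 t ht, ofFreq_of_le hσ hσρ]
  · rw [h2 t ht, ofFreq_of_le hσ hσρ]

lemma DtHs.add (hu : DtHs ρ T u u') (hv : DtHs ρ T v v') :
    DtHs ρ T (fun t => u t + v t) fun t => u' t + v' t := by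
  obtain ⟨a, a', h1, h2, h3⟩ := hu
  obtain ⟨b, b', k1, k2, k3⟩ := hv
  refine ⟨fun t => a t + b t, fun t => a' t + b' t, fun t ht => ?_, fun t ht => ?_,
    fun t ht => (h3 t ht).add (k3 t ht)⟩
  · beta_reduce
    rw [h1 t ht, k1 t ht, ofFreq_add]
  · beta_reduce
    rw [h2 t ht, k2 t ht, ofFreq_add]

lemma DtHs.smul (c : ℂ) (hu : DtHs ρ T u u') : DtHs ρ T (fun t => c • u t) fun t => c • u' t := by
  obtain ⟨a, a', h1, h2, h3⟩ := hu
  refine ⟨fun t => c • a t, fun t => c • a' t, fun t ht => ?_, fun t ht => ?_,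
    fun t ht => (h3 t ht).const_smul c⟩
  · beta_reduce
    rw [h1 t ht, ofFreq_smul]
  · beta_reduce
    rw [h2 t ht, ofFreq_smul]

lemma DtHs.conj (hρ : 0 ≤ ρ) (hu : DtHs ρ T u u') :
    DtHs ρ T (fun t => star (u t)) fun t => star (u' t) := by
  obtain ⟨a, a', h1, h2, h3⟩ := hu
  refine ⟨fun t => conjFreq (a t), fun t => conjFreq (a' t), fun t ht => ?_, fun t ht => ?_,
    fun t ht => conjFreqL.hasFDerivAt.comp_hasDerivWithinAt t (h3 t ht)⟩
  · beta_reduce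
    rw [h1 t ht, star_ofFreq hρ]
  · beta_reduce
    rw [h2 t ht, star_ofFreq hρ]

lemma DtHs.pmul (hρ : 1 < ρ) (hu : DtHs ρ T u u') (hv : DtHs ρ T v v') :
    DtHs ρ T (fun t => pmul (u t) (v t)) fun t => pmul (u' t) (v t) + pmul (u t) (v' t) := by
  obtain ⟨a, a', h1, h2, h3⟩ := hu
  obtain ⟨b, b', k1, k2, k3⟩ := hv
  refine ⟨fun t => freqMulL hρ (a t) (b t),
    fun t => freqMulL hρ (a' t) (b t) + freqMulL hρ (a t) (b' t), fun t ht => ?_, fun t ht => ?_,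
    fun t ht => ?_⟩
  · beta_reduce
    rw [h1 t ht, k1 t ht, ofFreq_freqMulL]
  · beta_reduce
    rw [h1 t ht, k1 t ht, h2 t ht, k2 t ht, ofFreq_add, ofFreq_freqMulL, ofFreq_freqMulL]
  · have h4 := ((freqMulL hρ).restrictScalars ℝ).hasFDerivAt.comp_hasDerivWithinAt t (h3 t ht)
    have h5 : HasDerivWithinAt (fun τ => (ContinuousLinearMap.restrictScalarsL ℂ L2 L2 ℝ ℝ)
        (freqMulL hρ (a τ))) ((ContinuousLinearMap.restrictScalarsL ℂ L2 L2 ℝ ℝ)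
        (freqMulL hρ (a' t))) (Ici 0) t :=
      (ContinuousLinearMap.restrictScalarsL ℂ L2 L2 ℝ ℝ).hasFDerivAt.comp_hasDerivWithinAt t h4
    exact h5.clm_apply (k3 t ht)

lemma DtHs.lap (hρ : 0 ≤ ρ) (hu : DtHs (ρ + 2) T u u') :
    DtHs ρ T (fun t => lap (u t)) fun t => lap (u' t) := by
  obtain ⟨a, a', h1, h2, h3⟩ := hu
  refine ⟨fun t => lapFreq (a t), fun t => lapFreq (a' t), fun t ht => ?_, fun t ht => ?_,
    fun t ht => (lapFreq.restrictScalars ℝ).hasFDerivAt.comp_hasDerivWithinAt t (h3 t ht)⟩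
  · beta_reduce
    rw [h1 t ht, lap_ofFreq hρ]
  · beta_reduce
    rw [h2 t ht, lap_ofFreq hρ]

lemma DtHs.pd (hρ : 0 ≤ ρ) (k : Fin 2) (hu : DtHs (ρ + 1) T u u') :
    DtHs ρ T (fun t => pd k (u t)) fun t => pd k (u' t) := by
  obtain ⟨a, a', h1, h2, h3⟩ := hu
  refine ⟨fun t => dFreq k (a t), fun t => dFreq k (a' t), fun t ht => ?_, fun t ht => ?_,
    fun t ht => ((dFreq k).restrictScalars ℝ).hasFDerivAt.comp_hasDerivWithinAt t (h3 t ht)⟩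
  · beta_reduce
    rw [h1 t ht, pd_ofFreq hρ]
  · beta_reduce
    rw [h2 t ht, pd_ofFreq hρ]

/-- The constant flow. -/
def idFlow : Flow L2 where
  toFun _ := ContinuousLinearMap.id ℝ L2
  bd := 1
  bd_nonneg := zero_le_one
  zero := rfl
  add _ _ _ := rfl
  bound _ _ := by simp
  cont _ := continuous_const

/-- A derivative in `L²` that is continuous in `H^ρ` is a derivative in `H^ρ`. -/
lemma DtHs.of_hasDerivAt (hρ : 0 ≤ ρ) (hu : ContHs ρ T u) (hu' : ContHs ρ T u')
    (h : ∀ t ∈ timeSet T, 0 < t → HasDerivAt u (u' t) t) : DtHs ρ T u u' := by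
  obtain ⟨a, ha, hua⟩ := (contHs_iff hρ).1 hu
  obtain ⟨a', ha', hua'⟩ := (contHs_iff hρ).1 hu'
  -- With the constant flow and generator zero, `mild_of_strong` says that a derivative known after
  -- smoothing is a derivative before it, provided that it is continuous there.
  have hgen : idFlow.Generates ((smoothing ρ).restrictScalars ℝ) 0 :=
    ⟨fun _ _ => rfl, fun _ => hasDerivAt_const ..⟩
  refine ⟨a, a', hua, hua', hgen.mild_of_strong (approxInv_smoothing hρ).injective ha ha'
    fun t ht ht0 => ?_⟩
  have h1 := h t ht ht0
  rw [hua' t ht] at h1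
  rw [zero_apply, zero_add]
  refine hasDerivAt_ofFreq_iff.1 (h1.congr_of_eventuallyEq ?_)
  filter_upwards [timeSet_mem_nhds ht ht0] with τ hτ using (hua τ hτ).symm

/-! #### Regularity classes -/

lemma Cl.contHs (h : Cl j ρ T u) : ContHs ρ T u := by
  cases j with
  | zero => exact h
  | succ j => exact h.1

lemma Cl.congr (h : Cl j ρ T u) (huv : ∀ t ∈ timeSet T, v t = u t) : Cl j ρ T v := by
  cases j with
  | zero => exact ContHs.congr h huv
  | succ j =>
    obtain ⟨h1, u', h2, h3⟩ := h
    exact ⟨h1.congr huv, u', h2.congr huv fun _ _ => rfl, h3⟩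

lemma Cl.dtHs (h : Cl (j + 1) ρ T u) : DtHs (ρ - 2) T u (Dt u) := by
  obtain ⟨-, u', h2, -⟩ := h
  exact h2.dt

lemma Cl.dt (h : Cl (j + 1) ρ T u) : Cl j (ρ - 2) T (Dt u) := by
  obtain ⟨-, u', h2, h3⟩ := h
  exact h3.congr fun t ht => h2.dt_eq ht

lemma cl_zero (j : ℕ) (ρ : ℝ) (T : ℝ≥0∞) : Cl j ρ T fun _ => 0 := by
  induction j generalizing ρ with
  | zero => exact contHs_zero ρ T
  | succ j ih => exact ⟨contHs_zero ρ T, fun _ => 0, dtHs_zero _ T, ih _⟩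

/-- The condition `2j ≤ σ` keeps all exponents `σ, σ - 2, …, σ - 2j` nonnegative. -/
lemma Cl.of_le (hσ : 2 * (j : ℝ) ≤ σ) (hσρ : σ ≤ ρ) (h : Cl j ρ T u) : Cl j σ T u := by
  induction j generalizing ρ σ u with
  | zero => exact ContHs.of_le (by simpa using hσ) hσρ h
  | succ j ih =>
    obtain ⟨h1, u', h2, h3⟩ := h
    push_cast at hσ
    have hj : (0 : ℝ) ≤ j := j.cast_nonneg
    exact ⟨h1.of_le (by linarith) hσρ, u', h2.of_le (by linarith) (by linarith),
      ih (by linarith) (by linarith) h3⟩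

lemma Cl.of_succ (h : Cl (j + 1) ρ T u) : Cl j ρ T u := by
  induction j generalizing ρ u with
  | zero => exact h.1
  | succ j ih =>
    obtain ⟨h1, u', h2, h3⟩ := h
    exact ⟨h1, u', h2, ih h3⟩

lemma Cl.of_le_left {i : ℕ} (hij : i ≤ j) (h : Cl j ρ T u) : Cl i ρ T u := by
  induction j, hij using Nat.le_induction with
  | base => exact h
  | succ j _ ih => exact ih h.of_succ

lemma Cl.add (hρ : 2 * (j : ℝ) ≤ ρ) (hu : Cl j ρ T u) (hv : Cl j ρ T v) :
    Cl j ρ T fun t => u t + v t := by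
  induction j generalizing ρ u v with
  | zero => exact ContHs.add (by simpa using hρ) hu hv
  | succ j ih =>
    obtain ⟨h1, u', h2, h3⟩ := hu
    obtain ⟨k1, v', k2, k3⟩ := hv
    push_cast at hρ
    have hj : (0 : ℝ) ≤ j := j.cast_nonneg
    exact ⟨h1.add (by linarith) k1, _, h2.add k2, ih (by linarith) h3 k3⟩

lemma Cl.smul (hρ : 2 * (j : ℝ) ≤ ρ) (c : ℂ) (hu : Cl j ρ T u) : Cl j ρ T fun t => c • u t := by
  induction j generalizing ρ u with
  | zero => exact ContHs.smul (by simpa using hρ) c hu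
  | succ j ih =>
    obtain ⟨h1, u', h2, h3⟩ := hu
    push_cast at hρ
    have hj : (0 : ℝ) ≤ j := j.cast_nonneg
    exact ⟨h1.smul (by linarith) c, _, h2.smul c, ih (by linarith) h3⟩

lemma Cl.neg (hρ : 2 * (j : ℝ) ≤ ρ) (hu : Cl j ρ T u) : Cl j ρ T fun t => -u t :=
  (hu.smul hρ (-1)).congr fun t _ => (neg_one_smul ℂ (u t)).symm

lemma Cl.sub (hρ : 2 * (j : ℝ) ≤ ρ) (hu : Cl j ρ T u) (hv : Cl j ρ T v) :
    Cl j ρ T fun t => u t - v t :=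
  (hu.add hρ (hv.neg hρ)).congr fun t _ => sub_eq_add_neg (u t) (v t)

lemma Cl.sum (hρ : 2 * (j : ℝ) ≤ ρ) {ι : Type*} (s : Finset ι) {u : ι → ℝ → L2}
    (hu : ∀ i ∈ s, Cl j ρ T (u i)) : Cl j ρ T fun t => ∑ i ∈ s, u i t := by
  classical
  induction s using Finset.induction_on with
  | empty => simpa using cl_zero j ρ T
  | insert i s hi ih =>
    simp only [Finset.sum_insert hi]
    exact (hu i (Finset.mem_insert_self i s)).add hρ
      (ih fun k hk => hu k (Finset.mem_insert_of_mem hk))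

lemma Cl.conj (hρ : 2 * (j : ℝ) ≤ ρ) (hu : Cl j ρ T u) : Cl j ρ T fun t => star (u t) := by
  induction j generalizing ρ u with
  | zero => exact ContHs.conj (by simpa using hρ) hu
  | succ j ih =>
    obtain ⟨h1, u', h2, h3⟩ := hu
    push_cast at hρ
    have hj : (0 : ℝ) ≤ j := j.cast_nonneg
    exact ⟨h1.conj (by linarith), _, h2.conj (by linarith), ih (by linarith) h3⟩

/-- Leibniz' rule; `2j + 1 < ρ` guarantees that the space is still an algebra after `j` time
derivatives. -/
lemma Cl.pmul (hρ : 2 * (j : ℝ) + 1 < ρ) (hu : Cl j ρ T u) (hv : Cl j ρ T v) :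
    Cl j ρ T fun t => pmul (u t) (v t) := by
  induction j generalizing ρ u v with
  | zero => exact ContHs.pmul (by simpa using hρ) hu hv
  | succ j ih =>
    have hu0 := hu.of_succ
    have hv0 := hv.of_succ
    obtain ⟨h1, u', h2, h3⟩ := hu
    obtain ⟨k1, v', k2, k3⟩ := hv
    push_cast at hρ
    have hj : (0 : ℝ) ≤ j := j.cast_nonneg
    have hu1 : Cl j (ρ - 2) T u := hu0.of_le (by linarith) (by linarith)
    have hv1 : Cl j (ρ - 2) T v := hv0.of_le (by linarith) (by linarith)
    exact ⟨h1.pmul (by linarith) k1, _, h2.pmul (by linarith) k2,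
      (ih (by linarith) h3 hv1).add (by linarith) (ih (by linarith) hu1 k3)⟩

lemma Cl.lap (hρ : 2 * (j : ℝ) ≤ ρ) (hu : Cl j (ρ + 2) T u) : Cl j ρ T fun t => lap (u t) := by
  induction j generalizing ρ u with
  | zero => exact ContHs.lap (by simpa using hρ) hu
  | succ j ih =>
    obtain ⟨h1, u', h2, h3⟩ := hu
    push_cast at hρ
    have hj : (0 : ℝ) ≤ j := j.cast_nonneg
    have he : ρ + 2 - 2 = ρ - 2 + 2 := by ring
    rw [he] at h2 h3
    exact ⟨h1.lap (by linarith), _, h2.lap (by linarith), ih (by linarith) h3⟩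

/-- A solution of a Schrödinger equation is as regular in time as the other terms allow. -/
lemma Cl.of_schrodinger {J : ℕ} (hρ : 2 * (J : ℝ) ≤ ρ) {g B : ℝ → L2} (hg : ContHs ρ T g)
    (hd : ∀ t ∈ timeSet T, 0 < t → HasDerivAt g ((2 * Complex.I)⁻¹ • (NonRelLimit.lap (g t) - B t)) t)
    (hB : ∀ j < J, Cl j ρ T g → Cl j (ρ - 2) T B) : Cl J ρ T g := by
  suffices H : ∀ j ≤ J, Cl j ρ T g from H J le_rfl
  intro j hj
  -- If `g` has `j` time derivatives, so has the right-hand side, which is `g'`; hence `g` has `j +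
  -- 1`.
  induction j with
  | zero => exact hg
  | succ j ih =>
    have hjg := ih (by omega)
    have hj' : ((j + 1 : ℕ) : ℝ) ≤ J := by exact_mod_cast hj
    push_cast at hj'
    have hj0 : (0 : ℝ) ≤ j := j.cast_nonneg
    have h1 : Cl j (ρ - 2) T fun t => (2 * Complex.I)⁻¹ • (NonRelLimit.lap (g t) - B t) :=
      (Cl.sub (by linarith) (Cl.lap (by linarith) (by rwa [sub_add_cancel]))
        (hB j (by omega) hjg)).smul (by linarith) _
    exact ⟨hg, _, DtHs.of_hasDerivAt (by linarith) (hg.of_le (by linarith) (by linarith))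
      h1.contHs hd, h1⟩

end TimeRegularity

/-! ### The Fourier coefficients of the cubic nonlinearity -/

section Cubic

lemma pmul_zero_left (f : L2) : pmul 0 f = 0 := by
  have h : pmul (ofFreq 2 0) f = 0 := by
    change pmulL (by norm_num : (1 : ℝ) < 2) 0 f = 0
    rw [map_zero, zero_apply]
  rwa [ofFreq_zero] at h

lemma pmul_zero_right (f : L2) : pmul f 0 = 0 := by rw [pmul_comm, pmul_zero_left]

lemma coe_sum_ae {ι : Type*} {s : Finset ι} {f : ι → L2} {g : ι → Plane → ℂ}
    (h : ∀ i ∈ s, ∀ᵐ x, f i x = g i x) : ∀ᵐ x, (∑ i ∈ s, f i) x = ∑ i ∈ s, g i x := by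
  classical
  induction s using Finset.induction_on with
  | empty =>
    simp only [Finset.sum_empty]
    exact Lp.coeFn_zero ℂ 2 (volume : Measure Plane)
  | insert i s hi ih =>
    simp only [Finset.sum_insert hi]
    filter_upwards [Lp.coeFn_add (f i) (∑ k ∈ s, f k), h i (Finset.mem_insert_self i s),
      ih fun k hk => h k (Finset.mem_insert_of_mem hk)] with x h1 h2 h3
    rw [h1, Pi.add_apply, h2, h3]

/-- The indices `(n, p)` of the amplitudes of a WKB solution. -/
def wkbIdx (K : ℕ) : Finset (ℤ × ℤ) :=
  (Finset.Icc (0 : ℤ) (K + 2) ×ˢ Finset.Icc (-(K + 3) : ℤ) (K + 3)).filter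
    fun i => i.2 ∈ harmonics i.1

variable {K : ℕ}

lemma mem_harmonics {n p : ℤ} :
    p ∈ harmonics n ↔ Odd p ∧ |p| ≤ if Even n then n + 1 else n := by
  rw [harmonics, Finset.mem_filter, Finset.mem_Icc, and_iff_right_iff_imp]
  rintro ⟨-, h⟩
  rw [← abs_le]
  split_ifs at h <;> omega

lemma neg_mem_harmonics {n p : ℤ} : -p ∈ harmonics n ↔ p ∈ harmonics n := by
  rw [mem_harmonics, mem_harmonics, abs_neg, odd_neg]

lemma mem_wkbIdx {i : ℤ × ℤ} :
    i ∈ wkbIdx K ↔ i.1 ∈ Finset.Icc (0 : ℤ) (K + 2) ∧ i.2 ∈ harmonics i.1 := by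
  rw [wkbIdx, Finset.mem_filter, Finset.mem_product, Finset.mem_Icc, Finset.mem_Icc]
  refine ⟨fun h => ⟨h.1.1, h.2⟩, fun h => ⟨⟨h.1, ?_⟩, h.2⟩⟩
  have h1 := (mem_harmonics.1 h.2).2
  rw [← abs_le]
  split_ifs at h1 <;> omega

lemma sum_wkbIdx {M : Type*} [AddCommMonoid M] (f : ℤ → ℤ → M) :
    ∑ i ∈ wkbIdx K, f i.1 i.2 = ∑ n ∈ Finset.Icc (0 : ℤ) (K + 2), ∑ p ∈ harmonics n, f n p :=
  Finset.sum_finset_product (f := fun i => f i.1 i.2) _ _ _ fun _ => mem_wkbIdx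

/-- `∑_{i+j+k=q} xᵢ xⱼ xₖ`. -/
def tripleSum {M : Type*} [AddCommMonoid M] (K : ℕ) (q : ℤ × ℤ) (F : ℤ × ℤ → ℤ × ℤ → ℤ × ℤ → M) :
    M :=
  ∑ i ∈ wkbIdx K, ∑ j ∈ wkbIdx K, ∑ k ∈ wkbIdx K, if i + j + k = q then F i j k else 0

lemma tripleSum_congr {M : Type*} [AddCommMonoid M] {q : ℤ × ℤ}
    {F G : ℤ × ℤ → ℤ × ℤ → ℤ × ℤ → M}
    (h : ∀ i ∈ wkbIdx K, ∀ j ∈ wkbIdx K, ∀ k ∈ wkbIdx K, i + j + k = q → F i j k = G i j k) :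
    tripleSum K q F = tripleSum K q G :=
  Finset.sum_congr rfl fun i hi => Finset.sum_congr rfl fun j hj => Finset.sum_congr rfl
    fun k hk => by
      split_ifs with hq
      · exact h i hi j hj k hk hq
      · rfl

lemma tripleSum_eq_zero {M : Type*} [AddCommMonoid M] {q : ℤ × ℤ}
    {F : ℤ × ℤ → ℤ × ℤ → ℤ × ℤ → M}
    (h : ∀ i ∈ wkbIdx K, ∀ j ∈ wkbIdx K, ∀ k ∈ wkbIdx K, i + j + k = q → F i j k = 0) :
    tripleSum K q F = 0 := by
  rw [tripleSum_congr h]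
  simp [tripleSum]

lemma cubicCoeff_eq (lam : ℝ) (A : Amplitudes) (n p : ℤ) (t : ℝ) (x : Plane) :
    cubicCoeff lam K A n p t x = (lam : ℂ) * tripleSum K (n, p)
      fun i j k => A i.1 i.2 t 3 x * A j.1 j.2 t 3 x * A k.1 k.2 t 3 x := by
  rw [cubicCoeff, tripleSum]
  congr 1
  have hc : ∀ i j k : ℤ × ℤ, (i + j + k = (n, p)) ↔
      (i.1 + j.1 + k.1 = n ∧ i.2 + j.2 + k.2 = p) := fun i j k => by
    rw [Prod.ext_iff]; rfl
  simp only [hc]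
  rw [sum_wkbIdx (fun n₁ p₁ => ∑ j ∈ wkbIdx K, ∑ k ∈ wkbIdx K,
    if n₁ + j.1 + k.1 = n ∧ p₁ + j.2 + k.2 = p then
      A n₁ p₁ t 3 x * A j.1 j.2 t 3 x * A k.1 k.2 t 3 x else 0)]
  refine Finset.sum_congr rfl fun n₁ _ => ?_
  have h2 : ∀ p₁ : ℤ, ∑ j ∈ wkbIdx K, ∑ k ∈ wkbIdx K,
      (if n₁ + j.1 + k.1 = n ∧ p₁ + j.2 + k.2 = p then
        A n₁ p₁ t 3 x * A j.1 j.2 t 3 x * A k.1 k.2 t 3 x else 0) =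
      ∑ n₂ ∈ Finset.Icc (0 : ℤ) (K + 2), ∑ n₃ ∈ Finset.Icc (0 : ℤ) (K + 2),
        ∑ p₂ ∈ harmonics n₂, ∑ p₃ ∈ harmonics n₃,
        (if n₁ + n₂ + n₃ = n ∧ p₁ + p₂ + p₃ = p then
          A n₁ p₁ t 3 x * A n₂ p₂ t 3 x * A n₃ p₃ t 3 x else 0) := by
    intro p₁
    rw [sum_wkbIdx (fun n₂ p₂ => ∑ k ∈ wkbIdx K,
      if n₁ + n₂ + k.1 = n ∧ p₁ + p₂ + k.2 = p then
        A n₁ p₁ t 3 x * A n₂ p₂ t 3 x * A k.1 k.2 t 3 x else 0)]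
    refine Finset.sum_congr rfl fun n₂ _ => ?_
    conv_rhs => rw [Finset.sum_comm]
    refine Finset.sum_congr rfl fun p₂ _ => ?_
    exact sum_wkbIdx (fun n₃ p₃ => if n₁ + n₂ + n₃ = n ∧ p₁ + p₂ + p₃ = p then
        A n₁ p₁ t 3 x * A n₂ p₂ t 3 x * A n₃ p₃ t 3 x else 0)
  simp only [h2]
  conv_rhs => rw [Finset.sum_comm]
  refine Finset.sum_congr rfl fun n₂ _ => ?_
  conv_rhs => rw [Finset.sum_comm]

/-- The coefficient `λ ∑_{i+j+k=(n,p)} wᵢ wⱼ wₖ`. -/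
def cub (lam : ℝ) (K : ℕ) (w : ℤ → ℤ → L2) (n p : ℤ) : L2 :=
  (lam : ℂ) • tripleSum K (n, p) fun i j k => pmul (w i.1 i.2) (pmul (w j.1 j.2) (w k.1 k.2))

variable {lam : ℝ} {w z : ℤ → ℤ → L2} {n p : ℤ} {σ : ℝ}

lemma le_of_add_eq {i j k : ℤ × ℤ} (hi : i ∈ wkbIdx K) (hj : j ∈ wkbIdx K) (hk : k ∈ wkbIdx K)
    (h : i + j + k = (n, p)) :
    0 ≤ i.1 ∧ 0 ≤ j.1 ∧ 0 ≤ k.1 ∧ i.1 + j.1 + k.1 = n ∧ i.2 + j.2 + k.2 = p := by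
  have hi' := (Finset.mem_Icc.1 (mem_wkbIdx.1 hi).1).1
  have hj' := (Finset.mem_Icc.1 (mem_wkbIdx.1 hj).1).1
  have hk' := (Finset.mem_Icc.1 (mem_wkbIdx.1 hk).1).1
  rw [Prod.ext_iff] at h
  exact ⟨hi', hj', hk', h.1, h.2⟩

/-- Orders are nonnegative and add up to `n`, so only orders up to `n` enter. This makes the
recurrence a genuine recursion. -/
lemma cub_congr (h : ∀ m ≤ n, ∀ q, w m q = z m q) : cub lam K w n p = cub lam K z n p := by
  rw [cub, cub]
  congr 1
  refine tripleSum_congr fun i hi j hj k hk hq => ?_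
  obtain ⟨h1, h2, h3, h4, -⟩ := le_of_add_eq hi hj hk hq
  rw [h _ (by omega), h _ (by omega), h _ (by omega)]

lemma cub_eq_zero (h : ∀ i ∈ wkbIdx K, ∀ j ∈ wkbIdx K, ∀ k ∈ wkbIdx K, i + j + k = (n, p) →
    w i.1 i.2 = 0 ∨ w j.1 j.2 = 0 ∨ w k.1 k.2 = 0) : cub lam K w n p = 0 := by
  rw [cub, tripleSum_eq_zero, smul_zero]
  intro i hi j hj k hk hq
  rcases h i hi j hj k hk hq with h | h | h <;> rw [h]
  · exact pmul_zero_left _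
  · rw [pmul_zero_left, pmul_zero_right]
  · rw [pmul_zero_right, pmul_zero_right]

lemma cub_of_neg (hn : n < 0) : cub lam K w n p = 0 :=
  cub_eq_zero fun i hi j hj k hk hq => by
    obtain ⟨h1, h2, h3, h4, -⟩ := le_of_add_eq hi hj hk hq
    omega

lemma cub_of_odd (hw : ∀ m q, ¬Even m → w m q = 0) (hn : ¬Even n) : cub lam K w n p = 0 :=
  cub_eq_zero fun i hi j hj k hk hq => by
    obtain ⟨-, -, -, h4, -⟩ := le_of_add_eq hi hj hk hq
    by_contra! hcon
    have h1 : Even i.1 := by_contra fun h => hcon.1 (hw _ _ h)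
    have h2 : Even j.1 := by_contra fun h => hcon.2.1 (hw _ _ h)
    have h3 : Even k.1 := by_contra fun h => hcon.2.2 (hw _ _ h)
    exact hn (h4 ▸ (h1.add h2).add h3)

/-- For even orders `|pᵢ| ≤ nᵢ + 1`, so the sum of the three harmonics is odd and at most `n + 3 =
(n + 2) + 1` in modulus: the cubic term creates just the harmonics of the order `n + 2`. -/
lemma cub_of_not_mem (hw : ∀ m q, ¬Even m → w m q = 0) (hn : Even n)
    (hp : p ∉ harmonics (n + 2)) : cub lam K w n p = 0 :=
  cub_eq_zero fun i hi j hj k hk hq => by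
    obtain ⟨h1, h2, h3, h4, h5⟩ := le_of_add_eq hi hj hk hq
    by_contra! hcon
    have e1 : Even i.1 := by_contra fun h => hcon.1 (hw _ _ h)
    have e2 : Even j.1 := by_contra fun h => hcon.2.1 (hw _ _ h)
    have e3 : Even k.1 := by_contra fun h => hcon.2.2 (hw _ _ h)
    obtain ⟨o1, a1⟩ := mem_harmonics.1 (mem_wkbIdx.1 hi).2
    obtain ⟨o2, a2⟩ := mem_harmonics.1 (mem_wkbIdx.1 hj).2
    obtain ⟨o3, a3⟩ := mem_harmonics.1 (mem_wkbIdx.1 hk).2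
    rw [if_pos e1] at a1
    rw [if_pos e2] at a2
    rw [if_pos e3] at a3
    refine hp (mem_harmonics.2 ⟨h5 ▸ (o1.add_odd o2).add_odd o3, ?_⟩)
    rw [if_pos (hn.add even_two), ← h5, ← h4]
    have := abs_add_three i.2 j.2 k.2
    omega

lemma tripleSum_coe {F : ℤ × ℤ → ℤ × ℤ → ℤ × ℤ → L2} {G : ℤ × ℤ → ℤ × ℤ → ℤ × ℤ → Plane → ℂ}
    {q : ℤ × ℤ} (h : ∀ i ∈ wkbIdx K, ∀ j ∈ wkbIdx K, ∀ k ∈ wkbIdx K,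
      ∀ᵐ x, F i j k x = G i j k x) :
    ∀ᵐ x, (tripleSum K q F) x = tripleSum K q fun i j k => G i j k x := by
  refine coe_sum_ae fun i hi => coe_sum_ae fun j hj => coe_sum_ae fun k hk => ?_
  split_ifs
  · exact h i hi j hj k hk
  · exact Lp.coeFn_zero ℂ 2 (volume : Measure Plane)

lemma pmul_coe' (hσ : 1 < σ) {f : L2} (hf : MemHs σ f) (g : L2) :
    ∀ᵐ x, pmul f g x = f x * g x := by
  obtain ⟨h, rfl⟩ := exists_ofFreq (by linarith) hf
  exact pmul_coe hσ h g

lemma cub_coe (hσ : 1 < σ) (hw : ∀ i ∈ wkbIdx K, MemHs σ (w i.1 i.2)) :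
    ∀ᵐ x, cub lam K w n p x = (lam : ℂ) * tripleSum K (n, p)
      fun i j k => w i.1 i.2 x * w j.1 j.2 x * w k.1 k.2 x := by
  have h1 : ∀ᵐ x, (tripleSum K (n, p)
      fun i j k => pmul (w i.1 i.2) (pmul (w j.1 j.2) (w k.1 k.2)) : L2) x =
      tripleSum K (n, p) fun i j k => w i.1 i.2 x * w j.1 j.2 x * w k.1 k.2 x := by
    refine tripleSum_coe fun i hi j hj k hk => ?_
    filter_upwards [pmul_coe' hσ (hw i hi) (pmul (w j.1 j.2) (w k.1 k.2)),
      pmul_coe' hσ (hw j hj) (w k.1 k.2)] with x h1 h2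
    rw [h1, h2, mul_assoc]
  filter_upwards [h1, Lp.coeFn_smul (lam : ℂ) (tripleSum K (n, p)
      fun i j k => pmul (w i.1 i.2) (pmul (w j.1 j.2) (w k.1 k.2)))] with x h2 h3
  rw [cub, h3, Pi.smul_apply, h2, smul_eq_mul]

/-- Expansion of a cube. -/
lemma sum_tripleSum {B : Finset (ℤ × ℤ)} {c x : ℤ × ℤ → ℂ}
    (hB : ∀ i ∈ wkbIdx K, ∀ j ∈ wkbIdx K, ∀ k ∈ wkbIdx K, i + j + k ∈ B)
    (hc : ∀ i j, c (i + j) = c i * c j) :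
    ∑ q ∈ B, c q * tripleSum K q (fun i j k => x i * x j * x k) =
      (∑ i ∈ wkbIdx K, c i * x i) ^ 3 := by
  simp only [tripleSum, Finset.mul_sum]
  rw [Finset.sum_comm]
  have h3 : (∑ i ∈ wkbIdx K, c i * x i) ^ 3 = ∑ i ∈ wkbIdx K, ∑ j ∈ wkbIdx K, ∑ k ∈ wkbIdx K,
      (c i * x i) * ((c j * x j) * (c k * x k)) := by
    simp only [← Finset.mul_sum, ← Finset.sum_mul]
    ring
  rw [h3]
  refine Finset.sum_congr rfl fun i hi => ?_
  rw [Finset.sum_comm]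
  refine Finset.sum_congr rfl fun j hj => ?_
  rw [Finset.sum_comm]
  refine Finset.sum_congr rfl fun k hk => ?_
  simp only [mul_ite, mul_zero]
  rw [Finset.sum_ite_eq, if_pos (hB i hi j hj k hk), hc, hc]
  ring

/-- The substitution `p ↦ -p` in all three indices preserves the index set and reverses the sign of
the total harmonic. -/
lemma star_cub (hσ : 1 < σ) (hw : ∀ i ∈ wkbIdx K, MemHs σ (w i.1 i.2))
    (hconj : ∀ m q, w m (-q) = star (w m q)) : star (cub lam K w n p) = cub lam K w n (-p) := by
  have hmem : ∀ i : ℤ × ℤ, i ∈ wkbIdx K ↔ (i.1, -i.2) ∈ wkbIdx K := fun i => by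
    rw [mem_wkbIdx, mem_wkbIdx, neg_mem_harmonics]
  have hs : ∀ F : ℤ × ℤ → ℤ × ℤ → ℤ × ℤ → L2,
      star (tripleSum K (n, p) F) = tripleSum K (n, p) fun i j k => star (F i j k) := fun F => by
    simp only [tripleSum, star_sum']
    refine Finset.sum_congr rfl fun i _ => Finset.sum_congr rfl fun j _ =>
      Finset.sum_congr rfl fun k _ => ?_
    split_ifs
    · rfl
    · exact star_zero'
  have hre : ∀ F : ℤ × ℤ → L2, ∑ i ∈ wkbIdx K, F (i.1, -i.2) = ∑ i ∈ wkbIdx K, F i := fun F =>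
    Finset.sum_nbij' (fun i => (i.1, -i.2)) (fun i => (i.1, -i.2)) (fun i hi => (hmem i).1 hi)
      (fun i hi => (hmem i).1 hi) (fun i _ => by simp) (fun i _ => by simp) fun i _ => rfl
  rw [cub, cub, star_smul', Complex.star_def, Complex.conj_ofReal, hs]
  congr 1
  rw [tripleSum, tripleSum, ← hre]
  refine Finset.sum_congr rfl fun i hi => ?_
  rw [← hre]
  refine Finset.sum_congr rfl fun j hj => ?_
  rw [← hre]
  refine Finset.sum_congr rfl fun k hk => ?_
  have hcond : ((i.1, -i.2) + (j.1, -j.2) + (k.1, -k.2) = (n, p)) ↔ i + j + k = (n, -p) := by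
    simp only [Prod.ext_iff, Prod.fst_add, Prod.snd_add, Prod.mk_add_mk]
    constructor <;> rintro ⟨h1, h2⟩ <;> constructor <;> omega
  simp only [hcond]
  split_ifs
  · obtain ⟨a, ha⟩ := exists_ofFreq (by linarith) (hw _ ((hmem i).1 hi))
    obtain ⟨b, hb⟩ := exists_ofFreq (by linarith) (hw _ ((hmem j).1 hj))
    rw [ha, hb, star_pmul hσ, star_pmul hσ, ← ha, ← hb]
    simp only [← hconj, neg_neg]
  · rfl

/-- The coefficient of the leading order term. -/
lemma cub_zero_one (hσ : 1 < σ) (hw : ∀ i ∈ wkbIdx K, MemHs σ (w i.1 i.2)) {N : L2}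
    (hN : ∀ᵐ x, N x = 3 * (lam : ℂ) * ((‖w 0 1 x‖ ^ 2 : ℝ) : ℂ) * w 0 1 x)
    (hconj : w 0 (-1) = star (w 0 1)) : cub lam K w 0 1 = N := by
  -- Three orders with sum zero are all zero, and at the order zero the harmonics are `±1`.
  set I₀ : Finset (ℤ × ℤ) := {(0, 1), (0, -1)} with hI₀
  have hI : ∀ i ∈ wkbIdx K, i.1 = 0 → i ∈ I₀ := by
    intro i hi h0
    obtain ⟨o, a⟩ := mem_harmonics.1 (mem_wkbIdx.1 hi).2
    rw [h0, if_pos Even.zero] at a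
    obtain ⟨a1, a2⟩ := abs_le.1 a
    obtain ⟨r, hr⟩ := o
    have : i.2 = 1 ∨ i.2 = -1 := by omega
    rcases this with h | h <;> simp [hI₀, Prod.ext_iff, h0, h]
  have hsub : I₀ ⊆ wkbIdx K := by
    intro i hi
    simp only [hI₀, Finset.mem_insert, Finset.mem_singleton] at hi
    rcases hi with rfl | rfl <;> rw [mem_wkbIdx, mem_harmonics] <;> simp <;> omega
  refine eq_of_ae ?_
  filter_upwards [hN, cub_coe (lam := lam) (n := 0) (p := 1) hσ hw, star_coe (w 0 1)]
    with x h1 h2 h3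
  rw [h2, h1]
  have h4 : tripleSum K (0, 1) (fun i j k => w i.1 i.2 x * w j.1 j.2 x * w k.1 k.2 x) =
      ∑ i ∈ I₀, ∑ j ∈ I₀, ∑ k ∈ I₀, if i + j + k = (0, 1) then
        w i.1 i.2 x * w j.1 j.2 x * w k.1 k.2 x else 0 := by
    rw [tripleSum]
    symm
    have hz : ∀ i ∈ wkbIdx K, ∀ j ∈ wkbIdx K, ∀ k ∈ wkbIdx K, i + j + k = (0, 1) →
        i ∈ I₀ ∧ j ∈ I₀ ∧ k ∈ I₀ := by
      intro i hi j hj k hk hq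
      obtain ⟨h1, h2, h3, h4, -⟩ := le_of_add_eq hi hj hk hq
      exact ⟨hI i hi (by omega), hI j hj (by omega), hI k hk (by omega)⟩
    have e3 : ∀ i ∈ wkbIdx K, ∀ j ∈ wkbIdx K, ∑ k ∈ I₀, (if i + j + k = (0, 1) then
        w i.1 i.2 x * w j.1 j.2 x * w k.1 k.2 x else 0) = ∑ k ∈ wkbIdx K,
        if i + j + k = (0, 1) then w i.1 i.2 x * w j.1 j.2 x * w k.1 k.2 x else 0 :=
      fun i hi j hj => Finset.sum_subset hsub fun k hk hk' =>
        if_neg fun hq => hk' (hz i hi j hj k hk hq).2.2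
    have e2 : ∀ i ∈ wkbIdx K, ∑ j ∈ I₀, ∑ k ∈ I₀, (if i + j + k = (0, 1) then
        w i.1 i.2 x * w j.1 j.2 x * w k.1 k.2 x else 0) = ∑ j ∈ wkbIdx K, ∑ k ∈ wkbIdx K,
        if i + j + k = (0, 1) then w i.1 i.2 x * w j.1 j.2 x * w k.1 k.2 x else 0 := by
      intro i hi
      rw [Finset.sum_congr rfl fun j hj => e3 i hi j (hsub hj)]
      exact Finset.sum_subset hsub fun j hj hj' => Finset.sum_eq_zero fun k hk =>
        if_neg fun hq => hj' (hz i hi j hj k hk hq).2.1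
    rw [Finset.sum_congr rfl fun i hi => e2 i (hsub hi)]
    exact Finset.sum_subset hsub fun i hi hi' => Finset.sum_eq_zero fun j hj =>
      Finset.sum_eq_zero fun k hk => if_neg fun hq => hi' (hz i hi j hj k hk hq).1
  have h5 : w 0 1 x * star (w 0 1 x) = ((‖w 0 1 x‖ ^ 2 : ℝ) : ℂ) := by
    rw [Complex.star_def, Complex.mul_conj, Complex.normSq_eq_norm_sq]
  rw [h4, ← h5, ← h3, ← hconj, hI₀]
  -- Of the eight triples of signs exactly the three with a single minus sign add up to `1`; hence
  -- the factor `3`.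
  simp [Prod.ext_iff]
  ring

lemma cl_cub {T : ℝ≥0∞} {ρ : ℝ} {j : ℕ} {u : ℤ → ℤ → ℝ → L2} (hρ : 2 * (j : ℝ) + 1 < ρ)
    (hu : ∀ i ∈ wkbIdx K, i.1 ≤ n → Cl j ρ T (u i.1 i.2)) :
    Cl j ρ T fun t => cub lam K (fun m q => u m q t) n p := by
  have hρ' : 2 * (j : ℝ) ≤ ρ := by linarith
  refine Cl.smul hρ' _ (Cl.sum hρ' _ fun i hi => Cl.sum hρ' _ fun k hk => Cl.sum hρ' _
    fun l hl => ?_)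
  by_cases hq : i + k + l = (n, p)
  · obtain ⟨h1, h2, h3, h4, -⟩ := le_of_add_eq hi hk hl hq
    simp only [if_pos hq]
    exact (hu i hi (by omega)).pmul hρ ((hu k hk (by omega)).pmul hρ (hu l hl (by omega)))
  · simp only [if_neg hq]
    exact cl_zero ..

/-- The coefficients of the nonlinearity on the frequency side. -/
def cubF (lam : ℝ) (K : ℕ) (hσ : 1 < σ) (α : ℤ → ℤ → L2) (n p : ℤ) : L2 :=
  (lam : ℂ) • tripleSum K (n, p) fun i j k => tri hσ (α i.1 i.2) (α j.1 j.2) (α k.1 k.2)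

lemma ofFreq_cubF (hσ : 1 < σ) (α : ℤ → ℤ → L2) :
    ofFreq σ (cubF lam K hσ α n p) = cub lam K (fun m q => ofFreq σ (α m q)) n p := by
  have hs : ∀ (q : ℤ × ℤ) (F : ℤ × ℤ → ℤ × ℤ → ℤ × ℤ → L2),
      ofFreq σ (tripleSum K q F) = tripleSum K q fun i j k => ofFreq σ (F i j k) := fun q F => by
    change ofFreqL σ _ = _
    simp only [tripleSum, map_sum]
    refine Finset.sum_congr rfl fun i _ => Finset.sum_congr rfl fun j _ =>
      Finset.sum_congr rfl fun k _ => ?_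
    split_ifs
    · rfl
    · exact map_zero _
  rw [cubF, cub, ofFreq_smul, hs]
  simp only [ofFreq_tri]

lemma norm_tripleSum_le {F : ℤ × ℤ → ℤ × ℤ → ℤ × ℤ → L2} {q : ℤ × ℤ} {C : ℝ} (hC : 0 ≤ C)
    (h : ∀ i ∈ wkbIdx K, ∀ j ∈ wkbIdx K, ∀ k ∈ wkbIdx K, i + j + k = q → ‖F i j k‖ ≤ C) :
    ‖tripleSum K q F‖ ≤ ((wkbIdx K).card : ℝ) ^ 3 * C := by
  calc ‖tripleSum K q F‖ ≤ ∑ i ∈ wkbIdx K, ∑ j ∈ wkbIdx K, ∑ k ∈ wkbIdx K, C := by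
        refine norm_sum_le_of_le _ fun i hi => norm_sum_le_of_le _ fun j hj =>
          norm_sum_le_of_le _ fun k hk => ?_
        split_ifs with hq
        · exact h i hi j hj k hk hq
        · rwa [norm_zero]
    _ = _ := by simp; ring

lemma tripleSum_sub (F G : ℤ × ℤ → ℤ × ℤ → ℤ × ℤ → L2) (q : ℤ × ℤ) :
    tripleSum K q F - tripleSum K q G = tripleSum K q fun i j k => F i j k - G i j k := by
  simp only [tripleSum, ← Finset.sum_sub_distrib]
  refine Finset.sum_congr rfl fun i _ => Finset.sum_congr rfl fun j _ =>
      Finset.sum_congr rfl fun k _ => ?_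
  split_ifs
  · rfl
  · exact sub_zero _

end Cubic

/-! ### Construction of the amplitudes -/

section Family

variable {lam : ℝ} {K : ℕ} {s : ℝ} {T : ℝ≥0∞} {u z : ℤ → ℤ → ℝ → L2} {n p : ℤ}

/-- `∂ₜ² u_{n-2,p} + 2ip ∂ₜ u_{n,p} - Δ u_{n,p} + f(u)_{n,p}`. -/
def wkbW (lam : ℝ) (K : ℕ) (u : ℤ → ℤ → ℝ → L2) (n p : ℤ) (t : ℝ) : L2 :=
  Dt (Dt (u (n - 2) p)) t + (2 * Complex.I * p) • Dt (u n p) t - lap (u n p t) +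
    cub lam K (fun m q => u m q t) n p

/-- Amplitudes `u_{n,p}` that are complete for `n ≤ N`, except that `u_{n,±1}` may be missing for
`N' < n ≤ N`. -/
structure WkbFamily (lam : ℝ) (K : ℕ) (s : ℝ) (T : ℝ≥0∞) (g₀ : ℝ → L2) (N N' : ℤ)
    (u : ℤ → ℤ → ℝ → L2) : Prop where
  support : ∀ n p : ℤ, ¬(0 ≤ n ∧ n ≤ N ∧ Even n ∧ p ∈ harmonics n) → u n p = 0
  vanish : ∀ n p : ℤ, N' < n → (p = 1 ∨ p = -1) → u n p = 0
  conj : ∀ n p : ℤ, ∀ t ∈ timeSet T, u n (-p) t = star (u n p t)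
  reg : ∀ n p : ℤ, ∀ j : ℕ, n + j ≤ K + 2 → Cl j (s - 2 * n) T (u n p)
  reg' : ∀ n p : ℤ, ∀ j : ℕ, n + j ≤ K + 3 → ¬(p = 1 ∨ p = -1) → Cl j (s - 2 * n + 2) T (u n p)
  eqn : ∀ n p : ℤ, 0 ≤ n → n + 2 ≤ N → Even n → ¬(p = 1 ∨ p = -1) → ∀ t ∈ timeSet T, 0 < t →
    wkbW lam K u n p t + (1 - (p : ℂ) ^ 2) • u (n + 2) p t = 0
  eqn_one : ∀ n p : ℤ, 0 ≤ n → n ≤ N' → Even n → (p = 1 ∨ p = -1) → ∀ t ∈ timeSet T, 0 < t →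
    wkbW lam K u n p t = 0
  init_u : ∀ n : ℤ, 2 ≤ n → n ≤ N' → Even n → ∑ p ∈ harmonics n, u n p 0 = 0
  init_v : ∀ n : ℤ, 2 ≤ n → n ≤ N' → Even n →
    ∑ p ∈ harmonics n, ((Complex.I * p) • u n p 0 + Dt (u (n - 2) p) 0) = 0
  leading : u 0 1 = g₀

lemma wkbW_congr (h : ∀ m ≤ n, ∀ q, z m q = u m q) (t : ℝ) :
    wkbW lam K z n p t = wkbW lam K u n p t := by
  rw [wkbW, wkbW, h (n - 2) (by omega), h n le_rfl,
    cub_congr (z := fun m q => u m q t) fun m hm q => by rw [h m hm]]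

lemma dt_star {ρ : ℝ} (hρ : 0 ≤ ρ) {f g : ℝ → L2} (hf : DtHs ρ T f (Dt f))
    (hg : ∀ t ∈ timeSet T, g t = star (f t)) : ∀ t ∈ timeSet T, Dt g t = star (Dt f t) :=
  fun _ ht => ((hf.conj hρ).congr hg fun _ _ => rfl).dt_eq ht

lemma memHs_of_reg (hs : 2 * (K : ℝ) + 5 < s)
    (hreg : ∀ n p : ℤ, ∀ j : ℕ, n + j ≤ K + 2 → Cl j (s - 2 * n) T (u n p)) {t : ℝ}
    (ht : t ∈ timeSet T) : ∀ i ∈ wkbIdx K, MemHs (s - 2 * K - 4) (u i.1 i.2 t) := by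
  intro i hi
  have hi' := (Finset.mem_Icc.1 (mem_wkbIdx.1 hi).1).2
  have h1 : (i.1 : ℝ) ≤ K + 2 := by exact_mod_cast hi'
  exact MemHs.of_le (by linarith) (by linarith)
    (((hreg i.1 i.2 0 (by simpa using hi')).contHs t ht).1)

lemma star_wkbW (hs : 2 * (K : ℝ) + 5 < s) (hconj : ∀ n p : ℤ, ∀ t ∈ timeSet T, u n (-p) t = star (u n p t))
    (hreg : ∀ n p : ℤ, ∀ j : ℕ, n + j ≤ K + 2 → Cl j (s - 2 * n) T (u n p)) (hn : n ≤ K) {t : ℝ}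
    (ht : t ∈ timeSet T) : star (wkbW lam K u n p t) = wkbW lam K u n (-p) t := by
  have hnK : (n : ℝ) ≤ K := by exact_mod_cast hn
  have h1 := hreg n p 1 (by push_cast; omega)
  have h2 := hreg (n - 2) p 2 (by push_cast; omega)
  push_cast at h1 h2
  have e1 := dt_star (by linarith) h1.dtHs (hconj n p) t ht
  have e2 := dt_star (by linarith) h2.dtHs (hconj (n - 2) p)
  have e3 := dt_star (by linarith) h2.dt.dtHs e2 t ht
  have e4 := star_cub (lam := lam) (n := n) (p := p) (w := fun m q => u m q t) (by linarith : 1 < s - 2 * (K : ℝ) - 4)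
    (memHs_of_reg hs hreg ht) (fun m q => hconj m q t ht)
  have e5 := star_lap (MemHs.of_le (by norm_num) (by linarith : (2 : ℝ) ≤ s - 2 * n)
    ((h1.contHs t ht).1))
  have e6 : star (2 * Complex.I * (p : ℂ)) = 2 * Complex.I * ((-p : ℤ) : ℂ) := by simp
  rw [wkbW, wkbW, star_add', star_sub', star_add', star_smul', e4, e5, e6, e1, e3, hconj n p t ht]

lemma harmonics_subset {m : ℤ} (hmn : m ≤ n) (hm : Even m) (hn : Even n) :
    harmonics m ⊆ harmonics n := by
  intro q hq
  rw [mem_harmonics] at hq ⊢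
  rw [if_pos hm] at hq
  rw [if_pos hn]
  exact ⟨hq.1, by omega⟩

/-- Count of derivatives: `∂ₜ²u_{n-2}` lies in `H^{s-2(n-2)-4} = H^{s-2n}`, while `∂ₜu_n` and `Δu_n`
lie in `H^{s-2n-2}`, which is the loss of one step. -/
lemma cl_wkbW (hs : 2 * (K : ℝ) + 5 < s)
    (hreg : ∀ n p : ℤ, ∀ j : ℕ, n + j ≤ K + 2 → Cl j (s - 2 * n) T (u n p)) {j : ℕ}
    (hn : n + j ≤ K + 1) : Cl j (s - 2 * n - 2) T (wkbW lam K u n p) := by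
  have hnK : (n : ℝ) + j ≤ K + 1 := by exact_mod_cast hn
  have hρ : 2 * (j : ℝ) ≤ s - 2 * n - 2 := by linarith
  have h1 := (hreg n p (j + 1) (by push_cast; omega)).dt
  have h2 := (hreg (n - 2) p (j + 1 + 1) (by push_cast; omega)).dt.dt
  have h3 := hreg n p j (by omega)
  have h4 : Cl j (s - 2 * n) T fun t => cub lam K (fun m q => u m q t) n p := by
    refine cl_cub (u := u) (by linarith) fun i hi hin => ?_
    have : (i.1 : ℝ) ≤ n := by exact_mod_cast hin
    exact (hreg i.1 i.2 j (by omega)).of_le (by linarith) (by linarith)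
  push_cast at h2
  have h5 : Cl j (s - 2 * n - 2) T (Dt (Dt (u (n - 2) p))) := h2.of_le hρ (by linarith)
  have h6 : Cl j (s - 2 * n - 2) T fun t => lap (u n p t) :=
    Cl.lap hρ (by rwa [sub_add_cancel])
  have h7 : Cl j (s - 2 * n - 2) T fun t => cub lam K (fun m q => u m q t) n p :=
    h4.of_le hρ (by linarith)
  unfold wkbW
  exact ((h5.add hρ (h1.smul hρ (2 * Complex.I * p))).sub hρ h6).add hρ h7

variable {g₀ : ℝ → L2} {N : ℤ}

/-- The amplitudes `u_{N+2,p}`, `p ≠ ±1`, are determined algebraically. -/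
lemma WkbFamily.extend (hs : 2 * (K : ℝ) + 5 < s) (hN0 : 0 ≤ N) (hNe : Even N) (hNK : N ≤ K)
    (h : WkbFamily lam K s T g₀ N N u) : ∃ u', WkbFamily lam K s T g₀ (N + 2) N u' := by
  -- The recurrence at order `N` solved for `u_{N+2,p}`; `1 - p²` is invertible precisely for `p ≠
  -- ±1`.
  set u' : ℤ → ℤ → ℝ → L2 := fun n p => if n = N + 2 ∧ ¬(p = 1 ∨ p = -1) then
    fun t => ((p : ℂ) ^ 2 - 1)⁻¹ • wkbW lam K u N p t else u n p with hu'
  have hold : ∀ m ≤ N, ∀ q, u' m q = u m q := fun m hm q => by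
    rw [hu']
    exact if_neg fun hc => by omega
  have hone : ∀ m q, (q = 1 ∨ q = -1) → u' m q = u m q := fun m q hq => by
    rw [hu']
    exact if_neg fun hc => hc.2 hq
  have hne : ∀ m q, m ≠ N + 2 → u' m q = u m q := fun m q hm => by
    rw [hu']
    exact if_neg fun hc => hm hc.1
  have hnew : ∀ q, ¬(q = 1 ∨ q = -1) →
      u' (N + 2) q = fun t => ((q : ℂ) ^ 2 - 1)⁻¹ • wkbW lam K u N q t := fun q hq => by
    rw [hu']
    exact if_pos ⟨rfl, hq⟩
  have hNK' : (N : ℝ) ≤ K := by exact_mod_cast hNK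
  have hodd : ∀ m q, ¬Even m → u m q = 0 := fun m q hm => h.support m q fun hc => hm hc.2.2.1
  have hreg' : ∀ q, ¬(q = 1 ∨ q = -1) → ∀ j : ℕ, N + j ≤ K + 1 →
      Cl j (s - 2 * N - 2) T (u' (N + 2) q) := fun q hq j hj => by
    have hj' : (N : ℝ) + j ≤ K + 1 := by exact_mod_cast hj
    rw [hnew q hq]
    exact (cl_wkbW hs h.reg hj).smul (by linarith) _
  have hone0 : ∀ q, (q = 1 ∨ q = -1) → u' (N + 2) q = 0 := fun q hq => by
    rw [hone _ q hq, h.vanish _ q (by omega) hq]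
  refine ⟨u', ?_, ?_, ?_, ?_, ?_, ?_, ?_, ?_, ?_, ?_⟩
  · intro m q hmq
    by_cases hm : m = N + 2
    · subst hm
      by_cases hq : q = 1 ∨ q = -1
      · exact hone0 q hq
      -- Outside the harmonics of the order `N + 2` all terms of the recurrence vanish, the cubic
      -- one by `cub_of_not_mem`.
      have hqn : q ∉ harmonics (N + 2) := fun hc =>
        hmq ⟨by omega, le_rfl, hNe.add even_two, hc⟩
      have h1 : u (N - 2) q = 0 := h.support _ _ fun hc =>
        hqn (harmonics_subset (by omega) hc.2.2.1 (hNe.add even_two) hc.2.2.2)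
      have h2 : u N q = 0 := h.support _ _ fun hc =>
        hqn (harmonics_subset (by omega) hc.2.2.1 (hNe.add even_two) hc.2.2.2)
      rw [hnew q hq]
      funext t
      rw [wkbW, h1, h2, dt_zero, dt_zero, cub_of_not_mem (fun m q hm => by rw [hodd m q hm]; rfl)
        hNe hqn]
      simp [lap_zero]
    · rw [hne m q hm]
      exact h.support m q fun hc => hmq ⟨hc.1, by omega, hc.2.2⟩
  · intro m q hm hq
    rw [hone m q hq, h.vanish m q hm hq]
  · intro m q t ht
    by_cases hm : m = N + 2
    · subst hm
      by_cases hq : q = 1 ∨ q = -1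
      · rw [hone0 q hq, hone0 (-q) (by omega)]
        exact star_zero'.symm
      · rw [hnew q hq, hnew (-q) (by omega)]
        simp only
        rw [star_smul', star_wkbW hs h.conj h.reg hNK ht]
        simp
    · rw [hne _ _ hm, hne _ _ hm, h.conj m q t ht]
  · intro m q j hj
    by_cases hm : m = N + 2
    · subst hm
      by_cases hq : q = 1 ∨ q = -1
      · rw [hone0 q hq]
        exact cl_zero ..
      · have hj' : (N : ℝ) + 2 + j ≤ K + 2 := by exact_mod_cast hj
        push_cast
        exact (hreg' q hq j (by omega)).of_le (by linarith) (by linarith)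
    · rw [hne m q hm]
      exact h.reg m q j hj
  -- The algebraic formula gives these amplitudes one more time derivative and two more space
  -- derivatives than `reg` demands. At the order `K + 2` this gain is essential.
  · intro m q j hj hq
    by_cases hm : m = N + 2
    · subst hm
      have := hreg' q hq j (by omega)
      convert this using 1
      push_cast
      ring
    · rw [hne m q hm]
      exact h.reg' m q j hj hq
  · intro m q hm0 hmN hme hq t ht ht0
    rw [wkbW_congr fun k hk => hold k (by omega)]
    rcases eq_or_ne m N with rfl | hmN'
    · rw [hnew q hq]
      have hq2 : (q : ℂ) ^ 2 - 1 ≠ 0 := by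
        intro h0
        have h1 : q ^ 2 = 1 := by
          have : ((q ^ 2 : ℤ) : ℂ) = (1 : ℤ) := by push_cast; linear_combination h0
          exact_mod_cast this
        have h2 : (q - 1) * (q + 1) = 0 := by linear_combination h1
        rcases mul_eq_zero.1 h2 with h2 | h2 <;> exact hq (by omega)
      have h3 : (1 - (q : ℂ) ^ 2) * ((q : ℂ) ^ 2 - 1)⁻¹ = -1 := by
        field_simp
        ring
      simp only
      rw [smul_smul, h3, neg_one_smul, add_neg_cancel]
    · have hmN2 : m + 2 ≤ N := by
        obtain ⟨a, ha⟩ := hme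
        obtain ⟨b, hb⟩ := hNe
        omega
      rw [hold _ hmN2]
      exact h.eqn m q hm0 hmN2 hme hq t ht ht0
  · intro m q hm0 hmN hme hq t ht ht0
    rw [wkbW_congr fun k hk => hold k (by omega)]
    exact h.eqn_one m q hm0 hmN hme hq t ht ht0
  · intro m hm hmN hme
    simp only [hold m hmN]
    exact h.init_u m hm hmN hme
  · intro m hm hmN hme
    simp only [hold m hmN, hold (m - 2) (by omega : m - 2 ≤ N)]
    exact h.init_v m hm hmN hme
  · rw [hold 0 hN0, h.leading]

end Family

/-! ### The linear Schrödinger equation for the resonant amplitudes. -/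

section Schrodinger

variable {lam : ℝ} {K : ℕ} {s : ℝ} {T : ℝ≥0∞} {u : ℤ → ℤ → ℝ → L2} {n p : ℤ}

/-- Replace the entries with the indices `(n, 1)` and `(n, -1)`. -/
def replaceAt {X : Type*} (n : ℤ) (x y : X) (w : ℤ → ℤ → X) (m q : ℤ) : X :=
  if m = n ∧ q = 1 then x else if m = n ∧ q = -1 then y else w m q

lemma replaceAt_one {X : Type*} (x y : X) (w : ℤ → ℤ → X) : replaceAt n x y w n 1 = x :=
  if_pos ⟨rfl, rfl⟩

lemma replaceAt_neg_one {X : Type*} (x y : X) (w : ℤ → ℤ → X) : replaceAt n x y w n (-1) = y := by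
  rw [replaceAt, if_neg (by simp), if_pos ⟨rfl, rfl⟩]

lemma replaceAt_of_ne {X : Type*} (x y : X) (w : ℤ → ℤ → X) {m : ℤ} (hm : m ≠ n) (q : ℤ) :
    replaceAt n x y w m q = w m q := by
  rw [replaceAt, if_neg fun h => hm h.1, if_neg fun h => hm h.1]

lemma replaceAt_of_not {X : Type*} (x y : X) (w : ℤ → ℤ → X) (m : ℤ) {q : ℤ}
    (hq : ¬(q = 1 ∨ q = -1)) : replaceAt n x y w m q = w m q := by
  rw [replaceAt, if_neg fun h => hq (Or.inl h.2), if_neg fun h => hq (Or.inr h.2)]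

/-- Induction principle for the entries of `replaceAt`. -/
lemma replaceAt_cases {X : Type*} {x y : X} {w : ℤ → ℤ → X} {P : ℤ → ℤ → X → Prop}
    (h1 : P n 1 x) (h2 : P n (-1) y) (m q : ℤ)
    (h : (m = n → ¬(q = 1 ∨ q = -1)) → P m q (w m q)) : P m q (replaceAt n x y w m q) := by
  rw [replaceAt]
  split_ifs with hc hc'
  · rw [hc.1, hc.2]; exact h1
  · rw [hc'.1, hc'.2]; exact h2
  · exact h fun hm hq => hq.elim (fun h => hc ⟨hm, h⟩) fun h => hc' ⟨hm, h⟩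

/-- The linearized cubic term, as a function of the unknown `u_{n,1}` on the frequency side. -/
def linN (lam : ℝ) (K : ℕ) {ρ : ℝ} (hρ : 1 < ρ) (n : ℤ) (α : ℤ → ℤ → ℝ → L2) (β : ℝ → L2) (t : ℝ)
    (h : L2) : L2 :=
  (-(2 * Complex.I)⁻¹) •
    (cubF lam K hρ (replaceAt n h (conjFreq h) fun m q => α m q t) n 1 + β t)

variable {ρ : ℝ} {α : ℤ → ℤ → ℝ → L2} {β : ℝ → L2}

lemma exists_norm_le_family (hα : ∀ m q, ContinuousOn (α m q) (timeSet T)) {T' : ℝ}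
    (hT' : T' ∈ timeSet T) :
    ∃ R : ℝ, 0 ≤ R ∧ ∀ t ∈ Icc 0 T', ∀ i ∈ wkbIdx K, ‖α i.1 i.2 t‖ ≤ R := by
  have hc : ContinuousOn (fun t => ∑ i ∈ wkbIdx K, ‖α i.1 i.2 t‖) (timeSet T) :=
    continuousOn_finsetSum _ fun i _ => (hα i.1 i.2).norm
  obtain ⟨R, hR, h⟩ := exists_norm_le_on_Icc hc hT'
  refine ⟨R, hR, fun t ht i hi => ?_⟩
  exact (Finset.single_le_sum (f := fun i : ℤ × ℤ => ‖α i.1 i.2 t‖) (fun _ _ => norm_nonneg _)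
    hi).trans ((le_abs_self _).trans (h t ht))

lemma linN_admissible (hρ : 1 < ρ) (hα : ∀ m q, ContinuousOn (α m q) (timeSet T))
    (hβ : ContinuousOn β (timeSet T)) : Admissible (linN lam K hρ n α β) T where
  cont h := by
    have hr : ∀ m q, ContinuousOn
        (fun t => replaceAt n h (conjFreq h) (fun m q => α m q t) m q) (timeSet T) := by
      intro m q
      unfold replaceAt
      split_ifs
      · exact continuousOn_const
      · exact continuousOn_const
      · exact hα m q
    have h1 : ContinuousOn (fun t => cubF lam K hρ
        (replaceAt n h (conjFreq h) fun m q => α m q t) n 1) (timeSet T) := by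
      unfold cubF tripleSum
      refine ContinuousOn.const_smul ?_ (lam : ℂ)
      refine continuousOn_finsetSum _ fun i _ => continuousOn_finsetSum _ fun j _ =>
        continuousOn_finsetSum _ fun k _ => ?_
      split_ifs
      · exact continuousOn_tri hρ (hr _ _) (hr _ _) (hr _ _)
      · exact continuousOn_const
    exact (h1.add hβ).const_smul (-(2 * Complex.I)⁻¹ : ℂ)
  lip T' hT' R₀ := by
    obtain ⟨R, hR, hαR⟩ := exists_norm_le_family (K := K) hα hT'
    have hκ := triConst_nonneg hρ
    set Q := R + max R₀ 0 with hQ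
    have hQ0 : 0 ≤ Q := by positivity
    set C := ‖-(2 * Complex.I)⁻¹‖ * (|lam| * (((wkbIdx K).card : ℝ) ^ 3 *
      (triConst hρ * Q ^ 2 * 3))) with hC
    refine ⟨C.toNNReal, fun t ht => LipschitzOnWith.of_dist_le_mul fun x hx y hy => ?_⟩
    rw [mem_closedBall_zero_iff] at hx hy
    have hsub : ∀ i ∈ wkbIdx K, ‖replaceAt n x (conjFreq x) (fun m q => α m q t) i.1 i.2 -
        replaceAt n y (conjFreq y) (fun m q => α m q t) i.1 i.2‖ ≤ ‖x - y‖ := by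
      intro i _
      unfold replaceAt
      split_ifs
      · exact le_rfl
      · rw [← conjFreqL_apply, ← conjFreqL_apply, ← map_sub, conjFreqL_apply, norm_conjFreq]
      · rw [sub_self, norm_zero]; exact norm_nonneg _
    have hbd : ∀ x : L2, ‖x‖ ≤ R₀ → ∀ i ∈ wkbIdx K,
        ‖replaceAt n x (conjFreq x) (fun m q => α m q t) i.1 i.2‖ ≤ Q := by
      intro x hx i hi
      have h1 : ‖x‖ ≤ Q := (hx.trans (le_max_left R₀ 0)).trans (le_add_of_nonneg_left hR)
      unfold replaceAt
      split_ifs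
      · exact h1
      · rwa [norm_conjFreq]
      · exact (hαR t ht i hi).trans (le_add_of_nonneg_right (le_max_right _ _))
    rw [dist_eq_norm, dist_eq_norm, Real.coe_toNNReal _ (by positivity), linN, linN, ← smul_sub,
      norm_smul, add_sub_add_right_eq_sub, cubF, cubF, ← smul_sub, norm_smul, Complex.norm_real,
      Real.norm_eq_abs, tripleSum_sub, hC]
    have key := norm_tripleSum_le (K := K) (q := (n, 1)) (C := triConst hρ * Q ^ 2 * (3 * ‖x - y‖))
      (F := fun i j k =>
        tri hρ (replaceAt n x (conjFreq x) (fun m q => α m q t) i.1 i.2)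
          (replaceAt n x (conjFreq x) (fun m q => α m q t) j.1 j.2)
          (replaceAt n x (conjFreq x) (fun m q => α m q t) k.1 k.2) -
        tri hρ (replaceAt n y (conjFreq y) (fun m q => α m q t) i.1 i.2)
          (replaceAt n y (conjFreq y) (fun m q => α m q t) j.1 j.2)
          (replaceAt n y (conjFreq y) (fun m q => α m q t) k.1 k.2)) (by positivity)
      fun i hi j hj k hk _ => (norm_tri_sub_le hρ (hbd x hx j hj) (hbd x hx k hk)
        (hbd y hy i hi) (hbd y hy j hj)).trans (by
          gcongr
          linarith [hsub i hi, hsub j hj, hsub k hk])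
    calc _ ≤ ‖-(2 * Complex.I)⁻¹‖ * (|lam| * (((wkbIdx K).card : ℝ) ^ 3 *
          (triConst hρ * Q ^ 2 * (3 * ‖x - y‖)))) := by gcongr
      _ = _ := by ring

/-- For `n > 0` at most one of three nonnegative orders with sum `n` can equal `n`, so the unknown
enters each product at most once. The growth is affine, and the equation is solvable on the whole
interval. -/
lemma norm_linN_le (hρ : 1 < ρ) (hn : 0 < n) (hα : ∀ m q, ContinuousOn (α m q) (timeSet T))
    (hβ : ContinuousOn β (timeSet T)) {T' : ℝ} (hT' : T' ∈ timeSet T) :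
    ∃ A c : ℝ, 0 ≤ A ∧ ∀ t ∈ Icc 0 T', ∀ x, ‖linN lam K hρ n α β t x‖ ≤ A * ‖x‖ + c := by
  obtain ⟨R, hR, hαR⟩ := exists_norm_le_family (K := K) hα hT'
  obtain ⟨B, hB, hβB⟩ := exists_norm_le_on_Icc hβ hT'
  have hκ := triConst_nonneg hρ
  set D := ‖-(2 * Complex.I)⁻¹‖ with hD
  set E := |lam| * ((wkbIdx K).card : ℝ) ^ 3 * (triConst hρ * R ^ 2) with hE
  refine ⟨D * E, D * (E * R + B), by positivity, fun t ht x => ?_⟩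
  have hbd : ∀ i ∈ wkbIdx K, ‖replaceAt n x (conjFreq x) (fun m q => α m q t) i.1 i.2‖ ≤
      if i.1 = n then R + ‖x‖ else R := by
    intro i hi
    unfold replaceAt
    split_ifs with h1 h2 h2 h3 h3
    · linarith
    · exact absurd h1.1 h2
    · rw [norm_conjFreq]; linarith
    · exact absurd h2.1 h3
    · exact (hαR t ht i hi).trans (by linarith [norm_nonneg x])
    · exact hαR t ht i hi
  have h1 : ‖cubF lam K hρ (replaceAt n x (conjFreq x) fun m q => α m q t) n 1‖ ≤
      E * (R + ‖x‖) := by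
    rw [cubF, norm_smul, Complex.norm_real, Real.norm_eq_abs]
    calc _ ≤ |lam| * (((wkbIdx K).card : ℝ) ^ 3 * (triConst hρ * (R ^ 2 * (R + ‖x‖)))) := by
          gcongr
          refine norm_tripleSum_le (by positivity) fun i hi j hj k hk hq => ?_
          obtain ⟨h1, h2, h3, h4, -⟩ := le_of_add_eq hi hj hk hq
          refine (norm_tri_le hρ _ _ _).trans ?_
          have hx := norm_nonneg x
          have hi' := hbd i hi
          have hj' := hbd j hj
          have hk' := hbd k hk
          by_cases hin : i.1 = n
          · rw [if_pos hin] at hi'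
            rw [if_neg (by omega)] at hj' hk'
            calc _ ≤ triConst hρ * ((R + ‖x‖) * R * R) := by gcongr
              _ = _ := by ring
          rw [if_neg hin] at hi'
          by_cases hjn : j.1 = n
          · rw [if_pos hjn] at hj'
            rw [if_neg (by omega)] at hk'
            calc _ ≤ triConst hρ * (R * (R + ‖x‖) * R) := by gcongr
              _ = _ := by ring
          rw [if_neg hjn] at hj'
          have hk'' := hk'.trans (show (if k.1 = n then R + ‖x‖ else R) ≤ R + ‖x‖ by
            split_ifs <;> linarith)
          calc _ ≤ triConst hρ * (R * R * (R + ‖x‖)) := by gcongr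
            _ = _ := by ring
      _ = _ := by rw [hE]; ring
  calc ‖linN lam K hρ n α β t x‖ ≤ D * (E * (R + ‖x‖) + B) := by
        rw [linN, norm_smul]
        gcongr
        exact (norm_add_le _ _).trans (add_le_add h1 (hβB t ht))
    _ = _ := by ring

lemma Flow.exists_global {X : Type*} [NormedAddCommGroup X] [NormedSpace ℝ X] [CompleteSpace X]
    (S : Flow X) {V : ℝ → X → X} (hV : Admissible V T) (hT : 0 < T)
    (hgrow : ∀ T' ∈ timeSet T, ∃ A c : ℝ, 0 ≤ A ∧ ∀ t ∈ Icc 0 T', ∀ x, ‖V t x‖ ≤ A * ‖x‖ + c)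
    (x₀ : X) : ∃ y, IsSol (S.interaction V) x₀ T y := by
  refine (S.interaction_admissible hV).exists_global hT (fun T' hT' => ?_) x₀
  obtain ⟨A, c, hA, h⟩ := hgrow T' hT'
  refine ⟨S.bd * A * S.bd, S.bd * c, fun t ht x => ?_⟩
  have hS := S.bd_nonneg
  calc ‖S.interaction V t x‖ ≤ S.bd * ‖V t (S t x)‖ := S.bound _ _
    _ ≤ S.bd * (A * ‖S t x‖ + c) := by gcongr; exact h t ht _
    _ ≤ S.bd * (A * (S.bd * ‖x‖) + c) := by gcongr; exact S.bound _ _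
    _ = _ := by ring

/-- The linear Schrödinger equation for `u_{n,1}`. -/
lemma exists_linear (hT : 0 < T) (hρ : 2 ≤ ρ) (hn : 0 < n)
    (hu : ∀ m q, ContHs ρ T (u m q)) {b : ℝ → L2} (hb : ContHs ρ T b) {a : L2} (ha : MemHs ρ a) :
    ∃ g : ℝ → L2, g 0 = a ∧ ContHs ρ T g ∧ ∀ t ∈ timeSet T, 0 < t →
      HasDerivAt g ((2 * Complex.I)⁻¹ • (lap (g t) -
        (cub lam K (replaceAt n (g t) (star (g t)) fun m q => u m q t) n 1 + b t))) t := by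
  have hρ0 : 0 ≤ ρ := by linarith
  have hρ1 : 1 < ρ := by linarith
  obtain ⟨τ, hτ, rfl⟩ : ∃ τ, 0 ≤ τ ∧ ρ = τ + 2 := ⟨ρ - 2, by linarith, by ring⟩
  obtain ⟨β, hβ, hbβ⟩ := (contHs_iff hρ0).1 hb
  choose α hα huα using fun m q => (contHs_iff hρ0).1 (hu m q)
  obtain ⟨a', rfl⟩ := exists_ofFreq hρ0 ha
  obtain ⟨y, hy⟩ := schrFlow.exists_global (linN_admissible (lam := lam) (K := K) (n := n) hρ1 hα hβ)
    hT (fun T' hT' => norm_linN_le hρ1 hn hα hβ hT') a'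
  refine ⟨fun t => ofFreq (τ + 2) (schrFlow t (y t)), ?_, ?_, fun t ht ht0 => ?_⟩
  · beta_reduce
    rw [schrFlow.zero, hy.init]
    rfl
  · exact (contHs_iff hρ0).2 ⟨_, fun t ht =>
      schrFlow.tendsto (tendsto_id.mono_left nhdsWithin_le_nhds) (hy.continuousOn t ht),
      fun _ _ => rfl⟩
  · have h1 := schr_strong hτ ((hy.deriv t ht).hasDerivAt (Ici_mem_nhds ht0))
    refine h1.congr_deriv ?_
    set h := schrFlow t (y t) with hh
    have h2 : (fun m q => ofFreq (τ + 2) (replaceAt n h (conjFreq h) (fun m q => α m q t) m q)) =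
        replaceAt n (ofFreq (τ + 2) h) (star (ofFreq (τ + 2) h)) fun m q => u m q t := by
      funext m q
      unfold replaceAt
      split_ifs
      · rfl
      · rw [star_ofFreq hρ0]
      · exact (huα m q t ht).symm
    rw [linN, ofFreq_smul, ofFreq_add, ofFreq_cubF, h2, lap_ofFreq hτ, ← hbβ t ht, smul_sub,
      neg_smul, sub_eq_add_neg]

end Schrodinger

/-! ### Determination of `u_{N+2,±1}` and cancellation of the initial data. -/

section Solve

variable {lam : ℝ} {K : ℕ} {s : ℝ} {T : ℝ≥0∞} {u : ℤ → ℤ → ℝ → L2} {N : ℤ} {g₀ : ℝ → L2}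

lemma zero_mem_timeSet (hT : 0 < T) : (0 : ℝ) ∈ timeSet T :=
  ⟨le_rfl, by rwa [ENNReal.ofReal_zero]⟩

lemma harmonics_even {n p : ℤ} (hn : Even n) : p ∈ harmonics n ↔ Odd p ∧ |p| ≤ n + 1 := by
  rw [mem_harmonics, if_pos hn]

lemma one_mem_harmonics {n : ℤ} (hn : Even n) (h0 : 0 ≤ n) : 1 ∈ harmonics n :=
  (harmonics_even hn).2 ⟨odd_one, by rw [abs_one]; omega⟩

lemma neg_one_mem_harmonics {n : ℤ} (hn : Even n) (h0 : 0 ≤ n) : -1 ∈ harmonics n :=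
  neg_mem_harmonics.2 (one_mem_harmonics hn h0)

lemma sum_harmonics_neg {M : Type*} [AddCommMonoid M] (n : ℤ) (f : ℤ → M) :
    ∑ p ∈ harmonics n, f (-p) = ∑ p ∈ harmonics n, f p :=
  Finset.sum_nbij' (fun p => -p) (fun p => -p) (fun _ h => neg_mem_harmonics.2 h)
    (fun _ h => neg_mem_harmonics.2 h) (fun _ _ => neg_neg _) (fun _ _ => neg_neg _)
    fun _ _ => rfl

/-- The initial value of `u_{n,1}`. -/
def slowDatum (u : ℤ → ℤ → ℝ → L2) (n : ℤ) (t : ℝ) : L2 :=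
  (1 / 2 : ℂ) • (Complex.I • ∑ p ∈ harmonics n, ((Complex.I * p) • u n p t + Dt (u (n - 2) p) t) -
    ∑ p ∈ harmonics n, u n p t)

lemma sum_replaceAt {n : ℤ} (hn : Even n) (h0 : 0 ≤ n) (x y : L2) (w : ℤ → ℤ → L2)
    (h1 : w n 1 = 0) (h2 : w n (-1) = 0) (c : ℤ → ℂ) :
    ∑ p ∈ harmonics n, c p • replaceAt n x y w n p =
      ∑ p ∈ harmonics n, c p • w n p + c 1 • x + c (-1) • y := by
  have h : ∀ p, c p • replaceAt n x y w n p =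
      c p • w n p + (if p = 1 then c 1 • x else 0) + if p = -1 then c (-1) • y else 0 := by
    intro p
    by_cases hp : p = 1
    · subst hp
      rw [replaceAt_one, h1, if_pos rfl, if_neg (by norm_num), smul_zero, zero_add, add_zero]
    by_cases hp' : p = -1
    · subst hp'
      rw [replaceAt_neg_one, h2, if_pos rfl, if_neg hp, smul_zero, zero_add, zero_add]
    · rw [replaceAt_of_not _ _ _ _ (by omega), if_neg hp, if_neg hp', add_zero, add_zero]
  rw [Finset.sum_congr rfl fun p _ => h p, Finset.sum_add_distrib, Finset.sum_add_distrib,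
    Finset.sum_ite_eq', Finset.sum_ite_eq', if_pos (one_mem_harmonics hn h0),
    if_pos (neg_one_mem_harmonics hn h0)]

/-- The amplitudes `u_{N+2,±1}` are determined by a linear Schrödinger equation. -/
lemma WkbFamily.solve (hT : 0 < T) (hs : 2 * (K : ℝ) + 5 < s) (hN0 : 0 ≤ N) (hNe : Even N)
    (hNK : N + 2 ≤ K) (h : WkbFamily lam K s T g₀ (N + 2) N u) :
    ∃ u', WkbFamily lam K s T g₀ (N + 2) (N + 2) u' := by
  set n := N + 2 with hn
  have hne : Even n := hNe.add even_two
  have hn2 : n - 2 = N := by omega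
  have hnK' : (n : ℝ) ≤ K := by exact_mod_cast hNK
  have hnN : (n : ℝ) = N + 2 := by rw [hn]; push_cast; ring
  set ρ := s - 2 * n with hρ
  have h0T := zero_mem_timeSet hT
  have hodd : ∀ m q, ¬Even m → u m q = 0 := fun m q hm => h.support m q fun hc => hm hc.2.2.1
  have hbig : ∀ m q, n < m → u m q = 0 := fun m q hm => h.support m q fun hc => by omega
  have hun1 : u n 1 = 0 := h.vanish n 1 (by omega) (Or.inl rfl)
  have hunm : u n (-1) = 0 := h.vanish n (-1) (by omega) (Or.inr rfl)
  have hu : ∀ m q (j : ℕ), n + j ≤ K + 2 → Cl j ρ T (u m q) := by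
    intro m q j hj
    rcases lt_or_ge n m with hm | hm
    · rw [hbig m q hm]; exact cl_zero ..
    · have hm' : (m : ℝ) ≤ n := by exact_mod_cast hm
      have hj' : (n : ℝ) + j ≤ K + 2 := by exact_mod_cast hj
      exact (h.reg m q j (by omega)).of_le (by linarith) (by linarith)
  have hb : ∀ q (j : ℕ), n + j ≤ K + 2 → Cl j ρ T (Dt (Dt (u N q))) := fun q j hj => by
    have h1 := (h.reg N q (j + 1 + 1) (by push_cast; omega)).dt.dt
    have : s - 2 * N - 2 - 2 = ρ := by rw [hρ, hnN]; ring
    rwa [this] at h1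
  have ha : MemHs ρ (slowDatum u n 0) := by
    have h1 : Cl 0 ρ T (slowDatum u n) := by
      have e0 : 2 * ((0 : ℕ) : ℝ) ≤ ρ := by push_cast; linarith
      refine Cl.smul e0 _ (Cl.sub e0 (Cl.smul e0 _ (Cl.sum e0 _ fun p _ => Cl.add e0
        (Cl.smul e0 _ (hu n p 0 (by omega))) ?_)) (Cl.sum e0 _ fun p _ => hu n p 0 (by omega)))
      rw [hn2]
      exact (h.reg N p 1 (by omega)).dt.of_le e0 (by linarith)
    exact (h1.contHs 0 h0T).1
  obtain ⟨g, hg0, hgc, hgd⟩ := exists_linear (lam := lam) (K := K) (n := n) hT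
    (by linarith : 2 ≤ ρ) (by omega) (fun m q => (hu m q 0 (by omega)).contHs)
    (hb 1 0 (by omega)).contHs ha
  set u' : ℤ → ℤ → ℝ → L2 := replaceAt n g (fun t => star (g t)) u with hu'
  have hu't : ∀ t, (fun m q => u' m q t) =
      replaceAt n (g t) (star (g t)) fun m q => u m q t := fun t => by
    funext m q
    rw [hu', replaceAt, replaceAt]
    split_ifs <;> rfl
  have hu'n : ∀ q, u' n q 0 = replaceAt n (g 0) (star (g 0)) (fun m q => u m q 0) n q := fun q =>
    congrFun (congrFun (hu't 0) n) q
  have hold : ∀ m, m ≠ n → ∀ q, u' m q = u m q := fun m hm q => replaceAt_of_ne _ _ _ hm q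
  have hnot : ∀ m q, ¬(q = 1 ∨ q = -1) → u' m q = u m q := fun m q hq =>
    replaceAt_of_not _ _ _ m hq
  have hgCl : ∀ j : ℕ, n + j ≤ K + 2 → Cl j ρ T g := by
    intro j hj
    have hj' : (n : ℝ) + j ≤ K + 2 := by exact_mod_cast hj
    -- The source contains `g` through the cubic term, so its time regularity is known only as far
    -- as that of `g`; `Cl.of_schrodinger` is made for this.
    refine Cl.of_schrodinger (by linarith) hgc hgd fun i hij hgi => ?_
    have hij' : (i : ℝ) + 1 ≤ j := by exact_mod_cast hij
    have hiρ : 2 * (i : ℝ) ≤ ρ - 2 := by linarith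
    refine Cl.add hiρ ?_ ((hb 1 i (by omega)).of_le hiρ (by linarith))
    have h1 : Cl i ρ T fun t => cub lam K (fun m q => u' m q t) n 1 := by
      refine cl_cub (u := u') (by linarith) fun k _ _ => ?_
      refine replaceAt_cases (P := fun _ _ f => Cl i ρ T f) hgi (hgi.conj (by linarith)) k.1 k.2
        fun _ => hu k.1 k.2 i (by omega)
    simp only [hu't] at h1
    exact h1.of_le hiρ (by linarith)
  have hreg : ∀ m q : ℤ, ∀ j : ℕ, m + j ≤ K + 2 → Cl j (s - 2 * m) T (u' m q) := by
    intro m q j hj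
    by_cases hm : m = n
    · subst hm
      have hj' : (n : ℝ) + j ≤ K + 2 := by exact_mod_cast hj
      exact replaceAt_cases (P := fun _ _ f => Cl j ρ T f) (hgCl j hj)
        ((hgCl j hj).conj (by linarith)) n q fun _ => h.reg n q j hj
    · rw [hold m hm]
      exact h.reg m q j hj
  have hconj : ∀ m q : ℤ, ∀ t ∈ timeSet T, u' m (-q) t = star (u' m q t) := by
    intro m q t ht
    by_cases hm : m = n
    · subst hm
      by_cases h1 : q = 1
      · rw [h1, hu', replaceAt_one, replaceAt_neg_one]
      by_cases h2 : q = -1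
      · rw [h2, neg_neg, hu', replaceAt_one, replaceAt_neg_one, star_star]
      · rw [hnot _ _ (by omega), hnot _ _ (by omega), h.conj _ q t ht]
    · rw [hold m hm, hold m hm, h.conj m q t ht]
  have heq1 : ∀ t ∈ timeSet T, 0 < t → wkbW lam K u' n 1 t = 0 := by
    intro t ht ht0
    have hDt : Dt (u' n 1) t = (2 * Complex.I)⁻¹ • (lap (g t) -
        (cub lam K (replaceAt n (g t) (star (g t)) fun m q => u m q t) n 1 + Dt (Dt (u N 1)) t)) := by
      rw [hu', replaceAt_one]
      exact ((hgd t ht ht0).hasDerivWithinAt).derivWithin (uniqueDiffOn_Ici 0 t ht.1)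
    rw [wkbW, hDt, hu't t, hn2, hold N (by omega), hu', replaceAt_one, smul_smul]
    have : 2 * Complex.I * ((1 : ℤ) : ℂ) * (2 * Complex.I)⁻¹ = 1 := by
      have := Complex.I_ne_zero
      push_cast
      field_simp
    rw [this, one_smul]
    abel
  have hS : star (∑ p ∈ harmonics n, u n p 0) = ∑ p ∈ harmonics n, u n p 0 := by
    rw [star_sum', ← sum_harmonics_neg]
    exact Finset.sum_congr rfl fun p _ => by rw [← h.conj _ _ 0 h0T, neg_neg]
  have hV : star (∑ p ∈ harmonics n, ((Complex.I * p) • u n p 0 + Dt (u (n - 2) p) 0)) =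
      ∑ p ∈ harmonics n, ((Complex.I * p) • u n p 0 + Dt (u (n - 2) p) 0) := by
    rw [star_sum', ← sum_harmonics_neg]
    refine Finset.sum_congr rfl fun p _ => ?_
    have h1 := dt_star (by linarith) (h.reg N (-p) 1 (by push_cast; omega)).dtHs
      (h.conj N (-p)) 0 h0T
    rw [neg_neg] at h1
    rw [star_add', star_smul', ← h.conj _ _ 0 h0T, hn2, ← h1, neg_neg]
    simp
  -- Write `S` and `V` for the sums of the known `u` and `v` data; both are real. The initial value
  -- `a = (iV - S)/2` is the solution of `a + ā = -S` and `i(a - ā) = -V`, the two cancellation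
  -- conditions.
  have hstar : star (g 0) = (1 / 2 : ℂ) • (-(Complex.I • ∑ p ∈ harmonics n,
      ((Complex.I * p) • u n p 0 + Dt (u (n - 2) p) 0)) - ∑ p ∈ harmonics n, u n p 0) := by
    rw [hg0, slowDatum, star_smul', star_sub', star_smul', hS, hV]
    simp
  refine ⟨u', ?_, ?_, hconj, hreg, ?_, ?_, ?_, ?_, ?_, ?_⟩
  · intro m q hmq
    by_cases hm : m = n
    · subst hm
      have hq : ¬(q = 1 ∨ q = -1) := by
        rintro (rfl | rfl)
        · exact hmq ⟨by omega, le_rfl, hne, one_mem_harmonics hne (by omega)⟩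
        · exact hmq ⟨by omega, le_rfl, hne, neg_one_mem_harmonics hne (by omega)⟩
      rw [hnot _ _ hq, h.support _ _ hmq]
    · rw [hold m hm, h.support m q hmq]
  · intro m q hm hq
    rw [hold m (by omega), h.vanish m q (by omega) hq]
  · intro m q j hj hq
    rw [hnot m q hq]
    exact h.reg' m q j hj hq
  · intro m q hm0 hmN hme hq t ht ht0
    rw [wkbW_congr (u := u) fun k hk => hold k (by omega), hnot _ _ hq]
    exact h.eqn m q hm0 hmN hme hq t ht ht0
  · intro m q hm0 hmN hme hq t ht ht0
    by_cases hm : m = n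
    · subst hm
      rcases hq with rfl | rfl
      · exact heq1 t ht ht0
      -- The equation for `p = -1` is the conjugate of that for `p = 1`.
      · rw [← star_wkbW hs hconj hreg hNK ht, heq1 t ht ht0, star_zero']
    · rw [wkbW_congr (u := u) fun k hk => hold k (by omega)]
      obtain ⟨a, ha⟩ := hme
      obtain ⟨b, hb⟩ := hNe
      exact h.eqn_one m q hm0 (by omega) ⟨a, ha⟩ hq t ht ht0
  · intro m hm2 hmn hme
    by_cases hm : m = n
    · subst hm
      have h1 := sum_replaceAt hne (by omega) (g 0) (star (g 0)) (fun m q => u m q 0)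
        (by rw [hun1]; rfl) (by rw [hunm]; rfl) fun _ => 1
      simp only [one_smul] at h1
      simp only [hu'n]
      rw [h1, hstar, hg0, slowDatum]
      module
    · simp only [hold m hm]
      obtain ⟨a, ha⟩ := hme
      obtain ⟨b, hb⟩ := hNe
      exact h.init_u m hm2 (by omega) ⟨a, ha⟩
  · intro m hm2 hmn hme
    by_cases hm : m = n
    · subst hm
      have h1 := sum_replaceAt hne (by omega) (g 0) (star (g 0)) (fun m q => u m q 0)
        (by rw [hun1]; rfl) (by rw [hunm]; rfl) fun p => Complex.I * p
      simp only [hu'n, hold (n - 2) (by omega : n - 2 ≠ n)]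
      rw [Finset.sum_add_distrib, h1, hstar, hg0, slowDatum, Finset.sum_add_distrib]
      have hI : Complex.I * Complex.I = -1 := Complex.I_mul_I
      match_scalars <;> first | ring1 | linear_combination hI
    · simp only [hold m hm, hold (m - 2) (by omega : m - 2 ≠ n)]
      obtain ⟨a, ha⟩ := hme
      obtain ⟨b, hb⟩ := hNe
      exact h.init_v m hm2 (by omega) ⟨a, ha⟩
  · rw [hold 0 (by omega), h.leading]

end Solve

/-! ### Leading order and induction on the order. -/

section Existence

variable {lam : ℝ} {K : ℕ} {s : ℝ} {T : ℝ≥0∞} {u : ℤ → ℤ → ℝ → L2} {g₀ : ℝ → L2} {φ ψ : L2}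

/-- The leading amplitudes, given by the cubic Schrödinger equation. -/
lemma exists_wkbFamily_zero (hs : 2 * (K : ℝ) + 5 < s) (hg : IsNLSSolution lam φ ψ s T g₀) :
    ∃ u, WkbFamily lam K s T g₀ 0 0 u := by
  have hK : (0 : ℝ) ≤ K := K.cast_nonneg
  set u : ℤ → ℤ → ℝ → L2 := replaceAt 0 g₀ (fun t => star (g₀ t)) 0 with hu
  have hu1 : u 0 1 = g₀ := replaceAt_one ..
  have hu2 : u 0 (-1) = fun t => star (g₀ t) := replaceAt_neg_one ..
  have hne : ∀ m q, m ≠ 0 → u m q = 0 := fun m q hm => replaceAt_of_ne _ _ _ hm q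
  have hnot : ∀ m q, ¬(q = 1 ∨ q = -1) → u m q = 0 := fun m q hq => replaceAt_of_not _ _ _ m hq
  have hall : ∀ (P : (ℝ → L2) → Prop), P g₀ → P (fun t => star (g₀ t)) → P (fun _ => 0) →
      ∀ m q, P (u m q) := fun P h1 h2 h3 m q =>
    replaceAt_cases (P := fun _ _ f => P f) h1 h2 m q fun _ => h3
  have hmem : ∀ m q, ContHs s T (u m q) :=
    hall _ hg.cont (hg.cont.conj (by linarith)) (contHs_zero s T)
  -- The cubic Schrödinger equation is the recurrence for `n = 0`, `p = 1`, because the cubic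
  -- coefficient there is `3λ|g₀|²g₀`.
  have hD : ∀ t ∈ timeSet T, 0 < t →
      HasDerivAt g₀ ((2 * Complex.I)⁻¹ • (lap (g₀ t) - cub lam K (fun m q => u m q t) 0 1)) t := by
    intro t ht ht0
    obtain ⟨dg, N, h1, h2, h3⟩ := hg.eqn t ht ht0
    have hm : MemHs s (g₀ t) := (hg.cont t ht).1
    have hN : cub lam K (fun m q => u m q t) 0 1 = N := by
      refine cub_zero_one (σ := s) (w := fun m q => u m q t) (by linarith) (fun i _ => (hmem i.1 i.2 t ht).1)
        ?_ ?_
      · beta_reduce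
        rwa [hu1]
      · beta_reduce
        rw [hu1, hu2]
    have h4 : (2 * Complex.I) • dg = lap (g₀ t) - N := by
      refine toDist_injective ?_
      rw [toDist_sub, toDist_smul, toDist_lap (hm.of_le (by norm_num) (by linarith))]
      rw [sub_add] at h3
      exact sub_eq_zero.1 h3
    rw [hN, ← h4, smul_smul, inv_mul_cancel₀ (mul_ne_zero two_ne_zero Complex.I_ne_zero), one_smul]
    exact h1
  have hgCl : Cl (K + 2) s T g₀ := by
    refine Cl.of_schrodinger (by push_cast; linarith) hg.cont hD fun i hi hgi => ?_
    have hi' : (i : ℝ) + 1 ≤ K + 2 := by exact_mod_cast hi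
    have h1 : Cl i s T fun t => cub lam K (fun m q => u m q t) 0 1 := by
      refine cl_cub (u := u) (by linarith) fun k _ _ => ?_
      exact hall (Cl i s T) hgi (hgi.conj (by linarith)) (cl_zero ..) k.1 k.2
    exact h1.of_le (by linarith) (by linarith)
  have hreg : ∀ m q : ℤ, ∀ j : ℕ, m + j ≤ K + 2 → Cl j (s - 2 * m) T (u m q) := by
    intro m q j hj
    by_cases hm : m = 0
    · subst hm
      have hj' : (j : ℝ) ≤ K + 2 := by exact_mod_cast (by omega : (j : ℤ) ≤ K + 2)
      rw [Int.cast_zero, mul_zero, sub_zero]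
      have h1 : Cl j s T g₀ := hgCl.of_le_left (by omega)
      exact hall (Cl j s T) h1 (h1.conj (by linarith)) (cl_zero ..) 0 q
    · rw [hne m q hm]; exact cl_zero ..
  have hconj : ∀ m q : ℤ, ∀ t ∈ timeSet T, u m (-q) t = star (u m q t) := by
    intro m q t _
    by_cases hm : m = 0
    · subst hm
      by_cases h1 : q = 1
      · rw [h1, hu1, hu2]
      by_cases h2 : q = -1
      · rw [h2, neg_neg, hu1, hu2, star_star]
      · rw [hnot _ _ (by omega), hnot _ _ (by omega)]
        exact star_zero'.symm
    · rw [hne m _ hm, hne m _ hm]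
      exact star_zero'.symm
  have heq1 : ∀ t ∈ timeSet T, 0 < t → wkbW lam K u 0 1 t = 0 := by
    intro t ht ht0
    have hDt : Dt (u 0 1) t = (2 * Complex.I)⁻¹ • (lap (g₀ t) -
        cub lam K (fun m q => u m q t) 0 1) := by
      rw [hu1]
      exact ((hD t ht ht0).hasDerivWithinAt).derivWithin (uniqueDiffOn_Ici 0 t ht.1)
    rw [wkbW, hDt, hne (0 - 2) 1 (by norm_num), dt_zero, dt_zero, hu1, smul_smul]
    have : 2 * Complex.I * ((1 : ℤ) : ℂ) * (2 * Complex.I)⁻¹ = 1 := by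
      have := Complex.I_ne_zero
      push_cast
      field_simp
    rw [this, one_smul, Pi.zero_apply]
    abel
  refine ⟨u, ?_, ?_, hconj, hreg, ?_, ?_, ?_, ?_, ?_, hu1⟩
  · intro m q hmq
    by_cases hm : m = 0
    · subst hm
      refine hnot _ _ ?_
      rintro (rfl | rfl)
      · exact hmq ⟨le_rfl, le_rfl, Even.zero, one_mem_harmonics Even.zero le_rfl⟩
      · exact hmq ⟨le_rfl, le_rfl, Even.zero, neg_one_mem_harmonics Even.zero le_rfl⟩
    · exact hne m q hm
  · intro m q hm _
    exact hne m q (by omega)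
  · intro m q j _ hq
    rw [hnot m q hq]
    exact cl_zero ..
  · intro m q h0 h2
    omega
  · intro m q h0 h0' _ hq t ht ht0
    obtain rfl : m = 0 := by omega
    rcases hq with rfl | rfl
    · exact heq1 t ht ht0
    · rw [← star_wkbW hs hconj hreg (by omega) ht, heq1 t ht ht0, star_zero']
  · intro m h2 h0
    omega
  · intro m h2 h0
    omega

/-- `extend` and `solve` alternate in steps of two up to the even order `K`. A last `extend`
supplies `u_{K+2,p}` for `p ≠ ±1`; the amplitudes `u_{K+2,±1}` may remain zero, since the profile
equations up to order `K` do not constrain them. -/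
theorem exists_wkbFamily (hT : 0 < T) (hKe : Even K) (hs : 2 * (K : ℝ) + 5 < s)
    (hg : IsNLSSolution lam φ ψ s T g₀) : ∃ u, WkbFamily lam K s T g₀ (K + 2) K u := by
  have h : ∀ m : ℕ, 2 * m ≤ K → ∃ u, WkbFamily lam K s T g₀ (2 * m) (2 * m) u := by
    intro m
    induction m with
    | zero => exact fun _ => by simpa using exists_wkbFamily_zero hs hg
    | succ m ih =>
      intro hm
      obtain ⟨u, hu⟩ := ih (by omega)
      have he : Even (2 * (m : ℤ)) := even_two_mul _
      obtain ⟨v, hv⟩ := hu.extend hs (by omega) he (by omega)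
      obtain ⟨w, hw⟩ := hv.solve hT hs (by omega) he (by omega)
      exact ⟨w, by push_cast; rwa [mul_add, mul_one]⟩
  obtain ⟨k, hk⟩ := hKe
  obtain ⟨u, hu⟩ := h k (by omega)
  have hk' : 2 * (k : ℤ) = K := by omega
  rw [hk'] at hu
  exact hu.extend hs (by omega) ⟨k, by omega⟩ le_rfl

end Existence

/-! ### Assembling the amplitudes -/

section Amplitude

lemma memHs_zero (σ : ℝ) : MemHs σ 0 := by
  have h : MemHs (max σ 0) 0 := by
    rw [← ofFreq_zero (σ := max σ 0)]
    exact memHs_ofFreq (le_max_right _ _) 0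
  exact (contHs_zero σ ⊤ 0 ⟨le_rfl, by simp⟩).1

lemma MemHs.add {σ : ℝ} (hσ : 0 ≤ σ) {f g : L2} (hf : MemHs σ f) (hg : MemHs σ g) :
    MemHs σ (f + g) := by
  obtain ⟨a, rfl⟩ := exists_ofFreq hσ hf
  obtain ⟨b, rfl⟩ := exists_ofFreq hσ hg
  rw [← ofFreq_add]
  exact memHs_ofFreq hσ _

lemma MemHs.smul {σ : ℝ} (hσ : 0 ≤ σ) (c : ℂ) {f : L2} (hf : MemHs σ f) : MemHs σ (c • f) := by
  obtain ⟨a, rfl⟩ := exists_ofFreq hσ hf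
  rw [← ofFreq_smul]
  exact memHs_ofFreq hσ _

lemma pd_ofFreq_one (k : Fin 2) (h : L2) : pd k (ofFreq 1 h) = ofFreq 0 (dFreq k h) := by
  have := pd_ofFreq le_rfl k h
  rwa [zero_add] at this

lemma pd_add (k : Fin 2) {f g : L2} (hf : MemHs 1 f) (hg : MemHs 1 g) :
    pd k (f + g) = pd k f + pd k g := by
  obtain ⟨a, rfl⟩ := exists_ofFreq (by norm_num) hf
  obtain ⟨b, rfl⟩ := exists_ofFreq (by norm_num) hg
  rw [← ofFreq_add, pd_ofFreq_one, pd_ofFreq_one, pd_ofFreq_one, map_add, ofFreq_add]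

lemma pd_smul (k : Fin 2) (c : ℂ) {f : L2} (hf : MemHs 1 f) : pd k (c • f) = c • pd k f := by
  obtain ⟨a, rfl⟩ := exists_ofFreq (by norm_num) hf
  rw [← ofFreq_smul, pd_ofFreq_one, pd_ofFreq_one, map_smul, ofFreq_smul]

lemma memHs_sum {σ : ℝ} (hσ : 0 ≤ σ) {ι : Type*} (t : Finset ι) {f : ι → L2}
    (hf : ∀ i ∈ t, MemHs σ (f i)) : MemHs σ (∑ i ∈ t, f i) :=
  Finset.sum_induction f (MemHs σ) (fun _ _ => MemHs.add hσ) (memHs_zero σ) hf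

lemma pd_sum (k : Fin 2) {ι : Type*} (t : Finset ι) {f : ι → L2} (hf : ∀ i ∈ t, MemHs 1 (f i)) :
    pd k (∑ i ∈ t, f i) = ∑ i ∈ t, pd k (f i) := by
  classical
  induction t using Finset.induction_on with
  | empty => simp [pd_zero]
  | insert i t hi ih =>
    have ht : ∀ j ∈ t, MemHs 1 (f j) := fun j hj => hf j (Finset.mem_insert_of_mem hj)
    rw [Finset.sum_insert hi, Finset.sum_insert hi, pd_add k (hf i (Finset.mem_insert_self i t))
      (memHs_sum zero_le_one t ht), ih ht]

lemma star_pd (k : Fin 2) {f : L2} (hf : MemHs 1 f) : star (pd k f) = pd k (star f) := by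
  obtain ⟨a, rfl⟩ := exists_ofFreq (by norm_num) hf
  rw [star_ofFreq zero_le_one, pd_ofFreq_one, pd_ofFreq_one, star_ofFreq le_rfl, conjFreq_dFreq]

lemma pd_pd_add {f : L2} (hf : MemHs 2 f) : pd 0 (pd 0 f) + pd 1 (pd 1 f) = lap f := by
  obtain ⟨a, rfl⟩ := exists_ofFreq (by norm_num) hf
  have h1 : ∀ k, pd k (pd k (ofFreq 2 a)) = ofFreq 0 (dFreq k (dFreq k a)) := fun k => by
    have := pd_ofFreq zero_le_one k a
    rw [one_add_one_eq_two] at this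
    rw [this, pd_ofFreq_one]
  have h2 := lap_ofFreq le_rfl a
  rw [zero_add] at h2
  rw [h1, h1, h2, ← ofFreq_add]
  congr 1
  refine eq_of_ae ?_
  rw [dFreq, dFreq, lapFreq, mulOp_mulOp (bddMult_symD 0) (bddMult_symD 0),
    mulOp_mulOp (bddMult_symD 1) (bddMult_symD 1)]
  have b0 := (bddMult_symD 0).mul (bddMult_symD 0)
  have b1 := (bddMult_symD 1).mul (bddMult_symD 1)
  filter_upwards [Lp.coeFn_add (mulOp (fun ξ => symD 0 ξ * jap (-1) ξ * (symD 0 ξ * jap (-1) ξ)) a)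
    (mulOp (fun ξ => symD 1 ξ * jap (-1) ξ * (symD 1 ξ * jap (-1) ξ)) a), mulOp_coe b0 a,
    mulOp_coe b1 a, mulOp_coe bddMult_symLap a] with ξ e1 e2 e3 e4
  have e5 : jap (-2) ξ = jap (-1) ξ * jap (-1) ξ := by rw [← jap_add]; norm_num
  have e6 : ((‖ξ‖ ^ 2 : ℝ) : ℂ) = (ξ 0 : ℂ) ^ 2 + (ξ 1 : ℂ) ^ 2 := by
    rw [EuclideanSpace.norm_sq_eq, Fin.sum_univ_two, Real.norm_eq_abs, Real.norm_eq_abs, sq_abs,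
      sq_abs]
    push_cast
    rfl
  rw [e1, Pi.add_apply, e2, e3, e4, e5, symD, symD, symLap]
  push_cast at e6 ⊢
  rw [e6]
  linear_combination (2 * Real.pi) ^ 2 * ((ξ 0 : ℂ) ^ 2 + (ξ 1 : ℂ) ^ 2) * jap (-1) ξ ^ 2 * a ξ *
    Complex.I_sq

/-- The operator `A(∂ₓ)` with values in `L²`. -/
def opL (U : State) : State := ![pd 0 (U 2), pd 1 (U 2), pd 0 (U 0) + pd 1 (U 1), 0]

lemma toDist_opL {U : State} (hU : ∀ k, MemHs 1 (U k)) (k : Fin 4) :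
    toDist (opL U k) = opA U k := by
  fin_cases k
  · exact toDist_pd 0 (hU 2)
  · exact toDist_pd 1 (hU 2)
  · exact (toDist_add _ _).trans (congrArg₂ (· + ·) (toDist_pd 0 (hU 0)) (toDist_pd 1 (hU 1)))
  · exact toDist_zero

lemma opL_zero : opL 0 = 0 := by
  funext k
  fin_cases k <;> simp [opL, pd_zero]

lemma opL_sum {ι : Type*} (t : Finset ι) (c : ι → ℂ) {U : ι → State}
    (hU : ∀ i ∈ t, ∀ k, MemHs 1 (U i k)) :
    opL (∑ i ∈ t, c i • U i) = ∑ i ∈ t, c i • opL (U i) := by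
  have h : ∀ (k : Fin 2) (l : Fin 4), pd k (∑ i ∈ t, c i • U i l) = ∑ i ∈ t, c i • pd k (U i l) :=
    fun k l => by
      rw [pd_sum k t fun i hi => (hU i hi l).smul zero_le_one _]
      exact Finset.sum_congr rfl fun i hi => pd_smul k _ (hU i hi l)
  funext k
  fin_cases k <;> simp [opL, h, Finset.sum_apply, Finset.sum_add_distrib]

lemma opA0_sum {ι : Type*} (t : Finset ι) (c : ι → ℂ) (U : ι → State) :
    opA0 (∑ i ∈ t, c i • U i) = ∑ i ∈ t, c i • opA0 (U i) := by
  funext k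
  fin_cases k <;> simp [opA0, Finset.sum_apply]

lemma opA0_zero : opA0 0 = 0 := by
  funext k
  fin_cases k <;> simp [opA0]

lemma sourceF_sum {ι : Type*} (t : Finset ι) (c : ι → ℂ) (N : ι → L2) :
    sourceF (∑ i ∈ t, c i • N i) = ∑ i ∈ t, c i • sourceF (N i) := by
  funext k
  fin_cases k <;> simp [sourceF, Finset.sum_apply]

/-- The amplitudes `U_{n,p}`. -/
def wkbAmp (K : ℕ) (u : ℤ → ℤ → ℝ → L2) : Amplitudes := fun n p t =>
  if n ≤ K + 2 then ![pd 0 (u (n - 1) p t), pd 1 (u (n - 1) p t),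
    (Complex.I * p) • u n p t + Dt (u (n - 2) p) t, u n p t] else 0

/-- The time derivatives of the amplitudes. -/
def wkbAmpDt (K : ℕ) (u : ℤ → ℤ → ℝ → L2) : Amplitudes := fun n p t =>
  if n ≤ K + 2 then ![pd 0 (Dt (u (n - 1) p) t), pd 1 (Dt (u (n - 1) p) t),
    (Complex.I * p) • Dt (u n p) t + Dt (Dt (u (n - 2) p)) t, Dt (u n p) t] else 0

/-- The left hand side of the profile equation. -/
def wkbProfile (K : ℕ) (u : ℤ → ℤ → ℝ → L2) (n p : ℤ) (t : ℝ) : State :=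
  wkbAmpDt K u n p t - opL (wkbAmp K u (n + 1) p t) +
    ((Complex.I * p) • wkbAmp K u (n + 2) p t + opA0 (wkbAmp K u (n + 2) p t))

end Amplitude

/-! ### Support, regularity and profile equations of the assembled amplitudes. -/

section FamilyAmplitude

variable {lam : ℝ} {K : ℕ} {s σ : ℝ} {T : ℝ≥0∞} {g₀ : ℝ → L2} {u : ℤ → ℤ → ℝ → L2} {n p : ℤ} {t : ℝ}

lemma WkbFamily.of_odd {N N' : ℤ} (h : WkbFamily lam K s T g₀ N N' u) (hn : ¬Even n) : u n p = 0 :=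
  h.support n p fun hc => hn hc.2.2.1

/-- The recurrence relation for the amplitudes. -/
lemma WkbFamily.recurrence (h : WkbFamily lam K s T g₀ (K + 2) K u) (hn : n ≤ K)
    (ht : t ∈ timeSet T) (ht0 : 0 < t) :
    wkbW lam K u n p t + (1 - (p : ℂ) ^ 2) • u (n + 2) p t = 0 := by
  have hone : (p = 1 ∨ p = -1) → (1 - (p : ℂ) ^ 2) = 0 := by
    rintro (rfl | rfl) <;> simp
  have hz : (∀ q, u n q = 0) → (∀ q, u (n - 2) q = 0) → cub lam K (fun m q => u m q t) n p = 0 →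
      wkbW lam K u n p t = 0 := fun h1 h2 h3 => by
    rw [wkbW, h1, h2, h3, dt_zero, dt_zero]
    simp [lap_zero]
  by_cases hne : Even n
  · rcases lt_or_ge n 0 with hn0 | hn0
    · rw [hz (fun q => h.support n q (by omega)) (fun q => h.support _ q (by omega))
        (cub_of_neg hn0), zero_add]
      -- For `n = -2` the recurrence reads `(1 - p²) u_{0,p} = 0`, so the harmonics of the order
      -- zero must be `±1`.
      by_cases hp : p = 1 ∨ p = -1
      · rw [hone hp, zero_smul]
      · rw [h.support (n + 2) p, Pi.zero_apply, smul_zero]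
        rintro ⟨h1, -, h3, h4⟩
        obtain ⟨h5, h6⟩ := (harmonics_even h3).1 h4
        rw [abs_le] at h6
        obtain ⟨k, hk⟩ := h5
        omega
    · by_cases hp : p = 1 ∨ p = -1
      · rw [h.eqn_one n p hn0 hn hne hp t ht ht0, hone hp, zero_smul, zero_add]
      · exact h.eqn n p hn0 (by omega) hne hp t ht ht0
  · have h2 : ¬Even (n + 2) := by rwa [Int.even_add, iff_true_right even_two]
    have h2' : ¬Even (n - 2) := by rwa [Int.even_sub, iff_true_right even_two]
    rw [h.of_odd h2, hz (fun q => h.of_odd hne) (fun q => h.of_odd h2')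
      (cub_of_odd (fun m q hm => by rw [h.of_odd hm]; rfl) hne)]
    simp

/-- `U_{n,p}` is built from the orders `n`, `n - 1`, `n - 2`, of which only the even ones
contribute. For odd `n` the highest is `n - 1`, with `|p| ≤ n`; this explains the two cases of
`harmonics`. -/
lemma WkbFamily.eq_zero_of_support (h : WkbFamily lam K s T g₀ (K + 2) K u)
    (hn : ¬(0 ≤ n ∧ n ≤ K + 2 ∧ p ∈ harmonics n)) (hnK : n ≤ K + 2) {m : ℤ}
    (hm : n - 2 ≤ m) (hmn : m ≤ n) : u m p = 0 := by
  refine h.support m p fun ⟨h1, h2, h3, h4⟩ => hn ⟨by omega, hnK, ?_⟩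
  obtain ⟨h5, h6⟩ := (harmonics_even h3).1 h4
  rw [mem_harmonics]
  refine ⟨h5, ?_⟩
  obtain ⟨k, hk⟩ := h3
  split_ifs with hne
  · omega
  · obtain ⟨l, hl⟩ := Int.not_even_iff_odd.1 hne
    omega

lemma WkbFamily.amp_eq_zero (h : WkbFamily lam K s T g₀ (K + 2) K u)
    (hn : ¬(0 ≤ n ∧ n ≤ K + 2 ∧ p ∈ harmonics n)) (t : ℝ) : wkbAmp K u n p t = 0 := by
  rw [wkbAmp]
  split_ifs with hnK
  · rw [h.eq_zero_of_support hn hnK (by omega) (by omega : n - 1 ≤ n),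
      h.eq_zero_of_support hn hnK le_rfl (by omega : n - 2 ≤ n),
      h.eq_zero_of_support hn hnK (by omega) le_rfl, dt_zero]
    funext k
    fin_cases k <;> simp [pd_zero]
  · rfl

lemma WkbFamily.ampDt_eq_zero (h : WkbFamily lam K s T g₀ (K + 2) K u)
    (hn : ¬(0 ≤ n ∧ n ≤ K + 2 ∧ p ∈ harmonics n)) (t : ℝ) : wkbAmpDt K u n p t = 0 := by
  rw [wkbAmpDt]
  split_ifs with hnK
  · rw [h.eq_zero_of_support hn hnK (by omega) (by omega : n - 1 ≤ n),
      h.eq_zero_of_support hn hnK le_rfl (by omega : n - 2 ≤ n),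
      h.eq_zero_of_support hn hnK (by omega) le_rfl, dt_zero, dt_zero]
    funext k
    fin_cases k <;> simp [pd_zero]
  · rfl

lemma WkbFamily.cl_two (hσ : 1 < σ) (hs : s = σ + 2 * K + 4)
    (h : WkbFamily lam K s T g₀ (K + 2) K u) (hn : n ≤ K) : Cl 2 (σ + 4) T (u n p) := by
  have hn' : (n : ℝ) ≤ K := by exact_mod_cast hn
  exact (h.reg n p 2 (by push_cast; omega)).of_le (by push_cast; linarith) (by linarith)

lemma WkbFamily.cl_one (hσ : 1 < σ) (hs : s = σ + 2 * K + 4) (hKe : Even K)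
    (h : WkbFamily lam K s T g₀ (K + 2) K u) (hn : n ≤ K + 1) : Cl 1 (σ + 3) T (u n p) := by
  rcases hn.lt_or_eq with hn | rfl
  · exact (h.cl_two hσ hs (by omega)).of_succ.of_le (by push_cast; linarith) (by linarith)
  · rw [h.of_odd (by rw [Int.even_add_one, not_not]; exact_mod_cast hKe)]
    exact cl_zero ..

/-- At the top order `K + 2` the field `reg` would give only `H^σ` and no time derivative; the gain
`reg'` of the nonresonant amplitudes gives `H^{σ+2}` and one time derivative. The resonant ones are
zero there. -/
lemma WkbFamily.cl_one' (hσ : 1 < σ) (hs : s = σ + 2 * K + 4) (hKe : Even K)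
    (h : WkbFamily lam K s T g₀ (K + 2) K u) (hn : n ≤ K + 2) : Cl 1 (σ + 2) T (u n p) := by
  rcases hn.lt_or_eq with hn | rfl
  · exact (h.cl_one hσ hs hKe (by omega)).of_le (by push_cast; linarith) (by linarith)
  · by_cases hp : p = 1 ∨ p = -1
    · rw [h.vanish _ p (by omega) hp]
      exact cl_zero ..
    · refine (h.reg' (K + 2) p 1 (by push_cast; omega) hp).of_le (by push_cast; linarith) ?_
      push_cast
      linarith

lemma WkbFamily.cl_one_dt (hσ : 1 < σ) (hs : s = σ + 2 * K + 4)
    (h : WkbFamily lam K s T g₀ (K + 2) K u) (hn : n ≤ K) : Cl 1 (σ + 2) T (Dt (u n p)) := by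
  have := (h.cl_two (p := p) hσ hs hn).dt
  rwa [show σ + 4 - 2 = σ + 2 by ring] at this

lemma cl_pd {ρ : ℝ} (hρ : 0 ≤ ρ) (k : Fin 2) {f : ℝ → L2} (hf : Cl 1 (ρ + 3) T f) :
    DtHs ρ T (fun t => pd k (f t)) (fun t => pd k (Dt f t)) := by
  have := hf.dtHs
  rw [show ρ + 3 - 2 = ρ + 1 by ring] at this
  exact this.pd hρ k

lemma WkbFamily.dtHs_amp (hσ : 1 < σ) (hs : s = σ + 2 * K + 4) (hKe : Even K)
    (h : WkbFamily lam K s T g₀ (K + 2) K u) (n p : ℤ) (k : Fin 4) :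
    DtHs σ T (fun t => wkbAmp K u n p t k) fun t => wkbAmpDt K u n p t k := by
  have hσ0 : 0 ≤ σ := by linarith
  by_cases hn : n ≤ K + 2
  · have h1 := h.cl_one (p := p) hσ hs hKe (n := n - 1) (by omega)
    have h2 := (h.cl_one' (p := p) hσ hs hKe hn).dtHs
    have h3 := (h.cl_one_dt (p := p) hσ hs (n := n - 2) (by omega)).dtHs
    rw [add_sub_cancel_right] at h2 h3
    simp only [wkbAmp, wkbAmpDt, if_pos hn]
    fin_cases k
    · exact cl_pd hσ0 0 h1
    · exact cl_pd hσ0 1 h1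
    · exact (h2.smul (Complex.I * p)).add h3
    · exact h2
  · simp only [wkbAmp, wkbAmpDt, if_neg hn]
    exact dtHs_zero σ T

lemma WkbFamily.contHs_amp (hσ : 1 < σ) (hs : s = σ + 2 * K + 4) (hKe : Even K)
    (h : WkbFamily lam K s T g₀ (K + 2) K u) (n p : ℤ) (k : Fin 4) :
    ContHs (σ + 2) T fun t => wkbAmp K u n p t k := by
  have hσ0 : 0 ≤ σ + 2 := by linarith
  by_cases hn : n ≤ K + 2
  · have h1 := (h.cl_one (p := p) hσ hs hKe (n := n - 1) (by omega)).contHs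
    have h2 := (h.cl_one' (p := p) hσ hs hKe hn).contHs
    have h3 := (h.cl_one_dt (p := p) hσ hs (n := n - 2) (by omega)).contHs
    rw [show σ + 3 = σ + 2 + 1 by ring] at h1
    simp only [wkbAmp, if_pos hn]
    fin_cases k
    · exact h1.pd hσ0 0
    · exact h1.pd hσ0 1
    · exact (h2.smul hσ0 (Complex.I * p)).add hσ0 h3
    · exact h2
  · simp only [wkbAmp, if_neg hn]
    exact contHs_zero _ T

lemma WkbFamily.contHs_ampDt (hσ : 1 < σ) (hs : s = σ + 2 * K + 4) (hKe : Even K)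
    (h : WkbFamily lam K s T g₀ (K + 2) K u) (n p : ℤ) (k : Fin 4) :
    ContHs σ T fun t => wkbAmpDt K u n p t k := by
  have hσ0 : 0 ≤ σ := by linarith
  by_cases hn : n ≤ K + 2
  · have h1 := (h.cl_one (p := p) hσ hs hKe (n := n - 1) (by omega)).dt.contHs
    have h2 := (h.cl_one' (p := p) hσ hs hKe hn).dt.contHs
    have h3 := (h.cl_one_dt (p := p) hσ hs (n := n - 2) (by omega)).dt.contHs
    rw [add_sub_cancel_right] at h2 h3
    rw [show σ + 3 - 2 = σ + 1 by ring] at h1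
    simp only [wkbAmpDt, if_pos hn]
    fin_cases k
    · exact h1.pd hσ0 0
    · exact h1.pd hσ0 1
    · exact (h2.smul hσ0 (Complex.I * p)).add hσ0 h3
    · exact h2
  · simp only [wkbAmpDt, if_neg hn]
    exact contHs_zero _ T

lemma contHs_opL {U : ℝ → State} (hσ : 0 ≤ σ) (hU : ∀ k, ContHs (σ + 1) T fun t => U t k)
    (k : Fin 4) : ContHs σ T fun t => opL (U t) k := by
  fin_cases k
  · exact (hU 2).pd hσ 0
  · exact (hU 2).pd hσ 1
  · exact ((hU 0).pd hσ 0).add hσ ((hU 1).pd hσ 1)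
  · exact contHs_zero σ T

lemma contHs_opA0 {U : ℝ → State} (hσ : 0 ≤ σ) (hU : ∀ k, ContHs σ T fun t => U t k)
    (k : Fin 4) : ContHs σ T fun t => opA0 (U t) k := by
  fin_cases k
  · exact contHs_zero σ T
  · exact contHs_zero σ T
  · exact hU 3
  · exact ((hU 2).smul hσ (-1)).congr fun t _ => (neg_one_smul ℂ _).symm

lemma contHs_sourceF {N : ℝ → L2} (hσ : 0 ≤ σ) (hN : ContHs σ T N) (k : Fin 4) :
    ContHs σ T fun t => sourceF (N t) k := by
  fin_cases k
  · exact contHs_zero σ T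
  · exact contHs_zero σ T
  · exact (hN.smul hσ (-1)).congr fun t _ => (neg_one_smul ℂ _).symm
  · exact contHs_zero σ T

lemma WkbFamily.contHs_profile (hσ : 1 < σ) (hs : s = σ + 2 * K + 4) (hKe : Even K)
    (h : WkbFamily lam K s T g₀ (K + 2) K u) (n p : ℤ) (k : Fin 4) :
    ContHs σ T fun t => wkbProfile K u n p t k := by
  have hσ0 : 0 ≤ σ := by linarith
  have h1 := h.contHs_ampDt hσ hs hKe n p k
  have h2 := contHs_opL hσ0 (fun k => (h.contHs_amp hσ hs hKe (n + 1) p k).of_le (by linarith)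
    (by linarith : σ + 1 ≤ σ + 2)) k
  have h3 : ∀ k, ContHs σ T fun t => wkbAmp K u (n + 2) p t k := fun k =>
    (h.contHs_amp hσ hs hKe (n + 2) p k).of_le hσ0 (by linarith)
  have h4 := contHs_opA0 hσ0 h3 k
  refine ((h1.add hσ0 (h2.smul hσ0 (-1))).add hσ0
    (((h3 k).smul hσ0 (Complex.I * p)).add hσ0 h4)).congr fun t _ => ?_
  simp only [wkbProfile, Pi.add_apply, Pi.sub_apply, Pi.smul_apply, neg_one_smul, ← sub_eq_add_neg]

/-- The profile equations. -/
lemma WkbFamily.profile_eq (hσ : 1 < σ) (hs : s = σ + 2 * K + 4) (hKe : Even K)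
    (h : WkbFamily lam K s T g₀ (K + 2) K u) (hn : n ≤ K) (ht : t ∈ timeSet T) (ht0 : 0 < t) :
    wkbProfile K u n p t = sourceF (cub lam K (fun m q => u m q t) n p) := by
  have e1 : n + 1 - 1 = n := by ring
  have e2 : n + 1 - 2 = n - 1 := by ring
  have e3 : n + 2 - 1 = n + 1 := by ring
  have e4 : n + 2 - 2 = n := by ring
  have m1 : MemHs 1 (u (n + 1) p t) := MemHs.of_le zero_le_one (by linarith)
    ((h.cl_one hσ hs hKe (by omega)).contHs t ht).1
  have m2 : MemHs 1 (Dt (u (n - 1) p) t) := MemHs.of_le zero_le_one (by linarith)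
    ((h.cl_one_dt hσ hs (by omega)).contHs t ht).1
  have m3 : MemHs 2 (u n p t) := MemHs.of_le zero_le_two (by linarith)
    ((h.cl_one hσ hs hKe (by omega)).contHs t ht).1
  have hpd : ∀ k, pd k ((Complex.I * p) • u (n + 1) p t + Dt (u (n - 1) p) t) =
      (Complex.I * p) • pd k (u (n + 1) p t) + pd k (Dt (u (n - 1) p) t) := fun k => by
    rw [pd_add k (m1.smul zero_le_one _) m2, pd_smul k _ m1]
  have hrec := h.recurrence (p := p) hn ht ht0
  rw [wkbW, ← pd_pd_add m3] at hrec
  rw [wkbProfile, wkbAmpDt, wkbAmp, wkbAmp, if_pos (by omega), if_pos (by omega), if_pos (by omega),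
    e1, e2, e3, e4]
  funext k
  -- Three of the components hold by the form of the amplitudes; the component of `v` is the
  -- recurrence, with `Δ = ∂₀² + ∂₁²`.
  fin_cases k
  · simp [opL, opA0, sourceF, hpd]
  · simp [opL, opA0, sourceF, hpd]
  · simp only [opL, opA0, sourceF, Pi.add_apply, Pi.sub_apply, Pi.smul_apply]
    refine eq_neg_of_add_eq_zero_left (Eq.trans ?_ hrec)
    simp
    match_scalars <;> first | ring1 | linear_combination (p : ℂ) ^ 2 * Complex.I_sq
  · simp [opL, opA0, sourceF]

end FamilyAmplitude

/-! ### The system evaluated at the WKB sum. -/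

section WkbSum

variable {lam : ℝ} {K : ℕ} {s σ : ℝ} {T : ℝ≥0∞} {g₀ : ℝ → L2} {u : ℤ → ℤ → ℝ → L2} {n p : ℤ} {t : ℝ}
  {ε : ℝ}

/-- `εⁿ e^{ipt/ε²}`. -/
def wkbPhase (ε t : ℝ) (i : ℤ × ℤ) : ℂ :=
  (ε : ℂ) ^ i.1 * Complex.exp (Complex.I * i.2 * t / (ε : ℂ) ^ 2)

lemma wkbPhase_add (hε : 0 < ε) (i j : ℤ × ℤ) :
    wkbPhase ε t (i + j) = wkbPhase ε t i * wkbPhase ε t j := by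
  have hε' : (ε : ℂ) ≠ 0 := by exact_mod_cast hε.ne'
  rw [wkbPhase, wkbPhase, wkbPhase, Prod.fst_add, Prod.snd_add, zpow_add₀ hε', mul_mul_mul_comm,
    ← Complex.exp_add]
  congr 2
  push_cast
  ring

/-- A factor `ε^{-j}` is a shift of the order by `j`. -/
lemma wkbPhase_shift (hε : 0 < ε) (j : ℤ) (i : ℤ × ℤ) :
    wkbPhase ε t i = ((ε : ℂ) ^ j)⁻¹ * wkbPhase ε t (i + (j, 0)) := by
  have hε' : (ε : ℂ) ≠ 0 := by exact_mod_cast hε.ne'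
  have h : wkbPhase ε t (j, 0) = (ε : ℂ) ^ j := by simp [wkbPhase]
  rw [wkbPhase_add hε, h]
  field_simp

lemma sum_range_eq_sum_Icc {M : Type*} [AddCommMonoid M] (f : ℤ → M) :
    ∑ n ∈ Finset.range (K + 3), f n = ∑ n ∈ Finset.Icc (0 : ℤ) (K + 2), f n := by
  refine Finset.sum_nbij' (fun n : ℕ => (n : ℤ)) Int.toNat ?_ ?_ ?_ ?_ ?_
  · intro n hn
    rw [Finset.mem_range] at hn
    rw [Finset.mem_Icc]
    omega
  · intro n hn
    rw [Finset.mem_Icc] at hn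
    rw [Finset.mem_range]
    omega
  · exact fun n _ => Int.toNat_natCast n
  · intro n hn
    exact Int.toNat_of_nonneg (Finset.mem_Icc.1 hn).1
  · exact fun _ _ => rfl

lemma wkbSum_eq (A : Amplitudes) (ε t : ℝ) :
    wkbSum K A ε t = ∑ i ∈ wkbIdx K, wkbPhase ε t i • A i.1 i.2 t := by
  rw [sum_wkbIdx (f := fun n p => wkbPhase ε t (n, p) • A n p t), wkbSum,
    ← sum_range_eq_sum_Icc fun n => ∑ p ∈ harmonics n, wkbPhase ε t (n, p) • A n p t]
  simp only [wkbPhase, zpow_natCast]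

/-- A finite set of indices that contains all harmonics of the cubic term. -/
def wkbBox (K : ℕ) : Finset (ℤ × ℤ) :=
  Finset.Icc (-2 : ℤ) (3 * K + 6) ×ˢ Finset.Icc (-(3 * K + 9) : ℤ) (3 * K + 9)

lemma mem_wkbBox {i : ℤ × ℤ} : i ∈ wkbBox K ↔
    (-2 ≤ i.1 ∧ i.1 ≤ 3 * K + 6) ∧ -(3 * (K : ℤ) + 9) ≤ i.2 ∧ i.2 ≤ 3 * K + 9 := by
  rw [wkbBox, Finset.mem_product, Finset.mem_Icc, Finset.mem_Icc]

lemma bounds_of_mem_wkbIdx {i : ℤ × ℤ} (hi : i ∈ wkbIdx K) :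
    (0 ≤ i.1 ∧ i.1 ≤ K + 2) ∧ -((K : ℤ) + 3) ≤ i.2 ∧ i.2 ≤ K + 3 := by
  rw [wkbIdx, Finset.mem_filter, Finset.mem_product, Finset.mem_Icc, Finset.mem_Icc] at hi
  exact hi.1

lemma add_mem_wkbBox {i j k : ℤ × ℤ} (hi : i ∈ wkbIdx K) (hj : j ∈ wkbIdx K) (hk : k ∈ wkbIdx K) :
    i + j + k ∈ wkbBox K := by
  have h1 := bounds_of_mem_wkbIdx hi
  have h2 := bounds_of_mem_wkbIdx hj
  have h3 := bounds_of_mem_wkbIdx hk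
  rw [mem_wkbBox]
  simp only [Prod.fst_add, Prod.snd_add]
  omega

/-- The box starts at the order `-2`, so shifts by up to two still cover every index at which `X`
may be nonzero. -/
lemma sum_wkbBox_shift {M : Type*} [AddCommMonoid M] {X : ℤ × ℤ → M}
    (hX : ∀ i, i ∉ wkbIdx K → X i = 0) {j : ℤ} (hj0 : 0 ≤ j) (hj2 : j ≤ 2) :
    ∑ i ∈ wkbBox K, X (i + (j, 0)) = ∑ i ∈ wkbIdx K, X i := by
  refine (Finset.sum_map (wkbBox K) (addRightEmbedding (j, 0)) X).symm.trans ?_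
  refine (Finset.sum_subset (fun i hi => ?_) fun i _ hi => hX i hi).symm
  have h1 := bounds_of_mem_wkbIdx hi
  refine Finset.mem_map.2 ⟨i - (j, 0), mem_wkbBox.2 ?_, sub_add_cancel _ _⟩
  simp only [Prod.fst_sub, Prod.snd_sub]
  omega

lemma WkbFamily.hasDerivAt_wkbSum (hσ : 1 < σ) (hs : s = σ + 2 * K + 4) (hKe : Even K)
    (h : WkbFamily lam K s T g₀ (K + 2) K u) (ht : t ∈ timeSet T) (ht0 : 0 < t) :
    HasDerivAt (wkbSum K (wkbAmp K u) ε) (∑ i ∈ wkbIdx K, (wkbPhase ε t i • wkbAmpDt K u i.1 i.2 t +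
      (wkbPhase ε t i * (Complex.I * i.2 / (ε : ℂ) ^ 2)) • wkbAmp K u i.1 i.2 t)) t := by
  have h1 : wkbSum K (wkbAmp K u) ε =
      fun τ => ∑ i ∈ wkbIdx K, wkbPhase ε τ i • wkbAmp K u i.1 i.2 τ := funext fun τ => wkbSum_eq _ _ _
  rw [h1]
  refine HasDerivAt.fun_sum fun i _ => ?_
  have h2 : HasDerivAt (fun τ => wkbAmp K u i.1 i.2 τ) (wkbAmpDt K u i.1 i.2 t) t :=
    hasDerivAt_pi.2 fun k => (h.dtHs_amp hσ hs hKe i.1 i.2 k).hasDerivAt ht ht0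
  have h3 : HasDerivAt (fun τ : ℝ => wkbPhase ε τ i)
      (wkbPhase ε t i * (Complex.I * i.2 / (ε : ℂ) ^ 2)) t := by
    have h4 : HasDerivAt (fun τ : ℝ => Complex.I * i.2 * (τ : ℂ) / (ε : ℂ) ^ 2)
        (Complex.I * i.2 * 1 / (ε : ℂ) ^ 2) t :=
      ((Complex.ofRealCLM.hasDerivAt (x := t)).const_mul (Complex.I * (i.2 : ℂ))).div_const _
    refine (h4.cexp.const_mul ((ε : ℂ) ^ i.1)).congr_deriv ?_
    rw [wkbPhase]
    ring
  exact h3.smul h2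

lemma WkbFamily.not_mem_support {i : ℤ × ℤ} (hi : i ∉ wkbIdx K) :
    ¬(0 ≤ i.1 ∧ i.1 ≤ K + 2 ∧ i.2 ∈ harmonics i.1) := fun hc =>
  hi (mem_wkbIdx.2 ⟨Finset.mem_Icc.2 ⟨hc.1, hc.2.1⟩, hc.2.2⟩)

/-- The factors `ε⁻¹` and `ε⁻²` shift orders by one and two, and differentiating the phase produces
`ip/ε²`. Sorting by powers of `ε` and harmonics turns the left-hand side of the system into the sum
of the profile expressions. -/
lemma WkbFamily.sum_profile (hσ : 1 < σ) (hs : s = σ + 2 * K + 4) (hKe : Even K)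
    (h : WkbFamily lam K s T g₀ (K + 2) K u) (hε : 0 < ε) (ht : t ∈ timeSet T) :
    ∑ i ∈ wkbBox K, wkbPhase ε t i • wkbProfile K u i.1 i.2 t =
      ∑ i ∈ wkbIdx K, (wkbPhase ε t i • wkbAmpDt K u i.1 i.2 t +
        (wkbPhase ε t i * (Complex.I * i.2 / (ε : ℂ) ^ 2)) • wkbAmp K u i.1 i.2 t) -
      ((ε⁻¹ : ℝ) : ℂ) • opL (wkbSum K (wkbAmp K u) ε t) +
      (((ε ^ 2)⁻¹ : ℝ) : ℂ) • opA0 (wkbSum K (wkbAmp K u) ε t) := by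
  have hA : ∀ i, i ∉ wkbIdx K → wkbAmp K u i.1 i.2 t = 0 := fun i hi =>
    h.amp_eq_zero (not_mem_support hi) t
  have hdA : ∀ i, i ∉ wkbIdx K → wkbAmpDt K u i.1 i.2 t = 0 := fun i hi =>
    h.ampDt_eq_zero (not_mem_support hi) t
  have hmem : ∀ i ∈ wkbIdx K, ∀ k, MemHs 1 (wkbAmp K u i.1 i.2 t k) := fun i _ k =>
    MemHs.of_le zero_le_one (by linarith) (h.contHs_amp hσ hs hKe i.1 i.2 k t ht).1
  have e0 := sum_wkbBox_shift (K := K) (X := fun i => wkbPhase ε t i • wkbAmpDt K u i.1 i.2 t)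
    (fun i hi => by simp only [hdA i hi, smul_zero]) (j := 0) le_rfl (by norm_num)
  have e1 := sum_wkbBox_shift (K := K) (X := fun i => wkbPhase ε t i • opL (wkbAmp K u i.1 i.2 t))
    (fun i hi => by simp only [hA i hi, opL_zero, smul_zero]) (j := 1) (by norm_num) (by norm_num)
  have e2 := sum_wkbBox_shift (K := K) (X := fun i => wkbPhase ε t i •
    ((Complex.I * i.2) • wkbAmp K u i.1 i.2 t + opA0 (wkbAmp K u i.1 i.2 t)))
    (fun i hi => by simp only [hA i hi, opA0_zero, smul_zero, add_zero]) (j := 2) (by norm_num) le_rfl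
  have h0 : ∀ i : ℤ × ℤ, i + (0, 0) = i := fun i => by simp
  simp only [h0] at e0
  simp only [Prod.fst_add, Prod.snd_add, add_zero] at e1 e2
  have hsplit : ∀ i : ℤ × ℤ, wkbPhase ε t i • wkbProfile K u i.1 i.2 t =
      wkbPhase ε t i • wkbAmpDt K u i.1 i.2 t -
      ((ε : ℂ) ^ (1 : ℤ))⁻¹ • wkbPhase ε t (i + (1, 0)) • opL (wkbAmp K u (i.1 + 1) i.2 t) +
      ((ε : ℂ) ^ (2 : ℤ))⁻¹ • wkbPhase ε t (i + (2, 0)) •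
        ((Complex.I * i.2) • wkbAmp K u (i.1 + 2) i.2 t + opA0 (wkbAmp K u (i.1 + 2) i.2 t)) := by
    intro i
    rw [smul_smul, smul_smul _ (wkbPhase ε t (i + (2, 0))), ← wkbPhase_shift hε,
      ← wkbPhase_shift hε, wkbProfile, smul_add, smul_sub]
  have e3 : ((ε : ℂ) ^ (2 : ℤ))⁻¹ • ∑ i ∈ wkbIdx K, wkbPhase ε t i •
      ((Complex.I * i.2) • wkbAmp K u i.1 i.2 t + opA0 (wkbAmp K u i.1 i.2 t)) =
      ∑ i ∈ wkbIdx K, (wkbPhase ε t i * (Complex.I * i.2 / (ε : ℂ) ^ 2)) • wkbAmp K u i.1 i.2 t +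
      ((ε : ℂ) ^ (2 : ℤ))⁻¹ • opA0 (wkbSum K (wkbAmp K u) ε t) := by
    rw [wkbSum_eq, opA0_sum, Finset.smul_sum, Finset.smul_sum, ← Finset.sum_add_distrib]
    refine Finset.sum_congr rfl fun i _ => ?_
    rw [smul_add, smul_add, smul_smul, smul_smul]
    congr 2
    rw [zpow_ofNat]
    ring
  have e4 : ∑ i ∈ wkbIdx K, wkbPhase ε t i • opL (wkbAmp K u i.1 i.2 t) =
      opL (wkbSum K (wkbAmp K u) ε t) := by
    rw [wkbSum_eq, opL_sum _ _ hmem]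
  have e5 : ((ε⁻¹ : ℝ) : ℂ) = ((ε : ℂ) ^ (1 : ℤ))⁻¹ := by simp
  have e6 : (((ε ^ 2)⁻¹ : ℝ) : ℂ) = ((ε : ℂ) ^ (2 : ℤ))⁻¹ := by rw [zpow_ofNat]; simp
  have e7 : ∀ X Y Z W : State, X - Y + (Z + W) = X + Z - Y + W := fun _ _ _ _ => by abel
  rw [Finset.sum_congr rfl fun i _ => hsplit i, Finset.sum_add_distrib, Finset.sum_sub_distrib,
    ← Finset.smul_sum, ← Finset.smul_sum, e0, e1, e2, e3, e4, e5, e6, Finset.sum_add_distrib]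
  exact e7 _ _ _ _

lemma WkbFamily.memHs (hσ : 1 < σ) (hs : s = σ + 2 * K + 4) (hKe : Even K)
    (h : WkbFamily lam K s T g₀ (K + 2) K u) (ht : t ∈ timeSet T) :
    ∀ i ∈ wkbIdx K, MemHs σ (u i.1 i.2 t) := fun i hi =>
  ((((h.cl_one' hσ hs hKe (bounds_of_mem_wkbIdx hi).1.2).contHs).of_le (by linarith)
    (by linarith : σ ≤ σ + 2)) t ht).1

/-- `wkbPhase` is multiplicative in the index, so the cube of the sum expands into the coefficients
`cub`. -/
lemma WkbFamily.sum_cub (hσ : 1 < σ) (hs : s = σ + 2 * K + 4) (hKe : Even K)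
    (h : WkbFamily lam K s T g₀ (K + 2) K u) (hε : 0 < ε) (ht : t ∈ timeSet T) :
    ∀ᵐ x, (∑ i ∈ wkbBox K, wkbPhase ε t i • cub lam K (fun m q => u m q t) i.1 i.2) x =
      (lam : ℂ) * (wkbSum K (wkbAmp K u) ε t 3 x) ^ 3 := by
  have h1 : wkbSum K (wkbAmp K u) ε t 3 = ∑ i ∈ wkbIdx K, wkbPhase ε t i • u i.1 i.2 t := by
    rw [wkbSum_eq, Finset.sum_apply]
    refine Finset.sum_congr rfl fun i hi => ?_
    rw [Pi.smul_apply, wkbAmp, if_pos (bounds_of_mem_wkbIdx hi).1.2]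
    rfl
  have h2 := coe_sum_ae (s := wkbBox K)
    (f := fun i => wkbPhase ε t i • cub lam K (fun m q => u m q t) i.1 i.2)
    (g := fun i x => wkbPhase ε t i * ((lam : ℂ) * tripleSum K (i.1, i.2)
      fun i j k => u i.1 i.2 t x * u j.1 j.2 t x * u k.1 k.2 t x)) fun i _ => by
    filter_upwards [Lp.coeFn_smul (wkbPhase ε t i) (cub lam K (fun m q => u m q t) i.1 i.2),
      cub_coe (lam := lam) (n := i.1) (p := i.2) (w := fun m q => u m q t) hσ
        (h.memHs hσ hs hKe ht)] with x e1 e2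
    rw [e1, Pi.smul_apply, e2, smul_eq_mul]
  have h3 := coe_sum_ae (s := wkbIdx K) (f := fun i => wkbPhase ε t i • u i.1 i.2 t)
    (g := fun i x => wkbPhase ε t i * u i.1 i.2 t x) fun i _ => by
    filter_upwards [Lp.coeFn_smul (wkbPhase ε t i) (u i.1 i.2 t)] with x e1
    rw [e1, Pi.smul_apply, smul_eq_mul]
  filter_upwards [h2, h3] with x e1 e2
  rw [e1, h1, e2, ← sum_tripleSum (B := wkbBox K) (fun i hi j hj k hk => add_mem_wkbBox hi hj hk)
    (wkbPhase_add hε), Finset.mul_sum]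
  exact Finset.sum_congr rfl fun i _ => by ring

end WkbSum

/-! ### Remainder and initial error. -/

section WkbError

variable {lam : ℝ} {K : ℕ} {s σ : ℝ} {T : ℝ≥0∞} {g₀ : ℝ → L2} {u : ℤ → ℤ → ℝ → L2} {n p : ℤ} {t : ℝ}
  {ε : ℝ} {φ ψ : L2}

/-- The defect of the equation for the amplitude with the index `(n, p)`. -/
def wkbDefect (lam : ℝ) (K : ℕ) (u : ℤ → ℤ → ℝ → L2) (i : ℤ × ℤ) (t : ℝ) : State :=
  sourceF (cub lam K (fun m q => u m q t) i.1 i.2) - wkbProfile K u i.1 i.2 t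

/-- The remainder `R_ε`. -/
def wkbResidual (lam : ℝ) (K : ℕ) (u : ℤ → ℤ → ℝ → L2) (ε t : ℝ) : State :=
  ∑ i ∈ (wkbBox K).filter fun i => (K : ℤ) < i.1,
    wkbPhase ε t (i - ((K : ℤ) + 1, 0)) • wkbDefect lam K u i t

lemma norm_wkbPhase (hε : 0 < ε) (t : ℝ) (i : ℤ × ℤ) : ‖wkbPhase ε t i‖ = ε ^ i.1 := by
  rw [wkbPhase, norm_mul, norm_wkb_phase, mul_one, norm_zpow, Complex.norm_real,
    Real.norm_of_nonneg hε.le]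

/-- The profile equations remove all terms of order at most `K`; what is left has order at least `K
+ 1`, and `ε^{K+1}` is taken out. -/
lemma WkbFamily.sum_profile_eq (hσ : 1 < σ) (hs : s = σ + 2 * K + 4) (hKe : Even K)
    (h : WkbFamily lam K s T g₀ (K + 2) K u) (hε : 0 < ε) (ht : t ∈ timeSet T) (ht0 : 0 < t) :
    ∑ i ∈ wkbBox K, wkbPhase ε t i • wkbProfile K u i.1 i.2 t =
      sourceF (∑ i ∈ wkbBox K, wkbPhase ε t i • cub lam K (fun m q => u m q t) i.1 i.2) -
        ((ε : ℂ) ^ (K + 1)) • wkbResidual lam K u ε t := by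
  have h1 : ((ε : ℂ) ^ (K + 1)) • wkbResidual lam K u ε t =
      ∑ i ∈ wkbBox K, wkbPhase ε t i • wkbDefect lam K u i t := by
    rw [wkbResidual, Finset.smul_sum, Finset.sum_filter]
    refine Finset.sum_congr rfl fun i _ => ?_
    split_ifs with hi
    · have h2 := wkbPhase_shift (t := t) hε (K + 1) (i - ((K : ℤ) + 1, 0))
      rw [sub_add_cancel] at h2
      have hε' : (ε : ℂ) ≠ 0 := by exact_mod_cast hε.ne'
      have h3 : (ε : ℂ) ^ ((K : ℤ) + 1) = (ε : ℂ) ^ (K + 1) := zpow_natCast (ε : ℂ) (K + 1)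
      rw [h2, smul_smul, h3, mul_inv_cancel_left₀ (pow_ne_zero _ hε')]
    · rw [wkbDefect, h.profile_eq hσ hs hKe (by omega) ht ht0, sub_self, smul_zero]
  rw [h1, sourceF_sum, ← Finset.sum_sub_distrib]
  refine Finset.sum_congr rfl fun i _ => ?_
  rw [wkbDefect, smul_sub, sub_sub_cancel]

lemma WkbFamily.contHs_defect (hσ : 1 < σ) (hs : s = σ + 2 * K + 4) (hKe : Even K)
    (h : WkbFamily lam K s T g₀ (K + 2) K u) (i : ℤ × ℤ) (k : Fin 4) :
    ContHs σ T fun t => wkbDefect lam K u i t k := by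
  have hσ0 : 0 ≤ σ := by linarith
  have h1 : ContHs σ T fun t => cub lam K (fun m q => u m q t) i.1 i.2 :=
    cl_cub (j := 0) (u := u) (by push_cast; linarith) fun j hj _ =>
      (h.cl_one' hσ hs hKe (bounds_of_mem_wkbIdx hj).1.2).contHs.of_le hσ0 (by linarith)
  refine ((contHs_sourceF hσ0 h1 k).add hσ0
    ((h.contHs_profile hσ hs hKe i.1 i.2 k).smul hσ0 (-1))).congr fun t _ => ?_
  rw [wkbDefect, Pi.sub_apply, neg_one_smul, sub_eq_add_neg]

lemma WkbFamily.exists_bound (hσ : 1 < σ) (hs : s = σ + 2 * K + 4) (hKe : Even K)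
    (h : WkbFamily lam K s T g₀ (K + 2) K u) : ∃ C, IsRate T C ∧ ∀ ε, 0 < ε → ε ≤ 1 →
      ∀ t ∈ timeSet T, stateNorm σ (wkbResidual lam K u ε t) ≤ ENNReal.ofReal (C t) := by
  have hσ0 : 0 ≤ σ := by linarith
  choose α hα hd using fun i => (contHs_state_iff hσ0).1 (h.contHs_defect hσ hs hKe i)
  set B := (wkbBox K).filter fun i => (K : ℤ) < i.1 with hB
  obtain ⟨C, hC, hm⟩ := exists_isRate (T := T) (m := fun t => 2 * ∑ i ∈ B, ‖α i t‖)
    ((continuousOn_finsetSum _ fun i _ => (hα i).norm).const_smul (2 : ℝ))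
  refine ⟨C, hC, fun ε hε hε1 t ht => ?_⟩
  have h1 : wkbResidual lam K u ε t =
      ofFreqS σ (∑ i ∈ B, wkbPhase ε t (i - ((K : ℤ) + 1, 0)) • α i t) := by
    funext k
    change _ = ofFreqL σ _
    rw [wkbResidual, Finset.sum_apply, Finset.sum_apply, map_sum]
    refine Finset.sum_congr rfl fun i _ => ?_
    rw [hd i t ht]
    exact (ofFreq_smul _ _ _).symm
  have h2 : ‖∑ i ∈ B, wkbPhase ε t (i - ((K : ℤ) + 1, 0)) • α i t‖ ≤ ∑ i ∈ B, ‖α i t‖ := by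
    refine norm_sum_le_of_le _ fun i hi => ?_
    rw [norm_smul, norm_wkbPhase hε]
    -- After division by `ε^{K+1}` the powers of `ε` are nonnegative, hence at most `1`.
    refine mul_le_of_le_one_left (norm_nonneg _) (zpow_le_one₀ hε hε1 ?_)
    have := (Finset.mem_filter.1 hi).2
    simp only [Prod.fst_sub]
    omega
  calc stateNorm σ (wkbResidual lam K u ε t)
      ≤ 2 * ‖∑ i ∈ B, wkbPhase ε t (i - ((K : ℤ) + 1, 0)) • α i t‖ₑ := by
        rw [h1]; exact stateNorm_ofFreqS_le hσ0 _
    _ = ENNReal.ofReal (2 * ‖∑ i ∈ B, wkbPhase ε t (i - ((K : ℤ) + 1, 0)) • α i t‖) := by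
        rw [ENNReal.ofReal_mul zero_le_two, ofReal_norm, ENNReal.ofReal_ofNat]
    _ ≤ ENNReal.ofReal (C t) := ENNReal.ofReal_le_ofReal
        ((mul_le_mul_of_nonneg_left h2 zero_le_two).trans (hm t ht))

lemma harmonics_zero : harmonics 0 = {1, -1} := by decide

lemma harmonics_one : harmonics 1 = {1, -1} := by decide

lemma harmonics_sub_one (hn : ¬Even n) : harmonics (n - 1) = harmonics n := by
  have h1 : Even (n - 1) := by rwa [Int.even_sub_one]
  ext q
  rw [mem_harmonics, mem_harmonics, if_pos h1, if_neg hn, sub_add_cancel]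

/-- The initial data of the WKB solution at the order `n`. -/
def wkbInit (K : ℕ) (u : ℤ → ℤ → ℝ → L2) (n : ℤ) : State := ∑ p ∈ harmonics n, wkbAmp K u n p 0

/-- With `g = (φ - iψ)/2` one has `g + ḡ = φ` and `i(g - ḡ) = ψ`. -/
lemma WkbFamily.init_zero (hT : 0 < T) (h : WkbFamily lam K s T g₀ (K + 2) K u)
    (hg : g₀ 0 = (1 / 2 : ℂ) • (φ - Complex.I • ψ)) (hφ : IsReal φ) (hψ : IsReal ψ) :
    wkbInit K u 0 = ![0, 0, ψ, φ] := by
  have hc := h.conj 0 1 0 (zero_mem_timeSet hT)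
  have hI := Complex.I_sq
  have hstar : star (g₀ 0) = (1 / 2 : ℂ) • (φ + Complex.I • ψ) := by
    rw [IsReal] at hφ hψ
    rw [hg, star_smul', star_sub', star_smul', hφ, hψ]
    simp
  rw [h.leading, hstar] at hc
  have e1 : ∀ q, u (-1) q = 0 := fun q => h.of_odd (by decide)
  have e2 : ∀ q, u (-2) q = 0 := fun q => h.support _ _ (by omega)
  rw [wkbInit, harmonics_zero, Finset.sum_pair (by norm_num), wkbAmp, wkbAmp, if_pos (by omega),
    if_pos (by omega), zero_sub, zero_sub, e1, e1, e2, e2, h.leading, hc, hg, dt_zero]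
  funext k
  fin_cases k
  · simp [pd_zero]
  · simp [pd_zero]
  · simp only [Pi.add_apply]
    simp
    match_scalars <;> first | ring1 | linear_combination -Complex.I_sq
  · simp only [Pi.add_apply]
    simp
    module

lemma WkbFamily.init_one (hT : 0 < T) (hσ : 1 < σ) (hs : s = σ + 2 * K + 4) (hKe : Even K)
    (h : WkbFamily lam K s T g₀ (K + 2) K u)
    (hg : g₀ 0 = (1 / 2 : ℂ) • (φ - Complex.I • ψ)) (hφ : IsReal φ) (hψ : IsReal ψ) :
    wkbInit K u 1 = ![pd 0 φ, pd 1 φ, 0, 0] := by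
  have h0 := zero_mem_timeSet hT
  have hc := h.conj 0 1 0 h0
  have hstar : star (g₀ 0) = (1 / 2 : ℂ) • (φ + Complex.I • ψ) := by
    rw [IsReal] at hφ hψ
    rw [hg, star_smul', star_sub', star_smul', hφ, hψ]
    simp
  have e1 : ∀ q, u 1 q = 0 := fun q => h.of_odd (by decide)
  have e2 : ∀ q, u (-1) q = 0 := fun q => h.of_odd (by decide)
  have hm : ∀ q, MemHs 1 (u 0 q 0) := fun q => MemHs.of_le zero_le_one (by linarith)
    ((h.cl_one (n := 0) hσ hs hKe (by omega)).contHs 0 h0).1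
  have hpd : ∀ k, pd k (u 0 1 0) + pd k (u 0 (-1) 0) = pd k φ := fun k => by
    rw [← pd_add k (hm _) (hm _), hc, h.leading, hstar, hg]
    congr 1
    module
  rw [wkbInit, harmonics_one, Finset.sum_pair (by norm_num), wkbAmp, wkbAmp, if_pos (by omega),
    if_pos (by omega), sub_self, e1, e1, show (1 : ℤ) - 2 = -1 by norm_num, e2, e2, dt_zero]
  funext k
  fin_cases k
  · simpa using hpd 0
  · simpa using hpd 1
  · simp
  · simp

/-- For even `n` these are the conditions `init_u` and `init_v`; for odd `n` only the gradient of
the order `n - 1` is present, and the sum of that order vanishes. -/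
lemma WkbFamily.init_eq_zero (hT : 0 < T) (hσ : 1 < σ) (hs : s = σ + 2 * K + 4) (hKe : Even K)
    (h : WkbFamily lam K s T g₀ (K + 2) K u) (hn2 : 2 ≤ n) (hnK : n ≤ K + 1) :
    wkbInit K u n = 0 := by
  have h0 := zero_mem_timeSet hT
  by_cases hne : Even n
  · have hnK' : n ≤ K := by
      obtain ⟨a, ha⟩ := hne
      obtain ⟨b, hb⟩ := hKe
      omega
    have e1 : ∀ q, u (n - 1) q = 0 := fun q => h.of_odd (by rwa [Int.even_sub_one, not_not])
    have e2 := h.init_u n hn2 hnK' hne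
    have e3 := h.init_v n hn2 hnK' hne
    rw [wkbInit]
    simp only [wkbAmp, if_pos (by omega : n ≤ K + 2), e1]
    funext k
    rw [Finset.sum_apply]
    fin_cases k
    · simp [pd_zero]
    · simp [pd_zero]
    · exact e3
    · exact e2
  · have hne1 : Even (n - 1) := by rwa [Int.even_sub_one]
    have e1 : ∀ q, u n q = 0 := fun q => h.of_odd hne
    have e2 : ∀ q, u (n - 2) q = 0 := fun q => h.of_odd (by rwa [Int.even_sub, iff_true_right even_two])
    have e3 := h.init_u (n - 1) (by
      obtain ⟨a, ha⟩ := hne1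
      omega) (by omega) hne1
    rw [harmonics_sub_one hne] at e3
    have hm : ∀ q, MemHs 1 (u (n - 1) q 0) := fun q => MemHs.of_le zero_le_one (by linarith)
      ((h.cl_one hσ hs hKe (by omega)).contHs 0 h0).1
    have hpd : ∀ k, ∑ p ∈ harmonics n, pd k (u (n - 1) p 0) = 0 := fun k => by
      rw [← pd_sum k _ fun q _ => hm q, e3, pd_zero]
    rw [wkbInit]
    simp only [wkbAmp, if_pos (by omega : n ≤ K + 2), e1, e2, dt_zero]
    funext k
    rw [Finset.sum_apply]
    fin_cases k
    · exact hpd 0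
    · exact hpd 1
    · simp
    · simp

lemma WkbFamily.wkbSum_zero (hT : 0 < T) (hσ : 1 < σ) (hs : s = σ + 2 * K + 4) (hKe : Even K)
    (h : WkbFamily lam K s T g₀ (K + 2) K u)
    (hg : g₀ 0 = (1 / 2 : ℂ) • (φ - Complex.I • ψ)) (hφ : IsReal φ) (hψ : IsReal ψ) (ε : ℝ) :
    wkbSum K (wkbAmp K u) ε 0 = ![0, 0, ψ, φ] + (ε : ℂ) • ![pd 0 φ, pd 1 φ, 0, 0] +
      ((ε : ℂ) ^ (K + 2)) • wkbInit K u (K + 2) := by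
  have h1 : wkbSum K (wkbAmp K u) ε 0 =
      ∑ n ∈ Finset.range (K + 3), ((ε : ℂ) ^ n) • wkbInit K u n := by
    rw [wkbSum]
    refine Finset.sum_congr rfl fun n _ => ?_
    rw [wkbInit, Finset.smul_sum]
    refine Finset.sum_congr rfl fun p _ => ?_
    simp
  have h2 : ∑ n ∈ Finset.range 2, ((ε : ℂ) ^ n) • wkbInit K u n =
      ∑ n ∈ Finset.range (K + 2), ((ε : ℂ) ^ n) • wkbInit K u n := by
    refine Finset.sum_subset (Finset.range_mono (by omega)) fun n hn hn' => ?_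
    rw [Finset.mem_range] at hn hn'
    rw [h.init_eq_zero hT hσ hs hKe (by omega) (by omega), smul_zero]
  rw [h1, Finset.sum_range_succ, ← h2, Finset.sum_range_succ, Finset.sum_range_one, pow_zero,
    one_smul, pow_one, Nat.cast_zero, Nat.cast_one, h.init_zero hT hg hφ hψ,
    h.init_one hT hσ hs hKe hg hφ hψ]
  push_cast
  rfl

/-- No cancellation is imposed at the order `K + 2`, so its initial value is the error `r_ε`; it
does not depend on `ε`. -/
lemma WkbFamily.exists_init_bound (hT : 0 < T) (hσ : 1 < σ) (hs : s = σ + 2 * K + 4) (hKe : Even K)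
    (h : WkbFamily lam K s T g₀ (K + 2) K u) :
    ∃ C₀ : ℝ, stateNorm (σ + 2) (-wkbInit K u (K + 2)) ≤ ENNReal.ofReal C₀ := by
  have hσ0 : 0 ≤ σ + 2 := by linarith
  choose a ha using fun k => exists_ofFreq hσ0 ((memHs_sum hσ0 (harmonics (K + 2)) fun p _ =>
    (h.contHs_amp hσ hs hKe (K + 2) p k 0 (zero_mem_timeSet hT)).1).smul hσ0 (-1))
  have h1 : -wkbInit K u (K + 2) = ofFreqS (σ + 2) a := by
    funext k
    rw [ofFreqS, ← ha k, neg_one_smul, Pi.neg_apply, wkbInit, Finset.sum_apply]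
  refine ⟨2 * ‖a‖, ?_⟩
  rw [h1, ENNReal.ofReal_mul zero_le_two, ofReal_norm, ENNReal.ofReal_ofNat]
  exact stateNorm_ofFreqS_le hσ0 a

end WkbError

/-! ### Existence of WKB solutions. -/

section ExistsWkb

theorem exists_wkb (lam : ℝ) {K : ℕ} (hKe : Even K) {s : ℝ}
    (hs : 2 * (K : ℝ) + 5 < s) {φ ψ : L2} (hφ_real : IsReal φ) (hψ_real : IsReal ψ)
    (hφ : MemHs s φ) (hψ : MemHs s ψ) :
    ∃ A, IsWKBSolution lam φ ψ s K (nlsLifespan lam φ ψ s) A := by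
  have hK0 : (0 : ℝ) ≤ K := K.cast_nonneg
  obtain ⟨hT, g₀, hg⟩ := nls_lifespan lam (by linarith : 2 ≤ s) hφ hψ
  set T := nlsLifespan lam φ ψ s with hTdef
  obtain ⟨u, h⟩ := exists_wkbFamily hT hKe hs hg
  obtain ⟨σ, hσs⟩ : ∃ σ, s = σ + 2 * K + 4 := ⟨s - 2 * K - 4, by ring⟩
  have hσ : 1 < σ := by linarith
  have e1 : s - 2 * K - 4 = σ := by linarith
  have e2 : s - 2 * K - 2 = σ + 2 := by linarith
  have hg0 : g₀ 0 = (1 / 2 : ℂ) • (φ - Complex.I • ψ) := hg.init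
  have hmem : ∀ n p k, ∀ t ∈ timeSet T, MemHs 1 (wkbAmp K u n p t k) := fun n p k t ht =>
    MemHs.of_le zero_le_one (by linarith) (h.contHs_amp hσ hσs hKe n p k t ht).1
  refine ⟨wkbAmp K u, fun n p hn t => h.amp_eq_zero hn t, ?_, ?_, ?_, ?_, ?_⟩
  · intro n hn p _ k
    have hn' : (n : ℝ) ≤ K + 2 := by exact_mod_cast hn
    have hρ : 0 ≤ s - 2 * n := by linarith
    have h1 := (h.reg (n - 1) p 0 (by push_cast; omega)).contHs
    have h2 := (h.reg n p 0 (by push_cast; omega)).contHs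
    have h3 := (h.reg (n - 2) p 1 (by push_cast; omega)).dt.contHs
    push_cast at h1 h2 h3
    simp only [wkbAmp, if_pos (by omega : (n : ℤ) ≤ K + 2)]
    fin_cases k
    · exact (h1.of_le (by linarith) (by linarith : s - 2 * n + 1 ≤ _)).pd hρ 0
    · exact (h1.of_le (by linarith) (by linarith : s - 2 * n + 1 ≤ _)).pd hρ 1
    · exact (h2.smul hρ (Complex.I * p)).add hρ (h3.of_le hρ (by linarith))
    · exact h2
  · intro n p t ht k
    by_cases hn : n ≤ K + 2
    · have c1 := h.conj n p t ht
      have c2 := h.conj (n - 1) p t ht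
      have c3 := dt_star (by linarith) (h.cl_two hσ hσs (by omega)).dtHs (h.conj (n - 2) p) t ht
      have m1 : MemHs 1 (u (n - 1) p t) := MemHs.of_le zero_le_one (by linarith)
        ((h.cl_one hσ hσs hKe (by omega)).contHs t ht).1
      simp only [wkbAmp, if_pos hn, c1, c2, c3]
      fin_cases k
      · exact (star_pd 0 m1).symm
      · exact (star_pd 1 m1).symm
      · change _ = star ((Complex.I * p) • u n p t + Dt (u (n - 2) p) t)
        rw [star_add', star_smul']
        simp
      · rfl
    · simp only [wkbAmp, if_neg hn]
      exact star_zero'.symm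
  · refine ⟨g₀, hg, fun t _ => ?_⟩
    have z1 : u (-1) 1 = 0 := h.of_odd (by decide)
    have z2 : u (-2) 1 = 0 := h.support _ _ (by omega)
    rw [wkbAmp, if_pos (by omega), zero_sub, zero_sub, z1, z2, dt_zero, h.leading]
    simp [pd_zero]
  · intro n _ hn p t ht ht0
    refine ⟨wkbAmpDt K u n p t, cub lam K (fun m q => u m q t) n p,
      hasDerivAt_pi.2 fun k => (h.dtHs_amp hσ hσs hKe n p k).hasDerivAt ht ht0, ?_, fun k => ?_⟩
    · filter_upwards [cub_coe (lam := lam) (n := n) (p := p) (w := fun m q => u m q t) hσ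
        (h.memHs hσ hσs hKe ht)] with x hx
      rw [hx, cubicCoeff_eq]
      congr 1
      refine tripleSum_congr fun i hi j hj k hk _ => ?_
      simp only [wkbAmp, if_pos (bounds_of_mem_wkbIdx hi).1.2,
        if_pos (bounds_of_mem_wkbIdx hj).1.2, if_pos (bounds_of_mem_wkbIdx hk).1.2]
      rfl
    · rw [← toDist_opL (fun k => hmem (n + 1) p k t ht), ← toDist_sub, ← toDist_add,
        ← h.profile_eq hσ hσs hKe hn ht ht0]
      rfl
  · obtain ⟨C, hC, hR⟩ := h.exists_bound hσ hσs hKe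
    obtain ⟨C₀, hC₀⟩ := h.exists_init_bound hT hσ hσs hKe
    refine ⟨wkbResidual lam K u, fun _ => -wkbInit K u (K + 2), C, C₀, hC, fun ε hε hε1 =>
      ⟨fun t ht ht0 => ⟨⟨_, h.hasDerivAt_wkbSum hσ hσs hKe ht ht0, _,
        h.sum_cub hσ hσs hKe hε ht, fun k => ?_⟩, ?_⟩, fun k => ?_, ?_⟩⟩
    · have hU : ∀ k, MemHs 1 (wkbSum K (wkbAmp K u) ε t k) := fun k => by
        rw [wkbSum_eq, Finset.sum_apply]
        exact memHs_sum zero_le_one _ fun i _ => (hmem i.1 i.2 k t ht).smul zero_le_one _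
      have key := congrFun ((h.sum_profile hσ hσs hKe hε ht).symm.trans
        (h.sum_profile_eq hσ hσs hKe hε ht ht0)) k
      rw [← toDist_opL hU, ← toDist_smul, ← toDist_smul, ← toDist_sub, ← toDist_sub, ← toDist_add]
      exact congrArg toDist key
    · rw [e1]
      exact hR ε hε hε1 t ht
    · have hφ1 : MemHs 1 φ := hφ.of_le zero_le_one (by linarith)
      have hz : (ε : ℂ) • (0 : Dist) = 0 := by rw [← toDist_zero, ← toDist_smul, smul_zero]
      rw [h.wkbSum_zero hT hσ hσs hKe hg0 hφ_real hψ_real]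
      simp only [Pi.add_apply, Pi.smul_apply, Pi.neg_apply, toDist_add, toDist_smul, toDist_neg,
        smul_neg, sub_neg_eq_add]
      congr 1
      fin_cases k
      · simp [initialDatum, toDist_zero, toDist_pd 0 hφ1]
      · simp [initialDatum, toDist_zero, toDist_pd 1 hφ1]
      · simp [initialDatum, toDist_zero, hz]
      · simp [initialDatum, toDist_zero, hz]
    · rw [e2]
      exact hC₀

end ExistsWkb

end NonRelLimit

end

/-! ### The theorem. -/

open NonRelLimit in
theorem mainTheorem7 (lam : ℝ) (hlam : lam < 0) (K : ℕ) (hKpos : 0 < K) (hKeven : Even K)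
    (s : ℝ) (hs : 2 * (K : ℝ) + 5 < s) (φ ψ : NonRelLimit.L2)
    (hφ_real : NonRelLimit.IsReal φ) (hψ_real : NonRelLimit.IsReal ψ)
    (hφ : NonRelLimit.MemHs s φ) (hψ : NonRelLimit.MemHs s ψ) :
    0 < NonRelLimit.nlsLifespan lam φ ψ s ∧
    ∃ (Tstar : ℝ → ℝ≥0∞) (U : ℝ → ℝ → NonRelLimit.State),
      -- for each `ε`, `U ε` is the unique maximal solution and `Tstar ε` its existence time
      (∀ ε : ℝ, 0 < ε →
        0 < Tstar ε ∧
        NonRelLimit.IsKGSolution lam φ ψ ε (s - 2 * K - 4) (Tstar ε) (U ε) ∧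
        (∀ t ∈ NonRelLimit.timeSet (Tstar ε), ∀ k, NonRelLimit.IsReal (U ε t k)) ∧
        ∀ (T' : ℝ≥0∞) (V : ℝ → NonRelLimit.State),
          NonRelLimit.IsKGSolution lam φ ψ ε (s - 2 * K - 4) T' V →
          T' ≤ Tstar ε ∧ ∀ t ∈ NonRelLimit.timeSet T', V t = U ε t) ∧
      NonRelLimit.nlsLifespan lam φ ψ s ≤ liminf Tstar (𝓝[>] (0 : ℝ)) ∧
      -- WKB solutions exist, and each of them is stable
      (∃ A, NonRelLimit.IsWKBSolution lam φ ψ s K (NonRelLimit.nlsLifespan lam φ ψ s) A) ∧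
      ∀ A, NonRelLimit.IsWKBSolution lam φ ψ s K (NonRelLimit.nlsLifespan lam φ ψ s) A →
        ∃ C : ℝ → ℝ, NonRelLimit.IsRate (NonRelLimit.nlsLifespan lam φ ψ s) C ∧
          ∀ T ∈ NonRelLimit.timeSet (NonRelLimit.nlsLifespan lam φ ψ s),
            ∃ ε₀ : ℝ, 0 < ε₀ ∧ ∀ ε : ℝ, 0 < ε → ε < ε₀ →
              ∀ t ∈ NonRelLimit.timeSet (Tstar ε), t ≤ T →
                NonRelLimit.stateNorm (s - 2 * K - 4) (U ε t - NonRelLimit.wkbSum K A ε t)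
                  ≤ ENNReal.ofReal (C t * ε ^ (K + 1)) := by
  obtain ⟨hTpos, -⟩ := nls_lifespan lam (by linarith [K.cast_nonneg (α := ℝ)] : 2 ≤ s) hφ hψ
  have hK0 : (0 : ℝ) ≤ K := K.cast_nonneg
  -- The Klein-Gordon theory is applied with `σ = s - 2K - 5 > 0`, in the algebra `H^{σ+1}`.
  have hσ : s - 2 * K - 4 = (s - 2 * K - 5) + 1 := by ring
  have hφ' : MemHs (s - 2 * K - 5 + 2) φ := hφ.of_le (by linarith) (by linarith)
  have hψ' : MemHs (s - 2 * K - 5 + 1) ψ := hψ.of_le (by linarith) (by linarith)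
  have hkg := fun ε : ℝ => kg_maximal lam ε (by linarith : 0 < s - 2 * (K : ℝ) - 5) hφ' hψ'
    hφ_real hψ_real
  rw [← hσ] at hkg
  choose Tm h hpos hcont hsol hreal huniq hblow using hkg
  obtain ⟨A, hA⟩ := exists_wkb lam hKeven hs hφ_real hψ_real hφ hψ
  have hstab := fun A (hA : IsWKBSolution lam φ ψ s K (nlsLifespan lam φ ψ s) A) =>
    wkb_stability lam K hs (fun ε _ => hcont ε) (fun ε _ => hsol ε) hA
  refine ⟨hTpos, Tm, fun ε t => ofFreqS (s - 2 * K - 4) (h ε t), fun ε _ =>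
    ⟨hpos ε, hsol ε, hreal ε, huniq ε⟩, ?_, ⟨A, hA⟩, fun A' hA' => ?_⟩
  -- The lower bound for the existence times compares with one WKB solution, so it relies on the
  -- existence part.
  · obtain ⟨_, M, _, hM, H⟩ := hstab A hA
    refine le_liminf_lifespan hM (fun ε _ => hblow ε) fun T' hT' => ?_
    obtain ⟨ε₀, hε₀, H'⟩ := H T' hT'
    exact ⟨ε₀, hε₀, fun ε h1 h2 t ht htT => (H' ε h1 h2 t ht htT).2⟩
  · obtain ⟨C, _, hC, _, H⟩ := hstab A' hA'
    refine ⟨C, hC, fun T' hT' => ?_⟩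
    obtain ⟨ε₀, hε₀, H'⟩ := H T' hT'
    exact ⟨ε₀, hε₀, fun ε h1 h2 t ht htT => (H' ε h1 h2 t ht htT).1⟩
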